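/- **Setting.** For every $n$ consider the model $$y_i=\alpha_0\sum_{j\ne i}w_{ij}y_j+X_i^{\mathrm T}\beta(s_i)+\varepsilon_i,\qquad i=1,\dots,n,$$ with weights $W=W_n=(w_{ij})\in\mathbb R^{n\times n}$, fixed locations $s_i\in\mathbb R^2$, covariates $X_i\in\mathbb R^p$, unknown $\beta(\cdot)=(\beta_1(\cdot),\dots,\beta_p(\cdot))^{\mathrm T}$, $\alpha_0$ and $\sigma^2>0$. Put $Y=(y_1,\dots,y_n)^{\mathrm T}$, $A(\alpha)=I_n-\alpha W$, $A=A(\alpha_0)$, $G=(g_{ij})=WA^{-1}$, $\mathbf m=(X_i^{\mathrm T}\beta(s_i))_{i\le n}$, $\Psi=E(X_1X_1^{\mathrm T})$, $\Gamma=EX_1$. For a kernel $K$ and a bandwidth $h=h_n>0$ let $K_h(t)=K(t/h)/h^2$ and $\kappa_0=\int_{\mathbb R^2}K(\|s\|)\,ds$. Let $S$ be the $n\times n$ matrix whose $i$-th row is $(X_i^{\mathrm T},\mathbf 0)(\mathcal X^{\mathrm T}\mathcal W\mathcal X)^{-1}\mathcal X^{\mathrm T}\mathcal W$, where $\mathcal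 X$ has the rows $(X_j^{\mathrm T},(X_j\otimes(s_j-s_i))^{\mathrm T})$ and $\mathcal W=\operatorname{diag}(K_h(\|s_1-s_i\|),\dots,K_h(\|s_n-s_i\|))$. Let $\tilde\sigma^2(\alpha)=\frac1n\|(I_n-S)A(\alpha)Y\|^2$. The estimator $\hat\alpha=\hat\alpha_n$ takes, with probability tending to one, values in a set $\Delta\subset\mathbb R$ and maximizes over $\Delta$ the profile log likelihood $-n\log\tilde\sigma(\alpha)+\log|\det A(\alpha)|$. Row and column sums "uniformly bounded" or "of uniform order" are sums of absolute values, bounded uniformly in the row or column and in $n$. **Conditions.** (1) $K:\mathbb R\to\mathbb R$ is a kernel: bounded, nonnegative with $K(0)>0$, symmetric, Lipschitz continuous, with compact support; and $h\to0$. (2) $\beta$ has continuous second partial derivatives on a neighbourhood of the region $\mathcal S$ of (4). (3) $(X_i)$ is i.i.d., $(\varepsilon_i)$ is i.i.d. with mean $0$ and variance $\sigma^2$ (not necessarily normal), the two sequences are independent, $\Psi$ is positive definite, and $E\|X_1\|^{2q}<\infty$, $E|\varepsilon_1|^{2q}<\infty$ for some $q>2$. (4) All $s_i$ lie in a compact set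 $\mathcal S\subset\mathbb R^2$ that is regular: for some $c>0$, $|\mathcal S\cap B(z,\delta)|\ge c\,\delta^2$ for all $z\in\mathcal S$ and $0<\delta\le1$. There is a function $f$, Lipschitz continuous on $\mathcal S$, bounded away from zero on $\mathcal S$ (that is, $f\ge c'$ on $\mathcal S$ for some $c'>0$), with $\int_{\mathcal S}f=1$, such that for every bounded Lipschitz function $r$ on $\mathbb R^2$ and every kernel $k$ as in (1) $$\sup_{s\in\mathcal S}\Bigl|\frac1n\sum_{i=1}^n r(s_i)k_h(\|s_i-s\|)-\int_{\mathcal S}r(t)k_h(\|t-s\|)f(t)\,dt\Bigr|=O(h).$$ (5) $w_{ii}=0$; there is a sequence $\rho_n>0$ with $w_{ij}=O(1/\rho_n)$ uniformly in $i,j$; $A$ is invertible, and $W$ and $A^{-1}$ are uniformly bounded in both row and column sums. (6) $\Delta$ is compact, $\alpha_0$ is an interior point of $\Delta$, and for $\alpha\in\Delta$ the inverses $A(\alpha)^{-1}$ exist and are uniformly bounded, also in $\alpha\in\Delta$, in either row or column sums. (9) $\rho_n\to\infty$, the row sums of $G$ have the uniform order $O(1/\sqrt{\rho_n})$, and $\lim_{n\to\infty}\frac{\rho_n}{n}E\|G\mathbf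 m-SG\mathbf m\|^2=\lambda_4$ for some $\lambda_4\in(0,\infty)$. **The matrix $\Omega$.** For $s\in\mathcal S$ let $$Z_1(s)=\lim_{n\to\infty}\frac1n\sum_{i}g_{ii}\beta(s_i)K_h(\|s_i-s\|),\qquad Z_2(s)=\lim_{n\to\infty}\frac1n\sum_i\sum_{j\ne i}g_{ij}\beta(s_j)K_h(\|s_i-s\|),$$ $Z(s)=Z_1(s)+\Psi^{-1}\Gamma\Gamma^{\mathrm T}Z_2(s)$, $Z=\kappa_0^{-1}(f(s_i)^{-1}X_i^{\mathrm T}Z(s_i))_{i\le n}$, $\lambda_1=\lim\frac1nE\|G\mathbf m-Z\|^2$, $\pi_1=\lim\frac1n\operatorname{tr}((G+G^{\mathrm T})G)$, $\pi_2=\lim\frac1n\operatorname{tr}G$, and $$\Omega=\begin{pmatrix}\lambda_1/\sigma^2+\pi_1&\pi_2/\sigma^2\\ \pi_2/\sigma^2&1/(2\sigma^4)\end{pmatrix}.$$ **Theorem.** Under (1)–(6) and (9), the limits defining $\Omega$ exist and $\Omega$ is singular. If moreover $nh^8\to0$, $n^{1/2}h^2/\log^2n\to\infty$, $\rho_n\to\infty$,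 $\rho_nh^4\to0$ and $nh^2/\rho_n\to\infty$, then $\hat\alpha$ is a consistent estimator of $\alpha_0$: $\hat\alpha_n\to\alpha_0$ in probability. -/

import Mathlib

open Filter Topology MeasureTheory ProbabilityTheory
open scoped Matrix

noncomputable section

namespace SpatialVC

/-- The plane with the Euclidean norm; locations are points of the plane. -/
abbrev Plane : Type := EuclideanSpace ℝ (Fin 2)

/-! ### Kernel and local linear smoother -/

/-- Admissible kernels: bounded, nonnegative and positive at the origin, symmetric, Lipschitz
continuous, with compact support.  (A function with compact support cannot be strictly positive
everywhere; strict positivity is required at the origin only.) -/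
structure IsKernel (K : ℝ → ℝ) : Prop where
  nonneg : ∀ t, 0 ≤ K t
  pos_zero : 0 < K 0
  symm : ∀ t, K (-t) = K t
  bounded : ∃ C : ℝ, ∀ t, K t ≤ C
  lipschitz : ∃ L : NNReal, LipschitzWith L K
  compactSupport : HasCompactSupport K

/-- `K_h(t) = K(t / h) / h ^ 2`. -/
def scaledKernel (K : ℝ → ℝ) (h t : ℝ) : ℝ := K (t / h) / h ^ 2

/-- The local linear design matrix at `s₀`: its `i`-th row is
`(x_iᵀ, (x_i ⊗ (s_i - s₀))ᵀ)`, `i < n`. -/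
def localDesign {p : ℕ} (n : ℕ) (x : ℕ → Fin p → ℝ) (s : ℕ → Plane) (s₀ : Plane) :
    Matrix (Fin n) (Fin p ⊕ Fin p × Fin 2) ℝ :=
  Matrix.of fun i c =>
    Sum.elim (fun a => x i a) (fun ab => x i ab.1 * (s i - s₀) ab.2) c

/-- The diagonal matrix of the kernel weights `K_h(‖s_i - s₀‖)`. -/
def localWeight (K : ℝ → ℝ) (h : ℝ) (n : ℕ) (s : ℕ → Plane) (s₀ : Plane) :
    Matrix (Fin n) (Fin n) ℝ :=
  Matrix.diagonal fun i => scaledKernel K h ‖s i - s₀‖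

/-- The smoothing matrix: its `i`-th row is
`(x_iᵀ, 0) (𝒳ᵀ 𝒲 𝒳)⁻¹ 𝒳ᵀ 𝒲`, where `𝒳` and `𝒲` are the local linear design and weight matrices
at `s_i`.  Thus, applied to `A(α) Y`, it gives the fitted values `x_iᵀ β̃(s_i; α)`. -/
def smoother {p : ℕ} (K : ℝ → ℝ) (h : ℝ) (n : ℕ) (x : ℕ → Fin p → ℝ) (s : ℕ → Plane) :
    Matrix (Fin n) (Fin n) ℝ :=
  Matrix.of fun i =>
    let D := localDesign n x s (s i)
    let V := localWeight K h n s (s i)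
    (Sum.elim (x i) 0 : Fin p ⊕ Fin p × Fin 2 → ℝ) ᵥ* ((Dᵀ * V * D)⁻¹ * Dᵀ * V)

/-! ### The spatial autoregressive varying coefficient model -/

/-- `A(α) = I - α W`. -/
def sarMatrix {n : ℕ} (W : Matrix (Fin n) (Fin n) ℝ) (α : ℝ) : Matrix (Fin n) (Fin n) ℝ :=
  1 - α • W

/-- `G = W A(α₀)⁻¹`. -/
def gMatrix {n : ℕ} (W : Matrix (Fin n) (Fin n) ℝ) (α₀ : ℝ) : Matrix (Fin n) (Fin n) ℝ :=
  W * (sarMatrix W α₀)⁻¹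

/-- The vector with entries `x_iᵀ β(s_i)`, `i < n`. -/
def meanVec {p : ℕ} (n : ℕ) (β : Plane → Fin p → ℝ) (s : ℕ → Plane) (x : ℕ → Fin p → ℝ) :
    Fin n → ℝ :=
  fun i => x i ⬝ᵥ β (s i)

/-- The model `y_i = α₀ ∑_{j ≠ i} w_{ij} y_j + x_iᵀ β(s_i) + ε_i`, `i < n`. -/
def SatisfiesModel {p n : ℕ} (W : Matrix (Fin n) (Fin n) ℝ) (α₀ : ℝ) (β : Plane → Fin p → ℝ)
    (s : ℕ → Plane) (x : ℕ → Fin p → ℝ) (e : ℕ → ℝ) (y : Fin n → ℝ) : Prop :=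
  ∀ i : Fin n, y i = α₀ * ∑ j ∈ Finset.univ.erase i, W i j * y j + x i ⬝ᵥ β (s i) + e i

/-- `σ̃²(α) = n⁻¹ ‖A(α) Y - S A(α) Y‖²`. -/
def profileVariance {p n : ℕ} (K : ℝ → ℝ) (h : ℝ) (W : Matrix (Fin n) (Fin n) ℝ)
    (s : ℕ → Plane) (x : ℕ → Fin p → ℝ) (y : Fin n → ℝ) (α : ℝ) : ℝ :=
  let z := sarMatrix W α *ᵥ y
  let r := z - smoother K h n x s *ᵥ z
  (n : ℝ)⁻¹ * (r ⬝ᵥ r)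

/-- The profile log likelihood `-n log σ̃(α) + log |det A(α)|` of `α`; if `α_i` are the (complex)
eigenvalues of `W`, then `log |det A(α)| = ∑ log |1 - α α_i|`. -/
def profileLogLik {p n : ℕ} (K : ℝ → ℝ) (h : ℝ) (W : Matrix (Fin n) (Fin n) ℝ)
    (s : ℕ → Plane) (x : ℕ → Fin p → ℝ) (y : Fin n → ℝ) (α : ℝ) : ℝ :=
  -(n : ℝ) * Real.log (Real.sqrt (profileVariance K h W s x y α))
    + Real.log |(sarMatrix W α).det|

/-- `a` maximizes the profile log likelihood over the parameter set `Δ`. -/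
def IsProfileEstimate {p n : ℕ} (K : ℝ → ℝ) (h : ℝ) (W : Matrix (Fin n) (Fin n) ℝ)
    (s : ℕ → Plane) (x : ℕ → Fin p → ℝ) (Δ : Set ℝ) (y : Fin n → ℝ) (a : ℝ) : Prop :=
  a ∈ Δ ∧ IsMaxOn (profileLogLik K h W s x y) Δ a

/-! ### Regularity conditions -/

/-- The row sums of absolute values are at most `C`. -/
def RowSumsLE {n : ℕ} (M : Matrix (Fin n) (Fin n) ℝ) (C : ℝ) : Prop :=
  ∀ i, ∑ j, |M i j| ≤ C

/-- The column sums of absolute values are at most `C`. -/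
def ColSumsLE {n : ℕ} (M : Matrix (Fin n) (Fin n) ℝ) (C : ℝ) : Prop :=
  ∀ j, ∑ i, |M i j| ≤ C

/-- Smoothness of the coefficients: continuous second partial derivatives around the region. -/
def SmoothCoefficients {p : ℕ} (R : Set Plane) (β : Plane → Fin p → ℝ) : Prop :=
  ∃ U : Set Plane, IsOpen U ∧ R ⊆ U ∧ ContDiffOn ℝ 2 β U

/-- `Ψ = E(X₁ X₁ᵀ)`. -/
def secondMoment {Ω : Type*} [MeasurableSpace Ω] {p : ℕ} (μ : Measure Ω)
    (X : Ω → Fin p → ℝ) : Matrix (Fin p) (Fin p) ℝ :=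
  Matrix.of fun a b => ∫ ω, X ω a * X ω b ∂μ

/-- `Γ = E X₁`. -/
def firstMoment {Ω : Type*} [MeasurableSpace Ω] {p : ℕ} (μ : Measure Ω)
    (X : Ω → Fin p → ℝ) : Fin p → ℝ :=
  fun a => ∫ ω, X ω a ∂μ

/-- I.i.d. covariates, i.i.d. centred errors with variance `σ² > 0` (not necessarily normal),
independence of covariates and errors, nondegenerate second moments of the covariates, and moments
of order `2 q > 4`; note that `(xᵀ x) ^ q = ‖x‖ ^ (2 q)`. -/
structure SampleCondition {Ω : Type*} [MeasurableSpace Ω] (μ : Measure Ω) {p : ℕ}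
    (X : ℕ → Ω → Fin p → ℝ) (ε : ℕ → Ω → ℝ) (σ : ℝ) : Prop where
  measurable_X : ∀ i, Measurable (X i)
  measurable_ε : ∀ i, Measurable (ε i)
  indep_X : iIndepFun X μ
  identDistrib_X : ∀ i, IdentDistrib (X i) (X 0) μ μ
  indep_ε : iIndepFun ε μ
  identDistrib_ε : ∀ i, IdentDistrib (ε i) (ε 0) μ μ
  indep_X_ε : IndepFun (fun ω i => X i ω) (fun ω i => ε i ω) μ
  mean_ε : ∫ ω, ε 0 ω ∂μ = 0
  sigma_pos : 0 < σ
  variance_ε : ∫ ω, ε 0 ω ^ 2 ∂μ = σ ^ 2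
  posDef : (secondMoment μ (X 0)).PosDef
  moments : ∃ q : ℝ, 2 < q ∧ Integrable (fun ω => (X 0 ω ⬝ᵥ X 0 ω) ^ q) μ ∧
    Integrable (fun ω => |ε 0 ω| ^ (2 * q)) μ

/-- Fixed design points in a compact region `R` that carries a density `f`, Lipschitz continuous
and bounded away from zero on `R`, such that kernel averages over the design points approximate,
with an error of order `h` uniformly over `R`, the corresponding integrals, for every bounded
Lipschitz function `r` and every admissible kernel.  The region is regular: it fills a fixed
proportion of every small disc centred in it (as do convex bodies and Lipschitz domains). -/
structure DesignCondition (R : Set Plane) (f : Plane → ℝ) (s : ℕ → Plane) (h : ℕ → ℝ) :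
    Prop where
  isCompact : IsCompact R
  regular : ∃ c : ℝ, 0 < c ∧ ∀ z ∈ R, ∀ δ : ℝ, 0 < δ → δ ≤ 1 →
    c * δ ^ 2 ≤ volume.real (R ∩ Metric.ball z δ)
  mem : ∀ i, s i ∈ R
  lipschitz : ∃ L : NNReal, LipschitzOnWith L f R
  bounded_below : ∃ c : ℝ, 0 < c ∧ ∀ z ∈ R, c ≤ f z
  density : ∫ t in R, f t = 1
  approx : ∀ K : ℝ → ℝ, IsKernel K → ∀ r : Plane → ℝ, (∃ B : ℝ, ∀ t, |r t| ≤ B) →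
    (∃ L : NNReal, LipschitzWith L r) →
    ∃ C : ℝ, ∀ᶠ n : ℕ in atTop, ∀ z ∈ R,
      |(n : ℝ)⁻¹ * ∑ i ∈ Finset.range n, r (s i) * scaledKernel K (h n) ‖s i - z‖
        - ∫ t in R, r t * scaledKernel K (h n) ‖t - z‖ * f t| ≤ C * h n

/-- Conditions on the weights: zero diagonal, entries `O(1 / ρ_n)` uniformly, `A(α₀)` invertible,
and `W`, `A(α₀)⁻¹` uniformly bounded in both row and column sums. -/
structure WeightCondition (W : ∀ n : ℕ, Matrix (Fin n) (Fin n) ℝ) (α₀ : ℝ) (ρ : ℕ → ℝ) :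
    Prop where
  diag_zero : ∀ n i, W n i i = 0
  rho_pos : ∀ n, 0 < ρ n
  entries : ∃ C : ℝ, ∀ n i j, |W n i j| ≤ C / ρ n
  invertible : ∀ n, IsUnit (sarMatrix (W n) α₀)
  sums : ∃ C : ℝ, ∀ n, RowSumsLE (W n) C ∧ ColSumsLE (W n) C ∧
    RowSumsLE (sarMatrix (W n) α₀)⁻¹ C ∧ ColSumsLE (sarMatrix (W n) α₀)⁻¹ C

/-- Conditions on the parameter set: compact, the true value is interior, and the inverses
`A(α)⁻¹`, `α ∈ Δ`, exist and are uniformly bounded in either row or column sums. -/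
structure ParameterCondition (W : ∀ n : ℕ, Matrix (Fin n) (Fin n) ℝ) (α₀ : ℝ) (Δ : Set ℝ) :
    Prop where
  isCompact : IsCompact Δ
  interior : α₀ ∈ interior Δ
  invertible : ∀ n, ∀ α ∈ Δ, IsUnit (sarMatrix (W n) α)
  sums : ∃ C : ℝ, (∀ n, ∀ α ∈ Δ, RowSumsLE (sarMatrix (W n) α)⁻¹ C) ∨
    (∀ n, ∀ α ∈ Δ, ColSumsLE (sarMatrix (W n) α)⁻¹ C)

/-- `ρ_n → ∞`, the row sums of `G` are `O(1 / √ρ_n)` uniformly, and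
`(ρ_n / n) E ‖G m - S G m‖² → λ₄ > 0`. -/
structure SingularCondition {Ω : Type*} [MeasurableSpace Ω] (μ : Measure Ω) {p : ℕ}
    (K : ℝ → ℝ) (h : ℕ → ℝ) (W : ∀ n : ℕ, Matrix (Fin n) (Fin n) ℝ) (α₀ : ℝ) (ρ : ℕ → ℝ)
    (β : Plane → Fin p → ℝ) (s : ℕ → Plane) (X : ℕ → Ω → Fin p → ℝ) : Prop where
  rho_tendsto : Tendsto ρ atTop atTop
  row_sums : ∃ C : ℝ, ∀ n, RowSumsLE (gMatrix (W n) α₀) (C / Real.sqrt (ρ n))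
  limit : ∃ lam₄ : ℝ, 0 < lam₄ ∧
    Tendsto (fun n : ℕ => ρ n / n * ∫ ω,
      (let x := fun i => X i ω
       let v := gMatrix (W n) α₀ *ᵥ meanVec n β s x
       let d := v - smoother K (h n) n x s *ᵥ v
       d ⬝ᵥ d) ∂μ) atTop (𝓝 lam₄)

/-! ### The limiting information matrix -/

/-- `κ₀ = ∫ K(‖t‖) dt` over the plane. -/
def kappaZero (K : ℝ → ℝ) : ℝ := ∫ t : Plane, K ‖t‖

/-- `Z₁(z) = lim n⁻¹ ∑_i g_{ii} β(s_i) K_h(‖s_i - z‖)` for every `z ∈ R`. -/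
def IsZOne {p : ℕ} (K : ℝ → ℝ) (h : ℕ → ℝ) (W : ∀ n : ℕ, Matrix (Fin n) (Fin n) ℝ) (α₀ : ℝ)
    (β : Plane → Fin p → ℝ) (s : ℕ → Plane) (R : Set Plane) (Z₁ : Plane → Fin p → ℝ) : Prop :=
  ∀ z ∈ R, Tendsto (fun n : ℕ => (n : ℝ)⁻¹ • ∑ i : Fin n,
    (gMatrix (W n) α₀ i i * scaledKernel K (h n) ‖s i - z‖) • β (s i)) atTop (𝓝 (Z₁ z))

/-- `Z₂(z) = lim n⁻¹ ∑_i ∑_{j ≠ i} g_{ij} β(s_j) K_h(‖s_i - z‖)` for every `z ∈ R`. -/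
def IsZTwo {p : ℕ} (K : ℝ → ℝ) (h : ℕ → ℝ) (W : ∀ n : ℕ, Matrix (Fin n) (Fin n) ℝ) (α₀ : ℝ)
    (β : Plane → Fin p → ℝ) (s : ℕ → Plane) (R : Set Plane) (Z₂ : Plane → Fin p → ℝ) : Prop :=
  ∀ z ∈ R, Tendsto (fun n : ℕ => (n : ℝ)⁻¹ • ∑ i : Fin n, ∑ j ∈ Finset.univ.erase i,
    (gMatrix (W n) α₀ i j * scaledKernel K (h n) ‖s i - z‖) • β (s j)) atTop (𝓝 (Z₂ z))

/-- The vector with entries `κ₀⁻¹ f(s_i)⁻¹ x_iᵀ (Z₁(s_i) + Ψ⁻¹ Γ Γᵀ Z₂(s_i))`, `i < n`. -/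
def zVec {p : ℕ} (n : ℕ) (K : ℝ → ℝ) (f : Plane → ℝ) (Ψ : Matrix (Fin p) (Fin p) ℝ)
    (Γ : Fin p → ℝ) (Z₁ Z₂ : Plane → Fin p → ℝ) (s : ℕ → Plane) (x : ℕ → Fin p → ℝ) :
    Fin n → ℝ :=
  fun i => (kappaZero K)⁻¹ * ((f (s i))⁻¹ *
    (x i ⬝ᵥ (Z₁ (s i) + (Ψ⁻¹ * Matrix.vecMulVec Γ Γ) *ᵥ Z₂ (s i))))

/-- `Om` is the limiting information matrix of `(α, σ²)`,
`[[λ₁/σ² + π₁, π₂/σ²], [π₂/σ², 1/(2σ⁴)]]`, where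
`λ₁ = lim n⁻¹ E ‖G m - Z‖²`, `π₁ = lim n⁻¹ tr((G + Gᵀ) G)` and `π₂ = lim n⁻¹ tr G`. -/
def IsInformationLimit {Ω : Type*} [MeasurableSpace Ω] (μ : Measure Ω) {p : ℕ}
    (K : ℝ → ℝ) (h : ℕ → ℝ) (W : ∀ n : ℕ, Matrix (Fin n) (Fin n) ℝ) (α₀ σ : ℝ)
    (β : Plane → Fin p → ℝ) (R : Set Plane) (f : Plane → ℝ) (s : ℕ → Plane)
    (X : ℕ → Ω → Fin p → ℝ) (Om : Matrix (Fin 2) (Fin 2) ℝ) : Prop :=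
  ∃ (Z₁ Z₂ : Plane → Fin p → ℝ) (lam₁ pi₁ pi₂ : ℝ),
    IsZOne K h W α₀ β s R Z₁ ∧
    IsZTwo K h W α₀ β s R Z₂ ∧
    Tendsto (fun n : ℕ => (n : ℝ)⁻¹ * ∫ ω,
      (let x := fun i => X i ω
       let d := gMatrix (W n) α₀ *ᵥ meanVec n β s x
         - zVec n K f (secondMoment μ (X 0)) (firstMoment μ (X 0)) Z₁ Z₂ s x
       d ⬝ᵥ d) ∂μ) atTop (𝓝 lam₁) ∧
    Tendsto (fun n : ℕ => (n : ℝ)⁻¹ *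
      ((gMatrix (W n) α₀ + (gMatrix (W n) α₀)ᵀ) * gMatrix (W n) α₀).trace) atTop (𝓝 pi₁) ∧
    Tendsto (fun n : ℕ => (n : ℝ)⁻¹ * (gMatrix (W n) α₀).trace) atTop (𝓝 pi₂) ∧
    Om = !![lam₁ / σ ^ 2 + pi₁, pi₂ / σ ^ 2; pi₂ / σ ^ 2, 1 / (2 * σ ^ 4)]

end SpatialVC

end

set_option linter.unusedSectionVars false

noncomputable section

namespace SpatialVC

/-! ### Linear algebra -/

/-! Write `G` for `gMatrix`, `m` for the mean vector, `S` for the smoother and `δ = α₀ - α`.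

Singularity. The entries of `G` are `O(1/ρ)`, because those of `W` are and `A⁻¹` has bounded column
sums; its row sums are `O(1/√ρ)`. As `ρ → ∞`, the kernel averages defining `Z₁` and `Z₂`, the mean
square of `G m` and both normalized traces therefore tend to zero. So `Ω = diag(0, 1/(2σ⁴))`: at the
scale `n` the likelihood says nothing about `α`. This is `informationLimit_singular`.

Consistency. The information sits at the scale `n/ρ`. Since `A(α) = (1 + δ G) A`, the residuals are
`r₀ + δ r₁` with `r₀ = (I - S)(m + ε)` and `r₁ = (I - S) G (m + ε)`, and the profile variance is
exactly `a + (2 δ b + δ² d)/ρ`, where `a = ‖r₀‖²/n`, `b = (ρ/n) r₀·r₁`, `d = (ρ/n) ‖r₁‖²`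
(`profileVariance_eq`). The change of the log determinant is at most `δ tr G + δ² ‖G‖²/2` in
Frobenius norm, and `(ρ/n) ‖G‖² = O(1/√ρ)`. Hence `ρ/n` times the gain in likelihood over `α₀` is at
most `δ ((ρ/n) tr G - b/a) - δ² d/(2a) + o(1)`, uniformly over the compact `Δ`
(`profileLogLik_gain_le`). With high probability `a` is close to `σ²`, `b` to `σ² (ρ/n) tr G`, and
`d` is bounded and at least `λ₄/8` (`exists_coefficient_limits`). So the linear term cancels and the
gain is negative as soon as `|δ| ≥ η`, whereas at a maximizer it is nonnegative. An upper bound on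
the gain is all that is needed.

The lower bound on `d` is the hard part. The hypothesis on `λ₄` concerns an expectation, in which
the random and possibly ill-conditioned `S` appears, and a limit of expectations alone gives no
bound in probability. Coercivity of the design (`design_coercive`) and Hoeffding's inequality for
truncated covariates give events `E n`, of overwhelming probability, on which all local Gram
matrices are well conditioned (`exists_gram_event`). There the smoothed signal is close to the mean
squared residual of a deterministic population fit, a sum of independent terms concentrated around
its mean `t n` (`exists_signal_majorant`). Off `E n` a crude bound that holds for every sample shows
that the bad event contributes nothing to the expectation. Hence `t n ≥ λ₄/4` eventually
(`exists_signal_limit`).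

All other terms are negligible at the scale `n/ρ`: the smoothed noise is `O(ρ/(n h²))`, the
smoothing bias `O(ρ h⁴)`, the terms in `G ε` are `O(1/√ρ)`. -/

lemma log_abs_det_one_add_smul_le {n : ℕ} (G : Matrix (Fin n) (Fin n) ℝ) (d : ℝ)
    (hdet : (1 + d • G).det ≠ 0) :
    Real.log |(1 + d • G).det| ≤ d * G.trace + d ^ 2 / 2 * ∑ i, ∑ j, G i j ^ 2 := by
  set B : Matrix (Fin n) (Fin n) ℝ := 1 + d • G with hB
  -- Passing to `Bᵀ B` makes the eigenvalues real and positive even though `G` is not symmetric.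
  -- Then `log λ ≤ λ - 1` turns the log determinant into a trace, which is quadratic in `d`.
  have hP : (Bᵀ * B).PosSemidef := by
    simpa [Matrix.conjTranspose_eq_transpose_of_trivial] using
      Matrix.posSemidef_conjTranspose_mul_self B
  have hdetP : (Bᵀ * B).det = |B.det| ^ 2 := by
    rw [Matrix.det_mul, Matrix.det_transpose, sq_abs, sq]
  have hpos : 0 < |B.det| := abs_pos.mpr hdet
  have hne : ∀ i, hP.1.eigenvalues i ≠ 0 := by
    have h1 := hP.1.det_eq_prod_eigenvalues
    intro i hi
    have h2 : ∏ i, (hP.1.eigenvalues i : ℝ) = 0 := Finset.prod_eq_zero (Finset.mem_univ i) hi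
    have h3 : (Bᵀ * B).det = 0 := by rw [h1]; exact_mod_cast h2
    rw [hdetP] at h3
    exact (pow_pos hpos 2).ne' h3
  have hlam : ∀ i, 0 < hP.1.eigenvalues i := fun i =>
    lt_of_le_of_ne (hP.eigenvalues_nonneg i) (hne i).symm
  have hlog : 2 * Real.log |B.det| ≤ (Bᵀ * B).trace - n := by
    have h1 : Real.log ((Bᵀ * B).det) = ∑ i, Real.log (hP.1.eigenvalues i) := by
      rw [hP.1.det_eq_prod_eigenvalues, ← Real.log_prod (fun i _ => hne i)]
      norm_cast
    have h2 : (Bᵀ * B).trace = ∑ i, hP.1.eigenvalues i := by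
      rw [hP.1.trace_eq_sum_eigenvalues]; norm_cast
    have h3 : Real.log ((Bᵀ * B).det) = 2 * Real.log |B.det| := by
      rw [hdetP, Real.log_pow]; norm_cast
    rw [← h3, h1, h2]
    calc ∑ i, Real.log (hP.1.eigenvalues i) ≤ ∑ i, (hP.1.eigenvalues i - 1) :=
          Finset.sum_le_sum fun i _ => Real.log_le_sub_one_of_pos (hlam i)
      _ = _ := by simp
  have htr : (Bᵀ * B).trace = n + 2 * d * G.trace + d ^ 2 * ∑ i, ∑ j, G i j ^ 2 := by
    have h1 : Bᵀ * B = 1 + d • G + d • Gᵀ + d ^ 2 • (Gᵀ * G) := by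
      rw [hB]
      simp only [Matrix.transpose_add, Matrix.transpose_one, Matrix.transpose_smul,
        add_mul, mul_add, one_mul, mul_one, Matrix.smul_mul, Matrix.mul_smul, smul_smul, sq]
      abel
    have h2 : (Gᵀ * G).trace = ∑ i, ∑ j, G i j ^ 2 := by
      simp only [Matrix.trace, Matrix.diag, Matrix.mul_apply, Matrix.transpose_apply, sq]
      rw [Finset.sum_comm]
    rw [h1]
    simp only [Matrix.trace_add, Matrix.trace_smul, Matrix.trace_transpose, h2, smul_eq_mul,
      Matrix.trace_one, Fintype.card_fin]
    ring
  linarith [hlog, htr]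

/-- A uniform lower bound for a positive definite quadratic form. -/
lemma exists_pos_le_quadForm {I : Type*} [Fintype I] (P : Matrix I I ℝ)
    (hP : P.PosDef) : ∃ l : ℝ, 0 < l ∧ ∀ u : I → ℝ, l * (u ⬝ᵥ u) ≤ u ⬝ᵥ (P *ᵥ u) := by
  classical
  rcases isEmpty_or_nonempty I with hI | hI
  · exact ⟨1, one_pos, fun u => by simp [dotProduct]⟩
  have hc : IsCompact {u : I → ℝ | u ⬝ᵥ u = 1} := by
    refine Metric.isCompact_of_isClosed_isBounded ?_ ?_
    · exact isClosed_eq (by fun_prop) continuous_const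
    · refine (Metric.isBounded_closedBall (x := (0 : I → ℝ)) (r := 1)).subset ?_
      intro u hu
      rw [mem_closedBall_zero_iff, pi_norm_le_iff_of_nonneg zero_le_one]
      intro i
      have h1 : u i * u i ≤ 1 := by
        rw [← hu, dotProduct]
        exact Finset.single_le_sum (f := fun i => u i * u i)
          (fun i _ => mul_self_nonneg _) (Finset.mem_univ i)
      rw [Real.norm_eq_abs]
      exact abs_le_one_iff_mul_self_le_one.mpr h1
  have hne : {u : I → ℝ | u ⬝ᵥ u = 1}.Nonempty := by
    obtain ⟨i⟩ := hI
    exact ⟨Pi.single i 1, by simp⟩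
  obtain ⟨u0, hu0, hmin⟩ := hc.exists_isMinOn hne
    (f := fun u => u ⬝ᵥ (P *ᵥ u)) (by fun_prop)
  have hu0ne : u0 ≠ 0 := by
    rintro rfl
    simp at hu0
  refine ⟨u0 ⬝ᵥ (P *ᵥ u0), ?_, ?_⟩
  · have := hP.dotProduct_mulVec_pos hu0ne
    simpa using this
  · intro u
    by_cases hu : u = 0
    · simp [hu]
    have hpos : 0 < u ⬝ᵥ u := by
      have h0 : 0 ≤ u ⬝ᵥ u := Finset.sum_nonneg fun _ _ => mul_self_nonneg _
      refine lt_of_le_of_ne h0 (fun h => hu ?_)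
      exact dotProduct_self_eq_zero.mp h.symm
    set r := Real.sqrt (u ⬝ᵥ u) with hr
    have hr2 : r * r = u ⬝ᵥ u := Real.mul_self_sqrt hpos.le
    have hrpos : 0 < r := Real.sqrt_pos.mpr hpos
    have h1 : (r⁻¹ • u) ∈ {u : I → ℝ | u ⬝ᵥ u = 1} := by
      simp only [Set.mem_ofPred_eq, smul_dotProduct, dotProduct_smul, smul_eq_mul]
      rw [← hr2]; field_simp
    have h2 := hmin h1
    simp only [Set.mem_ofPred_eq, Matrix.mulVec_smul, smul_dotProduct, dotProduct_smul,
      smul_eq_mul] at h2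
    calc _ ≤ (r⁻¹ * (r⁻¹ * (u ⬝ᵥ (P *ᵥ u)))) * (u ⬝ᵥ u) :=
          mul_le_mul_of_nonneg_right h2 hpos.le
      _ = _ := by rw [← hr2]; field_simp

lemma isUnit_of_le_quadForm {I : Type*} [Fintype I] [DecidableEq I] (M : Matrix I I ℝ) {c : ℝ}
    (hc : 0 < c) (hM : ∀ u : I → ℝ, c * (u ⬝ᵥ u) ≤ u ⬝ᵥ (M *ᵥ u)) : IsUnit M := by
  rw [← Matrix.mulVec_injective_iff_isUnit]
  intro a b hab
  have h0 : M *ᵥ (a - b) = 0 := by rw [Matrix.mulVec_sub, sub_eq_zero]; exact hab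
  have h1 := hM (a - b)
  rw [h0, dotProduct_zero] at h1
  have h2 : (a - b) ⬝ᵥ (a - b) = 0 := by
    have h3 : 0 ≤ (a - b) ⬝ᵥ (a - b) := Finset.sum_nonneg fun _ _ => mul_self_nonneg _
    nlinarith
  exact sub_eq_zero.mp (dotProduct_self_eq_zero.mp h2)

/-! ### Weighted local linear least squares -/

/-- The covariate to which a column of the local design belongs. -/
def featComp {p : ℕ} : Fin p ⊕ Fin p × Fin 2 → Fin p := Sum.elim id Prod.fst

/-- The factor `1` or `v_b / h` of a column of the rescaled local design. -/
def featMono {p : ℕ} (h : ℝ) (v : Plane) : Fin p ⊕ Fin p × Fin 2 → ℝ :=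
  Sum.elim (fun _ => 1) (fun ab => v ab.2 / h)

/-- The local design with the slopes measured in units of the bandwidth. -/
def scaledDesign {p : ℕ} (n : ℕ) (h : ℝ) (x : ℕ → Fin p → ℝ) (s : ℕ → Plane) (s₀ : Plane) :
    Matrix (Fin n) (Fin p ⊕ Fin p × Fin 2) ℝ :=
  Matrix.of fun j k => x j (featComp k) * featMono h (s j - s₀) k

/-- The coefficients `(u₀, h u₁)` of the rescaled local design. -/
def rescale {p : ℕ} (h : ℝ) (u : Fin p ⊕ Fin p × Fin 2 → ℝ) : Fin p ⊕ Fin p × Fin 2 → ℝ :=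
  Sum.elim (fun a => u (Sum.inl a)) (fun ab => h * u (Sum.inr ab))

/-- The weights of the observations in the local fit at `s_i`. -/
def rowWeight (K : ℝ → ℝ) (h : ℝ) (s : ℕ → Plane) (i j : ℕ) : ℝ :=
  scaledKernel K h ‖s j - s i‖

section Rows

variable {p n : ℕ} {K : ℝ → ℝ} {h : ℝ} {x : ℕ → Fin p → ℝ} {s : ℕ → Plane}

/-- Measuring slopes in units of `h` leaves the intercepts, hence the fitted values, unchanged, and
it makes the Gram matrices coercive with a constant that does not degenerate as `h → 0`. -/
lemma localDesign_mulVec (hh : h ≠ 0) (s₀ : Plane) (u : Fin p ⊕ Fin p × Fin 2 → ℝ) :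
    localDesign n x s s₀ *ᵥ u = scaledDesign n h x s s₀ *ᵥ rescale h u := by
  ext j
  simp only [Matrix.mulVec, dotProduct, localDesign, scaledDesign, Matrix.of_apply,
    Fintype.sum_sum_type, Sum.elim_inl, Sum.elim_inr, featComp, featMono, rescale, id, mul_one]
  congr 1
  refine Finset.sum_congr rfl fun ab _ => ?_
  field_simp

lemma localGram_apply (s₀ : Plane) (z : Fin n → ℝ) (u : Fin p ⊕ Fin p × Fin 2 → ℝ) :
    u ⬝ᵥ (((localDesign n x s s₀)ᵀ * localWeight K h n s s₀) *ᵥ z) =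
      ∑ j : Fin n, scaledKernel K h ‖s j - s₀‖ * (localDesign n x s s₀ *ᵥ u) j * z j := by
  rw [← Matrix.mulVec_mulVec, Matrix.dotProduct_mulVec, Matrix.vecMul_transpose]
  simp only [dotProduct, localWeight, Matrix.mulVec_diagonal]
  exact Finset.sum_congr rfl fun j _ => by ring

/-- Coercivity of the rescaled local Gram matrix at `s_i`. -/
def GramBound (n : ℕ) (K : ℝ → ℝ) (h : ℝ) (x : ℕ → Fin p → ℝ) (s : ℕ → Plane) (i : ℕ)
    (κ : ℝ) : Prop :=
  ∀ u : Fin p ⊕ Fin p × Fin 2 → ℝ, κ * (u ⬝ᵥ u) ≤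
    ∑ j : Fin n, rowWeight K h s i j * (scaledDesign n h x s (s i) *ᵥ u) j ^ 2

lemma rescale_surj (hh : h ≠ 0) (u : Fin p ⊕ Fin p × Fin 2 → ℝ) :
    ∃ v, rescale h v = u := by
  refine ⟨Sum.elim (fun a => u (Sum.inl a)) (fun ab => h⁻¹ * u (Sum.inr ab)), ?_⟩
  ext k
  rcases k with a | ab
  · simp [rescale]
  · simp [rescale, hh]

/-- The normal equations of the local fit, without any condition on the Gram matrix. -/
lemma smoother_eq_of_isUnit (hh : h ≠ 0) (i : Fin n) (z : Fin n → ℝ)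
    (hu : IsUnit ((localDesign n x s (s i))ᵀ * localWeight K h n s (s i)
      * localDesign n x s (s i))) :
    ∃ η : Fin p ⊕ Fin p × Fin 2 → ℝ,
      (∀ u, ∑ j : Fin n, rowWeight K h s i j * (scaledDesign n h x s (s i) *ᵥ u) j
        * (scaledDesign n h x s (s i) *ᵥ η) j = ∑ j : Fin n, rowWeight K h s i j
          * (scaledDesign n h x s (s i) *ᵥ u) j * z j) ∧
      (smoother K h n x s *ᵥ z) i = ∑ a, x i a * η (Sum.inl a) := by
  set D := localDesign n x s (s i) with hD
  set V := localWeight K h n s (s i) with hV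
  set θ := ((Dᵀ * V * D)⁻¹ * Dᵀ * V) *ᵥ z with hθ
  refine ⟨rescale h θ, ?_, ?_⟩
  · intro u
    obtain ⟨v, rfl⟩ := rescale_surj hh u
    rw [← localDesign_mulVec hh, ← localDesign_mulVec hh]
    have h1 := localGram_apply (K := K) (h := h) (x := x) (s := s) (s i) z v
    have h2 := localGram_apply (K := K) (h := h) (x := x) (s := s) (s i) (D *ᵥ θ) v
    unfold rowWeight
    rw [← h1, ← h2, Matrix.mulVec_mulVec, ← hD, ← hV]
    congr 1
    rw [hθ, Matrix.mulVec_mulVec, Matrix.mul_assoc (Dᵀ * V * D)⁻¹, ← Matrix.mul_assoc (Dᵀ * V * D),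
      Matrix.mul_nonsing_inv _ ((Matrix.isUnit_iff_isUnit_det _).mp hu), Matrix.one_mul]
  · have h1 : (smoother K h n x s *ᵥ z) i =
        ((Sum.elim (x i) 0 : Fin p ⊕ Fin p × Fin 2 → ℝ) ᵥ* ((Dᵀ * V * D)⁻¹ * Dᵀ * V)) ⬝ᵥ z := rfl
    rw [h1, ← Matrix.dotProduct_mulVec, ← hθ]
    simp [dotProduct, Fintype.sum_sum_type, rescale]

/-- The inverse of a singular matrix is `0` by convention, so a degenerate local fit returns zero.
This allows bounds valid for every sample. -/
lemma smoother_eq_zero_of_not_isUnit (i : Fin n) (z : Fin n → ℝ)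
    (hu : ¬ IsUnit ((localDesign n x s (s i))ᵀ * localWeight K h n s (s i)
      * localDesign n x s (s i))) :
    (smoother K h n x s *ᵥ z) i = 0 := by
  set D := localDesign n x s (s i) with hD
  set V := localWeight K h n s (s i) with hV
  have h1 : (smoother K h n x s *ᵥ z) i =
      ((Sum.elim (x i) 0 : Fin p ⊕ Fin p × Fin 2 → ℝ) ᵥ* ((Dᵀ * V * D)⁻¹ * Dᵀ * V)) ⬝ᵥ z := rfl
  rw [h1, Matrix.nonsing_inv_apply_not_isUnit _
    (fun hd => hu ((Matrix.isUnit_iff_isUnit_det _).mpr hd))]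
  simp

lemma GramBound.isUnit {i : Fin n} {κ : ℝ} (hG : GramBound n K h x s i κ) (hκ : 0 < κ)
    (hh : h ≠ 0) :
    IsUnit ((localDesign n x s (s i))ᵀ * localWeight K h n s (s i)
      * localDesign n x s (s i)) := by
  rw [← Matrix.mulVec_injective_iff_isUnit]
  intro a b hab
  set u := a - b with hu
  have h0 : ((localDesign n x s (s i))ᵀ * localWeight K h n s (s i)
      * localDesign n x s (s i)) *ᵥ u = 0 := by
    rw [hu, Matrix.mulVec_sub, sub_eq_zero]; exact hab
  have h1 := hG (rescale h u)
  rw [← localDesign_mulVec hh] at h1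
  have h2 := localGram_apply (K := K) (h := h) (x := x) (s := s) (s i)
    (localDesign n x s (s i) *ᵥ u) u
  rw [Matrix.mulVec_mulVec, h0, dotProduct_zero] at h2
  have h3 : ∑ j : Fin n, rowWeight K h s i j * (localDesign n x s (s i) *ᵥ u) j ^ 2 = 0 := by
    rw [h2]; exact Finset.sum_congr rfl fun j _ => by rw [rowWeight]; ring
  rw [h3] at h1
  have h4 : rescale h u ⬝ᵥ rescale h u = 0 := by
    have : 0 ≤ rescale h u ⬝ᵥ rescale h u := Finset.sum_nonneg fun _ _ => mul_self_nonneg _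
    nlinarith
  have h5 := dotProduct_self_eq_zero.mp h4
  have h6 : u = 0 := by
    ext k
    have h7 := congrFun h5 k
    rcases k with a | ab
    · simpa [rescale] using h7
    · simpa [rescale, hh] using h7
  exact sub_eq_zero.mp h6

/-- Weighted least squares reduces the weighted norm. -/
lemma wls_energy_le {J : Type*} [Fintype J] {w f z : J → ℝ} (hw : ∀ j, 0 ≤ w j)
    (hfz : ∑ j, w j * f j * f j = ∑ j, w j * f j * z j) :
    ∑ j, w j * f j ^ 2 ≤ ∑ j, w j * z j ^ 2 := by
  have h1 : 0 ≤ ∑ j, w j * (z j - f j) ^ 2 :=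
    Finset.sum_nonneg fun j _ => mul_nonneg (hw j) (sq_nonneg _)
  have h2 : ∑ j, w j * (z j - f j) ^ 2 = ∑ j, w j * z j ^ 2
      - 2 * ∑ j, w j * f j * z j + ∑ j, w j * f j * f j := by
    rw [Finset.mul_sum, ← Finset.sum_sub_distrib, ← Finset.sum_add_distrib]
    exact Finset.sum_congr rfl fun j _ => by ring
  have h3 : ∑ j, w j * f j ^ 2 = ∑ j, w j * f j * f j :=
    Finset.sum_congr rfl fun j _ => by ring
  linarith

lemma sum_inl_sq_le (u : Fin p ⊕ Fin p × Fin 2 → ℝ) :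
    ∑ a, u (Sum.inl a) ^ 2 ≤ u ⬝ᵥ u := by
  simp only [dotProduct, Fintype.sum_sum_type, ← sq]
  have : 0 ≤ ∑ ab : Fin p × Fin 2, u (Sum.inr ab) ^ 2 :=
    Finset.sum_nonneg fun i _ => sq_nonneg _
  linarith

lemma sq_fit_le (i : ℕ) (u : Fin p ⊕ Fin p × Fin 2 → ℝ) :
    (∑ a, x i a * u (Sum.inl a)) ^ 2 ≤ (x i ⬝ᵥ x i) * (u ⬝ᵥ u) := by
  calc _ ≤ (∑ a, x i a ^ 2) * ∑ a, u (Sum.inl a) ^ 2 := Finset.sum_mul_sq_le_sq_mul_sq _ _ _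
    _ ≤ (∑ a, x i a ^ 2) * (u ⬝ᵥ u) :=
        mul_le_mul_of_nonneg_left (sum_inl_sq_le u) (Finset.sum_nonneg fun i _ => sq_nonneg _)
    _ = _ := by simp only [dotProduct, ← sq]

lemma dot_self_nonneg {I : Type*} [Fintype I] (u : I → ℝ) : 0 ≤ u ⬝ᵥ u :=
  Finset.sum_nonneg fun _ _ => mul_self_nonneg _

/-- Coercivity bounds the coefficients of the fit by its weighted energy, which least squares keeps
below that of the data; Cauchy–Schwarz then bounds the fitted value. -/
lemma smoother_sq_le (hw : ∀ i j, 0 ≤ rowWeight K h s i j) (hh : h ≠ 0) {i : Fin n} {κ : ℝ}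
    (hκ : 0 < κ) (hG : GramBound n K h x s i κ) (z : Fin n → ℝ) :
    (smoother K h n x s *ᵥ z) i ^ 2 ≤
      (x i ⬝ᵥ x i) / κ * ∑ j : Fin n, rowWeight K h s i j * z j ^ 2 := by
  obtain ⟨η, h1, h2⟩ := smoother_eq_of_isUnit hh i z (hG.isUnit hκ hh)
  have h3 := (hG η).trans (wls_energy_le (fun j : Fin n => hw i j) (h1 η))
  rw [h2]
  refine (sq_fit_le _ η).trans ?_
  rw [div_mul_eq_mul_div, mul_div_assoc]
  refine mul_le_mul_of_nonneg_left ?_ (dot_self_nonneg _)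
  rw [le_div_iff₀ hκ]; linarith

/-- The fitted value at `s_i` is itself one term of the weighted energy of the fit, so no
conditioning of the Gram matrix is required. The price is a factor of order `n h²`, affordable only
on rare events. -/
lemma smoother_sq_le' (hw : ∀ i j, 0 ≤ rowWeight K h s i j) (hh : h ≠ 0) (i : Fin n)
    (z : Fin n → ℝ) :
    rowWeight K h s i i * (smoother K h n x s *ᵥ z) i ^ 2 ≤
      ∑ j : Fin n, rowWeight K h s i j * z j ^ 2 := by
  by_cases hu : IsUnit ((localDesign n x s (s i))ᵀ * localWeight K h n s (s i)
      * localDesign n x s (s i))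
  · obtain ⟨η, h1, h2⟩ := smoother_eq_of_isUnit hh i z hu
    have h3 := wls_energy_le (fun j : Fin n => hw i j) (h1 η)
    refine le_trans ?_ h3
    -- At `j = i` the offset `s_j - s_i` vanishes, so this row of the design is `(x_i, 0)`.
    have h4 : (smoother K h n x s *ᵥ z) i = (scaledDesign n h x s (s i) *ᵥ η) i := by
      rw [h2]
      simp [Matrix.mulVec, dotProduct, Fintype.sum_sum_type, scaledDesign, featComp, featMono]
    rw [h4]
    exact Finset.single_le_sum (f := fun j : Fin n => rowWeight K h s i j *
      (scaledDesign n h x s (s i) *ᵥ η) j ^ 2)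
      (fun j _ => mul_nonneg (hw i j) (sq_nonneg _)) (Finset.mem_univ i)
  · rw [smoother_eq_zero_of_not_isUnit i z hu]
    simpa using Finset.sum_nonneg fun (j : Fin n) _ => mul_nonneg (hw i j) (sq_nonneg _)

/-- Self-bounding: the smoother is applied to its own `i`-th row, whose fitted value is the squared
norm `q` of the row. The energy bound then reads `q² ≤ const · q`. -/
lemma smoother_row_sq_le (hw : ∀ i j, 0 ≤ rowWeight K h s i j) (hh : h ≠ 0) {i : Fin n} {κ B : ℝ}
    (hκ : 0 < κ) (hG : GramBound n K h x s i κ) (hB : ∀ j : Fin n, rowWeight K h s i j ≤ B) :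
    ∑ j, smoother K h n x s i j ^ 2 ≤ (x i ⬝ᵥ x i) / κ * B := by
  have h1 := smoother_sq_le hw hh hκ hG (fun j => smoother K h n x s i j)
  have h2 : (smoother K h n x s *ᵥ fun j => smoother K h n x s i j) i =
      ∑ j, smoother K h n x s i j ^ 2 := by
    simp only [Matrix.mulVec, dotProduct, sq]
  rw [h2] at h1
  set q := ∑ j, smoother K h n x s i j ^ 2 with hq
  have hq0 : 0 ≤ q := Finset.sum_nonneg fun j _ => sq_nonneg _
  have h3 : ∑ j : Fin n, rowWeight K h s i j * smoother K h n x s i j ^ 2 ≤ B * q := by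
    rw [hq, Finset.mul_sum]
    exact Finset.sum_le_sum fun j _ => mul_le_mul_of_nonneg_right (hB j) (sq_nonneg _)
  have h4 : 0 ≤ (x i ⬝ᵥ x i) / κ := div_nonneg (dot_self_nonneg _) hκ.le
  have h5 := h1.trans (mul_le_mul_of_nonneg_left h3 h4)
  have hB0 : 0 ≤ B := (hw i i).trans (hB i)
  rcases hq0.eq_or_lt with h6 | h6
  · rw [← h6]; positivity
  · have : q * q ≤ ((x i ⬝ᵥ x i) / κ * B) * q := by nlinarith
    exact le_of_mul_le_mul_right this h6

/-- Least squares reproduces everything in the span of the design, so any local fit may be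
subtracted from the data first. The fit `u` is later a Taylor polynomial of `β` (bias) or the
population fit (signal). -/
lemma smoother_sub_fit (hh : h ≠ 0) {i : Fin n} {κ : ℝ}
    (hκ : 0 < κ) (hG : GramBound n K h x s i κ) (z : Fin n → ℝ)
    (u : Fin p ⊕ Fin p × Fin 2 → ℝ) :
    (smoother K h n x s *ᵥ z) i - ∑ a, x i a * u (Sum.inl a) =
      (smoother K h n x s *ᵥ (z - scaledDesign n h x s (s i) *ᵥ u)) i := by
  have h0 : (smoother K h n x s *ᵥ (scaledDesign n h x s (s i) *ᵥ u)) i =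
      ∑ a, x i a * u (Sum.inl a) := by
    obtain ⟨η, h1, h2⟩ := smoother_eq_of_isUnit hh i (scaledDesign n h x s (s i) *ᵥ u)
      (hG.isUnit hκ hh)
    rw [h2]
    have h3 := hG (η - u)
    have h4 := h1 (η - u)
    have h5 : ∑ j : Fin n, rowWeight K h s i j *
        (scaledDesign n h x s (s i) *ᵥ (η - u)) j ^ 2 = 0 := by
      have h6 : ∀ j : Fin n, rowWeight K h s i j * (scaledDesign n h x s (s i) *ᵥ (η - u)) j ^ 2
          = rowWeight K h s i j * (scaledDesign n h x s (s i) *ᵥ (η - u)) j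
            * (scaledDesign n h x s (s i) *ᵥ η) j
            - rowWeight K h s i j * (scaledDesign n h x s (s i) *ᵥ (η - u)) j
            * (scaledDesign n h x s (s i) *ᵥ u) j := by
        intro j
        have : (scaledDesign n h x s (s i) *ᵥ (η - u)) j = (scaledDesign n h x s (s i) *ᵥ η) j
          - (scaledDesign n h x s (s i) *ᵥ u) j := by rw [Matrix.mulVec_sub]; rfl
        rw [sq]
        nth_rewrite 2 [this]
        ring
      rw [Finset.sum_congr rfl fun j _ => h6 j, Finset.sum_sub_distrib, h4, sub_self]
    rw [h5] at h3
    have h7 : (η - u) ⬝ᵥ (η - u) = 0 := by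
      have := dot_self_nonneg (η - u)
      nlinarith
    have h8 := sub_eq_zero.mp (dotProduct_self_eq_zero.mp h7)
    rw [h8]
  rw [Matrix.mulVec_sub, Pi.sub_apply, h0]

/-- Unlike the energy bound, a bound through the score `𝒳ᵀ 𝒲 z` retains the cancellation in sums of
nearly centred terms; coercivity enters twice, whence `κ²`. -/
lemma smoother_sq_le_score (hh : h ≠ 0) {i : Fin n}
    {κ : ℝ} (hκ : 0 < κ) (hG : GramBound n K h x s i κ) (z : Fin n → ℝ) :
    (smoother K h n x s *ᵥ z) i ^ 2 ≤ (x i ⬝ᵥ x i) / κ ^ 2 *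
      ∑ k, (∑ j : Fin n, rowWeight K h s i j * scaledDesign n h x s (s i) j k * z j) ^ 2 := by
  obtain ⟨η, h1, h2⟩ := smoother_eq_of_isUnit hh i z (hG.isUnit hκ hh)
  rw [h2]
  refine (sq_fit_le _ η).trans ?_
  rw [div_mul_eq_mul_div, mul_div_assoc]
  refine mul_le_mul_of_nonneg_left ?_ (dot_self_nonneg _)
  set g : Fin p ⊕ Fin p × Fin 2 → ℝ := fun k =>
    ∑ j : Fin n, rowWeight K h s i j * scaledDesign n h x s (s i) j k * z j with hg
  have h3 : κ * (η ⬝ᵥ η) ≤ η ⬝ᵥ g := by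
    refine (hG η).trans (le_of_eq ?_)
    have h4 := h1 η
    have h5 : ∑ j : Fin n, rowWeight K h s i j * (scaledDesign n h x s (s i) *ᵥ η) j ^ 2 =
      ∑ j : Fin n, rowWeight K h s i j * (scaledDesign n h x s (s i) *ᵥ η) j
        * (scaledDesign n h x s (s i) *ᵥ η) j := Finset.sum_congr rfl fun j _ => by ring
    rw [h5, h4]
    simp only [Matrix.mulVec, dotProduct, hg, Finset.mul_sum, Finset.sum_mul]
    rw [Finset.sum_comm]
    exact Finset.sum_congr rfl fun k _ => Finset.sum_congr rfl fun j _ => by ring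
  have h6 : (η ⬝ᵥ g) ^ 2 ≤ (η ⬝ᵥ η) * ∑ k, g k ^ 2 := by
    have := Finset.sum_mul_sq_le_sq_mul_sq Finset.univ η g
    simpa only [dotProduct, ← sq] using this
  have hq := dot_self_nonneg η
  rw [le_div_iff₀ (by positivity)]
  rcases hq.eq_or_lt with h7 | h7
  · rw [← h7, zero_mul]; exact Finset.sum_nonneg fun k _ => sq_nonneg (g k)
  · have h8 : (κ * (η ⬝ᵥ η)) ^ 2 ≤ (η ⬝ᵥ g) ^ 2 :=
      pow_le_pow_left₀ (by positivity) h3 2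
    have h9 : (η ⬝ᵥ η * κ ^ 2) * (η ⬝ᵥ η) ≤ (∑ k, g k ^ 2) * (η ⬝ᵥ η) := by nlinarith
    exact le_of_mul_le_mul_right h9 h7

end Rows

/-! ### Kernels -/

lemma IsKernel.exists_bound {K : ℝ → ℝ} (hK : IsKernel K) : ∃ C : ℝ, 0 < C ∧ ∀ t, K t ≤ C := by
  obtain ⟨C, hC⟩ := hK.bounded
  exact ⟨C, hK.pos_zero.trans_le (hC 0), hC⟩

lemma IsKernel.exists_support {K : ℝ → ℝ} (hK : IsKernel K) :
    ∃ L : ℝ, 1 ≤ L ∧ ∀ t, K t ≠ 0 → |t| ≤ L := by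
  obtain ⟨L, hL⟩ := hK.compactSupport.isCompact.isBounded.subset_closedBall (0 : ℝ)
  refine ⟨max 1 L, le_max_left _ _, fun t ht => ?_⟩
  have := hL (subset_tsupport _ (Function.mem_support.mpr ht))
  rw [mem_closedBall_zero_iff, Real.norm_eq_abs] at this
  exact this.trans (le_max_right _ _)

lemma IsKernel.continuous {K : ℝ → ℝ} (hK : IsKernel K) : Continuous K := by
  obtain ⟨L, hL⟩ := hK.lipschitz
  exact hL.continuous

lemma IsKernel.exists_half {K : ℝ → ℝ} (hK : IsKernel K) :
    ∃ η : ℝ, 0 < η ∧ η ≤ 1 ∧ ∀ t, |t| ≤ η → K 0 / 2 ≤ K t := by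
  have h1 : ∀ᶠ t in 𝓝 (0 : ℝ), K 0 / 2 < K t :=
    hK.continuous.continuousAt.eventually (lt_mem_nhds (by linarith [hK.pos_zero]))
  obtain ⟨η, hη, h2⟩ := Metric.eventually_nhds_iff.mp h1
  refine ⟨min (η / 2) 1, by positivity, min_le_right _ _, fun t ht => (h2 ?_).le⟩
  rw [dist_zero_right, Real.norm_eq_abs]
  linarith [min_le_left (η / 2) 1]

lemma scaledKernel_nonneg {K : ℝ → ℝ} (hK : IsKernel K) (h t : ℝ) : 0 ≤ scaledKernel K h t :=
  div_nonneg (hK.nonneg _) (sq_nonneg _)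

lemma scaledKernel_le {K : ℝ → ℝ} {C : ℝ} (hC : ∀ t, K t ≤ C) (h t : ℝ) :
    scaledKernel K h t ≤ C / h ^ 2 :=
  div_le_div_of_nonneg_right (hC _) (sq_nonneg _)

lemma abs_le_of_scaledKernel_ne_zero {K : ℝ → ℝ} {L : ℝ} (hL : ∀ t, K t ≠ 0 → |t| ≤ L) {h t : ℝ}
    (hh : 0 < h) (ht : scaledKernel K h t ≠ 0) : |t| ≤ L * h := by
  have h1 : K (t / h) ≠ 0 := fun h0 => ht (by simp [scaledKernel, h0])
  have h2 := hL _ h1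
  rwa [abs_div, abs_of_pos hh, div_le_iff₀ hh] at h2

/-- The triangular kernel of width `δ`. -/
def tent (δ t : ℝ) : ℝ := max 0 (1 - |t| / δ)

lemma tent_isKernel {δ : ℝ} (hδ : 0 < δ) : IsKernel (tent δ) where
  nonneg t := le_max_left _ _
  pos_zero := by simp [tent]
  symm t := by simp [tent]
  bounded := ⟨1, fun t => max_le zero_le_one (by have : 0 ≤ |t| / δ := by positivity
                                                 linarith)⟩
  lipschitz := by
    refine ⟨⟨δ⁻¹, by positivity⟩, LipschitzWith.of_dist_le_mul fun a b => ?_⟩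
    rw [Real.dist_eq, Real.dist_eq]
    have h1 := abs_max_sub_max_le_abs (1 - |a| / δ) (1 - |b| / δ) 0
    have h2 : |1 - |a| / δ - (1 - |b| / δ)| ≤ δ⁻¹ * |a - b| := by
      have : 1 - |a| / δ - (1 - |b| / δ) = δ⁻¹ * (|b| - |a|) := by field_simp; ring
      rw [this, abs_mul, abs_of_pos (inv_pos.mpr hδ), abs_sub_comm a b]
      exact mul_le_mul_of_nonneg_left (abs_abs_sub_abs_le _ _) (by positivity)
    simp only [tent]
    rw [max_comm 0, max_comm 0]
    exact h1.trans h2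
  compactSupport := by
    refine HasCompactSupport.of_support_subset_isCompact (isCompact_closedBall (0 : ℝ) δ) ?_
    intro t ht
    rw [mem_closedBall_zero_iff, Real.norm_eq_abs]
    by_contra hc
    push Not at hc
    refine ht (max_eq_left ?_)
    have : 1 < |t| / δ := by rwa [lt_div_iff₀ hδ, one_mul]
    linarith

lemma tent_le_one {δ : ℝ} (hδ : 0 < δ) (t : ℝ) : tent δ t ≤ 1 :=
  max_le zero_le_one (by have : 0 ≤ |t| / δ := by positivity
                         linarith)

lemma tent_eq_zero {δ : ℝ} (hδ : 0 < δ) {t : ℝ} (ht : δ ≤ |t|) : tent δ t = 0 := by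
  refine max_eq_left ?_
  have : 1 ≤ |t| / δ := by rwa [le_div_iff₀ hδ, one_mul]
  linarith

/-! ### Regularity of the design -/

lemma DesignCondition.isBounded_density {R : Set Plane} {f : Plane → ℝ} {s : ℕ → Plane}
    {h : ℕ → ℝ} (hs : DesignCondition R f s h) : ∃ F : ℝ, 0 < F ∧ ∀ z ∈ R, |f z| ≤ F := by
  obtain ⟨L, hL⟩ := hs.lipschitz
  obtain ⟨F, hF⟩ := hs.isCompact.exists_bound_of_continuousOn hL.continuousOn
  exact ⟨max 1 F, by positivity, fun z hz => (hF z hz).trans (le_max_right _ _)⟩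

lemma volume_closedBall_plane (z : Plane) {r : ℝ} (hr : 0 ≤ r) :
    volume.real (Metric.closedBall z r) = Real.pi * r ^ 2 := by
  rw [Measure.real, EuclideanSpace.volume_closedBall_fin_two, ENNReal.toReal_mul,
    ENNReal.toReal_pow, ENNReal.toReal_ofReal hr]
  simp [mul_comm, Real.pi_pos.le]

/-- The design condition with `r = 1` compares the sum with an integral of a function of size `1/h²`
over a disc of area of order `h²`. -/
lemma kernel_sum_le {R : Set Plane} {f : Plane → ℝ} {s : ℕ → Plane} {h : ℕ → ℝ} {K : ℝ → ℝ}
    (hs : DesignCondition R f s h) (hK : IsKernel K) (hpos : ∀ n, 0 < h n)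
    (hh : Tendsto h atTop (𝓝 0)) :
    ∃ C : ℝ, 0 < C ∧ ∀ᶠ n : ℕ in atTop, ∀ z ∈ R,
      ∑ j : Fin n, scaledKernel K (h n) ‖s j - z‖ ≤ C * n := by
  obtain ⟨C1, hC1⟩ := hs.approx K hK (fun _ => 1) ⟨1, by simp⟩ ⟨0, LipschitzWith.const _⟩
  obtain ⟨CK, hCK, hKle⟩ := hK.exists_bound
  obtain ⟨L, hL, hsupp⟩ := hK.exists_support
  obtain ⟨F, hF, hf⟩ := hs.isBounded_density
  refine ⟨CK * F * (Real.pi * L ^ 2) + |C1|, by have := Real.pi_pos; positivity, ?_⟩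
  have hh1 : ∀ᶠ n in atTop, h n ≤ 1 := hh.eventually (ge_mem_nhds one_pos)
  filter_upwards [hC1, hh1, eventually_gt_atTop 0] with n hn hn1 hn0 z hz
  have h1 := hn z hz
  have hn0' : (0 : ℝ) < n := by exact_mod_cast hn0
  have hhn := hpos n
  have h2 : |∫ t in R, (1 : ℝ) * scaledKernel K (h n) ‖t - z‖ * f t| ≤
      CK * F * (Real.pi * L ^ 2) := by
    set g : Plane → ℝ := fun t => 1 * scaledKernel K (h n) ‖t - z‖ * f t with hg
    have hgi : g = (Metric.closedBall z (L * h n)).indicator g := by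
      ext t
      by_cases ht : t ∈ Metric.closedBall z (L * h n)
      · rw [Set.indicator_of_mem ht]
      · rw [Set.indicator_of_notMem ht]
        have : scaledKernel K (h n) ‖t - z‖ = 0 := by
          by_contra hne
          refine ht ?_
          rw [Metric.mem_closedBall, dist_eq_norm]
          simpa using abs_le_of_scaledKernel_ne_zero hsupp hhn hne
        simp [hg, this]
    rw [hgi, setIntegral_indicator Metric.isClosed_closedBall.measurableSet, ← Real.norm_eq_abs]
    have hfin : volume (R ∩ Metric.closedBall z (L * h n)) < ⊤ :=
      (measure_mono Set.inter_subset_right).trans_lt measure_closedBall_lt_top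
    refine (norm_setIntegral_le_of_norm_le_const (C := CK / h n ^ 2 * F) hfin ?_).trans ?_
    · intro t ht
      rw [hg]
      simp only [one_mul, norm_mul, Real.norm_eq_abs]
      rw [abs_of_nonneg (scaledKernel_nonneg hK _ _)]
      exact mul_le_mul (scaledKernel_le hKle _ _) (hf t ht.1) (abs_nonneg _) (by positivity)
    · have h3 : volume.real (R ∩ Metric.closedBall z (L * h n)) ≤ Real.pi * (L * h n) ^ 2 := by
        rw [← volume_closedBall_plane z (by positivity)]
        exact measureReal_mono Set.inter_subset_right measure_closedBall_lt_top.ne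
      refine (mul_le_mul_of_nonneg_left h3 (by positivity)).trans (le_of_eq ?_)
      field_simp
  have h4 : (n : ℝ)⁻¹ * ∑ i ∈ Finset.range n, 1 * scaledKernel K (h n) ‖s i - z‖ ≤
      CK * F * (Real.pi * L ^ 2) + |C1| := by
    have h5 := abs_sub_le_iff.mp h1
    have h6 : C1 * h n ≤ |C1| := by
      calc C1 * h n ≤ |C1| * 1 := mul_le_mul (le_abs_self _) hn1 hhn.le (abs_nonneg _)
        _ = _ := mul_one _
    linarith [(abs_le.mp h2).2]
  rw [inv_mul_le_iff₀ hn0'] at h4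
  rw [Fin.sum_univ_eq_sum_range (fun j => scaledKernel K (h n) ‖s j - z‖) n]
  simp only [one_mul] at h4
  linarith

/-- Regularity of `R` provides an area of order `h²` in which the kernel is at least `K 0 / (2 h²)`,
also when `z` lies on the boundary of `R`. -/
lemma kernel_sum_ge {R : Set Plane} {f : Plane → ℝ} {s : ℕ → Plane} {h : ℕ → ℝ} {K : ℝ → ℝ}
    (hs : DesignCondition R f s h) (hK : IsKernel K) (hpos : ∀ n, 0 < h n)
    (hh : Tendsto h atTop (𝓝 0)) :
    ∃ c : ℝ, 0 < c ∧ ∀ᶠ n : ℕ in atTop, ∀ z ∈ R,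
      c * n ≤ ∑ j : Fin n, scaledKernel K (h n) ‖s j - z‖ := by
  obtain ⟨C1, hC1⟩ := hs.approx K hK (fun _ => 1) ⟨1, by simp⟩ ⟨0, LipschitzWith.const _⟩
  obtain ⟨η, hη, hη1, hhalf⟩ := hK.exists_half
  obtain ⟨c0, hc0, hreg⟩ := hs.regular
  obtain ⟨c1, hc1, hlow⟩ := hs.bounded_below
  obtain ⟨L, hL⟩ := hs.lipschitz
  have hK0 := hK.pos_zero
  set q := K 0 / 2 * c1 * (c0 * η ^ 2) with hq
  have hq0 : 0 < q := by positivity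
  refine ⟨q / 2, by positivity, ?_⟩
  have hh1 : ∀ᶠ n in atTop, h n ≤ 1 := hh.eventually (ge_mem_nhds one_pos)
  have hh2 : ∀ᶠ n in atTop, |C1| * h n ≤ q / 2 := by
    have : Tendsto (fun n => |C1| * h n) atTop (𝓝 (|C1| * 0)) := hh.const_mul _
    rw [mul_zero] at this
    exact this.eventually (ge_mem_nhds (by positivity))
  filter_upwards [hC1, hh1, hh2, eventually_gt_atTop 0] with n hn hn1 hn2 hn0 z hz
  have h1 := hn z hz
  have hn0' : (0 : ℝ) < n := by exact_mod_cast hn0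
  have hhn := hpos n
  set g : Plane → ℝ := fun t => 1 * scaledKernel K (h n) ‖t - z‖ * f t with hg
  have hgc : ContinuousOn g R := by
    have : Continuous fun t : Plane => scaledKernel K (h n) ‖t - z‖ := by
      unfold scaledKernel
      exact (hK.continuous.comp (by fun_prop)).div_const _
    exact (continuousOn_const.mul this.continuousOn).mul hL.continuousOn
  have hgi : IntegrableOn g R := hgc.integrableOn_compact hs.isCompact
  have hgn : ∀ t ∈ R, 0 ≤ g t := fun t ht =>
    mul_nonneg (mul_nonneg zero_le_one (scaledKernel_nonneg hK _ _)) (hc1.le.trans (hlow t ht))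
  have hRm := hs.isCompact.isClosed.measurableSet
  have h2 : q ≤ ∫ t in R, g t := by
    have h3 : ∫ t in R ∩ Metric.ball z (η * h n), g t ≤ ∫ t in R, g t :=
      setIntegral_mono_set hgi ((ae_restrict_iff' hRm).mpr (Eventually.of_forall hgn))
        (Set.inter_subset_left.eventuallyLE)
    refine le_trans ?_ h3
    have hfin : volume (R ∩ Metric.ball z (η * h n)) ≠ ⊤ :=
      ((measure_mono Set.inter_subset_right).trans_lt measure_ball_lt_top).ne
    have h4 : (K 0 / 2 / h n ^ 2 * c1) * volume.real (R ∩ Metric.ball z (η * h n)) ≤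
        ∫ t in R ∩ Metric.ball z (η * h n), g t := by
      refine setIntegral_ge_of_const_le_real (hRm.inter measurableSet_ball) hfin ?_
        (hgi.mono_set Set.inter_subset_left)
      intro t ht
      rw [hg]
      simp only [one_mul]
      refine mul_le_mul ?_ (hlow t ht.1) hc1.le (scaledKernel_nonneg hK _ _)
      refine div_le_div_of_nonneg_right (hhalf _ ?_) (by positivity)
      have h5 := ht.2
      rw [Metric.mem_ball, dist_eq_norm] at h5
      rw [abs_of_nonneg (by positivity), div_le_iff₀ hhn]
      exact h5.le
    refine le_trans ?_ h4
    have h6 := hreg z hz (η * h n) (by positivity) (mul_le_one₀ hη1 hhn.le hn1)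
    refine le_trans (le_of_eq ?_) (mul_le_mul_of_nonneg_left h6 (by positivity))
    rw [hq]; field_simp
  have h4 : q / 2 ≤ (n : ℝ)⁻¹ * ∑ i ∈ Finset.range n, 1 * scaledKernel K (h n) ‖s i - z‖ := by
    have h5 := abs_sub_le_iff.mp h1
    have h6 : C1 * h n ≤ |C1| * h n := mul_le_mul_of_nonneg_right (le_abs_self _) hhn.le
    linarith
  rw [le_inv_mul_iff₀ hn0'] at h4
  rw [Fin.sum_univ_eq_sum_range (fun j => scaledKernel K (h n) ‖s j - z‖) n]
  simp only [one_mul] at h4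
  linarith

lemma measurePreserving_coords :
    MeasurePreserving (fun t : Plane => ((t 0, t 1) : ℝ × ℝ)) volume volume := by
  have h1 := (volume_preserving_finTwoArrow ℝ).comp (PiLp.volume_preserving_ofLp (Fin 2))
  convert! h1 using 1

lemma measurePreserving_coords_swap :
    MeasurePreserving (fun t : Plane => ((t 1, t 0) : ℝ × ℝ)) volume volume := by
  have h1 : MeasurePreserving (Prod.swap : ℝ × ℝ → ℝ × ℝ) volume volume :=
    Measure.measurePreserving_swap
  exact h1.comp measurePreserving_coords

/-- The part of a disc in which an affine function with large first slope is small has small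
area. -/
lemma volume_strip_le {φ : Plane → ℝ × ℝ} (hφ : MeasurePreserving φ volume volume)
    {S : Set Plane} {r w y0 : ℝ} {ψ : ℝ → ℝ} (hψ : Continuous ψ) (hr : 0 ≤ r) (hw : 0 ≤ w)
    (hS : ∀ t ∈ S, |(φ t).1 - y0| < r ∧ |(φ t).2 - ψ (φ t).1| < w) :
    volume.real S ≤ 4 * r * w := by
  set B : Set (ℝ × ℝ) := regionBetween (fun y => ψ y - w) (fun y => ψ y + w)
    (Set.Ioo (y0 - r) (y0 + r)) with hB
  have hBm : MeasurableSet B :=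
    measurableSet_regionBetween (by fun_prop) (by fun_prop) measurableSet_Ioo
  have hsub : S ⊆ φ ⁻¹' B := by
    intro t ht
    obtain ⟨h1, h2⟩ := hS t ht
    rw [abs_lt] at h1 h2
    exact ⟨⟨by linarith, by linarith⟩, by constructor <;> simp only <;> linarith⟩
  have hvol : volume B = ENNReal.ofReal (4 * r * w) := by
    rw [hB, Measure.volume_eq_prod, volume_regionBetween_eq_lintegral (by fun_prop) (by fun_prop)
      measurableSet_Ioo]
    have : ∀ y : ℝ, ((fun y => ψ y + w) - fun y => ψ y - w) y = 2 * w := fun y => by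
      simp only [Pi.sub_apply]; ring
    simp only [this, lintegral_const, Measure.restrict_apply_univ, Real.volume_Ioo]
    rw [← ENNReal.ofReal_mul (by positivity)]
    congr 1; ring
  have h3 : volume S ≤ ENNReal.ofReal (4 * r * w) := by
    rw [← hvol, ← hφ.measure_preimage hBm.nullMeasurableSet]
    exact measure_mono hsub
  exact ENNReal.toReal_le_of_le_ofReal (by positivity) h3

/-- An affine function that is small at all points of `R ∩ ball z r` would confine this set to a
thin strip, whose area is smaller than regularity permits. -/
lemma exists_affine_ge {R : Set Plane} {c : ℝ} (hc : 0 < c)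
    (hreg : ∀ z ∈ R, ∀ δ : ℝ, 0 < δ → δ ≤ 1 → c * δ ^ 2 ≤ volume.real (R ∩ Metric.ball z δ)) :
    ∃ τ : ℝ, 0 < τ ∧ τ ≤ 1 ∧ ∀ z ∈ R, ∀ r : ℝ, 0 < r → r ≤ 1 → ∀ a b₀ b₁ : ℝ,
      ∃ z' ∈ R, ‖z' - z‖ < r ∧ τ * (|a| + |b₀| + |b₁|) ≤
        |a + b₀ * ((z' - z) 0 / r) + b₁ * ((z' - z) 1 / r)| := by
  -- The bound `1/8` makes `|a|` smaller than the larger slope. The bound `c/200` beats the strip,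
  -- whose area is at most `4 r · 6 τ r = 24 τ r²`, against `c r²`.
  set τ := min (1 / 8) (c / 200) with hτ
  have hτ0 : 0 < τ := by positivity
  have hτ1 : τ ≤ 1 / 8 := min_le_left _ _
  have hτ2 : τ ≤ c / 200 := min_le_right _ _
  have key : ∀ (k k' : Fin 2), MeasurePreserving (fun t : Plane => ((t k', t k) : ℝ × ℝ)) volume
      volume → ∀ z ∈ R, ∀ r : ℝ, 0 < r → r ≤ 1 → ∀ a b b' : ℝ, |b'| ≤ |b| →
      ∃ z' ∈ R, ‖z' - z‖ < r ∧ τ * (|a| + |b| + |b'|) ≤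
        |a + b * ((z' - z) k / r) + b' * ((z' - z) k' / r)| := by
    intro k k' hφ z hz r hr hr1 a b b' hb
    by_contra hcon
    push Not at hcon
    -- The centre `z` itself is a competitor; there the affine function equals `a`, so `a` is small
    -- compared with the slopes.
    have h0 := hcon z hz (by simpa using hr)
    simp only [sub_self, PiLp.zero_apply, zero_div, mul_zero, add_zero] at h0
    have hbpos : 0 < |b| := by
      by_contra h1
      have hb0 : |b| = 0 := le_antisymm (not_lt.mp h1) (abs_nonneg _)
      have hb1 : |b'| = 0 := le_antisymm (hb0 ▸ hb) (abs_nonneg _)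
      rw [hb0, hb1] at h0
      nlinarith [abs_nonneg a]
    have hbne : b ≠ 0 := abs_pos.mp hbpos
    have hN : |a| + |b| + |b'| ≤ 3 * |b| := by nlinarith [abs_nonneg a, abs_nonneg b']
    -- The affine inequality is solved for the coordinate `k` with the larger slope, so that the
    -- strip is a graph over the other coordinate with half-width `6 τ r`.
    have h1 : ∀ t ∈ R ∩ Metric.ball z r, |t k' - z k'| < r ∧
        |t k - (fun y => z k - (b' / b) * (y - z k')) (t k')| < 6 * τ * r := by
      intro t ht
      have ht2 := ht.2
      rw [Metric.mem_ball, dist_eq_norm] at ht2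
      constructor
      · have := PiLp.norm_apply_le (t - z) k'
        rw [Real.norm_eq_abs] at this
        exact lt_of_le_of_lt this ht2
      · have h2 := hcon t ht.1 ht2
        have h3 : |b * ((t - z) k / r) + b' * ((t - z) k' / r)| < 6 * τ * |b| := by
          have h4 : |b * ((t - z) k / r) + b' * ((t - z) k' / r)| ≤
              |a + b * ((t - z) k / r) + b' * ((t - z) k' / r)| + |a| := by
            have := abs_sub (a + b * ((t - z) k / r) + b' * ((t - z) k' / r)) a
            calc _ = |a + b * ((t - z) k / r) + b' * ((t - z) k' / r) - a| := by ring_nf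
              _ ≤ _ := this
          nlinarith
        have h5 : t k - (fun y => z k - (b' / b) * (y - z k')) (t k') =
            (r / b) * (b * ((t - z) k / r) + b' * ((t - z) k' / r)) := by
          simp only [PiLp.sub_apply]
          field_simp
          ring
        rw [h5, abs_mul, abs_div, abs_of_pos hr]
        calc r / |b| * |b * ((t - z) k / r) + b' * ((t - z) k' / r)|
            < r / |b| * (6 * τ * |b|) := mul_lt_mul_of_pos_left h3 (by positivity)
          _ = 6 * τ * r := by field_simp
    have h2 := volume_strip_le hφ (S := R ∩ Metric.ball z r)
      (ψ := fun y => z k - (b' / b) * (y - z k')) (by fun_prop) hr.le (by positivity) h1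
    have h3 := (hreg z hz r hr hr1).trans h2
    nlinarith [sq_nonneg r, mul_pos hr hr]
  refine ⟨τ, hτ0, by linarith, fun z hz r hr hr1 a b₀ b₁ => ?_⟩
  rcases le_total |b₁| |b₀| with hb | hb
  · exact key 0 1 measurePreserving_coords_swap z hz r hr hr1 a b₀ b₁ hb
  · obtain ⟨z', h1, h2, h3⟩ := key 1 0 measurePreserving_coords z hz r hr hr1 a b₁ b₀ hb
    refine ⟨z', h1, h2, ?_⟩
    calc _ = τ * (|a| + |b₁| + |b₀|) := by ring
      _ ≤ _ := h3
      _ = _ := by ring_nf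

/-- An affine function of size `N` exceeds `τ N` somewhere in `R` near `z`, hence `τ N / 2` on a
small disc around that point. The lower bound on kernel sums, applied to a narrow tent kernel
centred there, shows that the disc holds a fixed share of the kernel mass. -/
lemma design_coercive {R : Set Plane} {f : Plane → ℝ} {s : ℕ → Plane} {h : ℕ → ℝ} {K : ℝ → ℝ}
    (hs : DesignCondition R f s h) (hK : IsKernel K) (hpos : ∀ n, 0 < h n)
    (hh : Tendsto h atTop (𝓝 0)) :
    ∃ c : ℝ, 0 < c ∧ ∀ᶠ n : ℕ in atTop, ∀ z ∈ R, ∀ a b₀ b₁ : ℝ,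
      c * n * (a ^ 2 + b₀ ^ 2 + b₁ ^ 2) ≤ ∑ j : Fin n, scaledKernel K (h n) ‖s j - z‖ *
        (a + b₀ * ((s j - z) 0 / h n) + b₁ * ((s j - z) 1 / h n)) ^ 2 := by
  obtain ⟨c0, hc0, hreg⟩ := hs.regular
  obtain ⟨τ, hτ, hτ1, haff⟩ := exists_affine_ge hc0 hreg
  obtain ⟨η, hη, hη1, hhalf⟩ := hK.exists_half
  -- This tent width, in units of `h`, is `τ r / 2` for `r = η h / 2`: within it each rescaled
  -- coordinate moves by at most `τ / 2`, and the disc stays inside `‖· - z‖ ≤ η h`, where the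
  -- kernel is at least half its value at zero.
  have hδ : 0 < τ * (η / 2) / 2 := by positivity
  obtain ⟨c1, hc1, hsum⟩ := kernel_sum_ge hs (tent_isKernel hδ) hpos hh
  have hK0 := hK.pos_zero
  have hh1 : ∀ᶠ n in atTop, h n ≤ 1 := hh.eventually (ge_mem_nhds one_pos)
  refine ⟨K 0 / 2 * (τ * (η / 2) / 2) ^ 2 * c1, by positivity, ?_⟩
  filter_upwards [hsum, hh1] with n hn hn1 z hz a b₀ b₁
  have hhn := hpos n
  set r := η / 2 * h n with hr
  have hr0 : 0 < r := by positivity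
  have hr1 : r ≤ 1 := by nlinarith
  obtain ⟨z', hz', hzz, hge⟩ := haff z hz r hr0 hr1 a (η / 2 * b₀) (η / 2 * b₁)
  have hcoef : ∀ (b : ℝ) (t : Plane) (k : Fin 2),
      η / 2 * b * ((t - z) k / r) = b * ((t - z) k / h n) := by
    intro b t k; rw [hr]; field_simp
  simp only [hcoef] at hge
  set N := |a| + |η / 2 * b₀| + |η / 2 * b₁| with hN
  have hN0 : 0 ≤ N := by positivity
  have hNsq : (η / 2) ^ 2 * (a ^ 2 + b₀ ^ 2 + b₁ ^ 2) ≤ N ^ 2 := by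
    have h1 : a ^ 2 + (η / 2 * b₀) ^ 2 + (η / 2 * b₁) ^ 2 ≤ N ^ 2 := by
      rw [hN, ← sq_abs a, ← sq_abs (η / 2 * b₀), ← sq_abs (η / 2 * b₁)]
      nlinarith [mul_nonneg (abs_nonneg a) (abs_nonneg (η / 2 * b₀)),
        mul_nonneg (abs_nonneg a) (abs_nonneg (η / 2 * b₁)),
        mul_nonneg (abs_nonneg (η / 2 * b₀)) (abs_nonneg (η / 2 * b₁))]
    have h2 : (η / 2) ^ 2 * a ^ 2 ≤ a ^ 2 := by
      have : (η / 2) ^ 2 ≤ 1 := by nlinarith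
      nlinarith [sq_nonneg a]
    nlinarith
  have hterm : ∀ j : Fin n, K 0 / 2 * (τ / 2 * N) ^ 2 *
      scaledKernel (tent (τ * (η / 2) / 2)) (h n) ‖s j - z'‖ ≤
      scaledKernel K (h n) ‖s j - z‖ *
        (a + b₀ * ((s j - z) 0 / h n) + b₁ * ((s j - z) 1 / h n)) ^ 2 := by
    intro j
    by_cases hj : τ * (η / 2) / 2 ≤ |‖s j - z'‖ / h n|
    · rw [scaledKernel, tent_eq_zero hδ hj, zero_div, mul_zero]
      exact mul_nonneg (scaledKernel_nonneg hK _ _) (sq_nonneg _)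
    push Not at hj
    rw [abs_of_nonneg (by positivity), div_lt_iff₀ hhn] at hj
    have hj' : ‖s j - z'‖ < τ / 2 * r := by rw [hr]; linarith
    have h1 : K 0 / 2 ≤ K (‖s j - z‖ / h n) := by
      refine hhalf _ ?_
      rw [abs_of_nonneg (by positivity), div_le_iff₀ hhn]
      have h2 : ‖s j - z‖ ≤ ‖s j - z'‖ + ‖z' - z‖ := norm_sub_le_norm_sub_add_norm_sub _ _ _
      have h3 : τ / 2 * r ≤ r := by nlinarith
      rw [hr] at *
      linarith
    have h2 : scaledKernel (tent (τ * (η / 2) / 2)) (h n) ‖s j - z'‖ ≤ 1 / h n ^ 2 :=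
      scaledKernel_le (tent_le_one hδ) _ _
    have hdiff : ∀ k : Fin 2, |(s j - z) k / r - (z' - z) k / r| ≤ τ / 2 := by
      intro k
      have h3 : (s j - z) k / r - (z' - z) k / r = (s j - z') k / r := by
        simp only [PiLp.sub_apply]; ring
      rw [h3, abs_div, abs_of_pos hr0, div_le_iff₀ hr0]
      have := PiLp.norm_apply_le (s j - z') k
      rw [Real.norm_eq_abs] at this
      linarith
    have h3 : τ / 2 * N ≤ |a + b₀ * ((s j - z) 0 / h n) + b₁ * ((s j - z) 1 / h n)| := by
      rw [← hcoef b₀, ← hcoef b₁]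
      rw [← hcoef b₀, ← hcoef b₁] at hge
      set B0 := η / 2 * b₀
      set B1 := η / 2 * b₁
      have e : a + B0 * ((z' - z) 0 / r) + B1 * ((z' - z) 1 / r) =
        (a + B0 * ((s j - z) 0 / r) + B1 * ((s j - z) 1 / r))
        + (-(B0 * ((s j - z) 0 / r - (z' - z) 0 / r))
          + -(B1 * ((s j - z) 1 / r - (z' - z) 1 / r))) := by ring
      rw [e] at hge
      have h4 := abs_add_le (a + B0 * ((s j - z) 0 / r) + B1 * ((s j - z) 1 / r))
        (-(B0 * ((s j - z) 0 / r - (z' - z) 0 / r))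
          + -(B1 * ((s j - z) 1 / r - (z' - z) 1 / r)))
      have h5 := abs_add_le (-(B0 * ((s j - z) 0 / r - (z' - z) 0 / r)))
        (-(B1 * ((s j - z) 1 / r - (z' - z) 1 / r)))
      rw [abs_neg, abs_neg, abs_mul B0, abs_mul B1] at h5
      have h6 := mul_le_mul_of_nonneg_left (hdiff 0) (abs_nonneg B0)
      have h7 := mul_le_mul_of_nonneg_left (hdiff 1) (abs_nonneg B1)
      have h8 : 0 ≤ τ / 2 * |a| := by positivity
      have h9 : τ * N = τ * |a| + τ * |B0| + τ * |B1| := by rw [hN]; ring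
      have h10 : τ / 2 * N = τ / 2 * |a| + τ / 2 * |B0| + τ / 2 * |B1| := by rw [hN]; ring
      linarith
    have h4 : (τ / 2 * N) ^ 2 ≤
        (a + b₀ * ((s j - z) 0 / h n) + b₁ * ((s j - z) 1 / h n)) ^ 2 := by
      rw [← sq_abs (a + _ + _)]
      exact pow_le_pow_left₀ (by positivity) h3 2
    calc _ ≤ K 0 / 2 * (τ / 2 * N) ^ 2 * (1 / h n ^ 2) :=
          mul_le_mul_of_nonneg_left h2 (by positivity)
      _ = (K 0 / 2 / h n ^ 2) * (τ / 2 * N) ^ 2 := by ring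
      _ ≤ scaledKernel K (h n) ‖s j - z‖ * (τ / 2 * N) ^ 2 :=
          mul_le_mul_of_nonneg_right (div_le_div_of_nonneg_right h1 (by positivity))
            (by positivity)
      _ ≤ _ := mul_le_mul_of_nonneg_left h4 (scaledKernel_nonneg hK _ _)
  calc _ = K 0 / 2 * (τ / 2) ^ 2 * ((η / 2) ^ 2 * (a ^ 2 + b₀ ^ 2 + b₁ ^ 2)) * (c1 * n) := by ring
    _ ≤ K 0 / 2 * (τ / 2) ^ 2 * N ^ 2 * (c1 * n) := by gcongr
    _ ≤ K 0 / 2 * (τ / 2) ^ 2 * N ^ 2 *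
        ∑ j : Fin n, scaledKernel (tent (τ * (η / 2) / 2)) (h n) ‖s j - z'‖ := by
        gcongr; exact hn z' hz'
    _ = ∑ j : Fin n, K 0 / 2 * (τ / 2 * N) ^ 2 *
        scaledKernel (tent (τ * (η / 2) / 2)) (h n) ‖s j - z'‖ := by
        rw [Finset.mul_sum]; exact Finset.sum_congr rfl fun j _ => by ring
    _ ≤ _ := Finset.sum_le_sum fun j _ => hterm j

/-! ### Smooth coefficients -/

lemma SmoothCoefficients.exists_bound {p : ℕ} {R : Set Plane} {β : Plane → Fin p → ℝ}
    (hβ : SmoothCoefficients R β) (hR : IsCompact R) :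
    ∃ B : ℝ, 0 < B ∧ ∀ z ∈ R, β z ⬝ᵥ β z ≤ B := by
  obtain ⟨U, hU, hRU, hc⟩ := hβ
  have h1 : ContinuousOn (fun z => β z ⬝ᵥ β z) R := by
    have h2 := hc.continuousOn.mono hRU
    simp only [dotProduct]
    refine continuousOn_finsetSum _ fun a _ => ?_
    have h3 : ContinuousOn (fun z => β z a) R := (continuous_apply a).comp_continuousOn h2
    exact h3.mul h3
  obtain ⟨B, hB⟩ := hR.exists_bound_of_continuousOn h1
  refine ⟨max 1 B, by positivity, fun z hz => ?_⟩
  exact ((le_abs_self _).trans (hB z hz)).trans (le_max_right _ _)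

/-- Uniformity in `z` comes from a closed thickening of the compact `R` inside the domain of
smoothness, on which the second derivative is bounded. The mean value inequality is applied to the
derivative and then to `β` minus its linear part. -/
lemma SmoothCoefficients.exists_taylor {p : ℕ} {R : Set Plane} {β : Plane → Fin p → ℝ}
    (hβ : SmoothCoefficients R β) (hR : IsCompact R) :
    ∃ (C η : ℝ) (D : Plane → Fin p → Fin 2 → ℝ), 0 < C ∧ 0 < η ∧ ∀ z ∈ R, ∀ t : Plane,
      ‖t - z‖ ≤ η → ∀ a, |β t a - β z a - ∑ b, D z a b * (t - z) b| ≤ C * ‖t - z‖ ^ 2 := by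
  obtain ⟨U, hU, hRU, hc⟩ := hβ
  obtain ⟨η, hη, hηU⟩ := hR.exists_cthickening_subset_open hU hRU
  have hT : IsCompact (Metric.cthickening η R) := hR.cthickening
  have hd1 : ContDiffOn ℝ 1 (fderiv ℝ β) U := hc.fderiv_of_isOpen hU (by norm_num)
  have hd2 : ContinuousOn (fderiv ℝ (fderiv ℝ β)) U :=
    hd1.continuousOn_fderiv_of_isOpen hU (by norm_num)
  obtain ⟨C, hC⟩ := hT.exists_bound_of_continuousOn (f := fderiv ℝ (fderiv ℝ β)) (hd2.mono hηU)
  have hC0 : ∀ x ∈ Metric.cthickening η R, ‖fderiv ℝ (fderiv ℝ β) x‖ ≤ max 1 C :=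
    fun x hx => (hC x hx).trans (le_max_right _ _)
  refine ⟨max 1 C, η, fun z a b => fderiv ℝ β z (EuclideanSpace.single b 1) a, by positivity, hη,
    fun z hz t ht a => ?_⟩
  have hball : Metric.closedBall z ‖t - z‖ ⊆ Metric.cthickening η R :=
    (Metric.closedBall_subset_closedBall ht).trans (Metric.closedBall_subset_cthickening hz η)
  have hzb : z ∈ Metric.closedBall z ‖t - z‖ := by simp
  have htb : t ∈ Metric.closedBall z ‖t - z‖ := by simp [dist_eq_norm]
  have hdiff : ∀ x ∈ Metric.closedBall z ‖t - z‖, HasFDerivWithinAt β (fderiv ℝ β x)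
      (Metric.closedBall z ‖t - z‖) x := by
    intro x hx
    have h1 : DifferentiableAt ℝ β x := (hc.contDiffAt (hU.mem_nhds (hηU (hball hx)))).differentiableAt
      (by norm_num)
    exact h1.hasFDerivAt.hasFDerivWithinAt
  have hlip : ∀ x ∈ Metric.closedBall z ‖t - z‖,
      ‖fderiv ℝ β x - fderiv ℝ β z‖ ≤ max 1 C * ‖t - z‖ := by
    intro x hx
    have h1 := (convex_closedBall z ‖t - z‖).norm_image_sub_le_of_norm_hasFDerivWithin_le
      (f := fderiv ℝ β) (f' := fderiv ℝ (fderiv ℝ β)) (C := max 1 C) (fun y hy => by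
        have h2 : DifferentiableAt ℝ (fderiv ℝ β) y :=
          (hd1.contDiffAt (hU.mem_nhds (hηU (hball hy)))).differentiableAt (by norm_num)
        exact h2.hasFDerivAt.hasFDerivWithinAt) (fun y hy => hC0 y (hball hy)) hzb hx
    refine h1.trans (mul_le_mul_of_nonneg_left ?_ (by positivity))
    simpa [dist_eq_norm] using hx
  have h2 := (convex_closedBall z ‖t - z‖).norm_image_sub_le_of_norm_hasFDerivWithin_le'
    hdiff hlip hzb htb
  have h3 : ∑ b, fderiv ℝ β z (EuclideanSpace.single b 1) a * (t - z) b
      = fderiv ℝ β z (t - z) a := by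
    have h4 : t - z = ∑ b, (t - z) b • EuclideanSpace.single b (1 : ℝ) := by
      ext k
      fin_cases k <;> simp [Fin.sum_univ_two]
    conv_rhs => rw [h4]
    rw [map_sum, Finset.sum_apply]
    refine Finset.sum_congr rfl fun b _ => ?_
    rw [map_smul, Pi.smul_apply, smul_eq_mul, mul_comm]
  rw [h3]
  have h5 := (norm_le_pi_norm (β t - β z - fderiv ℝ β z (t - z)) a).trans h2
  rw [Real.norm_eq_abs] at h5
  calc _ ≤ _ := h5
    _ = _ := by ring

/-! ### Convergence in probability as convergence along a filter -/

section Whp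

variable {Ω : Type*} [MeasurableSpace Ω] {μ : Measure Ω}

/-- The filter of the events `A ⊆ ℕ × Ω` whose sections have probabilities tending to one. -/
def whp (μ : Measure Ω) : Filter (ℕ × Ω) where
  sets := {A | Tendsto (fun n => μ {ω | (n, ω) ∉ A}) atTop (𝓝 0)}
  univ_sets := by simp
  sets_of_superset := by
    intro A B hA hAB
    refine tendsto_of_tendsto_of_tendsto_of_le_of_le tendsto_const_nhds hA (fun _ => zero_le)
      fun n => measure_mono fun ω hω hA' => hω (hAB hA')
  inter_sets := by
    intro A B hA hB
    have h1 := Tendsto.add hA hB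
    rw [add_zero] at h1
    refine tendsto_of_tendsto_of_tendsto_of_le_of_le tendsto_const_nhds h1 (fun _ => zero_le)
      fun n => ?_
    refine (measure_mono ?_).trans (measure_union_le _ _)
    intro ω hω
    by_contra hc
    simp only [Set.mem_union, Set.mem_ofPred_eq, not_or, not_not] at hc
    exact hω hc

lemma eventually_whp {P : ℕ × Ω → Prop} :
    (∀ᶠ q in whp μ, P q) ↔ Tendsto (fun n => μ {ω | ¬ P (n, ω)}) atTop (𝓝 0) := Iff.rfl

lemma tendsto_fst_whp : Tendsto Prod.fst (whp μ) atTop := by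
  refine tendsto_atTop.mpr fun N => ?_
  rw [eventually_whp]
  refine tendsto_const_nhds.congr' ?_
  filter_upwards [eventually_ge_atTop N] with n hn
  simp [hn]

/-- Markov's inequality. Domination is required only with high probability, so majorants valid on
the good events suffice. -/
lemma tendsto_whp_of_integral {f G : ℕ → Ω → ℝ} {b : ℕ → ℝ}
    (hfG : ∀ᶠ q in whp μ, |f q.1 q.2| ≤ G q.1 q.2) (hG0 : ∀ n ω, 0 ≤ G n ω)
    (hG : ∀ᶠ n in atTop, Integrable (G n) μ ∧ ∫ ω, G n ω ∂μ ≤ b n)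
    (hb : Tendsto b atTop (𝓝 0)) [IsFiniteMeasure μ] :
    Tendsto (fun q : ℕ × Ω => f q.1 q.2) (whp μ) (𝓝 0) := by
  rw [Metric.tendsto_nhds]
  intro e he
  have h1 : ∀ᶠ q in whp μ, G q.1 q.2 < e := by
    rw [eventually_whp]
    have h2 : Tendsto (fun n => ENNReal.ofReal (b n / e)) atTop (𝓝 0) := by
      have := (ENNReal.continuous_ofReal.tendsto _).comp (hb.div_const e)
      rw [zero_div, ENNReal.ofReal_zero] at this
      exact this
    refine tendsto_of_tendsto_of_tendsto_of_le_of_le' tendsto_const_nhds h2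
      (Eventually.of_forall fun _ => zero_le) ?_
    filter_upwards [hG] with n hn
    have h3 := mul_meas_ge_le_integral_of_nonneg
      (Eventually.of_forall (hG0 n) : 0 ≤ᵐ[μ] G n) hn.1 e
    have h4 : μ.real {ω | e ≤ G n ω} ≤ b n / e := by
      rw [le_div_iff₀ he]; linarith [hn.2]
    simp only [not_lt]
    rw [← ENNReal.ofReal_toReal (measure_ne_top μ {ω | e ≤ G n ω})]
    exact ENNReal.ofReal_le_ofReal h4
  filter_upwards [hfG, h1] with q h2 h3
  rw [Real.dist_eq, sub_zero]
  exact lt_of_le_of_lt h2 h3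

end Whp

/-! ### Moments of sums of independent variables -/

section Moments

variable {Ω : Type*} [MeasurableSpace Ω] {μ : Measure Ω} [IsProbabilityMeasure μ]

lemma integral_sq_sum {ι : Type*} {η : ι → Ω → ℝ} (T : Finset ι)
    (hL : ∀ i ∈ T, MemLp (η i) 2 μ) (hz : ∀ i ∈ T, ∫ ω, η i ω ∂μ = 0)
    (hind : ∀ i ∈ T, ∀ j ∈ T, i ≠ j → IndepFun (η i) (η j) μ) :
    MemLp (fun ω => ∑ i ∈ T, η i ω) 2 μ ∧
      ∫ ω, (∑ i ∈ T, η i ω) ^ 2 ∂μ = ∑ i ∈ T, ∫ ω, η i ω ^ 2 ∂μ := by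
  have h1 : MemLp (fun ω => ∑ i ∈ T, η i ω) 2 μ := memLp_finsetSum T hL
  refine ⟨h1, ?_⟩
  have h2 : ∫ ω, ∑ i ∈ T, η i ω ∂μ = 0 := by
    rw [integral_finsetSum T fun i hi => (hL i hi).integrable one_le_two]
    exact Finset.sum_eq_zero hz
  have h3 := IndepFun.variance_sum (s := T) hL (fun i hi j hj hij => hind i hi j hj hij)
  have h4 : (∑ i ∈ T, η i) = fun ω => ∑ i ∈ T, η i ω := by ext ω; simp
  rw [h4, variance_of_integral_eq_zero h1.aestronglyMeasurable.aemeasurable h2] at h3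
  rw [h3]
  exact Finset.sum_congr rfl fun i hi =>
    variance_of_integral_eq_zero (hL i hi).aestronglyMeasurable.aemeasurable (hz i hi)

/-- A function of the variables with indices in `T` is independent of a variable whose index is not
in `T`. -/
lemma indepFun_of_notMem {E α : Type*} [MeasurableSpace E] [MeasurableSpace α] [Inhabited E]
    {ξ : ℕ → Ω → E} (hind : iIndepFun ξ μ) (hm : ∀ i, Measurable (ξ i)) {T : Finset ℕ} {i : ℕ}
    (hi : i ∉ T) {F : (ℕ → E) → α} (hF : Measurable F)
    (hFT : ∀ e e' : ℕ → E, (∀ k ∈ T, e k = e' k) → F e = F e') :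
    IndepFun (fun ω => F fun k => ξ k ω) (ξ i) μ := by
  classical
  have h1 := hind.indepFun_finset T {i} (by simpa using hi) hm
  -- Filling the remaining coordinates with a default value turns `F` into a function of the finite
  -- family indexed by `T`, without changing its value on the sample.
  set ext : (T → E) → ℕ → E := fun y k => if hk : k ∈ T then y ⟨k, hk⟩ else default with hext
  have hextm : Measurable ext := by
    refine measurable_pi_lambda _ fun k => ?_
    by_cases hk : k ∈ T
    · simp only [hext, hk, dif_pos]; exact measurable_pi_apply _
    · simp only [hext, hk, dif_neg, not_false_iff]; exact measurable_const
  have h2 := h1.comp (hF.comp hextm) (measurable_pi_apply (⟨i, by simp⟩ : ({i} : Finset ℕ)))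
  convert! h2 using 1
  ext ω
  refine hFT _ _ fun k hk => ?_
  simp [hext, hk]

lemma integrable_mul_of_sq {f g : Ω → ℝ} (hf : MemLp f 2 μ) (hg : MemLp g 2 μ) :
    Integrable (fun ω => f ω * g ω) μ := hf.integrable_mul hg

/-- Off-diagonal quadratic forms: the strictly lower triangular part. -/
lemma integral_sq_lower {ε : ℕ → Ω → ℝ} {v : ℝ} (hind : iIndepFun ε μ)
    (hm : ∀ i, Measurable (ε i)) (hL : ∀ i, MemLp (ε i) 2 μ) (hz : ∀ i, ∫ ω, ε i ω ∂μ = 0)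
    (hv : ∀ i, ∫ ω, ε i ω ^ 2 ∂μ = v) (a : ℕ → ℕ → ℝ) (n : ℕ) :
    MemLp (fun ω => ∑ i ∈ Finset.range n, ε i ω * ∑ j ∈ Finset.range i, a i j * ε j ω) 2 μ ∧
      ∫ ω, (∑ i ∈ Finset.range n, ε i ω * ∑ j ∈ Finset.range i, a i j * ε j ω) ^ 2 ∂μ =
        v ^ 2 * ∑ i ∈ Finset.range n, ∑ j ∈ Finset.range i, a i j ^ 2 := by
  induction n with
  | zero => simp
  | succ n ih =>
    obtain ⟨ih1, ih2⟩ := ih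
    set U : Ω → ℝ := fun ω =>
      ∑ i ∈ Finset.range n, ε i ω * ∑ j ∈ Finset.range i, a i j * ε j ω with hU
    set V : Ω → ℝ := fun ω => ∑ j ∈ Finset.range n, a n j * ε j ω with hV
    have hVs := integral_sq_sum (μ := μ) (η := fun j ω => a n j * ε j ω) (Finset.range n)
      (fun j _ => (hL j).const_mul _) (fun j _ => by rw [integral_const_mul, hz, mul_zero])
      (fun i _ j _ hij => (hind.indepFun hij).comp (φ := fun t => a n i * t)
        (ψ := fun t => a n j * t) (by fun_prop) (by fun_prop))
    have hV1 : MemLp V 2 μ := hVs.1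
    have hV2 : ∫ ω, V ω ^ 2 ∂μ = v * ∑ j ∈ Finset.range n, a n j ^ 2 := by
      rw [hVs.2, Finset.mul_sum]
      refine Finset.sum_congr rfl fun j _ => ?_
      simp only [mul_pow]
      rw [integral_const_mul, hv, mul_comm]
    have hn : n ∉ Finset.range n := Finset.notMem_range_self
    have hind1 : IndepFun (fun ω => V ω ^ 2) (ε n) μ :=
      indepFun_of_notMem hind hm hn
        (F := fun e : ℕ → ℝ => (∑ j ∈ Finset.range n, a n j * e j) ^ 2) (by fun_prop)
        (fun e e' he => by
          congr 1; exact Finset.sum_congr rfl fun j hj => by rw [he j hj])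
    -- Each new row is a martingale increment: `ε n` is centred and independent of the earlier
    -- errors, so the cross term vanishes, and second moments of the errors suffice.
    have hind2 : IndepFun (fun ω => U ω * V ω) (ε n) μ :=
      indepFun_of_notMem hind hm hn
        (F := fun e : ℕ → ℝ => (∑ i ∈ Finset.range n, e i * ∑ j ∈ Finset.range i, a i j * e j) *
          ∑ j ∈ Finset.range n, a n j * e j) (by fun_prop)
        (fun e e' he => by
          congr 1
          · refine Finset.sum_congr rfl fun i hi => ?_
            rw [he i hi]
            congr 1
            refine Finset.sum_congr rfl fun j hj => ?_
            rw [he j (Finset.mem_range.mpr ((Finset.mem_range.mp hj).trans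
              (Finset.mem_range.mp hi)))]
          · exact Finset.sum_congr rfl fun j hj => by rw [he j hj])
    have hind3 : IndepFun (fun ω => V ω ^ 2) (fun ω => ε n ω ^ 2) μ :=
      hind1.comp (φ := id) (ψ := fun t : ℝ => t ^ 2) measurable_id (by fun_prop)
    have hi1 : Integrable (fun ω => V ω ^ 2 * ε n ω ^ 2) μ :=
      hind3.integrable_mul hV1.integrable_sq (hL n).integrable_sq
    have hi2 : Integrable (fun ω => U ω * V ω * ε n ω) μ :=
      hind2.integrable_mul (integrable_mul_of_sq ih1 hV1) ((hL n).integrable one_le_two)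
    have hUV : MemLp (fun ω => ε n ω * V ω) 2 μ := by
      refine (memLp_two_iff_integrable_sq
        ((hL n).aestronglyMeasurable.mul hV1.aestronglyMeasurable)).mpr ?_
      refine hi1.congr (Eventually.of_forall fun ω => ?_)
      simp only [Pi.mul_apply]; ring
    simp only [Finset.sum_range_succ]
    refine ⟨ih1.add hUV, ?_⟩
    have e1 : ∀ ω, (U ω + ε n ω * V ω) ^ 2 =
        U ω ^ 2 + (2 * (U ω * V ω * ε n ω) + V ω ^ 2 * ε n ω ^ 2) := fun ω => by ring
    have e2 : ∫ ω, U ω * V ω * ε n ω ∂μ = 0 := by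
      rw [hind2.integral_fun_mul_eq_mul_integral
        (integrable_mul_of_sq ih1 hV1).aestronglyMeasurable (hL n).aestronglyMeasurable, hz,
        mul_zero]
    have e3 : ∫ ω, V ω ^ 2 * ε n ω ^ 2 ∂μ = (v * ∑ j ∈ Finset.range n, a n j ^ 2) * v := by
      rw [hind3.integral_fun_mul_eq_mul_integral
        hV1.integrable_sq.aestronglyMeasurable (hL n).integrable_sq.aestronglyMeasurable, hV2, hv]
    change ∫ ω, (U ω + ε n ω * V ω) ^ 2 ∂μ = _
    simp only [e1]
    have hi3 : Integrable (fun ω => 2 * (U ω * V ω * ε n ω) + V ω ^ 2 * ε n ω ^ 2) μ :=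
      (hi2.const_mul 2).add hi1
    rw [integral_add ih1.integrable_sq hi3, integral_add (hi2.const_mul 2) hi1, integral_const_mul, e2, e3, ih2]
    ring

/-- Linear transforms of the noise by matrices that are independent of it. -/
lemma integral_noise_le {𝒳 ι : Type*} [MeasurableSpace 𝒳] [Fintype ι] {ξ : Ω → 𝒳}
    (hξ : Measurable ξ) {ε : ℕ → Ω → ℝ} {v : ℝ}
    (hind : IndepFun ξ (fun ω i => ε i ω) μ)
    (hL : ∀ i, MemLp (ε i) 2 μ)
    (horth : ∀ i j, ∫ ω, ε i ω * ε j ω ∂μ = if i = j then v else 0) (hv : 0 ≤ v)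
    {n : ℕ} {A : 𝒳 → ι → Fin n → ℝ} (hA : ∀ i j, Measurable fun x => A x i j) {g : 𝒳 → ℝ}
    (hg : Integrable (fun ω => g (ξ ω)) μ) (hle : ∀ x, ∑ i, ∑ j, A x i j ^ 2 ≤ g x) :
    Integrable (fun ω => ∑ i, (∑ j : Fin n, A (ξ ω) i j * ε j ω) ^ 2) μ ∧
      ∫ ω, ∑ i, (∑ j : Fin n, A (ξ ω) i j * ε j ω) ^ 2 ∂μ ≤ v * ∫ ω, g (ξ ω) ∂μ := by
  have hsq : ∀ x i j, A x i j ^ 2 ≤ g x := fun x i j =>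
    ((Finset.single_le_sum (f := fun j => A x i j ^ 2) (fun j _ => sq_nonneg _)
      (Finset.mem_univ j)).trans
      (Finset.single_le_sum (f := fun i => ∑ j, A x i j ^ 2)
        (fun i _ => Finset.sum_nonneg fun j _ => sq_nonneg _) (Finset.mem_univ i))).trans (hle x)
  have hA2 : ∀ i j, Integrable (fun ω => A (ξ ω) i j ^ 2) μ := fun i j =>
    hg.mono' (((hA i j).comp hξ).pow_const 2).aestronglyMeasurable
      (Eventually.of_forall fun ω => by
        rw [Real.norm_eq_abs, abs_of_nonneg (sq_nonneg _)]; exact hsq _ _ _)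
  have hAL : ∀ i j, MemLp (fun ω => A (ξ ω) i j) 2 μ := fun i j =>
    (memLp_two_iff_integrable_sq ((hA i j).comp hξ).aestronglyMeasurable).mpr (hA2 i j)
  have hAA : ∀ i j k, Integrable (fun ω => A (ξ ω) i j * A (ξ ω) i k) μ := fun i j k =>
    integrable_mul_of_sq (hAL i j) (hAL i k)
  have hεε : ∀ j k, Integrable (fun ω => ε j ω * ε k ω) μ := fun j k =>
    integrable_mul_of_sq (hL j) (hL k)
  have hI : ∀ i (j k : Fin n), IndepFun (fun ω => A (ξ ω) i j * A (ξ ω) i k)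
      (fun ω => ε j ω * ε k ω) μ := fun i j k =>
    hind.comp (φ := fun x => A x i j * A x i k) (ψ := fun e : ℕ → ℝ => e j * e k)
      ((hA i j).mul (hA i k)) (by fun_prop)
  have hterm : ∀ i (j k : Fin n), Integrable
      (fun ω => (A (ξ ω) i j * A (ξ ω) i k) * (ε j ω * ε k ω)) μ := fun i j k =>
    (hI i j k).integrable_mul (hAA i j k) (hεε j k)
  have hexp : ∀ ω i, (∑ j : Fin n, A (ξ ω) i j * ε j ω) ^ 2 =
      ∑ j : Fin n, ∑ k : Fin n, (A (ξ ω) i j * A (ξ ω) i k) * (ε j ω * ε k ω) := by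
    intro ω i
    rw [sq, Finset.sum_mul_sum]
    exact Finset.sum_congr rfl fun j _ => Finset.sum_congr rfl fun k _ => by ring
  have hint : ∀ i, Integrable (fun ω => (∑ j : Fin n, A (ξ ω) i j * ε j ω) ^ 2) μ := by
    intro i
    simp only [hexp]
    exact integrable_finsetSum _ fun j _ => integrable_finsetSum _ fun k _ => hterm i j k
  have hval : ∀ i, ∫ ω, (∑ j : Fin n, A (ξ ω) i j * ε j ω) ^ 2 ∂μ =
      v * ∑ j : Fin n, ∫ ω, A (ξ ω) i j ^ 2 ∂μ := by
    intro i
    simp only [hexp]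
    rw [integral_finsetSum _ fun j _ => integrable_finsetSum _ fun k _ => hterm i j k,
      Finset.mul_sum]
    refine Finset.sum_congr rfl fun j _ => ?_
    rw [integral_finsetSum _ fun k _ => hterm i j k]
    rw [Finset.sum_eq_single j]
    · rw [(hI i j j).integral_fun_mul_eq_mul_integral (hAA i j j).aestronglyMeasurable
        (hεε j j).aestronglyMeasurable, horth, if_pos rfl, mul_comm]
      simp only [sq]
    · intro k _ hk
      rw [(hI i j k).integral_fun_mul_eq_mul_integral (hAA i j k).aestronglyMeasurable
        (hεε j k).aestronglyMeasurable, horth, if_neg (fun h => hk (Fin.ext h).symm), mul_zero]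
    · simp
  refine ⟨integrable_finsetSum _ fun i _ => hint i, ?_⟩
  rw [integral_finsetSum _ fun i _ => hint i]
  simp only [hval]
  rw [← Finset.mul_sum]
  refine mul_le_mul_of_nonneg_left ?_ hv
  have h1 : ∑ i, ∑ j : Fin n, ∫ ω, A (ξ ω) i j ^ 2 ∂μ =
      ∫ ω, ∑ i, ∑ j : Fin n, A (ξ ω) i j ^ 2 ∂μ := by
    rw [integral_finsetSum _ fun i _ => integrable_finsetSum _ fun j _ => hA2 i j]
    exact Finset.sum_congr rfl fun i _ => (integral_finsetSum _ fun j _ => hA2 i j).symm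
  rw [h1]
  exact integral_mono (integrable_finsetSum _ fun i _ => integrable_finsetSum _ fun j _ => hA2 i j)
    hg fun ω => hle _

end Moments

/-! ### Consequences of the sampling assumptions -/

section Sample

variable {Ω : Type*} [MeasurableSpace Ω] {μ : Measure Ω} [IsProbabilityMeasure μ]
  {p : ℕ} {X : ℕ → Ω → Fin p → ℝ} {ε : ℕ → Ω → ℝ} {σ : ℝ}

lemma integrable_of_rpow {f : Ω → ℝ} (hf : Measurable f) (h0 : ∀ ω, 0 ≤ f ω) {a b : ℝ}
    (hab : a ≤ b) (ha : 0 ≤ a) (hb : Integrable (fun ω => f ω ^ b) μ) :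
    Integrable (fun ω => f ω ^ a) μ := by
  refine ((integrable_const (1 : ℝ)).add hb).mono' (hf.pow_const a).aestronglyMeasurable
    (Eventually.of_forall fun ω => ?_)
  rw [Real.norm_eq_abs, abs_of_nonneg (Real.rpow_nonneg (h0 ω) _), Pi.add_apply]
  rcases le_total (f ω) 1 with h1 | h1
  · have h2 := Real.rpow_le_one (h0 ω) h1 ha
    have h3 := Real.rpow_nonneg (h0 ω) b
    linarith
  · have h2 := Real.rpow_le_rpow_of_exponent_le h1 hab
    linarith

variable (hX : SampleCondition μ X ε σ)
include hX

lemma SampleCondition.integrable_eps_pow_four (i : ℕ) : Integrable (fun ω => ε i ω ^ 4) μ := by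
  obtain ⟨q, hq, -, h2⟩ := hX.moments
  have h3 := integrable_of_rpow (hX.measurable_ε 0).abs (fun ω => abs_nonneg _)
    (a := 4) (b := 2 * q) (by linarith) (by norm_num) h2
  have h4 : Integrable (fun ω => ε 0 ω ^ 4) μ := by
    refine h3.congr (Eventually.of_forall fun ω => ?_)
    have : (4 : ℝ) = ((4 : ℕ) : ℝ) := by norm_num
    simp only
    rw [this, Real.rpow_natCast, Even.pow_abs ⟨2, rfl⟩]
  exact (((hX.identDistrib_ε i).comp (u := fun t : ℝ => t ^ 4) (by fun_prop)).integrable_iff).mpr h4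

lemma SampleCondition.memLp_eps_sq (i : ℕ) : MemLp (fun ω => ε i ω ^ 2) 2 μ := by
  refine (memLp_two_iff_integrable_sq ((hX.measurable_ε i).pow_const 2).aestronglyMeasurable).mpr ?_
  refine (hX.integrable_eps_pow_four i).congr (Eventually.of_forall fun ω => ?_)
  simp only; ring

lemma SampleCondition.memLp_eps (i : ℕ) : MemLp (ε i) 2 μ :=
  (memLp_two_iff_integrable_sq (hX.measurable_ε i).aestronglyMeasurable).mpr
    ((hX.memLp_eps_sq i).integrable one_le_two)

lemma SampleCondition.integral_eps (i : ℕ) : ∫ ω, ε i ω ∂μ = 0 := by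
  rw [(hX.identDistrib_ε i).integral_eq, hX.mean_ε]

lemma SampleCondition.integral_eps_sq (i : ℕ) : ∫ ω, ε i ω ^ 2 ∂μ = σ ^ 2 := by
  rw [← hX.variance_ε]
  exact ((hX.identDistrib_ε i).comp (u := fun t : ℝ => t ^ 2) (by fun_prop)).integral_eq

lemma SampleCondition.integral_eps_pow_four (i : ℕ) :
    ∫ ω, ε i ω ^ 4 ∂μ = ∫ ω, ε 0 ω ^ 4 ∂μ :=
  ((hX.identDistrib_ε i).comp (u := fun t : ℝ => t ^ 4) (by fun_prop)).integral_eq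

lemma SampleCondition.integral_eps_mul (i j : ℕ) :
    ∫ ω, ε i ω * ε j ω ∂μ = if i = j then σ ^ 2 else 0 := by
  split_ifs with h
  · subst h
    rw [← hX.integral_eps_sq i]
    simp only [sq]
  · rw [(hX.indep_ε.indepFun h).integral_fun_mul_eq_mul_integral
      (hX.measurable_ε i).aestronglyMeasurable (hX.measurable_ε j).aestronglyMeasurable,
      hX.integral_eps, zero_mul]

lemma SampleCondition.measurable_seq : Measurable (fun ω i => X i ω) :=
  measurable_pi_lambda _ fun i => hX.measurable_X i

lemma SampleCondition.measurable_normSq (i : ℕ) : Measurable fun ω => X i ω ⬝ᵥ X i ω := by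
  have := hX.measurable_X i
  unfold dotProduct
  fun_prop

lemma SampleCondition.identDistrib_comp (i : ℕ) {E : Type*} [MeasurableSpace E]
    {u : (Fin p → ℝ) → E} (hu : Measurable u) :
    IdentDistrib (fun ω => u (X i ω)) (fun ω => u (X 0 ω)) μ μ :=
  (hX.identDistrib_X i).comp hu

lemma SampleCondition.memLp_normSq (i : ℕ) : MemLp (fun ω => X i ω ⬝ᵥ X i ω) 2 μ := by
  obtain ⟨q, hq, h1, -⟩ := hX.moments
  have h3 := integrable_of_rpow (hX.measurable_normSq 0) (fun ω => dot_self_nonneg _)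
    (a := 2) (b := q) hq.le (by norm_num) h1
  have h4 : MemLp (fun ω => X 0 ω ⬝ᵥ X 0 ω) 2 μ := by
    refine (memLp_two_iff_integrable_sq (hX.measurable_normSq 0).aestronglyMeasurable).mpr ?_
    refine h3.congr (Eventually.of_forall fun ω => ?_)
    simp only
    exact_mod_cast Real.rpow_natCast (X 0 ω ⬝ᵥ X 0 ω) 2
  exact (hX.identDistrib_comp i (u := fun x => x ⬝ᵥ x) (by unfold dotProduct; fun_prop)).memLp_iff.mpr
    h4

lemma SampleCondition.integral_normSq_sq (i : ℕ) :
    ∫ ω, (X i ω ⬝ᵥ X i ω) ^ 2 ∂μ = ∫ ω, (X 0 ω ⬝ᵥ X 0 ω) ^ 2 ∂μ :=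
  (hX.identDistrib_comp i (u := fun x => (x ⬝ᵥ x) ^ 2) (by unfold dotProduct; fun_prop)).integral_eq

lemma SampleCondition.integral_normSq (i : ℕ) :
    ∫ ω, X i ω ⬝ᵥ X i ω ∂μ = ∫ ω, X 0 ω ⬝ᵥ X 0 ω ∂μ :=
  (hX.identDistrib_comp i (u := fun x => x ⬝ᵥ x) (by unfold dotProduct; fun_prop)).integral_eq

lemma SampleCondition.integral_normSq_mul_le (i j : ℕ) :
    Integrable (fun ω => (X i ω ⬝ᵥ X i ω) * (X j ω ⬝ᵥ X j ω)) μ ∧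
    ∫ ω, (X i ω ⬝ᵥ X i ω) * (X j ω ⬝ᵥ X j ω) ∂μ ≤ ∫ ω, (X 0 ω ⬝ᵥ X 0 ω) ^ 2 ∂μ := by
  have h1 := integrable_mul_of_sq (hX.memLp_normSq i) (hX.memLp_normSq j)
  refine ⟨h1, ?_⟩
  have h2 : ∫ ω, (X i ω ⬝ᵥ X i ω) * (X j ω ⬝ᵥ X j ω) ∂μ ≤
      ∫ ω, (1 / 2) * (X i ω ⬝ᵥ X i ω) ^ 2 + (1 / 2) * (X j ω ⬝ᵥ X j ω) ^ 2 ∂μ := by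
    refine integral_mono h1 (((hX.memLp_normSq i).integrable_sq.const_mul _).add
      ((hX.memLp_normSq j).integrable_sq.const_mul _)) fun ω => ?_
    simp only
    nlinarith [sq_nonneg (X i ω ⬝ᵥ X i ω - X j ω ⬝ᵥ X j ω)]
  rw [integral_add ((hX.memLp_normSq i).integrable_sq.const_mul _)
      ((hX.memLp_normSq j).integrable_sq.const_mul _), integral_const_mul, integral_const_mul,
    hX.integral_normSq_sq i, hX.integral_normSq_sq j] at h2
  linarith

omit hX in
lemma abs_apply_le_normSq (x : Fin p → ℝ) (a : Fin p) : x a ^ 2 ≤ x ⬝ᵥ x := by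
  rw [dotProduct]
  simp only [← sq]
  exact Finset.single_le_sum (f := fun a => x a ^ 2) (fun a _ => sq_nonneg _) (Finset.mem_univ a)

lemma SampleCondition.memLp_apply (i : ℕ) (a : Fin p) : MemLp (fun ω => X i ω a) 2 μ := by
  have hm : Measurable fun ω => X i ω a := (measurable_pi_apply a).comp (hX.measurable_X i)
  refine (memLp_two_iff_integrable_sq hm.aestronglyMeasurable).mpr ?_
  refine ((hX.memLp_normSq i).integrable one_le_two).mono' (hm.pow_const 2).aestronglyMeasurable
    (Eventually.of_forall fun ω => ?_)
  rw [Real.norm_eq_abs, abs_of_nonneg (sq_nonneg _)]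
  exact abs_apply_le_normSq _ _

lemma SampleCondition.integral_apply (i : ℕ) (a : Fin p) :
    ∫ ω, X i ω a ∂μ = firstMoment μ (X 0) a :=
  (hX.identDistrib_comp i (u := fun x => x a) (by fun_prop)).integral_eq

lemma SampleCondition.integral_apply_mul (i : ℕ) (a b : Fin p) :
    ∫ ω, X i ω a * X i ω b ∂μ = secondMoment μ (X 0) a b :=
  (hX.identDistrib_comp i (u := fun x => x a * x b) (by fun_prop)).integral_eq

end Sample

/-! ### The local Gram matrices are uniformly coercive with high probability -/

section Gram

variable {Ω : Type*} [MeasurableSpace Ω] {μ : Measure Ω} [IsProbabilityMeasure μ]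
  {p : ℕ} {X : ℕ → Ω → Fin p → ℝ} {ε : ℕ → Ω → ℝ} {σ : ℝ}

/-- The product `x_a x_b`, truncated to `‖x‖² ≤ M`. -/
def truncProd (M : ℝ) (x : Fin p → ℝ) (a b : Fin p) : ℝ :=
  if x ⬝ᵥ x ≤ M then x a * x b else 0

/-- The truncated second moment matrix. -/
def truncMoment (μ : Measure Ω) (X : Ω → Fin p → ℝ) (M : ℝ) : Matrix (Fin p) (Fin p) ℝ :=
  Matrix.of fun a b => ∫ ω, truncProd M (X ω) a b ∂μ

lemma abs_mul_le_normSq (x : Fin p → ℝ) (a b : Fin p) : |x a * x b| ≤ x ⬝ᵥ x := by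
  have h1 := abs_apply_le_normSq x a
  have h2 := abs_apply_le_normSq x b
  rw [abs_le]
  constructor <;> nlinarith [sq_nonneg (x a + x b), sq_nonneg (x a - x b)]

lemma abs_truncProd_le_normSq (M : ℝ) (x : Fin p → ℝ) (a b : Fin p) :
    |truncProd M x a b| ≤ x ⬝ᵥ x := by
  unfold truncProd
  split_ifs
  · exact abs_mul_le_normSq x a b
  · simpa using dot_self_nonneg x

lemma abs_truncProd_le {M : ℝ} (hM : 0 ≤ M) (x : Fin p → ℝ) (a b : Fin p) :
    |truncProd M x a b| ≤ M := by
  unfold truncProd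
  split_ifs with h
  · exact (abs_mul_le_normSq x a b).trans h
  · simpa using hM

lemma measurable_truncProd (M : ℝ) (a b : Fin p) :
    Measurable fun x : Fin p → ℝ => truncProd M x a b := by
  unfold truncProd
  refine Measurable.ite ?_ (by fun_prop) measurable_const
  exact measurableSet_le (by unfold dotProduct; fun_prop) measurable_const

lemma sum_abs_sq_le {I : Type*} [Fintype I] (u : I → ℝ) :
    (∑ k, |u k|) ^ 2 ≤ Fintype.card I * (u ⬝ᵥ u) := by
  have h := sq_sum_le_card_mul_sum_sq (s := Finset.univ) (f := fun k => |u k|)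
  simpa only [sq_abs, dotProduct, ← sq, Finset.card_univ] using h

lemma abs_quadForm_le {I : Type*} [Fintype I] (u : I → ℝ) {D : I → I → ℝ} {c : ℝ}
    (hD : ∀ k l, |D k l| ≤ c) :
    |∑ k, ∑ l, u k * u l * D k l| ≤ c * (Fintype.card I * (u ⬝ᵥ u)) := by
  rcases isEmpty_or_nonempty I with hI | ⟨⟨i0⟩⟩
  · simp
  have hc : 0 ≤ c := (abs_nonneg _).trans (hD i0 i0)
  calc |∑ k, ∑ l, u k * u l * D k l| ≤ ∑ k, ∑ l, |u k| * |u l| * c := by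
        refine (Finset.abs_sum_le_sum_abs _ _).trans (Finset.sum_le_sum fun k _ => ?_)
        refine (Finset.abs_sum_le_sum_abs _ _).trans (Finset.sum_le_sum fun l _ => ?_)
        rw [abs_mul, abs_mul]
        exact mul_le_mul_of_nonneg_left (hD k l) (by positivity)
    _ = c * (∑ k, |u k|) ^ 2 := by
        rw [sq, Finset.sum_mul_sum, Finset.mul_sum]
        refine Finset.sum_congr rfl fun k _ => ?_
        rw [Finset.mul_sum]
        exact Finset.sum_congr rfl fun l _ => by ring
    _ ≤ _ := mul_le_mul_of_nonneg_left (sum_abs_sq_le u) hc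

/-- Truncated moments converge to `Ψ` by dominated convergence, so a finite level already gives
coercivity. Truncation makes Hoeffding's inequality available. -/
lemma SampleCondition.exists_truncMoment_ge (hX : SampleCondition μ X ε σ) :
    ∃ M l : ℝ, 0 < M ∧ 0 < l ∧ ∀ u : Fin p → ℝ,
      l * (u ⬝ᵥ u) ≤ u ⬝ᵥ (truncMoment μ (X 0) M *ᵥ u) := by
  obtain ⟨l, hl, hlow⟩ := exists_pos_le_quadForm _ hX.posDef
  have hlim : ∀ a b, Tendsto (fun m : ℕ => truncMoment μ (X 0) m a b) atTop
      (𝓝 (secondMoment μ (X 0) a b)) := by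
    intro a b
    refine tendsto_integral_of_dominated_convergence (fun ω => X 0 ω ⬝ᵥ X 0 ω)
      (fun m => ((measurable_truncProd _ a b).comp (hX.measurable_X 0)).aestronglyMeasurable)
      ((hX.memLp_normSq 0).integrable one_le_two)
      (fun m => Eventually.of_forall fun ω => by
        rw [Real.norm_eq_abs]; exact abs_truncProd_le_normSq _ _ _ _)
      (Eventually.of_forall fun ω => ?_)
    refine tendsto_const_nhds.congr' ?_
    filter_upwards [eventually_ge_atTop ⌈X 0 ω ⬝ᵥ X 0 ω⌉₊] with m hm
    rw [truncProd, if_pos (Nat.ceil_le.mp hm)]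
  -- An entrywise error costs a factor `p` in the quadratic form; `p + 1` keeps the quotient
  -- positive when `p = 0`.
  have hev : ∀ᶠ m : ℕ in atTop, ∀ a b,
      |truncMoment μ (X 0) m a b - secondMoment μ (X 0) a b| ≤ l / (2 * (p + 1)) := by
    rw [eventually_all]; intro a
    rw [eventually_all]; intro b
    have h1 := (tendsto_iff_norm_sub_tendsto_zero.mp (hlim a b)).eventually
      (ge_mem_nhds (show 0 < l / (2 * (p + 1)) by positivity))
    simpa only [Real.norm_eq_abs] using h1
  obtain ⟨m, hm, hm0⟩ := (hev.and (eventually_gt_atTop 0)).exists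
  refine ⟨m, l / 2, by exact_mod_cast hm0, by positivity, fun u => ?_⟩
  have h1 := abs_quadForm_le u (D := fun a b =>
    truncMoment μ (X 0) m a b - secondMoment μ (X 0) a b) hm
  have h2 : u ⬝ᵥ (truncMoment μ (X 0) m *ᵥ u) = u ⬝ᵥ (secondMoment μ (X 0) *ᵥ u)
      + ∑ k, ∑ l, u k * u l * (truncMoment μ (X 0) m k l - secondMoment μ (X 0) k l) := by
    simp only [dotProduct, Matrix.mulVec, Finset.mul_sum, ← Finset.sum_add_distrib]
    exact Finset.sum_congr rfl fun a _ => Finset.sum_congr rfl fun b _ => by ring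
  have h3 : l / (2 * (p + 1)) * (Fintype.card (Fin p) * (u ⬝ᵥ u)) ≤ l / 2 * (u ⬝ᵥ u) := by
    rw [Fintype.card_fin]
    have h4 := dot_self_nonneg u
    have h5 : l / (2 * (p + 1)) * p ≤ l / 2 := by
      rw [div_mul_eq_mul_div, div_le_div_iff₀ (by positivity) (by positivity)]
      nlinarith
    calc _ = l / (2 * (p + 1)) * p * (u ⬝ᵥ u) := by ring
      _ ≤ _ := mul_le_mul_of_nonneg_right h5 h4
  have h4 := hlow u
  have h5 := (abs_le.mp h1).1
  rw [h2]
  linarith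

/-- The local linear combination `u₀ + u₁ v / h` of coefficient vectors. -/
def localCoef (h : ℝ) (v : Plane) (u : Fin p ⊕ Fin p × Fin 2 → ℝ) : Fin p → ℝ := fun a =>
  u (Sum.inl a) + u (Sum.inr (a, 0)) * (v 0 / h) + u (Sum.inr (a, 1)) * (v 1 / h)

/-- Grouping the columns of the design by covariate reduces forms in the local linear coefficients
to forms in a single vector of length `p` per observation. -/
lemma sum_feat (h : ℝ) (v : Plane) (u : Fin p ⊕ Fin p × Fin 2 → ℝ) (F : Fin p → ℝ) :
    ∑ k, u k * featMono h v k * F (featComp k) = localCoef h v u ⬝ᵥ F := by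
  simp only [Fintype.sum_sum_type, Fintype.sum_prod_type, Fin.sum_univ_two, featMono, featComp,
    Sum.elim_inl, Sum.elim_inr, dotProduct, localCoef, id, mul_one, ← Finset.sum_add_distrib]
  exact Finset.sum_congr rfl fun a _ => by ring

lemma scaledDesign_mulVec (n : ℕ) (h : ℝ) (x : ℕ → Fin p → ℝ) (s : ℕ → Plane) (s₀ : Plane)
    (u : Fin p ⊕ Fin p × Fin 2 → ℝ) (j : Fin n) :
    (scaledDesign n h x s s₀ *ᵥ u) j = x j ⬝ᵥ localCoef h (s j - s₀) u := by
  rw [dotProduct_comm, ← sum_feat]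
  simp only [Matrix.mulVec, dotProduct, scaledDesign, Matrix.of_apply]
  exact Finset.sum_congr rfl fun k _ => by ring

lemma sum_feat_quad (h : ℝ) (v : Plane) (u : Fin p ⊕ Fin p × Fin 2 → ℝ)
    (P : Fin p → Fin p → ℝ) :
    ∑ k, ∑ l, u k * u l * (featMono h v k * featMono h v l * P (featComp k) (featComp l)) =
      ∑ a, ∑ b, localCoef h v u a * localCoef h v u b * P a b := by
  have h1 : ∀ k, ∑ l, u k * u l * (featMono h v k * featMono h v l * P (featComp k) (featComp l))
      = u k * featMono h v k * ((fun a => localCoef h v u ⬝ᵥ P a) (featComp k)) := by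
    intro k
    simp only
    rw [← sum_feat, Finset.mul_sum]
    exact Finset.sum_congr rfl fun l _ => by ring
  rw [Finset.sum_congr rfl fun k _ => h1 k,
    sum_feat h v u (fun a => localCoef h v u ⬝ᵥ P a)]
  simp only [dotProduct, Finset.mul_sum]
  exact Finset.sum_congr rfl fun a _ => Finset.sum_congr rfl fun b _ => by ring

/-- The weighted sums of local coefficients dominate the coefficients. -/
lemma localCoef_sum_ge {n : ℕ} {K : ℝ → ℝ} {h c : ℝ} {s : ℕ → Plane} {i : ℕ}
    (hc : ∀ a b₀ b₁ : ℝ, c * n * (a ^ 2 + b₀ ^ 2 + b₁ ^ 2) ≤ ∑ j : Fin n,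
      rowWeight K h s i j * (a + b₀ * ((s j - s i) 0 / h) + b₁ * ((s j - s i) 1 / h)) ^ 2)
    (u : Fin p ⊕ Fin p × Fin 2 → ℝ) :
    c * n * (u ⬝ᵥ u) ≤ ∑ j : Fin n, rowWeight K h s i j *
      (localCoef h (s j - s i) u ⬝ᵥ localCoef h (s j - s i) u) := by
  have h1 : u ⬝ᵥ u = ∑ a, (u (Sum.inl a) ^ 2 + u (Sum.inr (a, 0)) ^ 2
      + u (Sum.inr (a, 1)) ^ 2) := by
    simp only [dotProduct, Fintype.sum_sum_type, Fintype.sum_prod_type, Fin.sum_univ_two,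
      ← Finset.sum_add_distrib]
    exact Finset.sum_congr rfl fun a _ => by ring
  rw [h1, Finset.mul_sum]
  calc _ ≤ ∑ a : Fin p, ∑ j : Fin n, rowWeight K h s i j *
        localCoef h (s j - s i) u a ^ 2 := Finset.sum_le_sum fun a _ => hc _ _ _
    _ = _ := by
        rw [Finset.sum_comm]
        refine Finset.sum_congr rfl fun j _ => ?_
        simp only [dotProduct, Finset.mul_sum, sq]

/-- The covariates whose truncated local second moments are close to their expectations. -/
def devEvent (n : ℕ) (K : ℝ → ℝ) (h : ℝ) (s : ℕ → Plane) (P : Matrix (Fin p) (Fin p) ℝ)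
    (M c : ℝ) : Set (ℕ → Fin p → ℝ) :=
  {x | ∀ (i : Fin n) (k l : Fin p ⊕ Fin p × Fin 2), |∑ j : Fin n, rowWeight K h s i j *
    (featMono h (s j - s i) k * featMono h (s j - s i) l *
      (truncProd M (x j) (featComp k) (featComp l) - P (featComp k) (featComp l)))| ≤ c * n}

lemma measurableSet_devEvent (n : ℕ) (K : ℝ → ℝ) (h : ℝ) (s : ℕ → Plane)
    (P : Matrix (Fin p) (Fin p) ℝ) (M c : ℝ) : MeasurableSet (devEvent n K h s P M c) := by
  simp only [devEvent, Set.ofPred_forall]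
  refine MeasurableSet.iInter fun i => MeasurableSet.iInter fun k => MeasurableSet.iInter fun l => ?_
  refine measurableSet_le (Measurable.abs ?_) measurable_const
  refine Finset.measurable_fun_sum _ fun j _ => ?_
  have := (measurable_truncProd M (featComp k) (featComp l)).comp
    (measurable_pi_apply (X := fun _ : ℕ => Fin p → ℝ) (j : ℕ))
  exact ((this.sub_const _).const_mul _).const_mul _

/-- Truncation only lowers the Gram form. The expectation of the truncated form is at least `l c n
‖u‖²`, by coercivity of the moments and of the design, and on the event the deviation takes away at
most half of it. -/
lemma gramBound_of_devEvent {n : ℕ} {K : ℝ → ℝ} {h c c₁ l M : ℝ} {s : ℕ → Plane}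
    {P : Matrix (Fin p) (Fin p) ℝ} (hw : ∀ i j, 0 ≤ rowWeight K h s i j) (hl : 0 ≤ l)
    (hP : ∀ u : Fin p → ℝ, l * (u ⬝ᵥ u) ≤ u ⬝ᵥ (P *ᵥ u)) {i : Fin n}
    (hc : ∀ a b₀ b₁ : ℝ, c * n * (a ^ 2 + b₀ ^ 2 + b₁ ^ 2) ≤ ∑ j : Fin n,
      rowWeight K h s i j * (a + b₀ * ((s j - s i) 0 / h) + b₁ * ((s j - s i) 1 / h)) ^ 2)
    (hc₁ : c₁ * Fintype.card (Fin p ⊕ Fin p × Fin 2) ≤ l * c / 2) {x : ℕ → Fin p → ℝ}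
    (hx : x ∈ devEvent n K h s P M c₁) : GramBound n K h x s i (l * c / 2 * n) := by
  intro u
  set m : Fin n → Fin p ⊕ Fin p × Fin 2 → ℝ := fun j => featMono h (s j - s i) with hm
  set D : (Fin p ⊕ Fin p × Fin 2) → (Fin p ⊕ Fin p × Fin 2) → ℝ := fun k l =>
    ∑ j : Fin n, rowWeight K h s i j * (m j k * m j l *
      (truncProd M (x j) (featComp k) (featComp l) - P (featComp k) (featComp l))) with hD
  have h1 : |∑ k, ∑ l, u k * u l * D k l| ≤ c₁ * n * (Fintype.card _ * (u ⬝ᵥ u)) :=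
    abs_quadForm_le u (fun k l => hx i k l)
  have h2 : ∀ j : Fin n, ∑ a, ∑ b, localCoef h (s j - s i) u a * localCoef h (s j - s i) u b *
      truncProd M (x j) a b ≤ (scaledDesign n h x s (s i) *ᵥ u) j ^ 2 := by
    intro j
    rw [scaledDesign_mulVec]
    by_cases hM : x j ⬝ᵥ x j ≤ M
    · refine le_of_eq ?_
      simp only [truncProd, if_pos hM]
      rw [sq, dotProduct, Finset.sum_mul_sum]
      exact Finset.sum_congr rfl fun a _ => Finset.sum_congr rfl fun b _ => by ring
    · simp only [truncProd, if_neg hM, mul_zero, Finset.sum_const_zero]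
      exact sq_nonneg _
  have h3 : ∑ k, ∑ l, u k * u l * D k l = ∑ j : Fin n, rowWeight K h s i j *
      (∑ a, ∑ b, localCoef h (s j - s i) u a * localCoef h (s j - s i) u b *
        truncProd M (x j) a b - localCoef h (s j - s i) u ⬝ᵥ
        (P *ᵥ localCoef h (s j - s i) u)) := by
    have h4 : ∀ j : Fin n, ∑ a, ∑ b, localCoef h (s j - s i) u a * localCoef h (s j - s i) u b *
        truncProd M (x j) a b - localCoef h (s j - s i) u ⬝ᵥ (P *ᵥ localCoef h (s j - s i) u) =
        ∑ k, ∑ l, u k * u l * (m j k * m j l * (truncProd M (x j) (featComp k) (featComp l)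
          - P (featComp k) (featComp l))) := by
      intro j
      rw [hm]
      rw [sum_feat_quad h (s j - s i) u (fun a b => truncProd M (x j) a b - P a b)]
      simp only [dotProduct, Matrix.mulVec, Finset.mul_sum, ← Finset.sum_sub_distrib]
      exact Finset.sum_congr rfl fun a _ => Finset.sum_congr rfl fun b _ => by ring
    simp only [h4, hD, Finset.mul_sum]
    rw [Finset.sum_comm' (t' := Finset.univ) (s' := fun _ => Finset.univ) (by simp)]
    symm
    rw [Finset.sum_comm]
    simp only [Finset.sum_comm (s := (Finset.univ : Finset (Fin n)))]
    rw [Finset.sum_comm]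
    refine Finset.sum_congr rfl fun k _ => Finset.sum_congr rfl fun l _ =>
      Finset.sum_congr rfl fun j _ => by ring
  have h5 : l * (c * n * (u ⬝ᵥ u)) ≤ ∑ j : Fin n, rowWeight K h s i j *
      (localCoef h (s j - s i) u ⬝ᵥ (P *ᵥ localCoef h (s j - s i) u)) := by
    refine (mul_le_mul_of_nonneg_left (localCoef_sum_ge hc u) hl).trans ?_
    rw [Finset.mul_sum]
    refine Finset.sum_le_sum fun j _ => ?_
    calc _ = rowWeight K h s i j * (l * (localCoef h (s j - s i) u ⬝ᵥ
          localCoef h (s j - s i) u)) := by ring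
      _ ≤ _ := mul_le_mul_of_nonneg_left (hP _) (hw _ _)
  have h6 : ∑ j : Fin n, rowWeight K h s i j * (∑ a, ∑ b, localCoef h (s j - s i) u a *
      localCoef h (s j - s i) u b * truncProd M (x j) a b) ≤
      ∑ j : Fin n, rowWeight K h s i j * (scaledDesign n h x s (s i) *ᵥ u) j ^ 2 :=
    Finset.sum_le_sum fun j _ => mul_le_mul_of_nonneg_left (h2 j) (hw _ _)
  rw [h3] at h1
  simp only [mul_sub, Finset.sum_sub_distrib] at h1
  have h7 := (abs_le.mp h1).1
  have h8 : c₁ * n * (Fintype.card (Fin p ⊕ Fin p × Fin 2) * (u ⬝ᵥ u)) ≤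
      l * c / 2 * n * (u ⬝ᵥ u) := by
    calc _ = c₁ * Fintype.card (Fin p ⊕ Fin p × Fin 2) * (n * (u ⬝ᵥ u)) := by ring
      _ ≤ l * c / 2 * (n * (u ⬝ᵥ u)) :=
        mul_le_mul_of_nonneg_right hc₁ (mul_nonneg (Nat.cast_nonneg _) (dot_self_nonneg u))
      _ = _ := by ring
  have h9 : l * c / 2 * n * (u ⬝ᵥ u) = l * (c * n * (u ⬝ᵥ u)) - l * c / 2 * n * (u ⬝ᵥ u) := by
    ring
  linarith

/-- Hoeffding's inequality for independent, centred variables with individual bounds. -/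
lemma hoeffding_abs {η : ℕ → Ω → ℝ} (hind : iIndepFun η μ) (hm : ∀ j, Measurable (η j))
    {B : ℕ → ℝ} (hB : ∀ j ω, |η j ω| ≤ B j) (hz : ∀ j, ∫ ω, η j ω ∂μ = 0) (n : ℕ) {t V : ℝ}
    (ht : 0 ≤ t) (hV : ∑ j ∈ Finset.range n, B j ^ 2 ≤ V) (hV0 : 0 < ∑ j ∈ Finset.range n, B j ^ 2) :
    μ.real {ω | t < |∑ j ∈ Finset.range n, η j ω|} ≤ 2 * Real.exp (-(t ^ 2 / (2 * V))) := by
  have hne : Nonempty Ω := μ.nonempty_of_neZero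
  have hB0 : ∀ j, 0 ≤ B j := fun j => by
    obtain ⟨ω⟩ := hne
    exact (abs_nonneg _).trans (hB j ω)
  have key : ∀ ζ : ℕ → Ω → ℝ, iIndepFun ζ μ → (∀ j, Measurable (ζ j)) → (∀ j ω, |ζ j ω| ≤ B j) →
      (∀ j, ∫ ω, ζ j ω ∂μ = 0) → μ.real {ω | t ≤ ∑ j ∈ Finset.range n, ζ j ω} ≤
        Real.exp (-(t ^ 2 / (2 * V))) := by
    intro ζ hζ hζm hζB hζz
    -- Values in `[-B, B]` give the variance proxy `(2B/2)² = B²`.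
    have h1 : ∀ j ∈ Finset.range n, HasSubgaussianMGF (ζ j) ((‖B j - -B j‖₊ / 2) ^ 2) μ :=
      fun j _ => hasSubgaussianMGF_of_mem_Icc_of_integral_eq_zero (hζm j).aemeasurable
        (Eventually.of_forall fun ω => abs_le.mp (hζB j ω)) (hζz j)
    have h2 := HasSubgaussianMGF.measure_sum_ge_le_of_iIndepFun hζ h1 ht
    refine h2.trans (Real.exp_le_exp.mpr ?_)
    have h3 : ((∑ j ∈ Finset.range n, (‖B j - -B j‖₊ / 2) ^ 2 : NNReal) : ℝ) =
        ∑ j ∈ Finset.range n, B j ^ 2 := by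
      push_cast
      refine Finset.sum_congr rfl fun j _ => ?_
      rw [Real.norm_eq_abs, sub_neg_eq_add, abs_of_nonneg (add_nonneg (hB0 j) (hB0 j))]
      ring
    rw [h3, neg_div]
    have h6 : t ^ 2 / (2 * V) ≤ t ^ 2 / (2 * ∑ j ∈ Finset.range n, B j ^ 2) := by gcongr
    linarith
  have h1 := key η hind hm hB hz
  have h2 := key (fun j ω => -η j ω)
    (hind.comp (fun _ t => -t) (fun _ => measurable_neg)) (fun j => (hm j).neg)
    (fun j ω => by rw [abs_neg]; exact hB j ω) (fun j => by rw [integral_neg, hz, neg_zero])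
  have h3 : {ω | t < |∑ j ∈ Finset.range n, η j ω|} ⊆
      {ω | t ≤ ∑ j ∈ Finset.range n, η j ω} ∪ {ω | t ≤ ∑ j ∈ Finset.range n, -η j ω} := by
    intro ω hω
    simp only [Set.mem_ofPred_eq, Set.mem_union, Finset.sum_neg_distrib] at hω ⊢
    rcases lt_abs.mp hω with h | h
    · exact Or.inl h.le
    · exact Or.inr h.le
  have h4 := (measureReal_mono (μ := μ) h3).trans (measureReal_union_le _ _)
  linarith



lemma abs_featMono_le {h L : ℝ} (hL : 1 ≤ L) (hh : 0 < h) {v : Plane} (hv : ‖v‖ ≤ L * h)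
    (k : Fin p ⊕ Fin p × Fin 2) : |featMono h v k| ≤ L := by
  rcases k with a | ab
  · simpa [featMono] using hL
  · simp only [featMono, Sum.elim_inr]
    rw [abs_div, abs_of_pos hh, div_le_iff₀ hh]
    have := PiLp.norm_apply_le v ab.2
    rw [Real.norm_eq_abs] at this
    exact this.trans hv

/-- The probability of a large deviation of the local second moments. -/
lemma measure_devEvent_le (hX : SampleCondition μ X ε σ) {n : ℕ} {K : ℝ → ℝ} {h : ℝ}
    {s : ℕ → Plane} {M L CK C c : ℝ} (hK : IsKernel K) (hh : 0 < h) (hL : 1 ≤ L)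
    (hsupp : ∀ t, K t ≠ 0 → |t| ≤ L) (hCK : ∀ t, K t ≤ CK) (hM : 0 < M) (hc : 0 < c)
    (hC : 0 < C) (hsum : ∀ i : Fin n, ∑ j : Fin n, rowWeight K h s i j ≤ C * n) :
    μ.real {ω | (fun i => X i ω) ∉ devEvent n K h s (truncMoment μ (X 0) M) M c} ≤
      2 * Fintype.card (Fin p ⊕ Fin p × Fin 2) ^ 2 *
        (n * Real.exp (-(c ^ 2 / (8 * M ^ 2 * L ^ 4 * CK * C) * (n * h ^ 2)))) := by
  set I := Fin p ⊕ Fin p × Fin 2 with hI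
  set P := truncMoment μ (X 0) M with hP
  have hCK0 : 0 < CK := hK.pos_zero.trans_le (hCK 0)
  have hPab : ∀ a b, |P a b| ≤ M := by
    intro a b
    have h1 := norm_integral_le_of_norm_le_const (μ := μ) (C := M)
      (f := fun ω => truncProd M (X 0 ω) a b)
      (Eventually.of_forall fun ω => abs_truncProd_le hM.le _ _ _)
    rw [probReal_univ, mul_one] at h1
    exact h1
  have hw0 : ∀ i j, 0 ≤ rowWeight K h s i j := fun i j => scaledKernel_nonneg hK _ _
  set η : ℕ → I → I → ℕ → Ω → ℝ := fun i k l j ω => rowWeight K h s i j *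
    (featMono h (s j - s i) k * featMono h (s j - s i) l *
      (truncProd M (X j ω) (featComp k) (featComp l) - P (featComp k) (featComp l))) with hη
  have hmeas : ∀ i k l j, Measurable fun x : Fin p → ℝ => rowWeight K h s i j *
      (featMono h (s j - s i) k * featMono h (s j - s i) l *
      (truncProd M x (featComp k) (featComp l) - P (featComp k) (featComp l))) := fun i k l j =>
    (((measurable_truncProd M _ _).sub_const _).const_mul _).const_mul _
  have hone : ∀ (i : Fin n) (k l : I), μ.real {ω | c * n < |∑ j ∈ Finset.range n, η i k l j ω|} ≤
      2 * Real.exp (-(c ^ 2 / (8 * M ^ 2 * L ^ 4 * CK * C) * (n * h ^ 2))) := by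
    intro i k l
    have hn : (0 : ℝ) < n := by exact_mod_cast (Nat.zero_le _).trans_lt i.2
    have hB : ∀ j ω, |η i k l j ω| ≤ rowWeight K h s i j * (L ^ 2 * (2 * M)) := by
      intro j ω
      rw [hη]
      simp only
      rw [abs_mul, abs_of_nonneg (hw0 _ _)]
      by_cases hw : rowWeight K h s i j = 0
      · simp [hw]
      refine mul_le_mul_of_nonneg_left ?_ (hw0 _ _)
      have hv : ‖s j - s i‖ ≤ L * h := by
        have := abs_le_of_scaledKernel_ne_zero hsupp hh hw
        rwa [abs_of_nonneg (norm_nonneg _)] at this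
      rw [abs_mul, abs_mul, sq]
      have h1 := abs_featMono_le hL hh hv k
      have h2 := abs_featMono_le hL hh hv l
      have h3 := abs_sub (truncProd M (X j ω) (featComp k) (featComp l))
        (P (featComp k) (featComp l))
      have h4 := abs_truncProd_le hM.le (X j ω) (featComp k) (featComp l)
      have h5 := hPab (featComp k) (featComp l)
      have hL0 : 0 ≤ L := by linarith
      exact mul_le_mul (mul_le_mul h1 h2 (abs_nonneg _) hL0) (by linarith) (abs_nonneg _)
        (by positivity)
    have hind : iIndepFun (η i k l) μ := hX.indep_X.comp _ (hmeas i k l)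
    have hz : ∀ j, ∫ ω, η i k l j ω ∂μ = 0 := by
      intro j
      have hint : Integrable (fun ω => truncProd M (X j ω) (featComp k) (featComp l)) μ :=
        Integrable.of_bound
          ((measurable_truncProd M _ _).comp (hX.measurable_X j)).aestronglyMeasurable M
          (Eventually.of_forall fun ω => abs_truncProd_le hM.le _ _ _)
      have h1 : ∫ ω, truncProd M (X j ω) (featComp k) (featComp l) ∂μ =
          P (featComp k) (featComp l) :=
        (hX.identDistrib_comp j (measurable_truncProd M (featComp k) (featComp l))).integral_eq
      rw [hη]
      simp only
      rw [integral_const_mul, integral_const_mul, integral_sub hint (integrable_const _), h1]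
      simp
    -- One weight is bounded by its maximum `CK / h²`, the other is summed to `C n`. Against `(c
    -- n)²` this produces an exponent of order `n h²`.
    have hV : ∑ j ∈ Finset.range n, (rowWeight K h s i j * (L ^ 2 * (2 * M))) ^ 2 ≤
        (L ^ 2 * (2 * M)) ^ 2 * (CK / h ^ 2 * (C * n)) := by
      calc _ = (L ^ 2 * (2 * M)) ^ 2 * ∑ j ∈ Finset.range n, rowWeight K h s i j ^ 2 := by
            rw [Finset.mul_sum]; exact Finset.sum_congr rfl fun j _ => by ring
        _ ≤ (L ^ 2 * (2 * M)) ^ 2 * ∑ j ∈ Finset.range n, CK / h ^ 2 * rowWeight K h s i j := by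
            refine mul_le_mul_of_nonneg_left (Finset.sum_le_sum fun j _ => ?_) (sq_nonneg _)
            rw [sq]
            exact mul_le_mul_of_nonneg_right (scaledKernel_le hCK _ _) (hw0 _ _)
        _ ≤ _ := by
            rw [← Finset.mul_sum]
            have := hsum i
            rw [Fin.sum_univ_eq_sum_range (fun j => rowWeight K h s i j) n] at this
            gcongr
    have hV0 : 0 < ∑ j ∈ Finset.range n, (rowWeight K h s i j * (L ^ 2 * (2 * M))) ^ 2 := by
      refine Finset.sum_pos' (fun j _ => sq_nonneg _) ⟨i, Finset.mem_range.mpr i.2, ?_⟩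
      have : 0 < rowWeight K h s i i := by
        simp only [rowWeight, scaledKernel, sub_self, norm_zero, zero_div]
        exact div_pos hK.pos_zero (by positivity)
      positivity
    have h1 := hoeffding_abs hind (fun j => (hmeas i k l j).comp (hX.measurable_X j)) hB hz n
      (t := c * n) (by positivity) hV hV0
    refine h1.trans (le_of_eq ?_)
    congr 3
    field_simp
    ring
  -- Union bound over the `n` centres and all pairs of columns: the events depend on the design
  -- points only, so no covering of the region is needed.
  have hsub : {ω | (fun i => X i ω) ∉ devEvent n K h s P M c} ⊆
      ⋃ q : Fin n × I × I, {ω | c * n < |∑ j ∈ Finset.range n, η q.1 q.2.1 q.2.2 j ω|} := by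
    intro ω hω
    simp only [devEvent, Set.mem_ofPred_eq, not_forall, not_le] at hω
    obtain ⟨i, k, l, h1⟩ := hω
    refine Set.mem_iUnion.mpr ⟨(i, k, l), ?_⟩
    rw [Fin.sum_univ_eq_sum_range (fun j => η i k l j ω) n] at h1
    exact h1
  refine (measureReal_mono hsub).trans ((measureReal_iUnion_fintype_le _).trans ?_)
  refine (Finset.sum_le_sum fun q _ => hone q.1 q.2.1 q.2.2).trans (le_of_eq ?_)
  rw [Finset.sum_const, Finset.card_univ, Fintype.card_prod, Fintype.card_prod, Fintype.card_fin,
    nsmul_eq_mul]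
  push_cast
  ring

omit [IsProbabilityMeasure μ] in
-- The form in which the bandwidth condition enters: any power of `n` is then dominated by `exp (-r
-- n h²)`.
lemma eventually_sqrt_le {h : ℕ → ℝ}
    (hb : Tendsto (fun n : ℕ => Real.sqrt n * h n ^ 2 / Real.log n ^ 2) atTop atTop) :
    ∀ᶠ n : ℕ in atTop, Real.sqrt n ≤ n * h n ^ 2 := by
  have hlog : ∀ᶠ n : ℕ in atTop, 1 ≤ Real.log n :=
    (Real.tendsto_log_atTop.comp tendsto_natCast_atTop_atTop).eventually_ge_atTop 1
  filter_upwards [hb.eventually_ge_atTop 1, hlog] with n h1 h2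
  rw [le_div_iff₀ (by positivity)] at h1
  have h3 : 1 ≤ Real.sqrt n * h n ^ 2 := by nlinarith
  calc Real.sqrt n = Real.sqrt n * 1 := (mul_one _).symm
    _ ≤ Real.sqrt n * (Real.sqrt n * h n ^ 2) := by gcongr
    _ = _ := by rw [← mul_assoc, Real.mul_self_sqrt (Nat.cast_nonneg _)]

lemma tendsto_bandwidth {h : ℕ → ℝ}
    (hb : ∀ᶠ n : ℕ in atTop, Real.sqrt n ≤ n * h n ^ 2) :
    Tendsto (fun n : ℕ => n * h n ^ 2) atTop atTop :=
  tendsto_atTop_mono' _ hb (Real.tendsto_sqrt_atTop.comp tendsto_natCast_atTop_atTop)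

/-- With overwhelming probability all local Gram matrices are coercive. -/
lemma exists_gram_event (hX : SampleCondition μ X ε σ) {R : Set Plane} {f : Plane → ℝ}
    {s : ℕ → Plane} {h : ℕ → ℝ} {K : ℝ → ℝ}
    (hs : DesignCondition R f s h) (hK : IsKernel K) (hpos : ∀ n, 0 < h n)
    (hh : Tendsto h atTop (𝓝 0)) (hb : ∀ᶠ n : ℕ in atTop, Real.sqrt n ≤ n * h n ^ 2) :
    ∃ (E : ℕ → Set (ℕ → Fin p → ℝ)) (c : ℝ), 0 < c ∧ (∀ n, MeasurableSet (E n)) ∧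
      Tendsto (fun n : ℕ => (n * h n ^ 2) ^ 3 * μ.real {ω | (fun i => X i ω) ∉ E n}) atTop (𝓝 0) ∧
      ∀ᶠ n : ℕ in atTop, ∀ x ∈ E n, ∀ i : Fin n, GramBound n K (h n) x s i (c * n) := by
  obtain ⟨M, l, hM, hl, hlow⟩ := hX.exists_truncMoment_ge
  obtain ⟨c, hc, hco⟩ := design_coercive hs hK hpos hh
  obtain ⟨C, hC, hsum⟩ := kernel_sum_le hs hK hpos hh
  obtain ⟨CK, hCK0, hCK⟩ := hK.exists_bound
  obtain ⟨L, hL, hsupp⟩ := hK.exists_support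
  set d : ℝ := ((Fintype.card (Fin p ⊕ Fin p × Fin 2) : ℕ) : ℝ) with hd
  have hd0 : 0 ≤ d := Nat.cast_nonneg _
  -- Entrywise tolerance: summed over `d` columns it uses up half of the coercivity constant `l c`;
  -- `d + 1` avoids dividing by zero.
  set c₁ := l * c / 2 / (d + 1) with hc₁
  have hc₁0 : 0 < c₁ := by positivity
  refine ⟨fun n => devEvent n K (h n) s (truncMoment μ (X 0) M) M c₁, l * c / 2, by positivity,
    fun n => measurableSet_devEvent _ _ _ _ _ _ _, ?_, ?_⟩
  · set r := c₁ ^ 2 / (8 * M ^ 2 * L ^ 4 * CK * C) with hr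
    have hL0 : 0 < L := by linarith
    have hr0 : 0 < r := by positivity
    have hN := tendsto_bandwidth hb
    -- Fifth power: three factors `n h²` are claimed, and two more absorb the `n` of the union bound
    -- through `n ≤ (n h²)²`.
    have h1 : Tendsto (fun n : ℕ => 2 * d ^ 2 / r ^ 5 *
        ((r * (n * h n ^ 2)) ^ 5 * Real.exp (-(r * (n * h n ^ 2))))) atTop (𝓝 0) := by
      have := ((Real.tendsto_pow_mul_exp_neg_atTop_nhds_zero 5).comp
        (hN.const_mul_atTop hr0)).const_mul (2 * d ^ 2 / r ^ 5)
      rw [mul_zero] at this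
      exact this
    refine squeeze_zero' (Eventually.of_forall fun n => by positivity) ?_ h1
    filter_upwards [hsum, hb] with n hn1 hn2
    have h2 := measure_devEvent_le hX hK (hpos n) hL hsupp hCK hM hc₁0 hC
      (fun i : Fin n => hn1 (s i) (hs.mem i))
    have h3 : (n : ℝ) ≤ (n * h n ^ 2) ^ 2 := by
      calc (n : ℝ) = Real.sqrt n ^ 2 := (Real.sq_sqrt (Nat.cast_nonneg _)).symm
        _ ≤ _ := pow_le_pow_left₀ (Real.sqrt_nonneg _) hn2 2
    set N := (n : ℝ) * h n ^ 2 with hNdef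
    have hN0 : 0 ≤ N := by positivity
    calc _ ≤ N ^ 3 * (2 * d ^ 2 * (N ^ 2 * Real.exp (-(r * N)))) := by
          refine mul_le_mul_of_nonneg_left (h2.trans ?_) (by positivity)
          gcongr
      _ = _ := by field_simp
  · filter_upwards [hco] with n hn x hx i
    refine gramBound_of_devEvent (fun i j => scaledKernel_nonneg hK _ _) hl.le hlow
      (hn (s i) (hs.mem i)) ?_ hx
    rw [hc₁, div_mul_eq_mul_div, div_le_iff₀ (by positivity)]
    have : 0 < l * c / 2 := by positivity
    change l * c / 2 * d ≤ _
    nlinarith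

end Gram

/-! ### Measurability of the smoother -/

section Measurability

lemma measurable_det {α I : Type*} [MeasurableSpace α] [Fintype I] [DecidableEq I]
    {M : α → Matrix I I ℝ} (hM : ∀ i j, Measurable fun x => M x i j) :
    Measurable fun x => (M x).det := by
  simp only [Matrix.det_apply]
  exact Finset.measurable_fun_sum _ fun τ _ =>
    (Finset.measurable_fun_prod _ fun i _ => hM _ _).const_smul _

/-- Cramer's rule. The conventional value at singular matrices agrees with the inverse of zero in
`ℝ`, so no case distinction is needed. -/
lemma measurable_matrix_inv {α I : Type*} [MeasurableSpace α] [Fintype I] [DecidableEq I]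
    {M : α → Matrix I I ℝ} (hM : ∀ i j, Measurable fun x => M x i j) (i j : I) :
    Measurable fun x => (M x)⁻¹ i j := by
  simp only [Matrix.inv_def, Matrix.smul_apply, smul_eq_mul, Ring.inverse_eq_inv',
    Matrix.adjugate_apply]
  refine (measurable_det hM).inv.mul (measurable_det fun k l => ?_)
  simp only [Matrix.updateRow_apply]
  split_ifs
  · exact measurable_const
  · exact hM k l

lemma measurable_matrix_mul {α I J L : Type*} [MeasurableSpace α] [Fintype J]
    {M : α → Matrix I J ℝ} {N : α → Matrix J L ℝ} (hM : ∀ i j, Measurable fun x => M x i j)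
    (hN : ∀ i j, Measurable fun x => N x i j) (i : I) (j : L) :
    Measurable fun x => (M x * N x) i j := by
  simp only [Matrix.mul_apply]
  exact Finset.measurable_fun_sum _ fun k _ => (hM _ _).mul (hN _ _)

lemma measurable_smoother {p n : ℕ} (K : ℝ → ℝ) (h : ℝ) (s : ℕ → Plane) (i j : Fin n) :
    Measurable fun x : ℕ → Fin p → ℝ => smoother K h n x s i j := by
  have hx : ∀ (k : ℕ) (a : Fin p), Measurable fun x : ℕ → Fin p → ℝ => x k a := fun k a =>
    (measurable_pi_apply a).comp (measurable_pi_apply (X := fun _ : ℕ => Fin p → ℝ) k)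
  have hD : ∀ k c, Measurable fun x : ℕ → Fin p → ℝ => localDesign n x s (s i) k c := by
    intro k c
    simp only [localDesign, Matrix.of_apply]
    rcases c with a | ab
    · simpa using hx k a
    · simpa using (hx k ab.1).mul_const _
  have hV : ∀ k l, Measurable fun _ : ℕ → Fin p → ℝ => localWeight K h n s (s i) k l :=
    fun k l => measurable_const
  have hDV := measurable_matrix_mul (M := fun x : ℕ → Fin p → ℝ => (localDesign n x s (s i))ᵀ)
    (N := fun _ => localWeight K h n s (s i)) (fun k l => hD l k) hV
  have hinv := measurable_matrix_inv (measurable_matrix_mul hDV hD)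
  have h1 := measurable_matrix_mul (measurable_matrix_mul hinv
    (N := fun x : ℕ → Fin p → ℝ => (localDesign n x s (s i))ᵀ) (fun k l => hD l k)) hV
  simp only [smoother, Matrix.of_apply, Matrix.vecMul, dotProduct]
  refine Finset.measurable_fun_sum _ fun k _ => Measurable.mul ?_ (h1 k j)
  rcases k with a | ab
  · simpa using hx i a
  · simp

end Measurability

/-! ### Bounds for `G` -/

/-- Entries `O(1 / ρ)` and row sums `O(1 / √ρ)`. -/
def SmallRows (G : ∀ n : ℕ, Matrix (Fin n) (Fin n) ℝ) (ρ : ℕ → ℝ) (C : ℝ) : Prop :=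
  (∀ n i j, |G n i j| ≤ C / ρ n) ∧ ∀ n i, ∑ j, |G n i j| ≤ C / Real.sqrt (ρ n)

/-- The entry bound survives multiplication by `A⁻¹` because the column sums of the latter are
bounded. -/
lemma exists_smallRows {Ω : Type*} [MeasurableSpace Ω] {μ : Measure Ω} {p : ℕ} {K : ℝ → ℝ}
    {h : ℕ → ℝ} {W : ∀ n : ℕ, Matrix (Fin n) (Fin n) ℝ} {α₀ : ℝ} {ρ : ℕ → ℝ}
    {β : Plane → Fin p → ℝ} {s : ℕ → Plane} {X : ℕ → Ω → Fin p → ℝ}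
    (hW : WeightCondition W α₀ ρ) (hsing : SingularCondition μ K h W α₀ ρ β s X) :
    ∃ C : ℝ, 0 < C ∧ SmallRows (fun n => gMatrix (W n) α₀) ρ C := by
  obtain ⟨C₁, hC₁⟩ := hW.entries
  obtain ⟨C₂, hC₂⟩ := hW.sums
  obtain ⟨C₃, hC₃⟩ := hsing.row_sums
  refine ⟨max 1 (max (|C₁| * |C₂|) C₃), by positivity, ?_, ?_⟩
  · intro n i j
    have hρ := hW.rho_pos n
    have h1 : |gMatrix (W n) α₀ i j| ≤ |C₁| * |C₂| / ρ n := by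
      rw [gMatrix, Matrix.mul_apply]
      calc _ ≤ ∑ k, |W n i k| * |(sarMatrix (W n) α₀)⁻¹ k j| := by
            refine (Finset.abs_sum_le_sum_abs _ _).trans (le_of_eq ?_)
            exact Finset.sum_congr rfl fun k _ => abs_mul _ _
        _ ≤ ∑ k, |C₁| / ρ n * |(sarMatrix (W n) α₀)⁻¹ k j| := by
            refine Finset.sum_le_sum fun k _ => mul_le_mul_of_nonneg_right ?_ (abs_nonneg _)
            exact (hC₁ n i k).trans (div_le_div_of_nonneg_right (le_abs_self _) hρ.le)
        _ ≤ |C₁| / ρ n * |C₂| := by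
            rw [← Finset.mul_sum]
            exact mul_le_mul_of_nonneg_left (((hC₂ n).2.2.2 j).trans (le_abs_self _))
              (by positivity)
        _ = _ := by ring
    exact h1.trans (div_le_div_of_nonneg_right
      ((le_max_left _ _).trans (le_max_right _ _)) hρ.le)
  · intro n i
    exact (hC₃ n i).trans (div_le_div_of_nonneg_right
      ((le_max_right _ _).trans (le_max_right _ _)) (Real.sqrt_nonneg _))

lemma SmallRows.sum_sq_le {G : ∀ n : ℕ, Matrix (Fin n) (Fin n) ℝ} {ρ : ℕ → ℝ} {C : ℝ}
    (hG : SmallRows G ρ C) (n : ℕ) (i : Fin n) :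
    ∑ j, G n i j ^ 2 ≤ C / ρ n * (C / Real.sqrt (ρ n)) := by
  have h0 : 0 ≤ C / ρ n := (abs_nonneg _).trans (hG.1 n i i)
  calc _ ≤ ∑ j, C / ρ n * |G n i j| := by
        refine Finset.sum_le_sum fun j _ => ?_
        rw [← sq_abs, sq]
        exact mul_le_mul_of_nonneg_right (hG.1 n i j) (abs_nonneg _)
    _ ≤ _ := by
        rw [← Finset.mul_sum]
        exact mul_le_mul_of_nonneg_left (hG.2 n i) h0

/-- Largest entry times row sum is `O(ρ^(-3/2))`. The spare `ρ^(-1/2)` is what makes all terms in `G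
ε`, and the Frobenius term of the determinant, negligible at the scale `n/ρ`. -/
lemma SmallRows.rho_sum_sq_le {G : ∀ n : ℕ, Matrix (Fin n) (Fin n) ℝ} {ρ : ℕ → ℝ} {C : ℝ}
    (hG : SmallRows G ρ C) (hρ : ∀ n, 0 < ρ n) (n : ℕ) (i : Fin n) :
    ρ n * ∑ j, G n i j ^ 2 ≤ C ^ 2 / Real.sqrt (ρ n) := by
  have h1 := hρ n
  calc _ ≤ ρ n * (C / ρ n * (C / Real.sqrt (ρ n))) :=
        mul_le_mul_of_nonneg_left (hG.sum_sq_le n i) h1.le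
    _ = _ := by field_simp

/-! ### Asymptotic regime of the local fits -/

section Regime

variable {Ω : Type*} [MeasurableSpace Ω] {μ : Measure Ω} [IsProbabilityMeasure μ]
  {p : ℕ} {X : ℕ → Ω → Fin p → ℝ} {ε : ℕ → Ω → ℝ} {σ : ℝ}

/-- Kernel weights, bandwidths and events on which the local fits are well conditioned. -/
structure LocalRegime (μ : Measure Ω) (X : ℕ → Ω → Fin p → ℝ) (s : ℕ → Plane) (h : ℕ → ℝ)
    (K : ℝ → ℝ) (E : ℕ → Set (ℕ → Fin p → ℝ)) (c c' C L : ℝ) : Prop where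
  kernel : IsKernel K
  h_pos : ∀ n, 0 < h n
  h_tendsto : Tendsto h atTop (𝓝 0)
  c_pos : 0 < c
  c'_pos : 0 < c'
  C_pos : 0 < C
  one_le_L : 1 ≤ L
  kernel_le : ∀ t, K t ≤ C
  supp : ∀ t, K t ≠ 0 → |t| ≤ L
  meas : ∀ n, MeasurableSet (E n)
  prob : Tendsto (fun n : ℕ => (n * h n ^ 2) ^ 3 * μ.real {ω | (fun i => X i ω) ∉ E n})
    atTop (𝓝 0)
  whp_mem : ∀ᶠ q in whp μ, (fun i => X i q.2) ∈ E q.1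
  gram : ∀ᶠ n : ℕ in atTop, ∀ x ∈ E n, ∀ i : Fin n, GramBound n K (h n) x s i (c * n)
  sum_le : ∀ᶠ n : ℕ in atTop, ∀ i, ∑ j : Fin n, rowWeight K (h n) s i j ≤ C * n
  coercive : ∀ᶠ n : ℕ in atTop, ∀ (i : ℕ) (a b₀ b₁ : ℝ),
      c' * n * (a ^ 2 + b₀ ^ 2 + b₁ ^ 2) ≤ ∑ j : Fin n, rowWeight K (h n) s i j *
        (a + b₀ * ((s j - s i) 0 / h n) + b₁ * ((s j - s i) 1 / h n)) ^ 2
  bandwidth : Tendsto (fun n : ℕ => n * h n ^ 2) atTop atTop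

lemma exists_localRegime (hX : SampleCondition μ X ε σ) {R : Set Plane} {f : Plane → ℝ}
    {s : ℕ → Plane} {h : ℕ → ℝ} {K : ℝ → ℝ}
    (hs : DesignCondition R f s h) (hK : IsKernel K) (hpos : ∀ n, 0 < h n)
    (hh : Tendsto h atTop (𝓝 0)) (hb : ∀ᶠ n : ℕ in atTop, Real.sqrt n ≤ n * h n ^ 2) :
    ∃ (E : ℕ → Set (ℕ → Fin p → ℝ)) (c c' C L : ℝ), LocalRegime μ X s h K E c c' C L := by
  obtain ⟨E, c, hc, hEm, hprob, hgram⟩ := exists_gram_event hX hs hK hpos hh hb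
  obtain ⟨c', hc', hco⟩ := design_coercive hs hK hpos hh
  obtain ⟨C, hC, hsum⟩ := kernel_sum_le hs hK hpos hh
  obtain ⟨CK, hCK0, hCK⟩ := hK.exists_bound
  obtain ⟨L, hL, hsupp⟩ := hK.exists_support
  have hN := tendsto_bandwidth hb
  refine ⟨E, c, c', max C CK, L, hK, hpos, hh, hc, hc', by positivity, hL,
    fun t => (hCK t).trans (le_max_right _ _), hsupp, hEm, hprob, ?_, hgram, ?_, ?_, hN⟩
  · rw [eventually_whp]
    have h1 : Tendsto (fun n => ENNReal.ofReal (μ.real {ω | (fun i => X i ω) ∉ E n})) atTop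
        (𝓝 0) := by
      rw [← ENNReal.ofReal_zero]
      refine (ENNReal.continuous_ofReal.tendsto _).comp ?_
      refine squeeze_zero' (Eventually.of_forall fun n => measureReal_nonneg) ?_ hprob
      filter_upwards [hN.eventually_ge_atTop 1] with n hn
      exact le_mul_of_one_le_left measureReal_nonneg (one_le_pow₀ hn)
    refine h1.congr fun n => ?_
    exact ENNReal.ofReal_toReal (measure_ne_top _ _)
  · filter_upwards [hsum] with n hn i
    exact (hn (s i) (hs.mem i)).trans
      (mul_le_mul_of_nonneg_right (le_max_left _ _) (Nat.cast_nonneg _))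
  · filter_upwards [hco] with n hn i
    exact hn (s i) (hs.mem i)

variable {s : ℕ → Plane} {h : ℕ → ℝ} {K : ℝ → ℝ} {E : ℕ → Set (ℕ → Fin p → ℝ)} {c c' C L : ℝ}

lemma LocalRegime.weight_nonneg (hR : LocalRegime μ X s h K E c c' C L) (n i j : ℕ) :
    0 ≤ rowWeight K (h n) s i j := scaledKernel_nonneg hR.kernel _ _

lemma LocalRegime.weight_le (hR : LocalRegime μ X s h K E c c' C L) (n i j : ℕ) :
    rowWeight K (h n) s i j ≤ C / h n ^ 2 := scaledKernel_le hR.kernel_le _ _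

lemma LocalRegime.norm_le (hR : LocalRegime μ X s h K E c c' C L) {n i j : ℕ}
    (hw : rowWeight K (h n) s i j ≠ 0) : ‖s j - s i‖ ≤ L * h n := by
  have := abs_le_of_scaledKernel_ne_zero hR.supp (hR.h_pos n) hw
  rwa [abs_of_nonneg (norm_nonneg _)] at this

/-- The bound for the average squared output of the smoother. -/
def smoothBound (c : ℝ) (n : ℕ) (K : ℝ → ℝ) (h : ℝ) (s : ℕ → Plane) (x : ℕ → Fin p → ℝ)
    (z : Fin n → Fin n → ℝ) : ℝ :=
  (n : ℝ)⁻¹ * ∑ i : Fin n, (x i ⬝ᵥ x i) / (c * n) *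
    ∑ j : Fin n, rowWeight K h s i j * z i j ^ 2

lemma LocalRegime.smoothBound_nonneg (hR : LocalRegime μ X s h K E c c' C L) (n : ℕ)
    (x : ℕ → Fin p → ℝ) (z : Fin n → Fin n → ℝ) : 0 ≤ smoothBound c n K (h n) s x z := by
  have := hR.c_pos
  unfold smoothBound
  refine mul_nonneg (by positivity) (Finset.sum_nonneg fun i _ => mul_nonneg
    (div_nonneg (dot_self_nonneg _) (by positivity)) (Finset.sum_nonneg fun j _ =>
      mul_nonneg (hR.weight_nonneg _ _ _) (sq_nonneg _)))

/-- The input `z i` may vary with the row, because the local fit subtracted beforehand depends on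
the centre `s_i`. -/
lemma LocalRegime.sum_smoother_sq_le (hR : LocalRegime μ X s h K E c c' C L) :
    ∀ᶠ n : ℕ in atTop, ∀ x ∈ E n, ∀ z : Fin n → Fin n → ℝ,
      (n : ℝ)⁻¹ * ∑ i, (smoother K (h n) n x s *ᵥ z i) i ^ 2 ≤ smoothBound c n K (h n) s x z := by
  filter_upwards [hR.gram, eventually_gt_atTop 0] with n hn hn0 x hx z
  have h0 : (0 : ℝ) < n := by exact_mod_cast hn0
  refine mul_le_mul_of_nonneg_left (Finset.sum_le_sum fun i _ => ?_) (by positivity)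
  exact smoother_sq_le (hR.weight_nonneg n) (hR.h_pos n).ne' (mul_pos hR.c_pos h0) (hn x hx i) _

lemma LocalRegime.integral_smoothBound_le (hR : LocalRegime μ X s h K E c c' C L) :
    ∀ᶠ n : ℕ in atTop, ∀ (z : Ω → Fin n → Fin n → ℝ) (B : ℝ), 0 ≤ B →
      (∀ i j : Fin n, rowWeight K (h n) s i j ≠ 0 →
        Integrable (fun ω => (X i ω ⬝ᵥ X i ω) * z ω i j ^ 2) μ ∧
        ∫ ω, (X i ω ⬝ᵥ X i ω) * z ω i j ^ 2 ∂μ ≤ B) →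
      Integrable (fun ω => smoothBound c n K (h n) s (fun i => X i ω) (z ω)) μ ∧
      ∫ ω, smoothBound c n K (h n) s (fun i => X i ω) (z ω) ∂μ ≤ C / c * B := by
  filter_upwards [hR.sum_le, eventually_gt_atTop 0] with n hn hn0 z B hB hz
  have h0 : (0 : ℝ) < n := by exact_mod_cast hn0
  have hc := hR.c_pos
  have e : ∀ ω, smoothBound c n K (h n) s (fun i => X i ω) (z ω) =
      ∑ i : Fin n, ∑ j : Fin n, (n : ℝ)⁻¹ * (c * n)⁻¹ * (rowWeight K (h n) s i j *
        ((X i ω ⬝ᵥ X i ω) * z ω i j ^ 2)) := by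
    intro ω
    simp only [smoothBound, Finset.mul_sum]
    exact Finset.sum_congr rfl fun i _ => Finset.sum_congr rfl fun j _ => by ring
  have hint : ∀ i j : Fin n, Integrable (fun ω => rowWeight K (h n) s i j *
        ((X i ω ⬝ᵥ X i ω) * z ω i j ^ 2)) μ := by
    intro i j
    by_cases hw : rowWeight K (h n) s i j = 0
    · simp [hw]
    · exact (hz i j hw).1.const_mul _
  have hle : ∀ i j : Fin n, ∫ ω, rowWeight K (h n) s i j *
        ((X i ω ⬝ᵥ X i ω) * z ω i j ^ 2) ∂μ ≤ rowWeight K (h n) s i j * B := by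
    intro i j
    by_cases hw : rowWeight K (h n) s i j = 0
    · simp [hw]
    · rw [integral_const_mul]
      exact mul_le_mul_of_nonneg_left (hz i j hw).2 (hR.weight_nonneg _ _ _)
  simp only [e]
  refine ⟨integrable_finsetSum _ fun i _ => integrable_finsetSum _ fun j _ =>
    (hint i j).const_mul _, ?_⟩
  rw [integral_finsetSum _ fun i _ => integrable_finsetSum _ fun j _ => (hint i j).const_mul _]
  calc _ ≤ ∑ i : Fin n, (n : ℝ)⁻¹ * (c * n)⁻¹ * (C * n * B) := by
        refine Finset.sum_le_sum fun i _ => ?_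
        rw [integral_finsetSum _ fun j _ => (hint i j).const_mul _]
        simp only [integral_const_mul _ (fun ω => rowWeight K (h n) s i _ * _)]
        rw [← Finset.mul_sum]
        refine mul_le_mul_of_nonneg_left ?_ (by positivity)
        refine (Finset.sum_le_sum fun j _ => hle i j).trans ?_
        rw [← Finset.sum_mul]
        exact mul_le_mul_of_nonneg_right (hn i) hB
    _ = _ := by
        rw [Finset.sum_const, Finset.card_univ, Fintype.card_fin, nsmul_eq_mul]
        field_simp

lemma LocalRegime.tendsto_smooth (hR : LocalRegime μ X s h K E c c' C L)
    {z : ∀ n : ℕ, Ω → Fin n → Fin n → ℝ} {B : ℕ → ℝ} (hB : Tendsto B atTop (𝓝 0))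
    (hB0 : ∀ n, 0 ≤ B n)
    (hz : ∀ᶠ n : ℕ in atTop, ∀ i j : Fin n, rowWeight K (h n) s i j ≠ 0 →
      Integrable (fun ω => (X i ω ⬝ᵥ X i ω) * z n ω i j ^ 2) μ ∧
      ∫ ω, (X i ω ⬝ᵥ X i ω) * z n ω i j ^ 2 ∂μ ≤ B n) :
    Tendsto (fun q : ℕ × Ω => (q.1 : ℝ)⁻¹ * ∑ i,
      (smoother K (h q.1) q.1 (fun i => X i q.2) s *ᵥ z q.1 q.2 i) i ^ 2) (whp μ) (𝓝 0) := by
  refine tendsto_whp_of_integral (μ := μ)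
    (f := fun n ω => (n : ℝ)⁻¹ * ∑ i, (smoother K (h n) n (fun i => X i ω) s *ᵥ z n ω i) i ^ 2)
    (G := fun n ω => smoothBound c n K (h n) s (fun i => X i ω) (z n ω))
    (b := fun n => C / c * B n) ?_ (fun n ω => hR.smoothBound_nonneg n _ _) ?_ ?_
  · filter_upwards [hR.whp_mem, tendsto_fst_whp.eventually hR.sum_smoother_sq_le] with q h1 h2
    rw [abs_of_nonneg (mul_nonneg (by positivity) (Finset.sum_nonneg fun i _ => sq_nonneg _))]
    exact h2 _ h1 _
  · filter_upwards [hR.integral_smoothBound_le, hz] with n h1 h2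
    exact h1 (z n) (B n) (hB0 n) h2
  · simpa using hB.const_mul (C / c)

/-- Given the covariates, the mean squared norm of `A ε` is `σ²` times the squared Frobenius norm of
`A`. Cutting `A` off outside `E n` makes a bound known only on `E n` integrable, and changes nothing
with high probability. -/
lemma LocalRegime.tendsto_noise (hR : LocalRegime μ X s h K E c c' C L)
    (hX : SampleCondition μ X ε σ) {ι : ℕ → Type*} [∀ n, Fintype (ι n)]
    {A : ∀ n : ℕ, (ℕ → Fin p → ℝ) → ι n → Fin n → ℝ}
    (hA : ∀ n i j, Measurable fun x => A n x i j)
    {g : ℕ → (ℕ → Fin p → ℝ) → ℝ} (hg0 : ∀ n x, 0 ≤ g n x) {b : ℕ → ℝ}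
    (hle : ∀ᶠ n in atTop, ∀ x ∈ E n, ∑ i, ∑ j, A n x i j ^ 2 ≤ g n x)
    (hg : ∀ᶠ n in atTop, Integrable (fun ω => g n fun i => X i ω) μ ∧
      ∫ ω, g n (fun i => X i ω) ∂μ ≤ b n) (hb : Tendsto b atTop (𝓝 0)) :
    Tendsto (fun q : ℕ × Ω => ∑ i, (∑ j : Fin q.1, A q.1 (fun i => X i q.2) i j * ε j q.2) ^ 2)
      (whp μ) (𝓝 0) := by
  classical
  set A' : ∀ n : ℕ, (ℕ → Fin p → ℝ) → ι n → Fin n → ℝ := fun n x i j =>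
    (E n).indicator (fun x => A n x i j) x with hA'
  refine tendsto_whp_of_integral (μ := μ)
    (f := fun n ω => ∑ i, (∑ j : Fin n, A n (fun i => X i ω) i j * ε j ω) ^ 2)
    (G := fun n ω => ∑ i, (∑ j : Fin n, A' n (fun i => X i ω) i j * ε j ω) ^ 2)
    (b := fun n => σ ^ 2 * b n) ?_ (fun n ω => Finset.sum_nonneg fun i _ => sq_nonneg _) ?_ ?_
  · filter_upwards [hR.whp_mem] with q h1
    rw [abs_of_nonneg (Finset.sum_nonneg fun i _ => sq_nonneg _)]
    simp only [hA', Set.indicator_of_mem h1]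
    exact le_rfl
  · filter_upwards [hle, hg] with n h1 h2
    have h3 := integral_noise_le (μ := μ) hX.measurable_seq hX.indep_X_ε hX.memLp_eps
      hX.integral_eps_mul (sq_nonneg σ) (A := A' n) (g := g n)
      (fun i j => (hA n i j).indicator (hR.meas n)) h2.1 (fun x => by
        by_cases hx : x ∈ E n
        · simp only [hA', Set.indicator_of_mem hx]; exact h1 x hx
        · simp only [hA', Set.indicator_of_notMem hx]; simpa using hg0 n x)
    exact ⟨h3.1, h3.2.trans (mul_le_mul_of_nonneg_left h2.2 (sq_nonneg _))⟩
  · simpa using hb.const_mul (σ ^ 2)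

omit [IsProbabilityMeasure μ] in
lemma tendsto_zero_of_sq {α : Type*} {l : Filter α} {f : α → ℝ}
    (hf : Tendsto (fun a => f a ^ 2) l (𝓝 0)) : Tendsto f l (𝓝 0) := by
  have h1 := (Real.continuous_sqrt.tendsto _).comp hf
  rw [Real.sqrt_zero] at h1
  rw [tendsto_zero_iff_abs_tendsto_zero]
  refine h1.congr fun a => ?_
  simp [Real.sqrt_sq_eq_abs]

/-- A weak law of large numbers for triangular arrays. -/
lemma tendsto_whp_sum {ι : ℕ → Type*} [∀ n, Fintype (ι n)] {η : ∀ n, ι n → Ω → ℝ} {b : ℕ → ℝ}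
    (h2 : ∀ n i, MemLp (η n i) 2 μ)
    (hz : ∀ n i, ∫ ω, η n i ω ∂μ = 0) (hind : ∀ n i j, i ≠ j → IndepFun (η n i) (η n j) μ)
    (hle : ∀ᶠ n in atTop, ∑ i, ∫ ω, η n i ω ^ 2 ∂μ ≤ b n) (hb : Tendsto b atTop (𝓝 0)) :
    Tendsto (fun q : ℕ × Ω => ∑ i, η q.1 i q.2) (whp μ) (𝓝 0) := by
  refine tendsto_zero_of_sq ?_
  refine tendsto_whp_of_integral (μ := μ) (f := fun n ω => (∑ i, η n i ω) ^ 2)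
    (G := fun n ω => (∑ i, η n i ω) ^ 2) (b := b) ?_ (fun n ω => sq_nonneg _) ?_ hb
  · exact Eventually.of_forall fun q => (abs_of_nonneg (sq_nonneg _)).le
  · filter_upwards [hle] with n hn
    have h3 := integral_sq_sum (μ := μ) Finset.univ (fun i _ => h2 n i) (fun i _ => hz n i)
      (fun i _ j _ hij => hind n i j hij)
    exact ⟨h3.1.integrable_sq, h3.2.le.trans hn⟩

end Regime

/-! ### Negligible and leading noise terms -/

section Noise

variable {Ω : Type*} [MeasurableSpace Ω] {μ : Measure Ω} [IsProbabilityMeasure μ]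
  {p : ℕ} {X : ℕ → Ω → Fin p → ℝ} {ε : ℕ → Ω → ℝ} {σ : ℝ}
  {s : ℕ → Plane} {h : ℕ → ℝ} {K : ℝ → ℝ} {E : ℕ → Set (ℕ → Fin p → ℝ)} {c c' C L : ℝ}
  {ρ : ℕ → ℝ} {G : ∀ n : ℕ, Matrix (Fin n) (Fin n) ℝ} {CG : ℝ}

/-- The first `n` errors at the sample point `q = (n, ω)`. -/
def noiseAt (ε : ℕ → Ω → ℝ) (q : ℕ × Ω) : Fin q.1 → ℝ := fun j => ε j q.2

/-- The smoothing matrix at the sample point `q = (n, ω)`. -/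
def smootherAt (K : ℝ → ℝ) (h : ℕ → ℝ) (s : ℕ → Plane) (X : ℕ → Ω → Fin p → ℝ) (q : ℕ × Ω) :
    Matrix (Fin q.1) (Fin q.1) ℝ := smoother K (h q.1) q.1 (fun i => X i q.2) s

lemma tendsto_inv_sqrt (hρ : Tendsto ρ atTop atTop) :
    Tendsto (fun n => (Real.sqrt (ρ n))⁻¹) atTop (𝓝 0) :=
  tendsto_inv_atTop_zero.comp (Real.tendsto_sqrt_atTop.comp hρ)

lemma tendsto_inv_of_ratio
    (hb : Tendsto (fun n : ℕ => (n : ℝ) * h n ^ 2 / ρ n) atTop atTop) :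
    Tendsto (fun n : ℕ => ρ n / (n * h n ^ 2)) atTop (𝓝 0) := by
  refine (tendsto_inv_atTop_zero.comp hb).congr fun n => ?_
  simp [inv_div]

/-- The squared Frobenius norm of the smoother. -/
lemma LocalRegime.sum_sum_smoother_sq_le (hR : LocalRegime μ X s h K E c c' C L) :
    ∀ᶠ n : ℕ in atTop, ∀ x ∈ E n,
      ∑ i, ∑ j, smoother K (h n) n x s i j ^ 2 ≤
        ∑ i : Fin n, (x i ⬝ᵥ x i) / (c * n) * (C / h n ^ 2) := by
  filter_upwards [hR.gram, eventually_gt_atTop 0] with n hn hn0 x hx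
  have h0 : (0 : ℝ) < n := by exact_mod_cast hn0
  exact Finset.sum_le_sum fun i _ => smoother_row_sq_le (hR.weight_nonneg n) (hR.h_pos n).ne'
    (mul_pos hR.c_pos h0) (hn x hx i) (fun j => hR.weight_le n i j)

lemma LocalRegime.integral_frobenius_le (hR : LocalRegime μ X s h K E c c' C L)
    (hX : SampleCondition μ X ε σ) {n : ℕ} (hn : 0 < n) :
    Integrable (fun ω => ρ n / n * ∑ i : Fin n, (X i ω ⬝ᵥ X i ω) / (c * n) * (C / h n ^ 2)) μ ∧
    ∫ ω, ρ n / n * ∑ i : Fin n, (X i ω ⬝ᵥ X i ω) / (c * n) * (C / h n ^ 2) ∂μ ≤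
      C / c * (∫ ω, X 0 ω ⬝ᵥ X 0 ω ∂μ) * (ρ n / (n * h n ^ 2)) := by
  have hint : ∀ i : Fin n, Integrable
      (fun ω => (X i ω ⬝ᵥ X i ω) / (c * n) * (C / h n ^ 2)) μ := fun i =>
    (((hX.memLp_normSq i).integrable one_le_two).div_const _).mul_const _
  refine ⟨(integrable_finsetSum _ fun i _ => hint i).const_mul _, le_of_eq ?_⟩
  rw [integral_const_mul, integral_finsetSum _ fun i _ => hint i]
  simp only [integral_mul_const, integral_div, hX.integral_normSq]
  rw [Finset.sum_const, Finset.card_univ, Fintype.card_fin, nsmul_eq_mul]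
  have h0 : (0 : ℝ) < n := by exact_mod_cast hn
  have h1 := hR.c_pos
  have h2 := hR.h_pos n
  field_simp

/-- The squared Frobenius norm of `S`, which is also that of `Sᵀ`, has a majorant with mean
`O(h⁻²)`, so the noise contributes `O(ρ/(n h²))`. The transpose is needed for the cross term `ε · S
G ε`. -/
lemma LocalRegime.tendsto_smoother_noise (hR : LocalRegime μ X s h K E c c' C L)
    (hX : SampleCondition μ X ε σ) (hρ : ∀ n, 0 < ρ n)
    (hb : Tendsto (fun n : ℕ => (n : ℝ) * h n ^ 2 / ρ n) atTop atTop) :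
    Tendsto (fun q : ℕ × Ω => ρ q.1 / q.1 * ((smootherAt K h s X q *ᵥ noiseAt ε q) ⬝ᵥ
      (smootherAt K h s X q *ᵥ noiseAt ε q))) (whp μ) (𝓝 0) ∧
    Tendsto (fun q : ℕ × Ω => ρ q.1 / q.1 * (((smootherAt K h s X q)ᵀ *ᵥ noiseAt ε q) ⬝ᵥ
      ((smootherAt K h s X q)ᵀ *ᵥ noiseAt ε q))) (whp μ) (𝓝 0) := by
  have hg0 : ∀ n (x : ℕ → Fin p → ℝ),
      0 ≤ ρ n / n * ∑ i : Fin n, (x i ⬝ᵥ x i) / (c * n) * (C / h n ^ 2) := fun n x => by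
    have h1 := hR.c_pos
    have h2 := hR.C_pos
    have h3 := hρ n
    refine mul_nonneg (by positivity) (Finset.sum_nonneg fun i _ => mul_nonneg
      (div_nonneg (dot_self_nonneg _) (by positivity)) (by positivity))
  have hlim : Tendsto (fun n : ℕ => C / c * (∫ ω, X 0 ω ⬝ᵥ X 0 ω ∂μ) * (ρ n / (n * h n ^ 2)))
      atTop (𝓝 0) := by
    simpa using (tendsto_inv_of_ratio hb).const_mul (C / c * (∫ ω, X 0 ω ⬝ᵥ X 0 ω ∂μ))
  have hint : ∀ᶠ n : ℕ in atTop, _ :=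
    (eventually_gt_atTop 0).mono fun n hn => hR.integral_frobenius_le (ρ := ρ) hX hn
  have hsq : ∀ n : ℕ, Real.sqrt (ρ n / n) ^ 2 = ρ n / n := fun n =>
    Real.sq_sqrt (div_nonneg (hρ n).le (Nat.cast_nonneg _))
  constructor
  · have h1 := hR.tendsto_noise hX (ι := fun n => Fin n)
      (A := fun n x i j => Real.sqrt (ρ n / n) * smoother K (h n) n x s i j)
      (fun n i j => (measurable_smoother K (h n) s i j).const_mul _) hg0 ?_ hint hlim
    · refine h1.congr fun q => ?_
      rw [dotProduct, Finset.mul_sum]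
      refine Finset.sum_congr rfl fun i _ => ?_
      rw [← sq]
      conv_rhs => rw [← hsq q.1, ← mul_pow, Matrix.mulVec, dotProduct, Finset.mul_sum]
      congr 1
      exact Finset.sum_congr rfl fun j _ => by rw [smootherAt, noiseAt, mul_assoc]
    · filter_upwards [hR.sum_sum_smoother_sq_le] with n hn x hx
      simp only [mul_pow, hsq, ← Finset.mul_sum]
      exact mul_le_mul_of_nonneg_left (hn x hx) (div_nonneg (hρ n).le (Nat.cast_nonneg _))
  · have h1 := hR.tendsto_noise hX (ι := fun n => Fin n)
      (A := fun n x i j => Real.sqrt (ρ n / n) * smoother K (h n) n x s j i)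
      (fun n i j => (measurable_smoother K (h n) s j i).const_mul _) hg0 ?_ hint hlim
    · refine h1.congr fun q => ?_
      rw [dotProduct, Finset.mul_sum]
      refine Finset.sum_congr rfl fun i _ => ?_
      rw [← sq]
      conv_rhs => rw [← hsq q.1, ← mul_pow, Matrix.mulVec, dotProduct, Finset.mul_sum]
      congr 1
      exact Finset.sum_congr rfl fun j _ => by
        rw [Matrix.transpose_apply, smootherAt, noiseAt, mul_assoc]
    · filter_upwards [hR.sum_sum_smoother_sq_le] with n hn x hx
      simp only [mul_pow, hsq, ← Finset.mul_sum]
      rw [Finset.sum_comm]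
      exact mul_le_mul_of_nonneg_left (hn x hx) (div_nonneg (hρ n).le (Nat.cast_nonneg _))

lemma LocalRegime.tendsto_G_noise (hR : LocalRegime μ X s h K E c c' C L)
    (hX : SampleCondition μ X ε σ) (hρ : ∀ n, 0 < ρ n) (hρt : Tendsto ρ atTop atTop)
    (hG : SmallRows G ρ CG) :
    Tendsto (fun q : ℕ × Ω => ρ q.1 / q.1 * ((G q.1 *ᵥ noiseAt ε q) ⬝ᵥ
      (G q.1 *ᵥ noiseAt ε q))) (whp μ) (𝓝 0) := by
  have hsq : ∀ n : ℕ, Real.sqrt (ρ n / n) ^ 2 = ρ n / n := fun n =>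
    Real.sq_sqrt (div_nonneg (hρ n).le (Nat.cast_nonneg _))
  have hlim : Tendsto (fun n : ℕ => CG ^ 2 / Real.sqrt (ρ n)) atTop (𝓝 0) := by
    simpa [div_eq_mul_inv] using (tendsto_inv_sqrt hρt).const_mul (CG ^ 2)
  have h1 := hR.tendsto_noise hX (ι := fun n => Fin n)
    (A := fun n _ i j => Real.sqrt (ρ n / n) * G n i j) (fun n i j => measurable_const)
    (g := fun n _ => CG ^ 2 / Real.sqrt (ρ n)) (fun n x => by positivity) ?_
    (Eventually.of_forall fun n => ⟨integrable_const _, by simp⟩) hlim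
  · refine h1.congr fun q => ?_
    rw [dotProduct, Finset.mul_sum]
    refine Finset.sum_congr rfl fun i _ => ?_
    rw [← sq]
    conv_rhs => rw [← hsq q.1, ← mul_pow, Matrix.mulVec, dotProduct, Finset.mul_sum]
    congr 1
    exact Finset.sum_congr rfl fun j _ => by rw [noiseAt, mul_assoc]
  · filter_upwards [eventually_gt_atTop 0] with n hn x _
    have h0 : (0 : ℝ) < n := by exact_mod_cast hn
    simp only [mul_pow, hsq, ← Finset.mul_sum]
    calc _ = (n : ℝ)⁻¹ * ∑ i, ρ n * ∑ j, G n i j ^ 2 := by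
          rw [← Finset.mul_sum]; ring
      _ ≤ (n : ℝ)⁻¹ * ∑ i : Fin n, CG ^ 2 / Real.sqrt (ρ n) := by
          refine mul_le_mul_of_nonneg_left (Finset.sum_le_sum fun i _ => ?_) (by positivity)
          exact hG.rho_sum_sq_le hρ n i
      _ = _ := by
          rw [Finset.sum_const, Finset.card_univ, Fintype.card_fin, nsmul_eq_mul]
          field_simp

/-- The smoother is bounded by local weighted averages of squares, and `G ε` is independent of the
covariates; each coordinate has variance `O(ρ^(-3/2))`. -/
lemma LocalRegime.tendsto_smoother_G_noise (hR : LocalRegime μ X s h K E c c' C L)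
    (hX : SampleCondition μ X ε σ) (hρ : ∀ n, 0 < ρ n) (hρt : Tendsto ρ atTop atTop)
    (hG : SmallRows G ρ CG) :
    Tendsto (fun q : ℕ × Ω => ρ q.1 / q.1 *
      ((smootherAt K h s X q *ᵥ (G q.1 *ᵥ noiseAt ε q)) ⬝ᵥ
      (smootherAt K h s X q *ᵥ (G q.1 *ᵥ noiseAt ε q)))) (whp μ) (𝓝 0) := by
  set m := ∫ ω, X 0 ω ⬝ᵥ X 0 ω ∂μ with hm
  have hm0 : 0 ≤ m := integral_nonneg fun ω => dot_self_nonneg _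
  have hlim : Tendsto (fun n : ℕ => m * σ ^ 2 * CG ^ 2 / Real.sqrt (ρ n)) atTop (𝓝 0) := by
    simpa [div_eq_mul_inv] using (tendsto_inv_sqrt hρt).const_mul (m * σ ^ 2 * CG ^ 2)
  have hsq : ∀ n : ℕ, Real.sqrt (ρ n) ^ 2 = ρ n := fun n => Real.sq_sqrt (hρ n).le
  have h1 := hR.tendsto_smooth
    (z := fun n ω _ j => Real.sqrt (ρ n) * (G n *ᵥ noiseAt ε (n, ω)) j) hlim
    (fun n => by positivity) ?_
  · refine h1.congr fun q => ?_
    rw [dotProduct, div_eq_inv_mul, mul_assoc, Finset.mul_sum _ _ (ρ q.1)]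
    congr 1
    refine Finset.sum_congr rfl fun i _ => ?_
    have : (fun j => Real.sqrt (ρ q.1) * (G q.1 *ᵥ noiseAt ε q) j) =
        Real.sqrt (ρ q.1) • (G q.1 *ᵥ noiseAt ε q) := by ext j; simp
    rw [this, Matrix.mulVec_smul, Pi.smul_apply, smul_eq_mul, mul_pow, hsq, sq]
    rfl
  · refine Eventually.of_forall fun n i j _ => ?_
    have h2 := integral_sq_sum (μ := μ) (η := fun (k : Fin n) ω => G n j k * ε k ω) Finset.univ
      (fun k _ => (hX.memLp_eps k).const_mul _)
      (fun k _ => by rw [integral_const_mul, hX.integral_eps, mul_zero])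
      (fun k _ l _ hkl => (hX.indep_ε.indepFun fun h => hkl (Fin.ext h)).comp
        (φ := fun t => G n j k * t) (ψ := fun t => G n j l * t) (by fun_prop) (by fun_prop))
    have h3 : ∫ ω, (∑ k : Fin n, G n j k * ε k ω) ^ 2 ∂μ = σ ^ 2 * ∑ k, G n j k ^ 2 := by
      rw [h2.2, Finset.mul_sum]
      refine Finset.sum_congr rfl fun k _ => ?_
      simp only [mul_pow]
      rw [integral_const_mul, hX.integral_eps_sq, mul_comm]
    have hind : IndepFun (fun ω => X i ω ⬝ᵥ X i ω)
        (fun ω => (Real.sqrt (ρ n) * ∑ k : Fin n, G n j k * ε k ω) ^ 2) μ :=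
      hX.indep_X_ε.comp (φ := fun x : ℕ → Fin p → ℝ => x i ⬝ᵥ x i)
        (ψ := fun e : ℕ → ℝ => (Real.sqrt (ρ n) * ∑ k : Fin n, G n j k * e k) ^ 2)
        (by unfold dotProduct; fun_prop) (by fun_prop)
    have hi1 := (hX.memLp_normSq i).integrable one_le_two
    have hi2 : Integrable (fun ω => (Real.sqrt (ρ n) * ∑ k : Fin n, G n j k * ε k ω) ^ 2) μ := by
      simp only [mul_pow]
      exact h2.1.integrable_sq.const_mul _
    have e : ∀ ω, (G n *ᵥ noiseAt ε (n, ω)) j = ∑ k : Fin n, G n j k * ε k ω := fun ω => rfl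
    simp only [e]
    refine ⟨hind.integrable_mul hi1 hi2, ?_⟩
    rw [hind.integral_fun_mul_eq_mul_integral hi1.aestronglyMeasurable hi2.aestronglyMeasurable,
      hX.integral_normSq]
    simp only [mul_pow, hsq]
    rw [integral_const_mul, h3]
    calc m * (ρ n * (σ ^ 2 * ∑ k, G n j k ^ 2)) = m * σ ^ 2 * (ρ n * ∑ k, G n j k ^ 2) := by ring
      _ ≤ m * σ ^ 2 * (CG ^ 2 / Real.sqrt (ρ n)) :=
          mul_le_mul_of_nonneg_left (hG.rho_sum_sq_le hρ n j) (by positivity)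
      _ = _ := by ring

lemma SampleCondition.integral_centred_sq_le (hX : SampleCondition μ X ε σ) (i : ℕ) :
    MemLp (fun ω => ε i ω ^ 2 - σ ^ 2) 2 μ ∧ ∫ ω, ε i ω ^ 2 - σ ^ 2 ∂μ = 0 ∧
      ∫ ω, (ε i ω ^ 2 - σ ^ 2) ^ 2 ∂μ ≤ ∫ ω, ε 0 ω ^ 4 ∂μ := by
  have h1 : MemLp (fun ω => ε i ω ^ 2 - σ ^ 2) 2 μ := (hX.memLp_eps_sq i).sub (memLp_const _)
  have h2 := (hX.memLp_eps i).integrable_sq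
  refine ⟨h1, ?_, ?_⟩
  · rw [integral_sub h2 (integrable_const _), hX.integral_eps_sq]
    simp
  · have e : ∀ ω, (ε i ω ^ 2 - σ ^ 2) ^ 2 = ε i ω ^ 4 - (2 * σ ^ 2 * ε i ω ^ 2 - σ ^ 4) :=
      fun ω => by ring
    simp only [e]
    have h3 : Integrable (fun ω => 2 * σ ^ 2 * ε i ω ^ 2 - σ ^ 4) μ :=
      (h2.const_mul _).sub (integrable_const _)
    rw [integral_sub (hX.integrable_eps_pow_four i) h3,
      integral_sub (h2.const_mul _) (integrable_const _), integral_const_mul, hX.integral_eps_sq,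
      hX.integral_eps_pow_four]
    simp only [integral_const, probReal_univ, one_smul]
    nlinarith [sq_nonneg (σ ^ 2)]

lemma SampleCondition.tendsto_weighted_sq (hX : SampleCondition μ X ε σ)
    {a : ∀ n : ℕ, Fin n → ℝ} {B : ℕ → ℝ} (ha : ∀ᶠ n in atTop, ∑ i, a n i ^ 2 ≤ B n)
    (hB : Tendsto B atTop (𝓝 0)) :
    Tendsto (fun q : ℕ × Ω => ∑ i, a q.1 i * (ε i q.2 ^ 2 - σ ^ 2)) (whp μ) (𝓝 0) := by
  refine tendsto_whp_sum (μ := μ) (ι := fun n => Fin n)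
    (η := fun n i ω => a n i * (ε i ω ^ 2 - σ ^ 2))
    (b := fun n => (∫ ω, ε 0 ω ^ 4 ∂μ) * B n)
    (fun n i => (hX.integral_centred_sq_le i).1.const_mul _)
    (fun n i => by rw [integral_const_mul, (hX.integral_centred_sq_le i).2.1, mul_zero])
    (fun n i j hij => (hX.indep_ε.indepFun fun h => hij (Fin.ext h)).comp
      (φ := fun t => a n i * (t ^ 2 - σ ^ 2)) (ψ := fun t => a n j * (t ^ 2 - σ ^ 2))
      (by fun_prop) (by fun_prop)) ?_ (by simpa using hB.const_mul (∫ ω, ε 0 ω ^ 4 ∂μ))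
  filter_upwards [ha] with n hn
  have h0 : 0 ≤ ∫ ω, ε 0 ω ^ 4 ∂μ := integral_nonneg fun ω => by positivity
  refine le_trans ?_ (mul_le_mul_of_nonneg_left hn h0)
  rw [Finset.mul_sum]
  refine Finset.sum_le_sum fun i _ => ?_
  simp only [mul_pow]
  rw [integral_const_mul, mul_comm]
  exact mul_le_mul_of_nonneg_right (hX.integral_centred_sq_le i).2.2 (sq_nonneg _)

lemma SampleCondition.tendsto_noise_sq (hX : SampleCondition μ X ε σ) :
    Tendsto (fun q : ℕ × Ω => (q.1 : ℝ)⁻¹ * (noiseAt ε q ⬝ᵥ noiseAt ε q)) (whp μ)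
      (𝓝 (σ ^ 2)) := by
  have h1 := hX.tendsto_weighted_sq (a := fun n _ => (n : ℝ)⁻¹) (B := fun n => (n : ℝ)⁻¹)
    ((eventually_gt_atTop 0).mono fun n hn => by
      have h0 : (0 : ℝ) < n := by exact_mod_cast hn
      rw [Finset.sum_const, Finset.card_univ, Fintype.card_fin, nsmul_eq_mul]
      exact le_of_eq (by field_simp)) tendsto_inv_atTop_nhds_zero_nat
  have h2 := h1.add_const (σ ^ 2)
  rw [zero_add] at h2
  refine h2.congr' ?_
  filter_upwards [tendsto_fst_whp.eventually (eventually_gt_atTop 0)] with q hq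
  have h0 : (0 : ℝ) < q.1 := by exact_mod_cast hq
  rw [← Finset.mul_sum, Finset.sum_sub_distrib, Finset.sum_const, Finset.card_univ,
    Fintype.card_fin, nsmul_eq_mul, dotProduct]
  simp only [noiseAt, ← sq]
  field_simp
  ring

omit [MeasurableSpace Ω] [IsProbabilityMeasure μ] in
lemma sum_range_square (F : ℕ → ℕ → ℝ) (n : ℕ) :
    ∑ i ∈ Finset.range n, ∑ j ∈ Finset.range n, F i j = ∑ i ∈ Finset.range n, F i i
      + (∑ i ∈ Finset.range n, ∑ j ∈ Finset.range i, F i j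
        + ∑ i ∈ Finset.range n, ∑ j ∈ Finset.range i, F j i) := by
  induction n with
  | zero => simp
  | succ n ih =>
    simp only [Finset.sum_range_succ, Finset.sum_add_distrib, ih]
    ring

/-- The form splits into its diagonal, centred at the trace, and two triangular parts. The
triangular parts have variance of order `(ρ/n)² ‖G‖² ≤ (ρ/n) C²/√ρ`, the diagonal one of order
`1/n`. -/
lemma SampleCondition.tendsto_quadratic (hX : SampleCondition μ X ε σ) (hρ : ∀ n, 0 < ρ n)
    (hρt : Tendsto ρ atTop atTop) (hG : SmallRows G ρ CG)
    (hρn : Tendsto (fun n : ℕ => ρ n / n) atTop (𝓝 0)) :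
    Tendsto (fun q : ℕ × Ω => ρ q.1 / q.1 * (noiseAt ε q ⬝ᵥ (G q.1 *ᵥ noiseAt ε q)
      - σ ^ 2 * (G q.1).trace)) (whp μ) (𝓝 0) := by
  -- Extension by zero to all pairs of natural numbers, as required by the induction on the size in
  -- `integral_sq_lower`.
  set g : ∀ n : ℕ, ℕ → ℕ → ℝ := fun n i j =>
    if hi : i < n then if hj : j < n then G n ⟨i, hi⟩ ⟨j, hj⟩ else 0 else 0 with hg
  have hgG : ∀ n (i j : Fin n), g n i j = G n i j := fun n i j => by simp [hg]
  have hlow : ∀ a : ∀ n : ℕ, ℕ → ℕ → ℝ,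
      (∀ n, ∑ i ∈ Finset.range n, ∑ j ∈ Finset.range i, a n i j ^ 2 ≤
        ∑ i, ∑ j, G n i j ^ 2) →
      Tendsto (fun q : ℕ × Ω => ρ q.1 / q.1 * ∑ i ∈ Finset.range q.1, ε i q.2 *
        ∑ j ∈ Finset.range i, a q.1 i j * ε j q.2) (whp μ) (𝓝 0) := by
    intro a ha
    refine tendsto_zero_of_sq ?_
    refine tendsto_whp_of_integral (μ := μ)
      (f := fun n ω => (ρ n / n * ∑ i ∈ Finset.range n, ε i ω *
        ∑ j ∈ Finset.range i, a n i j * ε j ω) ^ 2)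
      (G := fun n ω => (ρ n / n * ∑ i ∈ Finset.range n, ε i ω *
        ∑ j ∈ Finset.range i, a n i j * ε j ω) ^ 2)
      (b := fun n => (σ ^ 2) ^ 2 * (ρ n / n * (CG ^ 2 / Real.sqrt (ρ n))))
      (Eventually.of_forall fun q => (abs_of_nonneg (sq_nonneg _)).le)
      (fun n ω => sq_nonneg _) ?_ ?_
    · filter_upwards [eventually_gt_atTop 0] with n hn
      have h0 : (0 : ℝ) < n := by exact_mod_cast hn
      have h1 := integral_sq_lower hX.indep_ε hX.measurable_ε hX.memLp_eps hX.integral_eps hX.integral_eps_sq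
        (a n) n
      simp only [mul_pow]
      refine ⟨h1.1.integrable_sq.const_mul _, ?_⟩
      rw [integral_const_mul, h1.2]
      have h2 : ρ n * ∑ i, ∑ j, G n i j ^ 2 ≤ n * (CG ^ 2 / Real.sqrt (ρ n)) := by
        rw [Finset.mul_sum]
        refine (Finset.sum_le_sum fun i _ => hG.rho_sum_sq_le hρ n i).trans (le_of_eq ?_)
        rw [Finset.sum_const, Finset.card_univ, Fintype.card_fin, nsmul_eq_mul]
      have h3 := hρ n
      calc _ ≤ (ρ n / n) ^ 2 * ((σ ^ 2) ^ 2 * ∑ i, ∑ j, G n i j ^ 2) := by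
            gcongr; exact ha n
        _ = (σ ^ 2) ^ 2 * (ρ n / n ^ 2 * (ρ n * ∑ i, ∑ j, G n i j ^ 2)) := by
            field_simp
        _ ≤ (σ ^ 2) ^ 2 * (ρ n / n ^ 2 * (n * (CG ^ 2 / Real.sqrt (ρ n)))) := by gcongr
        _ = _ := by field_simp
    · have h1 : Tendsto (fun n : ℕ => CG ^ 2 / Real.sqrt (ρ n)) atTop (𝓝 0) := by
        simpa [div_eq_mul_inv] using (tendsto_inv_sqrt hρt).const_mul (CG ^ 2)
      simpa using (hρn.mul h1).const_mul ((σ ^ 2) ^ 2)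
  have hsum : ∀ n, ∑ i ∈ Finset.range n, ∑ j ∈ Finset.range n, g n i j ^ 2 =
      ∑ i, ∑ j, G n i j ^ 2 := by
    intro n
    rw [← Fin.sum_univ_eq_sum_range (fun i => ∑ j ∈ Finset.range n, g n i j ^ 2) n]
    refine Finset.sum_congr rfl fun i _ => ?_
    rw [← Fin.sum_univ_eq_sum_range (fun j => g n i j ^ 2) n]
    exact Finset.sum_congr rfl fun j _ => by rw [hgG]
  have hpos : ∀ (n : ℕ) (F : ℕ → ℕ → ℝ),
      0 ≤ ∑ i ∈ Finset.range n, ∑ j ∈ Finset.range i, F i j ^ 2 := fun n F =>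
    Finset.sum_nonneg fun i _ => Finset.sum_nonneg fun j _ => sq_nonneg _
  have hpos' : ∀ n : ℕ, 0 ≤ ∑ i ∈ Finset.range n, g n i i ^ 2 := fun n =>
    Finset.sum_nonneg fun i _ => sq_nonneg _
  have h1 := hlow g fun n => by
    rw [← hsum, sum_range_square (fun i j => g n i j ^ 2)]
    linarith [hpos' n, hpos n fun i j => g n j i]
  have h2 := hlow (fun n i j => g n j i) fun n => by
    rw [← hsum, sum_range_square (fun i j => g n i j ^ 2)]
    linarith [hpos' n, hpos n fun i j => g n i j]
  have h3 := hX.tendsto_weighted_sq (a := fun n i => ρ n / n * G n i i)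
    (B := fun n => CG ^ 2 * (n : ℝ)⁻¹) (by
      filter_upwards [eventually_gt_atTop 0] with n hn
      have h0 : (0 : ℝ) < n := by exact_mod_cast hn
      have h4 : ∀ i : Fin n, (ρ n / n * G n i i) ^ 2 ≤ (CG / n) ^ 2 := by
        intro i
        rw [← sq_abs, abs_mul, abs_of_pos (div_pos (hρ n) h0)]
        refine pow_le_pow_left₀ (mul_nonneg (div_pos (hρ n) h0).le (abs_nonneg _)) ?_ 2
        refine (mul_le_mul_of_nonneg_left (hG.1 n i i) (div_pos (hρ n) h0).le).trans
          (le_of_eq ?_)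
        have := hρ n
        field_simp
      refine (Finset.sum_le_sum fun i _ => h4 i).trans (le_of_eq ?_)
      rw [Finset.sum_const, Finset.card_univ, Fintype.card_fin, nsmul_eq_mul]
      field_simp) (by simpa using tendsto_inv_atTop_nhds_zero_nat.const_mul (CG ^ 2))
  have h4 := h3.add (h1.add h2)
  simp only [add_zero] at h4
  refine h4.congr fun q => ?_
  set n := q.1
  have e1 : noiseAt ε q ⬝ᵥ (G n *ᵥ noiseAt ε q) =
      ∑ i ∈ Finset.range n, ∑ j ∈ Finset.range n, ε i q.2 * (g n i j * ε j q.2) := by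
    rw [← Fin.sum_univ_eq_sum_range
      (fun i => ∑ j ∈ Finset.range n, ε i q.2 * (g n i j * ε j q.2)) n]
    simp only [dotProduct, Matrix.mulVec]
    refine Finset.sum_congr rfl fun i _ => ?_
    rw [← Fin.sum_univ_eq_sum_range (fun j => ε i q.2 * (g n i j * ε j q.2)) n, Finset.mul_sum]
    exact Finset.sum_congr rfl fun j _ => by rw [hgG]; rfl
  have e2 : ∑ i ∈ Finset.range n, ε i q.2 * (g n i i * ε i q.2) - σ ^ 2 * (G n).trace =
      ∑ i : Fin n, G n i i * (ε i q.2 ^ 2 - σ ^ 2) := by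
    rw [← Fin.sum_univ_eq_sum_range (fun i => ε i q.2 * (g n i i * ε i q.2)) n, Matrix.trace,
      Finset.mul_sum, ← Finset.sum_sub_distrib]
    refine Finset.sum_congr rfl fun i _ => ?_
    rw [hgG, Matrix.diag]; ring
  have e3 : ∑ i ∈ Finset.range n, ∑ j ∈ Finset.range i, ε j q.2 * (g n j i * ε i q.2) =
      ∑ i ∈ Finset.range n, ε i q.2 * ∑ j ∈ Finset.range i, g n j i * ε j q.2 := by
    refine Finset.sum_congr rfl fun i _ => ?_
    rw [Finset.mul_sum]
    exact Finset.sum_congr rfl fun j _ => by ring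
  rw [e1, sum_range_square, e3, add_sub_right_comm, e2]
  simp only [← Finset.mul_sum, mul_assoc]
  ring

end Noise

/-! ### Bias of the local linear fit -/

section Bias

variable {Ω : Type*} [MeasurableSpace Ω] {μ : Measure Ω} [IsProbabilityMeasure μ]
  {p : ℕ} {X : ℕ → Ω → Fin p → ℝ} {ε : ℕ → Ω → ℝ} {σ : ℝ}
  {s : ℕ → Plane} {h : ℕ → ℝ} {K : ℝ → ℝ} {E : ℕ → Set (ℕ → Fin p → ℝ)} {c c' C L : ℝ}
  {ρ : ℕ → ℝ} {β : Plane → Fin p → ℝ} {R : Set Plane}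

lemma dotProduct_sq_le {I : Type*} [Fintype I] (u v : I → ℝ) :
    (u ⬝ᵥ v) ^ 2 ≤ (u ⬝ᵥ u) * (v ⬝ᵥ v) := by
  have := Finset.sum_mul_sq_le_sq_mul_sq Finset.univ u v
  simpa only [dotProduct, ← sq] using this

/-- The Taylor polynomial of `β` at `s_i` is reproduced exactly, so only remainders of order `h²`
within the kernel window are smoothed; their squares times `ρ` are `O(ρ h⁴)`. -/
lemma LocalRegime.tendsto_bias (hR : LocalRegime μ X s h K E c c' C L)
    (hX : SampleCondition μ X ε σ) (hRc : IsCompact R) (hβ : SmoothCoefficients R β)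
    (hs : ∀ i, s i ∈ R) (hρ : ∀ n, 0 < ρ n)
    (hb : Tendsto (fun n : ℕ => ρ n * h n ^ 4) atTop (𝓝 0)) :
    Tendsto (fun q : ℕ × Ω => ρ q.1 / q.1 *
      ((meanVec q.1 β s (fun i => X i q.2)
        - smootherAt K h s X q *ᵥ meanVec q.1 β s fun i => X i q.2) ⬝ᵥ
      (meanVec q.1 β s (fun i => X i q.2)
        - smootherAt K h s X q *ᵥ meanVec q.1 β s fun i => X i q.2))) (whp μ) (𝓝 0) := by
  obtain ⟨CT, η, D, hCT, hη, hT⟩ := hβ.exists_taylor hRc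
  -- The slopes carry a factor `h` because the rescaled design divides the offsets by `h`.
  set u : ℕ → ℕ → Fin p ⊕ Fin p × Fin 2 → ℝ := fun n i =>
    Sum.elim (β (s i)) (fun ab => h n * D (s i) ab.1 ab.2) with hu
  set m4 := ∫ ω, (X 0 ω ⬝ᵥ X 0 ω) ^ 2 ∂μ with hm4
  have hm40 : 0 ≤ m4 := integral_nonneg fun ω => sq_nonneg _
  set r : ℕ → ℕ → ℕ → Fin p → ℝ := fun n i j => β (s j) - localCoef (h n) (s j - s i) (u n i)
    with hr
  have hsq : ∀ n : ℕ, Real.sqrt (ρ n) ^ 2 = ρ n := fun n => Real.sq_sqrt (hρ n).le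
  have hrle : ∀ᶠ n : ℕ in atTop, ∀ i j, rowWeight K (h n) s i j ≠ 0 →
      r n i j ⬝ᵥ r n i j ≤ p * CT ^ 2 * L ^ 4 * h n ^ 4 := by
    have h1 : ∀ᶠ n in atTop, L * h n ≤ η := by
      have := hR.h_tendsto.const_mul L
      rw [mul_zero] at this
      exact this.eventually (ge_mem_nhds hη)
    filter_upwards [h1] with n hn i j hw
    have h2 := hR.norm_le hw
    have h3 := hT (s i) (hs i) (s j) (h2.trans hn)
    have hhn := hR.h_pos n
    have h4 : ∀ a, r n i j a ^ 2 ≤ (CT * (L * h n) ^ 2) ^ 2 := by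
      intro a
      rw [← sq_abs]
      refine pow_le_pow_left₀ (abs_nonneg _) ?_ 2
      have h5 : r n i j a = β (s j) a - β (s i) a - ∑ b, D (s i) a b * (s j - s i) b := by
        simp only [hr, hu, Pi.sub_apply, localCoef, Sum.elim_inl, Sum.elim_inr, Fin.sum_univ_two]
        field_simp
        ring
      rw [h5]
      refine (h3 a).trans ?_
      gcongr
    rw [dotProduct]
    simp only [← sq]
    refine (Finset.sum_le_sum fun a _ => h4 a).trans (le_of_eq ?_)
    rw [Finset.sum_const, Finset.card_univ, Fintype.card_fin, nsmul_eq_mul]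
    ring
  have hlim : Tendsto (fun n : ℕ => m4 * (p * CT ^ 2 * L ^ 4) * (ρ n * h n ^ 4)) atTop (𝓝 0) := by
    simpa using hb.const_mul (m4 * (p * CT ^ 2 * L ^ 4))
  have h1 := hR.tendsto_smooth
    (z := fun n ω i j => Real.sqrt (ρ n) * (X j ω ⬝ᵥ r n i j)) hlim
    (fun n => by have := hρ n; have := hR.h_pos n; have := hR.one_le_L; positivity) ?_
  · refine h1.congr' ?_
    filter_upwards [hR.whp_mem, tendsto_fst_whp.eventually hR.gram,
      tendsto_fst_whp.eventually (eventually_gt_atTop 0)] with q hq hgram hq0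
    have h0 : (0 : ℝ) < q.1 := by exact_mod_cast hq0
    rw [dotProduct, div_eq_inv_mul, mul_assoc, Finset.mul_sum _ _ (ρ q.1)]
    congr 1
    refine Finset.sum_congr rfl fun i _ => ?_
    have h2 := smoother_sub_fit (hR.h_pos q.1).ne' (mul_pos hR.c_pos h0) (hgram _ hq i)
      (meanVec q.1 β s fun i => X i q.2) (u q.1 i)
    have h3 : ∑ a, X i q.2 a * u q.1 i (Sum.inl a) = meanVec q.1 β s (fun i => X i q.2) i := rfl
    have h4 : meanVec q.1 β s (fun i => X i q.2) - scaledDesign q.1 (h q.1) (fun i => X i q.2) s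
        (s i) *ᵥ u q.1 i = fun j : Fin q.1 => X j q.2 ⬝ᵥ r q.1 i j := by
      ext j
      rw [Pi.sub_apply, scaledDesign_mulVec, meanVec, hr, dotProduct_sub]
    rw [h3, h4] at h2
    have h5 : (fun j : Fin q.1 => Real.sqrt (ρ q.1) * (X j q.2 ⬝ᵥ r q.1 i j)) =
        Real.sqrt (ρ q.1) • fun j : Fin q.1 => X j q.2 ⬝ᵥ r q.1 i j := by ext j; simp
    rw [h5, Matrix.mulVec_smul, Pi.smul_apply, smul_eq_mul, mul_pow, hsq, ← h2, Pi.sub_apply,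
      smootherAt]
    ring
  · filter_upwards [hrle] with n hn i j hw
    have hXr : ∀ ω, (X i ω ⬝ᵥ X i ω) * (Real.sqrt (ρ n) * (X j ω ⬝ᵥ r n i j)) ^ 2 ≤
        (p * CT ^ 2 * L ^ 4) * (ρ n * h n ^ 4) * ((X i ω ⬝ᵥ X i ω) * (X j ω ⬝ᵥ X j ω)) := by
      intro ω
      have h3 := dotProduct_sq_le (X j ω) (r n i j)
      have h4 := mul_le_mul_of_nonneg_left (hn i j hw) (dot_self_nonneg (X j ω))
      rw [mul_pow, hsq]
      calc _ ≤ (X i ω ⬝ᵥ X i ω) * (ρ n * ((X j ω ⬝ᵥ X j ω) * (p * CT ^ 2 * L ^ 4 * h n ^ 4))) := by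
            refine mul_le_mul_of_nonneg_left ?_ (dot_self_nonneg _)
            exact mul_le_mul_of_nonneg_left (h3.trans h4) (hρ n).le
        _ = _ := by ring
    have hij := hX.integral_normSq_mul_le i j
    have hdom : Integrable (fun ω => (p * CT ^ 2 * L ^ 4) * (ρ n * h n ^ 4) *
      ((X i ω ⬝ᵥ X i ω) * (X j ω ⬝ᵥ X j ω))) μ := hij.1.const_mul _
    have hint : Integrable
        (fun ω => (X i ω ⬝ᵥ X i ω) * (Real.sqrt (ρ n) * (X j ω ⬝ᵥ r n i j)) ^ 2) μ := by
      refine hdom.mono' ?_ (Eventually.of_forall fun ω => ?_)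
      · have h5 := hX.measurable_X j
        refine ((hX.measurable_normSq i).mul ?_).aestronglyMeasurable
        unfold dotProduct
        fun_prop
      · rw [Real.norm_eq_abs, abs_of_nonneg (mul_nonneg (dot_self_nonneg _) (sq_nonneg _))]
        exact hXr ω
    refine ⟨hint, (integral_mono hint hdom hXr).trans ?_⟩
    rw [integral_const_mul]
    have := hρ n
    calc _ ≤ (p * CT ^ 2 * L ^ 4) * (ρ n * h n ^ 4) * m4 :=
          mul_le_mul_of_nonneg_left hij.2 (by have := hR.one_le_L; positivity)
      _ = _ := by ring

end Bias

/-! ### Moments of the signal -/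

section Population

variable {Ω : Type*} [MeasurableSpace Ω] {μ : Measure Ω} [IsProbabilityMeasure μ]
  {p : ℕ} {X : ℕ → Ω → Fin p → ℝ} {ε : ℕ → Ω → ℝ} {σ : ℝ}
  {s : ℕ → Plane} {h : ℕ → ℝ} {K : ℝ → ℝ} {E : ℕ → Set (ℕ → Fin p → ℝ)} {c c' C L : ℝ}
  {ρ : ℕ → ℝ} {G : ∀ n : ℕ, Matrix (Fin n) (Fin n) ℝ} {CG : ℝ}

lemma integral_sub_mean_sq_le {f : Ω → ℝ} (hf : MemLp f 2 μ) :
    ∫ ω, (f ω - ∫ ω, f ω ∂μ) ^ 2 ∂μ ≤ ∫ ω, f ω ^ 2 ∂μ := by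
  rw [← variance_eq_integral hf.aemeasurable]
  exact variance_le_expectation_sq hf.aestronglyMeasurable

lemma SampleCondition.integral_sq_sum_le (hX : SampleCondition μ X ε σ) {n : ℕ}
    {φ : Fin n → (Fin p → ℝ) → ℝ} (hφ : ∀ j, Measurable (φ j)) {T : Finset (Fin n)}
    (hL : ∀ j ∈ T, MemLp (fun ω => φ j (X j ω)) 2 μ) :
    MemLp (fun ω => ∑ j ∈ T, φ j (X j ω)) 2 μ ∧
    ∫ ω, (∑ j ∈ T, φ j (X j ω)) ^ 2 ∂μ ≤
      2 * ∑ j ∈ T, ∫ ω, φ j (X j ω) ^ 2 ∂μ + 2 * (∑ j ∈ T, ∫ ω, φ j (X j ω) ∂μ) ^ 2 := by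
  have h1 : MemLp (fun ω => ∑ j ∈ T, φ j (X j ω)) 2 μ := memLp_finsetSum T hL
  refine ⟨h1, ?_⟩
  have h2 := integral_sq_sum (μ := μ) (η := fun (j : Fin n) ω =>
      φ j (X j ω) - ∫ ω, φ j (X j ω) ∂μ) T
    (fun j hj => (hL j hj).sub (memLp_const _))
    (fun j hj => by
      rw [integral_sub ((hL j hj).integrable one_le_two) (integrable_const _)]; simp)
    (fun j _ k _ hjk => (hX.indep_X.indepFun fun h => hjk (Fin.ext h)).comp
      ((hφ j).sub_const _) ((hφ k).sub_const _))
  have h3 : ∀ ω, (∑ j ∈ T, φ j (X j ω)) ^ 2 ≤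
      2 * (∑ j ∈ T, (φ j (X j ω) - ∫ ω, φ j (X j ω) ∂μ)) ^ 2
        + 2 * (∑ j ∈ T, ∫ ω, φ j (X j ω) ∂μ) ^ 2 := by
    intro ω
    rw [Finset.sum_sub_distrib]
    nlinarith [sq_nonneg (∑ j ∈ T, φ j (X j ω) - 2 * ∑ j ∈ T, ∫ ω, φ j (X j ω) ∂μ)]
  refine (integral_mono h1.integrable_sq
    ((h2.1.integrable_sq.const_mul 2).add (integrable_const _)) h3).trans ?_
  rw [integral_add' (h2.1.integrable_sq.const_mul 2) (integrable_const _), integral_const_mul, h2.2]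
  simp only [integral_const, probReal_univ, one_smul]
  refine add_le_add (mul_le_mul_of_nonneg_left (Finset.sum_le_sum fun j hj => ?_) two_pos.le) le_rfl
  exact integral_sub_mean_sq_le (hL j hj)

/-- Leaving `i` out of the sum makes it independent of `X i`, so the expectation factorizes and no
moments beyond the fourth are needed. -/
lemma SampleCondition.integral_normSq_mul_sq_sum_le (hX : SampleCondition μ X ε σ) {n : ℕ}
    {φ : Fin n → (Fin p → ℝ) → ℝ} (hφ : ∀ j, Measurable (φ j)) {T : Finset (Fin n)}
    (hL : ∀ j ∈ T, MemLp (fun ω => φ j (X j ω)) 2 μ) {i : Fin n} (hi : i ∉ T) :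
    Integrable (fun ω => (X i ω ⬝ᵥ X i ω) * (∑ j ∈ T, φ j (X j ω)) ^ 2) μ ∧
    ∫ ω, (X i ω ⬝ᵥ X i ω) * (∑ j ∈ T, φ j (X j ω)) ^ 2 ∂μ ≤ (∫ ω, X 0 ω ⬝ᵥ X 0 ω ∂μ) *
      (2 * ∑ j ∈ T, ∫ ω, φ j (X j ω) ^ 2 ∂μ + 2 * (∑ j ∈ T, ∫ ω, φ j (X j ω) ∂μ) ^ 2) := by
  obtain ⟨h1, h2⟩ := hX.integral_sq_sum_le hφ hL
  have h3 := indepFun_of_notMem hX.indep_X hX.measurable_X (T := T.map Fin.valEmbedding)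
    (i := (i : ℕ)) (by simpa [Fin.val_inj] using hi)
    (F := fun x : ℕ → Fin p → ℝ => (∑ j ∈ T, φ j (x j)) ^ 2)
    ((Finset.measurable_fun_sum _ fun j _ =>
      (hφ j).comp (measurable_pi_apply (X := fun _ : ℕ => Fin p → ℝ) (j : ℕ))).pow_const 2)
    (fun e e' hee => by
      refine congrArg (· ^ 2) (Finset.sum_congr rfl fun j hj => ?_)
      rw [hee j (Finset.mem_map.mpr ⟨j, hj, rfl⟩)])
  have hind : IndepFun (fun ω => X i ω ⬝ᵥ X i ω) (fun ω => (∑ j ∈ T, φ j (X j ω)) ^ 2) μ :=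
    (h3.comp (φ := id) (ψ := fun x : Fin p → ℝ => x ⬝ᵥ x) measurable_id
      (by unfold dotProduct; fun_prop)).symm
  have hi1 := (hX.memLp_normSq i).integrable one_le_two
  refine ⟨hind.integrable_mul hi1 h1.integrable_sq, ?_⟩
  rw [hind.integral_fun_mul_eq_mul_integral hi1.aestronglyMeasurable
    h1.integrable_sq.aestronglyMeasurable, hX.integral_normSq]
  exact mul_le_mul_of_nonneg_left h2 (integral_nonneg fun ω => dot_self_nonneg _)

omit [IsProbabilityMeasure μ] in
/-- A dominated nonnegative function. -/
lemma integral_le_of_le {f g : Ω → ℝ} (hf : Measurable f) (h0 : ∀ ω, 0 ≤ f ω)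
    (hfg : ∀ ω, f ω ≤ g ω) (hg : Integrable g μ) :
    Integrable f μ ∧ ∫ ω, f ω ∂μ ≤ ∫ ω, g ω ∂μ := by
  have h1 : Integrable f μ := hg.mono' hf.aestronglyMeasurable (Eventually.of_forall fun ω => by
    rw [Real.norm_eq_abs, abs_of_nonneg (h0 ω)]; exact hfg ω)
  exact ⟨h1, integral_mono h1 hg hfg⟩

section Signal

variable {β : Plane → Fin p → ℝ} {B : ℝ}

/-- The scaled signal `√ρ G m` as a function of the covariates. -/
def signal (G : ∀ n : ℕ, Matrix (Fin n) (Fin n) ℝ) (ρ : ℕ → ℝ) (β : Plane → Fin p → ℝ)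
    (s : ℕ → Plane) (n : ℕ) (x : ℕ → Fin p → ℝ) : Fin n → ℝ :=
  Real.sqrt (ρ n) • (G n *ᵥ meanVec n β s x)

lemma signal_apply (n : ℕ) (x : ℕ → Fin p → ℝ) (j : Fin n) :
    signal G ρ β s n x j = ∑ k : Fin n, Real.sqrt (ρ n) * G n j k * (x k ⬝ᵥ β (s k)) := by
  simp only [signal, Pi.smul_apply, smul_eq_mul, Matrix.mulVec, dotProduct, meanVec,
    Finset.mul_sum, mul_assoc]

/-- Row sums of order `1/√ρ` exactly offset the scaling by `√ρ`: the mean of the signal is bounded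
but need not vanish. It is the deterministic part to which the population fit is made. -/
lemma signal_const_sq_le (hρ : ∀ n, 0 < ρ n) (hG : SmallRows G ρ CG)
    (hB : ∀ i, β (s i) ⬝ᵥ β (s i) ≤ B) (Γ : Fin p → ℝ) (n : ℕ) (j : Fin n) :
    |signal G ρ β s n (fun _ => Γ) j| ≤ CG * Real.sqrt ((Γ ⬝ᵥ Γ) * B) := by
  rw [signal_apply]
  have h1 : ∀ k : Fin n, |Γ ⬝ᵥ β (s k)| ≤ Real.sqrt ((Γ ⬝ᵥ Γ) * B) := fun k => by
    refine Real.abs_le_sqrt ((dotProduct_sq_le _ _).trans ?_)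
    exact mul_le_mul_of_nonneg_left (hB k) (dot_self_nonneg _)
  have h2 := Real.sqrt_pos.mpr (hρ n)
  calc _ ≤ ∑ k, Real.sqrt (ρ n) * |G n j k| * Real.sqrt ((Γ ⬝ᵥ Γ) * B) := by
        refine (Finset.abs_sum_le_sum_abs _ _).trans (Finset.sum_le_sum fun k _ => ?_)
        rw [abs_mul, abs_mul, abs_of_pos h2]
        exact mul_le_mul_of_nonneg_left (h1 k) (by positivity)
    _ = Real.sqrt (ρ n) * (∑ k, |G n j k|) * Real.sqrt ((Γ ⬝ᵥ Γ) * B) := by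
        rw [← Finset.sum_mul, Finset.mul_sum]
    _ ≤ Real.sqrt (ρ n) * (CG / Real.sqrt (ρ n)) * Real.sqrt ((Γ ⬝ᵥ Γ) * B) := by
        gcongr; exact hG.2 n j
    _ = _ := by field_simp

/-- Deviation of the signal from its mean. -/
lemma SampleCondition.integral_signal_sub_le (hX : SampleCondition μ X ε σ) (hρ : ∀ n, 0 < ρ n)
    (hG : SmallRows G ρ CG) (hB : ∀ i, β (s i) ⬝ᵥ β (s i) ≤ B) :
    ∃ A : ℝ, 0 ≤ A ∧ ∀ (n : ℕ) (i j : Fin n),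
      (Integrable (fun ω => (signal G ρ β s n (fun k => X k ω) j
        - signal G ρ β s n (fun _ => firstMoment μ (X 0)) j) ^ 2) μ ∧
      ∫ ω, (signal G ρ β s n (fun k => X k ω) j
        - signal G ρ β s n (fun _ => firstMoment μ (X 0)) j) ^ 2 ∂μ ≤ A / Real.sqrt (ρ n)) ∧
      (Integrable (fun ω => (X i ω ⬝ᵥ X i ω) * (signal G ρ β s n (fun k => X k ω) j
        - signal G ρ β s n (fun _ => firstMoment μ (X 0)) j) ^ 2) μ ∧
      ∫ ω, (X i ω ⬝ᵥ X i ω) * (signal G ρ β s n (fun k => X k ω) j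
        - signal G ρ β s n (fun _ => firstMoment μ (X 0)) j) ^ 2 ∂μ ≤ A / Real.sqrt (ρ n)) := by
  set Γ := firstMoment μ (X 0) with hΓ
  set m2 := ∫ ω, X 0 ω ⬝ᵥ X 0 ω ∂μ with hm2
  set m4 := ∫ ω, (X 0 ω ⬝ᵥ X 0 ω) ^ 2 ∂μ with hm4
  have hm20 : 0 ≤ m2 := integral_nonneg fun ω => dot_self_nonneg _
  have hm40 : 0 ≤ m4 := integral_nonneg fun ω => sq_nonneg _
  have hB0 : 0 ≤ B := (dot_self_nonneg _).trans (hB 0)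
  have hΓ0 := dot_self_nonneg Γ
  set B' := 2 * B * (1 + Γ ⬝ᵥ Γ) with hB'
  have hB'0 : 0 ≤ B' := by positivity
  set A := CG ^ 2 * (2 * B' * (m2 + 1) + (2 * (B' * (m4 + m2))
    + 2 * (m2 * (2 * (B' * (m2 + 1)))))) with hA
  refine ⟨A, by positivity, fun n i j => ?_⟩
  set φ : Fin n → (Fin p → ℝ) → ℝ := fun k x =>
    Real.sqrt (ρ n) * G n j k * (x ⬝ᵥ β (s k) - Γ ⬝ᵥ β (s k)) with hφ
  have hφm : ∀ k, Measurable (φ k) := fun k => by simp only [hφ, dotProduct]; fun_prop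
  have hdiff : ∀ ω, signal G ρ β s n (fun k => X k ω) j - signal G ρ β s n (fun _ => Γ) j =
      ∑ k, φ k (X k ω) := by
    intro ω
    rw [signal_apply, signal_apply, ← Finset.sum_sub_distrib]
    exact Finset.sum_congr rfl fun k _ => by simp only [hφ]; ring
  have hφsq : ∀ k x, φ k x ^ 2 ≤ ρ n * G n j k ^ 2 * B' * (x ⬝ᵥ x + 1) := by
    intro k x
    have h1 := (dotProduct_sq_le x (β (s k))).trans
      (mul_le_mul_of_nonneg_left (hB k) (dot_self_nonneg _))
    have h2 := (dotProduct_sq_le Γ (β (s k))).trans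
      (mul_le_mul_of_nonneg_left (hB k) (dot_self_nonneg _))
    have h3 : (x ⬝ᵥ β (s k) - Γ ⬝ᵥ β (s k)) ^ 2 ≤ B' * (x ⬝ᵥ x + 1) := by
      have h4 := mul_nonneg (mul_nonneg hB0 hΓ0) (dot_self_nonneg x)
      have h5 : B' * (x ⬝ᵥ x + 1) = 2 * (x ⬝ᵥ x * B) + 2 * (Γ ⬝ᵥ Γ * B)
          + 2 * (B * (Γ ⬝ᵥ Γ) * (x ⬝ᵥ x)) + 2 * B := by rw [hB']; ring
      rw [h5]
      nlinarith [sq_nonneg (x ⬝ᵥ β (s k) + Γ ⬝ᵥ β (s k))]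
    simp only [hφ]
    rw [mul_pow, mul_pow, Real.sq_sqrt (hρ n).le, mul_assoc (ρ n * G n j k ^ 2)]
    exact mul_le_mul_of_nonneg_left h3 (mul_nonneg (hρ n).le (sq_nonneg _))
  have hN1 : ∀ k : ℕ, Integrable (fun ω => X k ω ⬝ᵥ X k ω) μ := fun k =>
    (hX.memLp_normSq k).integrable one_le_two
  have hcomp : ∀ k : Fin n, Measurable fun ω => φ k (X k ω) := fun k =>
    (hφm k).comp (hX.measurable_X k)
  have hint : ∀ k : Fin n, Integrable (fun ω => φ k (X k ω) ^ 2) μ ∧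
      ∫ ω, φ k (X k ω) ^ 2 ∂μ ≤ ρ n * G n j k ^ 2 * (B' * (m2 + 1)) := by
    intro k
    have h1 := integral_le_of_le (μ := μ) ((hcomp k).pow_const 2) (fun ω => sq_nonneg _)
      (fun ω => hφsq k (X k ω)) (((hN1 k).add (integrable_const _)).const_mul _)
    refine ⟨h1.1, h1.2.trans (le_of_eq ?_)⟩
    rw [integral_const_mul, integral_add (hN1 k) (integrable_const _), hX.integral_normSq]
    simp only [integral_const, probReal_univ, one_smul]
    ring
  have hL : ∀ k : Fin n, MemLp (fun ω => φ k (X k ω)) 2 μ := fun k =>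
    (memLp_two_iff_integrable_sq (hcomp k).aestronglyMeasurable).mpr (hint k).1
  have hmean : ∀ k : Fin n, ∫ ω, φ k (X k ω) ∂μ = 0 := by
    intro k
    have h1 : ∀ a, Integrable (fun ω => X k ω a * β (s k) a) μ := fun a =>
      ((hX.memLp_apply k a).integrable one_le_two).mul_const _
    simp only [hφ, dotProduct]
    rw [integral_const_mul, integral_sub (integrable_finsetSum _ fun a _ => h1 a)
      (integrable_const _), integral_finsetSum _ fun a _ => h1 a]
    simp only [integral_mul_const, hX.integral_apply, integral_const, probReal_univ, one_smul]
    simp [hΓ]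
  have hrow := hG.rho_sum_sq_le hρ n j
  have hsumle : ∀ T : Finset (Fin n), ∑ k ∈ T, ∫ ω, φ k (X k ω) ^ 2 ∂μ ≤
      CG ^ 2 / Real.sqrt (ρ n) * (B' * (m2 + 1)) := by
    intro T
    calc _ ≤ ∑ k, ∫ ω, φ k (X k ω) ^ 2 ∂μ :=
          Finset.sum_le_univ_sum_of_nonneg fun k => integral_nonneg fun ω => sq_nonneg _
      _ ≤ ∑ k, ρ n * G n j k ^ 2 * (B' * (m2 + 1)) := Finset.sum_le_sum fun k _ => (hint k).2
      _ = (ρ n * ∑ k, G n j k ^ 2) * (B' * (m2 + 1)) := by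
          rw [← Finset.sum_mul, Finset.mul_sum]
      _ ≤ _ := mul_le_mul_of_nonneg_right hrow (by positivity)
  simp only [hdiff]
  constructor
  · have h1 := hX.integral_sq_sum_le hφm (T := Finset.univ) fun k _ => hL k
    refine ⟨h1.1.integrable_sq, h1.2.trans ?_⟩
    simp only [hmean, Finset.sum_const_zero]
    calc _ ≤ 2 * (CG ^ 2 / Real.sqrt (ρ n) * (B' * (m2 + 1))) + 2 * 0 ^ 2 := by
          gcongr; exact hsumle _
      _ = CG ^ 2 * (2 * B' * (m2 + 1)) / Real.sqrt (ρ n) := by ring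
      _ ≤ _ := by
          refine div_le_div_of_nonneg_right ?_ (Real.sqrt_nonneg _)
          rw [hA]
          refine mul_le_mul_of_nonneg_left (le_add_of_nonneg_right (by positivity)) (sq_nonneg _)
  -- The sum without the index `i` is independent of `X i`; the single summand `i` is bounded
  -- separately by fourth moments.
  · have h1 := hX.integral_normSq_mul_sq_sum_le hφm (T := Finset.univ.erase i)
      (fun k _ => hL k) (Finset.notMem_erase i _)
    have hi4 : Integrable (fun ω => ρ n * G n j i ^ 2 * B' *
        ((X i ω ⬝ᵥ X i ω) ^ 2 + X i ω ⬝ᵥ X i ω)) μ :=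
      ((hX.memLp_normSq i).integrable_sq.add (hN1 i)).const_mul _
    have h2 := integral_le_of_le (μ := μ)
      (f := fun ω => (X i ω ⬝ᵥ X i ω) * φ i (X i ω) ^ 2)
      ((hX.measurable_normSq i).mul ((hcomp i).pow_const 2))
      (fun ω => mul_nonneg (dot_self_nonneg _) (sq_nonneg _))
      (fun ω => (mul_le_mul_of_nonneg_left (hφsq i (X i ω)) (dot_self_nonneg (X i ω))).trans
        (le_of_eq (by ring))) hi4
    have h3 := integral_le_of_le (μ := μ)
      (f := fun ω => (X i ω ⬝ᵥ X i ω) * (∑ k, φ k (X k ω)) ^ 2)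
      ((hX.measurable_normSq i).mul
        ((Finset.measurable_fun_sum _ fun k _ => hcomp k).pow_const 2))
      (fun ω => mul_nonneg (dot_self_nonneg _) (sq_nonneg _))
      (fun ω => (by
        rw [← Finset.add_sum_erase _ _ (Finset.mem_univ i)]
        nlinarith [mul_nonneg (dot_self_nonneg (X i ω)) (sq_nonneg (φ i (X i ω)
          - ∑ k ∈ Finset.univ.erase i, φ k (X k ω)))] :
        (X i ω ⬝ᵥ X i ω) * (∑ k, φ k (X k ω)) ^ 2 ≤
          2 * ((X i ω ⬝ᵥ X i ω) * φ i (X i ω) ^ 2)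
          + 2 * ((X i ω ⬝ᵥ X i ω) * (∑ k ∈ Finset.univ.erase i, φ k (X k ω)) ^ 2)))
      ((h2.1.const_mul 2).add (h1.1.const_mul 2))
    refine ⟨h3.1, h3.2.trans ?_⟩
    rw [integral_add (h2.1.const_mul 2) (h1.1.const_mul 2), integral_const_mul,
      integral_const_mul]
    have h4 : ∫ ω, (X i ω ⬝ᵥ X i ω) * φ i (X i ω) ^ 2 ∂μ ≤
        CG ^ 2 / Real.sqrt (ρ n) * (B' * (m4 + m2)) := by
      refine h2.2.trans ?_
      rw [integral_const_mul, integral_add (hX.memLp_normSq i).integrable_sq (hN1 i),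
        hX.integral_normSq_sq, hX.integral_normSq, mul_assoc]
      refine mul_le_mul_of_nonneg_right (le_trans ?_ hrow) (by positivity)
      exact mul_le_mul_of_nonneg_left (Finset.single_le_sum
        (f := fun k => G n j k ^ 2) (fun k _ => sq_nonneg _) (Finset.mem_univ i)) (hρ n).le
    have h5 := h1.2
    simp only [hmean, Finset.sum_const_zero] at h5
    have h6 : m2 * (2 * ∑ k ∈ Finset.univ.erase i, ∫ ω, φ k (X k ω) ^ 2 ∂μ + 2 * 0 ^ 2) ≤
        m2 * (2 * (CG ^ 2 / Real.sqrt (ρ n) * (B' * (m2 + 1))) + 2 * 0 ^ 2) := by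
      gcongr; exact hsumle _
    calc _ ≤ 2 * (CG ^ 2 / Real.sqrt (ρ n) * (B' * (m4 + m2)))
          + 2 * (m2 * (2 * (CG ^ 2 / Real.sqrt (ρ n) * (B' * (m2 + 1))) + 2 * 0 ^ 2)) := by
          linarith [h5.trans h6]
      _ = CG ^ 2 * (2 * (B' * (m4 + m2)) + 2 * (m2 * (2 * (B' * (m2 + 1)))))
          / Real.sqrt (ρ n) := by ring
      _ ≤ _ := by
          refine div_le_div_of_nonneg_right ?_ (Real.sqrt_nonneg _)
          rw [hA]
          refine mul_le_mul_of_nonneg_left (le_add_of_nonneg_left (by positivity)) (sq_nonneg _)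

set_option maxHeartbeats 800000 in
/-- The mean square of the signal has bounded second moments. -/
lemma SampleCondition.integral_signal_meanSq_le (hX : SampleCondition μ X ε σ)
    (hρ : ∀ n, 0 < ρ n) (hG : SmallRows G ρ CG) (hB : ∀ i, β (s i) ⬝ᵥ β (s i) ≤ B) :
    ∃ A : ℝ, ∀ n : ℕ, 0 < n →
      Integrable (fun ω => ((n : ℝ)⁻¹ * ∑ j, signal G ρ β s n (fun k => X k ω) j ^ 2) ^ 2) μ ∧
      ∫ ω, ((n : ℝ)⁻¹ * ∑ j, signal G ρ β s n (fun k => X k ω) j ^ 2) ^ 2 ∂μ ≤ A := by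
  have hB0 : 0 ≤ B := (dot_self_nonneg _).trans (hB 0)
  -- Cauchy–Schwarz with weights `|a k|`. The scaled rows have total weight at most `CG`, so fourth
  -- powers of the signal are bounded by weighted averages of `‖x_k‖⁴`.
  have hCS : ∀ {n : ℕ} (a y : Fin n → ℝ), (∑ k, a k * y k) ^ 2 ≤
      (∑ k, |a k|) * ∑ k, |a k| * y k ^ 2 := by
    intro n a y
    refine Finset.sum_sq_le_sum_mul_sum_of_sq_le_mul _ (fun k _ => abs_nonneg _)
      (fun k _ => mul_nonneg (abs_nonneg _) (sq_nonneg _)) fun k _ => le_of_eq ?_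
    rw [mul_pow, ← sq_abs (a k)]; ring
  set m4 := ∫ ω, (X 0 ω ⬝ᵥ X 0 ω) ^ 2 ∂μ with hm4
  have hm40 : 0 ≤ m4 := integral_nonneg fun ω => sq_nonneg _
  refine ⟨CG * B * (CG * B * (CG * (CG * m4))), fun n hn => ?_⟩
  have h0 : (0 : ℝ) < n := by exact_mod_cast hn
  have hCG : 0 ≤ CG := by
    have := (abs_nonneg _).trans (hG.1 n ⟨0, hn⟩ ⟨0, hn⟩)
    by_contra hlt
    exact absurd this (not_le.mpr (div_neg_of_neg_of_pos (not_le.mp hlt) (hρ n)))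
  have hr := Real.sqrt_pos.mpr (hρ n)
  have hrow : ∀ j, ∑ k, |Real.sqrt (ρ n) * G n j k| ≤ CG := by
    intro j
    simp only [abs_mul, abs_of_pos hr]
    rw [← Finset.mul_sum]
    calc _ ≤ Real.sqrt (ρ n) * (CG / Real.sqrt (ρ n)) := mul_le_mul_of_nonneg_left (hG.2 n j) hr.le
      _ = _ := by field_simp
  have hpt : ∀ (x : ℕ → Fin p → ℝ) (j : Fin n), signal G ρ β s n x j ^ 4 ≤
      CG * B * (CG * B * (CG * ∑ k : Fin n, |Real.sqrt (ρ n) * G n j k| * (x k ⬝ᵥ x k) ^ 2)) := by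
    intro x j
    have h1 : signal G ρ β s n x j ^ 2 ≤
        CG * (B * ∑ k : Fin n, |Real.sqrt (ρ n) * G n j k| * (x k ⬝ᵥ x k)) := by
      rw [signal_apply]
      refine (hCS _ _).trans ?_
      refine mul_le_mul (hrow j) ?_ (Finset.sum_nonneg fun k _ =>
        mul_nonneg (abs_nonneg _) (sq_nonneg _)) hCG
      rw [Finset.mul_sum]
      refine Finset.sum_le_sum fun k _ => ?_
      have h2 := (dotProduct_sq_le (x k) (β (s k))).trans
        (mul_le_mul_of_nonneg_left (hB k) (dot_self_nonneg _))
      calc _ ≤ |Real.sqrt (ρ n) * G n j k| * (x k ⬝ᵥ x k * B) :=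
            mul_le_mul_of_nonneg_left h2 (abs_nonneg _)
        _ = _ := by ring
    have h3 : (∑ k : Fin n, |Real.sqrt (ρ n) * G n j k| * (x k ⬝ᵥ x k)) ^ 2 ≤
        CG * ∑ k : Fin n, |Real.sqrt (ρ n) * G n j k| * (x k ⬝ᵥ x k) ^ 2 := by
      have := hCS (fun k => |Real.sqrt (ρ n) * G n j k|) (fun k : Fin n => x k ⬝ᵥ x k)
      simp only [abs_abs] at this
      exact this.trans (mul_le_mul_of_nonneg_right (hrow j) (Finset.sum_nonneg fun k _ =>
        mul_nonneg (abs_nonneg _) (sq_nonneg _)))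
    calc _ = (signal G ρ β s n x j ^ 2) ^ 2 := by ring
      _ ≤ (CG * (B * ∑ k : Fin n, |Real.sqrt (ρ n) * G n j k| * (x k ⬝ᵥ x k))) ^ 2 :=
          pow_le_pow_left₀ (sq_nonneg _) h1 2
      _ = CG * B * (CG * B *
          (∑ k : Fin n, |Real.sqrt (ρ n) * G n j k| * (x k ⬝ᵥ x k)) ^ 2) := by ring
      _ ≤ _ := by gcongr
  have hk : ∀ j : Fin n, Integrable (fun ω =>
      ∑ k : Fin n, |Real.sqrt (ρ n) * G n j k| * (X k ω ⬝ᵥ X k ω) ^ 2) μ := fun j =>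
    integrable_finsetSum _ fun k _ => (hX.memLp_normSq k).integrable_sq.const_mul _
  have hdom : ∀ j : Fin n, Integrable (fun ω => CG * B * (CG * B * (CG *
      ∑ k : Fin n, |Real.sqrt (ρ n) * G n j k| * (X k ω ⬝ᵥ X k ω) ^ 2))) μ := fun j =>
    (((hk j).const_mul _).const_mul _).const_mul _
  have hdomle : ∀ j : Fin n, ∫ ω, CG * B * (CG * B * (CG *
      ∑ k : Fin n, |Real.sqrt (ρ n) * G n j k| * (X k ω ⬝ᵥ X k ω) ^ 2)) ∂μ ≤
      CG * B * (CG * B * (CG * (CG * m4))) := by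
    intro j
    rw [integral_const_mul, integral_const_mul, integral_const_mul,
      integral_finsetSum _ fun (k : Fin n) _ => (hX.memLp_normSq k).integrable_sq.const_mul _]
    simp only [integral_const_mul, hX.integral_normSq_sq]
    rw [← Finset.sum_mul]
    gcongr
    exact hrow j
  have hmeas : Measurable fun ω =>
      ((n : ℝ)⁻¹ * ∑ j, signal G ρ β s n (fun k => X k ω) j ^ 2) ^ 2 := by
    have hx := hX.measurable_X
    have hs : ∀ j, Measurable fun ω => signal G ρ β s n (fun k => X k ω) j := fun j => by
      simp only [signal_apply, dotProduct]
      refine Finset.measurable_fun_sum _ fun k _ => Measurable.const_mul ?_ _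
      refine Finset.measurable_fun_sum _ fun a _ => Measurable.mul_const ?_ _
      exact (measurable_pi_apply a).comp (hx k)
    exact ((Finset.measurable_fun_sum _ fun j _ => (hs j).pow_const 2).const_mul _).pow_const 2
  have hle : ∀ ω, ((n : ℝ)⁻¹ * ∑ j, signal G ρ β s n (fun k => X k ω) j ^ 2) ^ 2 ≤
      (n : ℝ)⁻¹ * ∑ j : Fin n, CG * B * (CG * B * (CG *
          ∑ k : Fin n, |Real.sqrt (ρ n) * G n j k| * (X k ω ⬝ᵥ X k ω) ^ 2)) := by
      intro ω
      have h2 : (∑ j, signal G ρ β s n (fun k => X k ω) j ^ 2) ^ 2 ≤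
          n * ∑ j, signal G ρ β s n (fun k => X k ω) j ^ 4 := by
        have := sq_sum_le_card_mul_sum_sq (s := Finset.univ)
          (f := fun j => signal G ρ β s n (fun k => X k ω) j ^ 2)
        simpa only [Finset.card_univ, Fintype.card_fin, ← pow_mul] using this
      rw [mul_pow]
      calc _ ≤ ((n : ℝ)⁻¹) ^ 2 * (n * ∑ j, signal G ρ β s n (fun k => X k ω) j ^ 4) := by gcongr
        _ = (n : ℝ)⁻¹ * ∑ j, signal G ρ β s n (fun k => X k ω) j ^ 4 := by field_simp
        _ ≤ _ := mul_le_mul_of_nonneg_left (Finset.sum_le_sum fun j _ =>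
            hpt (fun k => X k ω) j) (by positivity)
  have h1 := integral_le_of_le (μ := μ) hmeas (fun ω => sq_nonneg _) hle
    ((integrable_finsetSum _ fun j _ => hdom j).const_mul _)
  refine ⟨h1.1, h1.2.trans ?_⟩
  rw [integral_const_mul, integral_finsetSum _ fun j _ => hdom j]
  calc _ ≤ (n : ℝ)⁻¹ * ∑ j : Fin n, CG * B * (CG * B * (CG * (CG * m4))) := by
        refine mul_le_mul_of_nonneg_left (Finset.sum_le_sum fun j _ => hdomle j) (by positivity)
    _ = _ := by
        rw [Finset.sum_const, Finset.card_univ, Fintype.card_fin, nsmul_eq_mul]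
        field_simp

end Signal

end Population

/-! ### Population version of the local fits -/

section Fit

variable {Ω : Type*} [MeasurableSpace Ω] {μ : Measure Ω} [IsProbabilityMeasure μ]
  {p : ℕ} {X : ℕ → Ω → Fin p → ℝ} {ε : ℕ → Ω → ℝ} {σ : ℝ}
  {s : ℕ → Plane} {h : ℕ → ℝ} {K : ℝ → ℝ} {E : ℕ → Set (ℕ → Fin p → ℝ)} {c c' C L : ℝ}

omit [MeasurableSpace Ω] [IsProbabilityMeasure μ] in
lemma localCoef_dot_le {L h : ℝ} (hL : 1 ≤ L) (hh : 0 < h) {v : Plane} (hv : ‖v‖ ≤ L * h)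
    (u : Fin p ⊕ Fin p × Fin 2 → ℝ) :
    localCoef h v u ⬝ᵥ localCoef h v u ≤ 3 * L ^ 2 * (u ⬝ᵥ u) := by
  have h1 : u ⬝ᵥ u = ∑ a, (u (Sum.inl a) ^ 2 + u (Sum.inr (a, 0)) ^ 2
      + u (Sum.inr (a, 1)) ^ 2) := by
    simp only [dotProduct, Fintype.sum_sum_type, Fintype.sum_prod_type, Fin.sum_univ_two,
      ← Finset.sum_add_distrib]
    exact Finset.sum_congr rfl fun a _ => by ring
  have h2 : ∀ b : Fin 2, (v b / h) ^ 2 ≤ L ^ 2 := by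
    intro b
    rw [← sq_abs]
    refine pow_le_pow_left₀ (abs_nonneg _) ?_ 2
    rw [abs_div, abs_of_pos hh, div_le_iff₀ hh]
    exact (by simpa using PiLp.norm_apply_le v b : |v b| ≤ ‖v‖).trans hv
  rw [h1, Finset.mul_sum, dotProduct]
  refine Finset.sum_le_sum fun a _ => ?_
  rw [← sq, localCoef]
  set x := u (Sum.inl a)
  set y := u (Sum.inr (a, 0)) with hy
  set z := u (Sum.inr (a, 1)) with hz
  have h3 : 1 ≤ L ^ 2 := one_le_pow₀ hL
  have h4 : (y * (v 0 / h)) ^ 2 ≤ y ^ 2 * L ^ 2 := by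
    rw [mul_pow]; exact mul_le_mul_of_nonneg_left (h2 0) (sq_nonneg _)
  have h5 : (z * (v 1 / h)) ^ 2 ≤ z ^ 2 * L ^ 2 := by
    rw [mul_pow]; exact mul_le_mul_of_nonneg_left (h2 1) (sq_nonneg _)
  have h6 : x ^ 2 ≤ x ^ 2 * L ^ 2 := le_mul_of_one_le_right (sq_nonneg _) h3
  nlinarith [sq_nonneg (x - y * (v 0 / h)), sq_nonneg (x - z * (v 1 / h)),
    sq_nonneg (y * (v 0 / h) - z * (v 1 / h))]

/-- Coefficients solving the expected normal equations of all local fits, uniformly bounded. -/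
lemma LocalRegime.exists_population_fit (hR : LocalRegime μ X s h K E c c' C L)
    {Ψ : Matrix (Fin p) (Fin p) ℝ} (hΨ : Ψ.PosDef) (Γ : Fin p → ℝ)
    {vb : ∀ n : ℕ, Fin n → ℝ} {V : ℝ} (hvb : ∀ n j, |vb n j| ≤ V) :
    ∃ (θ : ∀ n : ℕ, Fin n → Fin p ⊕ Fin p × Fin 2 → ℝ) (Cθ : ℝ), 0 ≤ Cθ ∧
      ∀ᶠ n : ℕ in atTop, ∀ i, θ n i ⬝ᵥ θ n i ≤ Cθ ∧ ∀ k, ∑ j : Fin n, rowWeight K (h n) s i j *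
        (featMono (h n) (s j - s i) k * (Γ (featComp k) * vb n j
          - (Ψ *ᵥ localCoef (h n) (s j - s i) (θ n i)) (featComp k))) = 0 := by
  obtain ⟨l, hl, hlow⟩ := exists_pos_le_quadForm Ψ hΨ
  have hc' := hR.c'_pos
  have hC := hR.C_pos
  set M : ∀ n : ℕ, Fin n → Matrix (Fin p ⊕ Fin p × Fin 2) (Fin p ⊕ Fin p × Fin 2) ℝ :=
    fun n i => Matrix.of fun k m => ∑ j : Fin n, rowWeight K (h n) s i j *
      (featMono (h n) (s j - s i) k * featMono (h n) (s j - s i) m * Ψ (featComp k) (featComp m))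
    with hM
  set r : ∀ n : ℕ, Fin n → Fin p ⊕ Fin p × Fin 2 → ℝ := fun n i k => ∑ j : Fin n,
    rowWeight K (h n) s i j * (featMono (h n) (s j - s i) k * (Γ (featComp k) * vb n j)) with hr
  -- The bound on `θ` follows by testing the normal equations with `θ`: ellipticity `l` of `Ψ` is
  -- used twice, coercivity `c'` of the design once, and the weights have total at most `C n`.
  refine ⟨fun n i => (M n i)⁻¹ *ᵥ r n i, (Γ ⬝ᵥ Γ) * V ^ 2 * C / (l ^ 2 * c'),
    div_nonneg (mul_nonneg (mul_nonneg (dot_self_nonneg _) (sq_nonneg _)) hC.le) (by positivity),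
    ?_⟩
  filter_upwards [hR.coercive, hR.sum_le, eventually_gt_atTop 0] with n hco hsum hn0 i
  have h0 : (0 : ℝ) < n := by exact_mod_cast hn0
  set w : Fin n → ℝ := fun j => rowWeight K (h n) s i j with hw
  have hw0 : ∀ j, 0 ≤ w j := fun j => hR.weight_nonneg n i j
  set ℓ : (Fin p ⊕ Fin p × Fin 2 → ℝ) → Fin n → Fin p → ℝ := fun u j =>
    localCoef (h n) (s j - s i) u with hℓ
  have hquad : ∀ u, u ⬝ᵥ (M n i *ᵥ u) = ∑ j, w j * (ℓ u j ⬝ᵥ (Ψ *ᵥ ℓ u j)) := by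
    intro u
    have h1 : ∀ j, ℓ u j ⬝ᵥ (Ψ *ᵥ ℓ u j) = ∑ k, ∑ m, u k * u m *
        (featMono (h n) (s j - s i) k * featMono (h n) (s j - s i) m
          * Ψ (featComp k) (featComp m)) := by
      intro j
      rw [sum_feat_quad (h n) (s j - s i) u fun a b => Ψ a b]
      simp only [dotProduct, Matrix.mulVec, Finset.mul_sum]
      exact Finset.sum_congr rfl fun a _ => Finset.sum_congr rfl fun b _ => by ring
    simp only [h1]
    simp only [dotProduct, Matrix.mulVec, hM, Matrix.of_apply, Finset.mul_sum, Finset.sum_mul]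
    simp only [hw]
    refine (Finset.sum_congr rfl fun k _ => Finset.sum_comm).trans ?_
    rw [Finset.sum_comm]
    exact Finset.sum_congr rfl fun j _ => Finset.sum_congr rfl fun k _ =>
      Finset.sum_congr rfl fun m _ => by ring
  have hge : ∀ u, l * (∑ j, w j * (ℓ u j ⬝ᵥ ℓ u j)) ≤ u ⬝ᵥ (M n i *ᵥ u) := by
    intro u
    rw [hquad, Finset.mul_sum]
    refine Finset.sum_le_sum fun j _ => ?_
    calc _ = w j * (l * (ℓ u j ⬝ᵥ ℓ u j)) := by ring
      _ ≤ _ := mul_le_mul_of_nonneg_left (hlow _) (hw0 j)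
  have hge' : ∀ u, c' * n * (u ⬝ᵥ u) ≤ ∑ j, w j * (ℓ u j ⬝ᵥ ℓ u j) := fun u =>
    localCoef_sum_ge (hco i) u
  have hunit : IsUnit (M n i) := isUnit_of_le_quadForm (M n i) (c := l * (c' * n)) (by positivity)
    fun u => by
      rw [mul_assoc]
      exact (mul_le_mul_of_nonneg_left (hge' u) hl.le).trans (hge u)
  set θ := (M n i)⁻¹ *ᵥ r n i with hθ
  have hMθ : M n i *ᵥ θ = r n i := by
    rw [hθ, Matrix.mulVec_mulVec, Matrix.mul_nonsing_inv _ ((Matrix.isUnit_iff_isUnit_det _).mp hunit),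
      Matrix.one_mulVec]
  constructor
  · have h1 : θ ⬝ᵥ r n i = ∑ j, w j * (vb n j * (ℓ θ j ⬝ᵥ Γ)) := by
      have h2 : ∀ j, ℓ θ j ⬝ᵥ Γ = ∑ k, θ k * featMono (h n) (s j - s i) k * Γ (featComp k) :=
        fun j => (sum_feat _ _ _ _).symm
      simp only [h2]
      simp only [dotProduct, hr, Finset.mul_sum]
      rw [Finset.sum_comm]
      exact Finset.sum_congr rfl fun j _ => Finset.sum_congr rfl fun k _ => by
        simp only [hw]; ring
    set q := ∑ j, w j * (ℓ θ j ⬝ᵥ ℓ θ j) with hq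
    -- Young's inequality balanced so that `l/2` times the energy can be absorbed on the left.
    have h3 : ∀ j, vb n j * (ℓ θ j ⬝ᵥ Γ) ≤
        (Γ ⬝ᵥ Γ) * V ^ 2 / (2 * l) + l / 2 * (ℓ θ j ⬝ᵥ ℓ θ j) := by
      intro j
      have h4 := dotProduct_sq_le (ℓ θ j) Γ
      have h5 : vb n j ^ 2 ≤ V ^ 2 := by
        rw [← sq_abs]; exact pow_le_pow_left₀ (abs_nonneg _) (hvb n j) 2
      have hg := dot_self_nonneg Γ
      have he := dot_self_nonneg (ℓ θ j)
      set e := ℓ θ j ⬝ᵥ ℓ θ j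
      set g := Γ ⬝ᵥ Γ
      refine abs_le_of_sq_le_sq' ?_ (by positivity) |>.2
      rw [mul_pow]
      calc vb n j ^ 2 * (ℓ θ j ⬝ᵥ Γ) ^ 2 ≤ V ^ 2 * (e * g) :=
            mul_le_mul h5 h4 (sq_nonneg _) (sq_nonneg _)
        _ = 4 * (g * V ^ 2 / (2 * l)) * (l / 2 * e) := by field_simp; ring
        _ ≤ _ := by nlinarith [sq_nonneg (g * V ^ 2 / (2 * l) - l / 2 * e)]
    have h6 : θ ⬝ᵥ r n i ≤ (Γ ⬝ᵥ Γ) * V ^ 2 / (2 * l) * (C * n) + l / 2 * q := by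
      rw [h1]
      have hg : 0 ≤ (Γ ⬝ᵥ Γ) * V ^ 2 / (2 * l) :=
        div_nonneg (mul_nonneg (dot_self_nonneg _) (sq_nonneg _)) (by positivity)
      calc _ ≤ ∑ j, w j * ((Γ ⬝ᵥ Γ) * V ^ 2 / (2 * l) + l / 2 * (ℓ θ j ⬝ᵥ ℓ θ j)) :=
            Finset.sum_le_sum fun j _ => mul_le_mul_of_nonneg_left (h3 j) (hw0 j)
        _ = (Γ ⬝ᵥ Γ) * V ^ 2 / (2 * l) * (∑ j, w j) + l / 2 * q := by
            rw [hq, Finset.mul_sum, Finset.mul_sum, ← Finset.sum_add_distrib]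
            exact Finset.sum_congr rfl fun j _ => by ring
        _ ≤ _ := by
            gcongr
            exact hsum i
    have h7 := hge θ
    rw [hMθ] at h7
    have h8 := hge' θ
    rw [le_div_iff₀ (by positivity)]
    have h9 : l * q ≤ (Γ ⬝ᵥ Γ) * V ^ 2 / l * (C * n) := by
      have : (Γ ⬝ᵥ Γ) * V ^ 2 / l * (C * n) = 2 * ((Γ ⬝ᵥ Γ) * V ^ 2 / (2 * l) * (C * n)) := by
        field_simp
      rw [this]; linarith
    have h10 : l * (l * (c' * n * (θ ⬝ᵥ θ))) ≤ (Γ ⬝ᵥ Γ) * V ^ 2 * (C * n) := by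
      calc _ ≤ l * (l * q) := by gcongr
        _ ≤ l * ((Γ ⬝ᵥ Γ) * V ^ 2 / l * (C * n)) := by gcongr
        _ = _ := by field_simp
    have h11 : n * (θ ⬝ᵥ θ * (l ^ 2 * c')) ≤ n * ((Γ ⬝ᵥ Γ) * V ^ 2 * C) := by
      calc _ = l * (l * (c' * n * (θ ⬝ᵥ θ))) := by ring
        _ ≤ _ := h10
        _ = _ := by ring
    exact le_of_mul_le_mul_left h11 h0
  · intro k
    have h1 := congrFun hMθ k
    have h2 : (M n i *ᵥ θ) k = ∑ j, w j * (featMono (h n) (s j - s i) k *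
        (Ψ *ᵥ ℓ θ j) (featComp k)) := by
      have h3 : ∀ j, (Ψ *ᵥ ℓ θ j) (featComp k) = ∑ m, θ m * featMono (h n) (s j - s i) m *
          Ψ (featComp k) (featComp m) := fun j => by
        rw [sum_feat (h n) (s j - s i) θ (Ψ (featComp k)), dotProduct_comm]; rfl
      simp only [h3]
      simp only [Matrix.mulVec, dotProduct, hM, Matrix.of_apply, Finset.mul_sum, Finset.sum_mul]
      rw [Finset.sum_comm]
      exact Finset.sum_congr rfl fun j _ => Finset.sum_congr rfl fun m _ => by
        simp only [hw]; ring
    rw [h2] at h1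
    simp only [mul_sub, Finset.sum_sub_distrib]
    rw [sub_eq_zero]
    exact h1.symm

end Fit

/-! ### The signal after smoothing -/

section Majorant

variable {Ω : Type*} [MeasurableSpace Ω] {μ : Measure Ω} [IsProbabilityMeasure μ]
  {p : ℕ} {X : ℕ → Ω → Fin p → ℝ} {ε : ℕ → Ω → ℝ} {σ : ℝ}
  {s : ℕ → Plane} {h : ℕ → ℝ} {K : ℝ → ℝ} {E : ℕ → Set (ℕ → Fin p → ℝ)} {c c' C L : ℝ}
  {ρ : ℕ → ℝ} {G : ∀ n : ℕ, Matrix (Fin n) (Fin n) ℝ} {CG : ℝ}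
  {vb : ∀ n : ℕ, Fin n → ℝ} {θ : ∀ n : ℕ, Fin n → Fin p ⊕ Fin p × Fin 2 → ℝ}

/-- Residual of the `j`-th observation in the population fit at `s_i`. -/
def fitResid (h : ℕ → ℝ) (s : ℕ → Plane) (vb : ∀ n : ℕ, Fin n → ℝ)
    (θ : ∀ n : ℕ, Fin n → Fin p ⊕ Fin p × Fin 2 → ℝ) (n : ℕ) (i j : Fin n) (x : Fin p → ℝ) : ℝ :=
  vb n j - x ⬝ᵥ localCoef (h n) (s j - s i) (θ n i)

lemma measurable_fitResid (n : ℕ) (i j : Fin n) : Measurable (fitResid h s vb θ n i j) := by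
  unfold fitResid dotProduct
  fun_prop

lemma LocalRegime.fitResid_sq_le (hR : LocalRegime μ X s h K E c c' C L) {V Cθ : ℝ}
    (hvb : ∀ n j, |vb n j| ≤ V) (hCθ : 0 ≤ Cθ) {n : ℕ} (hθ : ∀ i, θ n i ⬝ᵥ θ n i ≤ Cθ)
    {i j : Fin n} (hw : rowWeight K (h n) s i j ≠ 0) (x : Fin p → ℝ) :
    fitResid h s vb θ n i j x ^ 2 ≤ (2 * V ^ 2 + 6 * L ^ 2 * Cθ) * (1 + x ⬝ᵥ x) := by
  have h1 := localCoef_dot_le hR.one_le_L (hR.h_pos n) (hR.norm_le hw) (θ n i)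
  have h2 := dotProduct_sq_le x (localCoef (h n) (s j - s i) (θ n i))
  have h3 : vb n j ^ 2 ≤ V ^ 2 := by
    rw [← sq_abs]; exact pow_le_pow_left₀ (abs_nonneg _) (hvb n j) 2
  have hx := dot_self_nonneg x
  have h4 : 3 * L ^ 2 * (θ n i ⬝ᵥ θ n i) ≤ 3 * L ^ 2 * Cθ :=
    mul_le_mul_of_nonneg_left (hθ i) (by positivity)
  have h5 := mul_le_mul_of_nonneg_left (h1.trans h4) hx
  have h6 : 0 ≤ V ^ 2 * (x ⬝ᵥ x) := mul_nonneg (sq_nonneg _) hx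
  have h7 : 0 ≤ L ^ 2 * Cθ := by positivity
  unfold fitResid
  nlinarith [sq_nonneg (vb n j + x ⬝ᵥ localCoef (h n) (s j - s i) (θ n i))]

/-- Contribution of the diagonal to the error of the local fits. -/
def diagError (c : ℝ) (K : ℝ → ℝ) (h : ℕ → ℝ) (s : ℕ → Plane) (vb : ∀ n : ℕ, Fin n → ℝ)
    (θ : ∀ n : ℕ, Fin n → Fin p ⊕ Fin p × Fin 2 → ℝ) (n : ℕ) (x : ℕ → Fin p → ℝ) : ℝ :=
  (n : ℝ)⁻¹ * ∑ i : Fin n, (x i ⬝ᵥ x i) / (c * n) *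
    (rowWeight K (h n) s i i * fitResid h s vb θ n i i (x i) ^ 2)

/-- One summand of a component of the off-diagonal score. -/
def scoreTerm (K : ℝ → ℝ) (h : ℕ → ℝ) (s : ℕ → Plane) (vb : ∀ n : ℕ, Fin n → ℝ)
    (θ : ∀ n : ℕ, Fin n → Fin p ⊕ Fin p × Fin 2 → ℝ) (n : ℕ) (i : Fin n)
    (k : Fin p ⊕ Fin p × Fin 2) (j : Fin n) (x : Fin p → ℝ) : ℝ :=
  rowWeight K (h n) s i j * (featMono (h n) (s j - s i) k * x (featComp k))
    * fitResid h s vb θ n i j x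

/-- Contribution of the off-diagonal scores to the error of the local fits. -/
def scoreError (c : ℝ) (K : ℝ → ℝ) (h : ℕ → ℝ) (s : ℕ → Plane) (vb : ∀ n : ℕ, Fin n → ℝ)
    (θ : ∀ n : ℕ, Fin n → Fin p ⊕ Fin p × Fin 2 → ℝ) (n : ℕ) (x : ℕ → Fin p → ℝ) : ℝ :=
  (n : ℝ)⁻¹ * ∑ i : Fin n, (x i ⬝ᵥ x i) / (c * n) ^ 2 * ∑ k,
    (∑ j ∈ Finset.univ.erase i, scoreTerm K h s vb θ n i k j (x j)) ^ 2

lemma measurable_scoreTerm (n : ℕ) (i : Fin n) (k : Fin p ⊕ Fin p × Fin 2) (j : Fin n) :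
    Measurable (scoreTerm K h s vb θ n i k j) := by
  have := measurable_fitResid (h := h) (s := s) (vb := vb) (θ := θ) n i j
  unfold scoreTerm
  fun_prop

lemma SampleCondition.integral_quartic (hX : SampleCondition μ X ε σ) (A : ℝ) (j : ℕ) :
    Integrable (fun ω => A * ((X j ω ⬝ᵥ X j ω) * (1 + X j ω ⬝ᵥ X j ω))) μ ∧
    ∫ ω, A * ((X j ω ⬝ᵥ X j ω) * (1 + X j ω ⬝ᵥ X j ω)) ∂μ =
      A * (∫ ω, X 0 ω ⬝ᵥ X 0 ω ∂μ + ∫ ω, (X 0 ω ⬝ᵥ X 0 ω) ^ 2 ∂μ) := by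
  have h1 := (hX.memLp_normSq j).integrable one_le_two
  have h2 := (hX.memLp_normSq j).integrable_sq
  have e : ∀ ω, (X j ω ⬝ᵥ X j ω) * (1 + X j ω ⬝ᵥ X j ω) = X j ω ⬝ᵥ X j ω
      + (X j ω ⬝ᵥ X j ω) ^ 2 := fun ω => by ring
  simp only [e]
  refine ⟨(h1.add h2).const_mul A, ?_⟩
  rw [integral_const_mul, integral_add h1 h2, hX.integral_normSq, hX.integral_normSq_sq]

/-- A single observation has weight at most `C/h²`, against a Gram matrix of order `n`; hence the
order `1/(n h²)`. -/
lemma LocalRegime.integral_diagError_le (hR : LocalRegime μ X s h K E c c' C L)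
    (hX : SampleCondition μ X ε σ) {V Cθ : ℝ} (hvb : ∀ n j, |vb n j| ≤ V) (hCθ : 0 ≤ Cθ)
    (hθ : ∀ᶠ n : ℕ in atTop, ∀ i, θ n i ⬝ᵥ θ n i ≤ Cθ) :
    ∃ A : ℝ, ∀ᶠ n : ℕ in atTop,
      Integrable (fun ω => diagError c K h s vb θ n fun i => X i ω) μ ∧
      ∫ ω, diagError c K h s vb θ n (fun i => X i ω) ∂μ ≤ A * ((n : ℝ) * h n ^ 2)⁻¹ := by
  set m := ∫ ω, X 0 ω ⬝ᵥ X 0 ω ∂μ + ∫ ω, (X 0 ω ⬝ᵥ X 0 ω) ^ 2 ∂μ with hm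
  set Cz := 2 * V ^ 2 + 6 * L ^ 2 * Cθ with hCz
  have hc := hR.c_pos
  have hC := hR.C_pos
  refine ⟨C * Cz * m / c, ?_⟩
  filter_upwards [hθ, eventually_gt_atTop 0] with n hn hn0
  have h0 : (0 : ℝ) < n := by exact_mod_cast hn0
  have hh := hR.h_pos n
  have hterm : ∀ (i : Fin n) (x : Fin p → ℝ), (x ⬝ᵥ x) / (c * n) *
      (rowWeight K (h n) s i i * fitResid h s vb θ n i i x ^ 2) ≤
      C * Cz / (c * n * h n ^ 2) * ((x ⬝ᵥ x) * (1 + x ⬝ᵥ x)) := by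
    intro i x
    have hx := dot_self_nonneg x
    have h1 : rowWeight K (h n) s i i * fitResid h s vb θ n i i x ^ 2 ≤
        C / h n ^ 2 * (Cz * (1 + x ⬝ᵥ x)) := by
      by_cases hw : rowWeight K (h n) s i i = 0
      · rw [hw, zero_mul]; positivity
      · exact mul_le_mul (hR.weight_le n i i) (hR.fitResid_sq_le hvb hCθ hn hw x) (sq_nonneg _)
          (by positivity)
    calc _ ≤ (x ⬝ᵥ x) / (c * n) * (C / h n ^ 2 * (Cz * (1 + x ⬝ᵥ x))) := by gcongr
      _ = _ := by field_simp
  have hmeas : Measurable fun ω => diagError c K h s vb θ n fun i => X i ω := by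
    unfold diagError
    refine (Finset.measurable_fun_sum _ fun i _ => ?_).const_mul _
    exact ((hX.measurable_normSq i).div_const _).mul
      ((((measurable_fitResid n i i).comp (hX.measurable_X i)).pow_const 2).const_mul _)
  have h1 := integral_le_of_le (μ := μ) hmeas
    (fun ω => mul_nonneg (by positivity) (Finset.sum_nonneg fun i _ => mul_nonneg
      (div_nonneg (dot_self_nonneg _) (by positivity))
      (mul_nonneg (hR.weight_nonneg _ _ _) (sq_nonneg _))))
    (fun ω => mul_le_mul_of_nonneg_left (Finset.sum_le_sum fun i _ => hterm i (X i ω))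
      (by positivity))
    ((integrable_finsetSum _ fun (i : Fin n) _ => (hX.integral_quartic _ i).1).const_mul _)
  refine ⟨h1.1, h1.2.trans (le_of_eq ?_)⟩
  rw [integral_const_mul, integral_finsetSum _ fun (i : Fin n) _ => (hX.integral_quartic _ i).1]
  simp only [(hX.integral_quartic _ _).2, ← hm]
  rw [Finset.sum_const, Finset.card_univ, Fintype.card_fin, nsmul_eq_mul]
  field_simp

lemma LocalRegime.integral_scoreTerm_sq_le (hR : LocalRegime μ X s h K E c c' C L)
    (hX : SampleCondition μ X ε σ) {V Cθ : ℝ} (hvb : ∀ n j, |vb n j| ≤ V) (hCθ : 0 ≤ Cθ) {n : ℕ}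
    (hθ : ∀ i, θ n i ⬝ᵥ θ n i ≤ Cθ) (i j : Fin n) (k : Fin p ⊕ Fin p × Fin 2) :
    MemLp (fun ω => scoreTerm K h s vb θ n i k j (X j ω)) 2 μ ∧
    ∫ ω, scoreTerm K h s vb θ n i k j (X j ω) ^ 2 ∂μ ≤ rowWeight K (h n) s i j * (C / h n ^ 2) *
      (L ^ 2 * (2 * V ^ 2 + 6 * L ^ 2 * Cθ)) *
      (∫ ω, X 0 ω ⬝ᵥ X 0 ω ∂μ + ∫ ω, (X 0 ω ⬝ᵥ X 0 ω) ^ 2 ∂μ) := by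
  set Cz := 2 * V ^ 2 + 6 * L ^ 2 * Cθ with hCz
  have hh := hR.h_pos n
  have hC := hR.C_pos
  have hw0 := hR.weight_nonneg n i j
  have hpt : ∀ x : Fin p → ℝ, scoreTerm K h s vb θ n i k j x ^ 2 ≤
      rowWeight K (h n) s i j * (C / h n ^ 2) * (L ^ 2 * Cz) * ((x ⬝ᵥ x) * (1 + x ⬝ᵥ x)) := by
    intro x
    have hx := dot_self_nonneg x
    unfold scoreTerm
    by_cases hw : rowWeight K (h n) s i j = 0
    · simp [hw]
    have h1 := hR.fitResid_sq_le hvb hCθ hθ hw x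
    have h2 : featMono (h n) (s j - s i) k ^ 2 ≤ L ^ 2 := by
      rw [← sq_abs]
      exact pow_le_pow_left₀ (abs_nonneg _)
        (abs_featMono_le hR.one_le_L hh (hR.norm_le hw) k) 2
    have h3 := abs_apply_le_normSq x (featComp k)
    have h4 : rowWeight K (h n) s i j ^ 2 ≤ rowWeight K (h n) s i j * (C / h n ^ 2) := by
      rw [sq]; exact mul_le_mul_of_nonneg_left (hR.weight_le n i j) hw0
    calc _ = rowWeight K (h n) s i j ^ 2 * (featMono (h n) (s j - s i) k ^ 2
          * x (featComp k) ^ 2) * fitResid h s vb θ n i j x ^ 2 := by ring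
      _ ≤ rowWeight K (h n) s i j * (C / h n ^ 2) * (L ^ 2 * (x ⬝ᵥ x)) *
          (Cz * (1 + x ⬝ᵥ x)) := by gcongr
      _ = _ := by ring
  have hm : Measurable fun ω => scoreTerm K h s vb θ n i k j (X j ω) :=
    (measurable_scoreTerm n i k j).comp (hX.measurable_X j)
  have h1 := integral_le_of_le (μ := μ) (hm.pow_const 2) (fun ω => sq_nonneg _)
    (fun ω => hpt (X j ω)) (hX.integral_quartic _ j).1
  exact ⟨(memLp_two_iff_integrable_sq hm.aestronglyMeasurable).mpr h1.1,
    h1.2.trans (le_of_eq (hX.integral_quartic _ j).2)⟩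

/-- The mean of a score term is the matching summand of the population normal equations; this is why
`θ` was chosen to solve them. -/
lemma SampleCondition.integral_scoreTerm (hX : SampleCondition μ X ε σ) (n : ℕ) (i j : Fin n)
    (k : Fin p ⊕ Fin p × Fin 2) :
    ∫ ω, scoreTerm K h s vb θ n i k j (X j ω) ∂μ = rowWeight K (h n) s i j *
        (featMono (h n) (s j - s i) k * (firstMoment μ (X 0) (featComp k) * vb n j
          - (secondMoment μ (X 0) *ᵥ localCoef (h n) (s j - s i) (θ n i)) (featComp k))) := by
  have h1 : ∀ a b, Integrable (fun ω => X j ω a * X j ω b) μ := fun a b =>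
    integrable_mul_of_sq (hX.memLp_apply j a) (hX.memLp_apply j b)
  have h2 : ∀ a, Integrable (fun ω => X j ω a) μ := fun a =>
    (hX.memLp_apply j a).integrable one_le_two
  have e : ∀ ω, scoreTerm K h s vb θ n i k j (X j ω) = rowWeight K (h n) s i j *
      featMono (h n) (s j - s i) k * (X j ω (featComp k) * vb n j - ∑ a,
        X j ω (featComp k) * X j ω a * localCoef (h n) (s j - s i) (θ n i) a) := by
    intro ω
    have : ∑ a, X j ω (featComp k) * X j ω a * localCoef (h n) (s j - s i) (θ n i) a =
        X j ω (featComp k) * (X j ω ⬝ᵥ localCoef (h n) (s j - s i) (θ n i)) := by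
      rw [dotProduct, Finset.mul_sum]
      exact Finset.sum_congr rfl fun a _ => by ring
    rw [this, scoreTerm, fitResid]
    ring
  simp only [e]
  rw [integral_const_mul, integral_sub ((h2 _).mul_const _)
    (integrable_finsetSum _ fun a _ => (h1 _ a).mul_const _),
    integral_finsetSum _ fun a _ => (h1 _ a).mul_const _]
  simp only [integral_mul_const, hX.integral_apply, hX.integral_apply_mul]
  rw [mul_assoc]
  rfl

/-- Off-diagonal scores are sums of independent terms, with variance `O(n/h²)` and almost zero mean;
the normalization by `n²` leaves `O(1/(n h²))`. -/
lemma LocalRegime.integral_scoreError_le (hR : LocalRegime μ X s h K E c c' C L)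
    (hX : SampleCondition μ X ε σ) {V Cθ : ℝ} (hvb : ∀ n j, |vb n j| ≤ V) (hCθ : 0 ≤ Cθ)
    (hθ : ∀ᶠ n : ℕ in atTop, ∀ i, θ n i ⬝ᵥ θ n i ≤ Cθ)
    (hnorm : ∀ᶠ n : ℕ in atTop, ∀ (i : Fin n) k, ∑ j : Fin n, rowWeight K (h n) s i j *
        (featMono (h n) (s j - s i) k * (firstMoment μ (X 0) (featComp k) * vb n j
          - (secondMoment μ (X 0) *ᵥ localCoef (h n) (s j - s i) (θ n i)) (featComp k))) = 0) :
    ∃ A : ℝ, ∀ᶠ n : ℕ in atTop,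
      Integrable (fun ω => scoreError c K h s vb θ n fun i => X i ω) μ ∧
      ∫ ω, scoreError c K h s vb θ n (fun i => X i ω) ∂μ ≤ A * ((n : ℝ) * h n ^ 2)⁻¹ := by
  set m2 := ∫ ω, X 0 ω ⬝ᵥ X 0 ω ∂μ with hm2
  set m := m2 + ∫ ω, (X 0 ω ⬝ᵥ X 0 ω) ^ 2 ∂μ with hm
  have hm20 : 0 ≤ m2 := integral_nonneg fun ω => dot_self_nonneg _
  have hm0 : 0 ≤ m := add_nonneg hm20 (integral_nonneg fun ω => sq_nonneg _)
  set Cz := 2 * V ^ 2 + 6 * L ^ 2 * Cθ with hCz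
  have hCz0 : 0 ≤ Cz := by positivity
  have hc := hR.c_pos
  have hC := hR.C_pos
  set q : ℝ := ((Fintype.card (Fin p ⊕ Fin p × Fin 2) : ℕ) : ℝ) with hq
  have hq0 : 0 ≤ q := Nat.cast_nonneg _
  refine ⟨q * (m2 * (4 * (C ^ 2 * (L ^ 2 * Cz) * m))) / c ^ 2, ?_⟩
  filter_upwards [hθ, hnorm, hR.sum_le, hR.bandwidth.eventually_ge_atTop 1,
    eventually_gt_atTop 0] with n hn hno hsum hb hn0
  have h0 : (0 : ℝ) < n := by exact_mod_cast hn0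
  have hh := hR.h_pos n
  have hsq := fun i j k => hR.integral_scoreTerm_sq_le hX hvb hCθ hn i j k
  have hik : ∀ (i : Fin n) (k : Fin p ⊕ Fin p × Fin 2),
      Integrable (fun ω => (X i ω ⬝ᵥ X i ω) *
        (∑ j ∈ Finset.univ.erase i, scoreTerm K h s vb θ n i k j (X j ω)) ^ 2) μ ∧
      ∫ ω, (X i ω ⬝ᵥ X i ω) *
        (∑ j ∈ Finset.univ.erase i, scoreTerm K h s vb θ n i k j (X j ω)) ^ 2 ∂μ ≤
        m2 * (4 * (C ^ 2 * (L ^ 2 * Cz) * m)) * (n / h n ^ 2) := by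
    intro i k
    have h1 := hX.integral_normSq_mul_sq_sum_le (fun j => measurable_scoreTerm (K := K) (h := h)
      (s := s) (vb := vb) (θ := θ) n i k j) (T := Finset.univ.erase i)
      (fun j _ => (hsq i j k).1) (Finset.notMem_erase i _)
    refine ⟨h1.1, h1.2.trans ?_⟩
    have h2 : ∑ j ∈ Finset.univ.erase i, ∫ ω, scoreTerm K h s vb θ n i k j (X j ω) ^ 2 ∂μ ≤
        C ^ 2 * (L ^ 2 * Cz) * m * (n / h n ^ 2) := by
      calc _ ≤ ∑ j, ∫ ω, scoreTerm K h s vb θ n i k j (X j ω) ^ 2 ∂μ :=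
            Finset.sum_le_univ_sum_of_nonneg fun j => integral_nonneg fun ω => sq_nonneg _
        _ ≤ ∑ j : Fin n, rowWeight K (h n) s i j * (C / h n ^ 2) * (L ^ 2 * Cz) * m :=
            Finset.sum_le_sum fun j _ => (hsq i j k).2
        _ = (∑ j : Fin n, rowWeight K (h n) s i j) * ((C / h n ^ 2) * (L ^ 2 * Cz) * m) := by
            rw [Finset.sum_mul]; exact Finset.sum_congr rfl fun j _ => by ring
        _ ≤ C * n * ((C / h n ^ 2) * (L ^ 2 * Cz) * m) :=
            mul_le_mul_of_nonneg_right (hsum i) (by positivity)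
        _ = _ := by ring
    -- The normal equations sum over all `j`, so without `j = i` the mean is minus that of the
    -- diagonal term. Its square is `O(1/h⁴)`, which `n h² ≥ 1` bounds by the variance order `n/h²`.
    have h3 : (∑ j ∈ Finset.univ.erase i, ∫ ω, scoreTerm K h s vb θ n i k j (X j ω) ∂μ) ^ 2 ≤
        C ^ 2 * (L ^ 2 * Cz) * m * (n / h n ^ 2) := by
      have h4 : ∑ j ∈ Finset.univ.erase i, ∫ ω, scoreTerm K h s vb θ n i k j (X j ω) ∂μ =
          - ∫ ω, scoreTerm K h s vb θ n i k i (X i ω) ∂μ := by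
        have h5 := hno i k
        simp only [← hX.integral_scoreTerm] at h5
        rw [← Finset.add_sum_erase _ _ (Finset.mem_univ i)] at h5
        linarith
      have h6 : (∫ ω, scoreTerm K h s vb θ n i k i (X i ω) ∂μ) ^ 2 ≤
          ∫ ω, scoreTerm K h s vb θ n i k i (X i ω) ^ 2 ∂μ := by
        have h7 := variance_nonneg (fun ω => scoreTerm K h s vb θ n i k i (X i ω)) μ
        rw [variance_eq_sub (hsq i i k).1] at h7
        simpa using sub_nonneg.mp h7
      rw [h4, neg_sq]
      refine (h6.trans (hsq i i k).2).trans ?_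
      have h8 : (h n ^ 2)⁻¹ ≤ n := by
        rw [inv_le_iff_one_le_mul₀ (by positivity)]; exact hb
      calc _ ≤ C / h n ^ 2 * (C / h n ^ 2) * (L ^ 2 * Cz) * m := by
            gcongr; exact hR.weight_le n i i
        _ = C ^ 2 * (L ^ 2 * Cz) * m * ((h n ^ 2)⁻¹ * (h n ^ 2)⁻¹) := by field_simp
        _ ≤ C ^ 2 * (L ^ 2 * Cz) * m * (n * (h n ^ 2)⁻¹) := by gcongr
        _ = _ := by ring
    calc _ ≤ m2 * (2 * (C ^ 2 * (L ^ 2 * Cz) * m * (n / h n ^ 2))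
          + 2 * (C ^ 2 * (L ^ 2 * Cz) * m * (n / h n ^ 2))) := by gcongr
      _ = _ := by ring
  have e : ∀ ω, scoreError c K h s vb θ n (fun i => X i ω) = ∑ i : Fin n, ∑ k,
      (n : ℝ)⁻¹ * ((c * n) ^ 2)⁻¹ * ((X i ω ⬝ᵥ X i ω) *
        (∑ j ∈ Finset.univ.erase i, scoreTerm K h s vb θ n i k j (X j ω)) ^ 2) := by
    intro ω
    simp only [scoreError, Finset.mul_sum]
    exact Finset.sum_congr rfl fun i _ => Finset.sum_congr rfl fun k _ => by ring
  have hin : ∀ (i : Fin n) (k : Fin p ⊕ Fin p × Fin 2), Integrable (fun ω =>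
      (n : ℝ)⁻¹ * ((c * n) ^ 2)⁻¹ * ((X i ω ⬝ᵥ X i ω) *
        (∑ j ∈ Finset.univ.erase i, scoreTerm K h s vb θ n i k j (X j ω)) ^ 2)) μ :=
    fun i k => (hik i k).1.const_mul _
  simp only [e]
  refine ⟨integrable_finsetSum _ fun i _ => integrable_finsetSum _ fun k _ => hin i k, ?_⟩
  rw [integral_finsetSum _ fun i _ => integrable_finsetSum _ fun k _ => hin i k]
  calc _ = ∑ i : Fin n, ∑ k, (n : ℝ)⁻¹ * ((c * n) ^ 2)⁻¹ * ∫ ω, (X i ω ⬝ᵥ X i ω) *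
        (∑ j ∈ Finset.univ.erase i, scoreTerm K h s vb θ n i k j (X j ω)) ^ 2 ∂μ := by
        refine Finset.sum_congr rfl fun i _ => ?_
        rw [integral_finsetSum _ fun k _ => hin i k]
        exact Finset.sum_congr rfl fun k _ => integral_const_mul _ _
    _ ≤ ∑ i : Fin n, ∑ k : Fin p ⊕ Fin p × Fin 2, (n : ℝ)⁻¹ * ((c * n) ^ 2)⁻¹ *
        (m2 * (4 * (C ^ 2 * (L ^ 2 * Cz) * m)) * (n / h n ^ 2)) :=
        Finset.sum_le_sum fun i _ => Finset.sum_le_sum fun k _ =>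
          mul_le_mul_of_nonneg_left (hik i k).2 (by positivity)
    _ = _ := by
        rw [Finset.sum_const, Finset.sum_const, Finset.card_univ, Finset.card_univ,
          Fintype.card_fin, nsmul_eq_mul, nsmul_eq_mul, ← hq]
        field_simp

end Majorant

/-! ### Limit of the smoothed signal -/

section SignalLimit

variable {Ω : Type*} [MeasurableSpace Ω] {μ : Measure Ω} [IsProbabilityMeasure μ]
  {p : ℕ} {X : ℕ → Ω → Fin p → ℝ} {ε : ℕ → Ω → ℝ} {σ : ℝ}
  {s : ℕ → Plane} {h : ℕ → ℝ} {K : ℝ → ℝ} {E : ℕ → Set (ℕ → Fin p → ℝ)} {c c' C L : ℝ}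
  {ρ : ℕ → ℝ} {G : ∀ n : ℕ, Matrix (Fin n) (Fin n) ℝ} {CG : ℝ}
  {vb : ∀ n : ℕ, Fin n → ℝ} {θ : ∀ n : ℕ, Fin n → Fin p ⊕ Fin p × Fin 2 → ℝ}
  {β : Plane → Fin p → ℝ} {B : ℝ}

lemma LocalRegime.weight_self (_hR : LocalRegime μ X s h K E c c' C L) (n i : ℕ) :
    rowWeight K (h n) s i i = K 0 / h n ^ 2 := by
  simp [rowWeight, scaledKernel]

lemma LocalRegime.weight_self_pos (hR : LocalRegime μ X s h K E c c' C L) (n i : ℕ) :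
    0 < rowWeight K (h n) s i i := by
  rw [hR.weight_self]
  exact div_pos hR.kernel.pos_zero (pow_pos (hR.h_pos n) 2)

/-- The error of the local fits of `v`, relative to the population fit of `vb`. -/
def fitError (c : ℝ) (K : ℝ → ℝ) (h : ℕ → ℝ) (s : ℕ → Plane) (vb : ∀ n : ℕ, Fin n → ℝ)
    (θ : ∀ n : ℕ, Fin n → Fin p ⊕ Fin p × Fin 2 → ℝ) (n : ℕ) (x : ℕ → Fin p → ℝ)
    (v : Fin n → ℝ) : ℝ :=
  4 * ((n : ℝ)⁻¹ * ∑ i, (v i - vb n i) ^ 2 + smoothBound c n K (h n) s x (fun _ j => v j - vb n j)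
    + diagError c K h s vb θ n x + scoreError c K h s vb θ n x)

/-- The signal is replaced by its mean, from which the population fit is subtracted. What remains at
`s_i` is split into its `i`-th entry, which shares `x_i` with the row of the smoother and is bounded
by energy, and the others, which enter through their scores. -/
lemma LocalRegime.exists_decomposition (hR : LocalRegime μ X s h K E c c' C L) :
    ∀ᶠ n : ℕ in atTop, ∀ x ∈ E n, ∀ v : Fin n → ℝ, ∃ d : Fin n → ℝ,
      (∀ i, (v - smoother K (h n) n x s *ᵥ v) i = fitResid h s vb θ n i i (x i) + d i) ∧
      (n : ℝ)⁻¹ * ∑ i, d i ^ 2 ≤ fitError c K h s vb θ n x v := by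
  filter_upwards [hR.gram, hR.sum_smoother_sq_le, eventually_gt_atTop 0] with n hgram hsm hn0 x hx v
  have h0 : (0 : ℝ) < n := by exact_mod_cast hn0
  have hh := (hR.h_pos n).ne'
  have hκ := mul_pos hR.c_pos h0
  set S := smoother K (h n) n x s with hS
  set u : Fin n → ℝ := fun j => v j - vb n j with hu
  set z : Fin n → Fin n → ℝ := fun i j => fitResid h s vb θ n i j (x j) with hz
  set z' : Fin n → Fin n → ℝ := fun i => Function.update (z i) i 0 with hz'
  set e : Fin n → Fin n → ℝ := fun i => Pi.single i (z i i) with he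
  have hzz : ∀ i, z i = z' i + e i := by
    intro i
    ext j
    by_cases hij : j = i
    · subst hij; simp [hz', he]
    · simp [hz', he, hij]
  refine ⟨fun i => u i - (S *ᵥ u) i - (S *ᵥ z' i) i - (S *ᵥ e i) i, fun i => ?_, ?_⟩
  · have h1 := smoother_sub_fit hh hκ (hgram x hx i) v (θ n i)
    have h2 : v - scaledDesign n (h n) x s (s i) *ᵥ θ n i = u + z i := by
      ext j
      rw [Pi.sub_apply, scaledDesign_mulVec]
      simp only [hu, hz, fitResid, Pi.add_apply]
      ring
    rw [h2, hzz, Matrix.mulVec_add, Matrix.mulVec_add] at h1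
    simp only [Pi.add_apply] at h1
    have h3 : ∑ a, x i a * θ n i (Sum.inl a) = x i ⬝ᵥ localCoef (h n) (s i - s i) (θ n i) := by
      simp [dotProduct, localCoef]
    rw [Pi.sub_apply]
    simp only [hu, fitResid] at h1 ⊢
    linarith
  · have h1 := hsm x hx fun _ => u
    have h2 : ∀ i, (S *ᵥ e i) i ^ 2 ≤ (x i ⬝ᵥ x i) / (c * n) *
        (rowWeight K (h n) s i i * z i i ^ 2) := by
      intro i
      refine (smoother_sq_le (hR.weight_nonneg n) hh hκ (hgram x hx i) (e i)).trans (le_of_eq ?_)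
      congr 1
      rw [Finset.sum_eq_single i]
      · simp [he]
      · intro j _ hji; simp [he, hji]
      · simp
    have h3 : ∀ i, (S *ᵥ z' i) i ^ 2 ≤ (x i ⬝ᵥ x i) / (c * n) ^ 2 * ∑ k,
        (∑ j ∈ Finset.univ.erase i, scoreTerm K h s vb θ n i k j (x j)) ^ 2 := by
      intro i
      refine (smoother_sq_le_score hh hκ (hgram x hx i) (z' i)).trans (le_of_eq ?_)
      congr 1
      refine Finset.sum_congr rfl fun k _ => ?_
      rw [← Finset.add_sum_erase _ _ (Finset.mem_univ i)]
      simp only [hz', Function.update_self, mul_zero, zero_add]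
      congr 1
      refine Finset.sum_congr rfl fun j hj => ?_
      rw [Function.update_of_ne (Finset.ne_of_mem_erase hj), scaledDesign, Matrix.of_apply,
        scoreTerm]
      ring
    have h4 : ∀ i, (u i - (S *ᵥ u) i - (S *ᵥ z' i) i - (S *ᵥ e i) i) ^ 2 ≤
        4 * (u i ^ 2 + (S *ᵥ u) i ^ 2 + (S *ᵥ e i) i ^ 2 + (S *ᵥ z' i) i ^ 2) := by
      intro i
      nlinarith [sq_nonneg (u i + (S *ᵥ u) i), sq_nonneg (u i + (S *ᵥ z' i) i),
        sq_nonneg (u i + (S *ᵥ e i) i), sq_nonneg ((S *ᵥ u) i - (S *ᵥ z' i) i),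
        sq_nonneg ((S *ᵥ u) i - (S *ᵥ e i) i), sq_nonneg ((S *ᵥ z' i) i - (S *ᵥ e i) i)]
    calc _ ≤ (n : ℝ)⁻¹ * ∑ i, 4 * (u i ^ 2 + (S *ᵥ u) i ^ 2 + (x i ⬝ᵥ x i) / (c * n) *
          (rowWeight K (h n) s i i * z i i ^ 2) + (x i ⬝ᵥ x i) / (c * n) ^ 2 * ∑ k,
            (∑ j ∈ Finset.univ.erase i, scoreTerm K h s vb θ n i k j (x j)) ^ 2) := by
          refine mul_le_mul_of_nonneg_left (Finset.sum_le_sum fun i _ => (h4 i).trans ?_)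
            (by positivity)
          have := h2 i
          have := h3 i
          linarith
      _ = 4 * ((n : ℝ)⁻¹ * ∑ i, u i ^ 2 + (n : ℝ)⁻¹ * ∑ i, (S *ᵥ u) i ^ 2
          + diagError c K h s vb θ n x + scoreError c K h s vb θ n x) := by
          rw [← Finset.mul_sum, Finset.sum_add_distrib, Finset.sum_add_distrib,
            Finset.sum_add_distrib, diagError, scoreError]
          ring
      _ ≤ _ := by
          rw [fitError]
          linarith

/-- A bound for the smoother that does not require the Gram matrices to be well conditioned. -/
lemma LocalRegime.exists_resid_sq_le (hR : LocalRegime μ X s h K E c c' C L) :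
    ∃ A : ℝ, 0 ≤ A ∧ ∀ᶠ n : ℕ in atTop, ∀ (x : ℕ → Fin p → ℝ) (v : Fin n → ℝ),
      ∑ i, (v - smoother K (h n) n x s *ᵥ v) i ^ 2 ≤ A * (n * h n ^ 2) * ∑ i, v i ^ 2 := by
  have hK0 := hR.kernel.pos_zero
  have hC := hR.C_pos
  refine ⟨2 + 2 * C / K 0, by positivity, ?_⟩
  filter_upwards [hR.sum_le, hR.bandwidth.eventually_ge_atTop 1] with n hsum hb x v
  have hh := hR.h_pos n
  set S := smoother K (h n) n x s with hS
  have hv : 0 ≤ ∑ i, v i ^ 2 := Finset.sum_nonneg fun i _ => sq_nonneg _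
  -- Symmetry of the weights turns the bound on their row sums into one on column sums, so the crude
  -- bounds can be summed over `i`.
  have hsym : ∀ i j : ℕ, rowWeight K (h n) s i j = rowWeight K (h n) s j i := fun i j => by
    rw [rowWeight, rowWeight, norm_sub_rev]
  have h1 : K 0 / h n ^ 2 * ∑ i, (S *ᵥ v) i ^ 2 ≤ C * n * ∑ i, v i ^ 2 := by
    rw [Finset.mul_sum]
    calc _ ≤ ∑ i : Fin n, ∑ j : Fin n, rowWeight K (h n) s i j * v j ^ 2 := by
          refine Finset.sum_le_sum fun i _ => ?_
          have := smoother_sq_le' (x := x) (hR.weight_nonneg n) hh.ne' i v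
          rwa [hR.weight_self] at this
      _ = ∑ j : Fin n, (∑ i : Fin n, rowWeight K (h n) s j i) * v j ^ 2 := by
          rw [Finset.sum_comm]
          refine Finset.sum_congr rfl fun j _ => ?_
          rw [Finset.sum_mul]
          exact Finset.sum_congr rfl fun i _ => by rw [hsym]
      _ ≤ ∑ j, C * n * v j ^ 2 := Finset.sum_le_sum fun j _ =>
          mul_le_mul_of_nonneg_right (hsum j) (sq_nonneg _)
      _ = _ := by rw [Finset.mul_sum]
  have h2 : ∑ i, (S *ᵥ v) i ^ 2 ≤ C / K 0 * (n * h n ^ 2) * ∑ i, v i ^ 2 := by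
    have h3 : ∑ i, (S *ᵥ v) i ^ 2 = h n ^ 2 / K 0 * (K 0 / h n ^ 2 * ∑ i, (S *ᵥ v) i ^ 2) := by
      field_simp
    rw [h3]
    calc _ ≤ h n ^ 2 / K 0 * (C * n * ∑ i, v i ^ 2) := by gcongr
      _ = _ := by ring
  calc _ ≤ ∑ i, (2 * v i ^ 2 + 2 * (S *ᵥ v) i ^ 2) := by
        refine Finset.sum_le_sum fun i _ => ?_
        rw [Pi.sub_apply]
        nlinarith [sq_nonneg (v i + (S *ᵥ v) i)]
    _ = 2 * ∑ i, v i ^ 2 + 2 * ∑ i, (S *ᵥ v) i ^ 2 := by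
        rw [Finset.sum_add_distrib, Finset.mul_sum, Finset.mul_sum]
    _ ≤ 2 * ((n * h n ^ 2) * ∑ i, v i ^ 2) + 2 * (C / K 0 * (n * h n ^ 2) * ∑ i, v i ^ 2) := by
        have := le_mul_of_one_le_left hv hb
        linarith
    _ = _ := by ring

/-- The mean squared residual of the population fits. -/
def meanResid (h : ℕ → ℝ) (s : ℕ → Plane) (vb : ∀ n : ℕ, Fin n → ℝ)
    (θ : ∀ n : ℕ, Fin n → Fin p ⊕ Fin p × Fin 2 → ℝ) (n : ℕ) (x : ℕ → Fin p → ℝ) : ℝ :=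
  (n : ℝ)⁻¹ * ∑ i : Fin n, fitResid h s vb θ n i i (x i) ^ 2

lemma SampleCondition.memLp_fitResid_sq (hX : SampleCondition μ X ε σ) (n : ℕ) (i j : Fin n) :
    MemLp (fun ω => fitResid h s vb θ n i j (X j ω) ^ 2) 2 μ := by
  set ψ := localCoef (h n) (s j - s i) (θ n i) with hψ
  have hc : MemLp (fun _ : Ω => 2 * vb n j ^ 2) 2 μ := memLp_const _
  have hN : MemLp (fun ω => 2 * (ψ ⬝ᵥ ψ) * (X j ω ⬝ᵥ X j ω)) 2 μ :=
    (hX.memLp_normSq j).const_mul _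
  have hm : Measurable fun ω => fitResid h s vb θ n i j (X j ω) ^ 2 :=
    ((measurable_fitResid n i j).comp (hX.measurable_X j)).pow_const 2
  refine (hc.add hN).mono' hm.aestronglyMeasurable (Eventually.of_forall fun ω => ?_)
  rw [Real.norm_eq_abs, abs_of_nonneg (sq_nonneg _), fitResid, ← hψ]
  have := dotProduct_sq_le (X j ω) ψ
  simp only [Pi.add_apply]
  nlinarith [sq_nonneg (vb n j + X j ω ⬝ᵥ ψ)]

/-- Each summand depends on a single covariate vector, so the average obeys a weak law; boundedness
of `θ` and fourth moments give variance `O(1/n)`. -/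
lemma LocalRegime.tendsto_meanResid (hR : LocalRegime μ X s h K E c c' C L)
    (hX : SampleCondition μ X ε σ) {V Cθ : ℝ} (hvb : ∀ n j, |vb n j| ≤ V) (hCθ : 0 ≤ Cθ)
    (hθ : ∀ᶠ n : ℕ in atTop, ∀ i, θ n i ⬝ᵥ θ n i ≤ Cθ) :
    (∀ n, Integrable (fun ω => meanResid h s vb θ n fun i => X i ω) μ) ∧
    (∃ A : ℝ, ∀ᶠ n : ℕ in atTop, ∫ ω, meanResid h s vb θ n (fun i => X i ω) ∂μ ≤ A) ∧
    Tendsto (fun q : ℕ × Ω => meanResid h s vb θ q.1 (fun i => X i q.2)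
      - ∫ ω, meanResid h s vb θ q.1 (fun i => X i ω) ∂μ) (whp μ) (𝓝 0) := by
  set Cz := 2 * V ^ 2 + 6 * L ^ 2 * Cθ with hCz
  have hCz0 : 0 ≤ Cz := by positivity
  have hL2 := fun (n : ℕ) (i : Fin n) => hX.memLp_fitResid_sq (h := h) (s := s) (vb := vb)
    (θ := θ) n i i
  have hI := fun (n : ℕ) (i : Fin n) => (hL2 n i).integrable one_le_two
  have hint : ∀ n, ∫ ω, meanResid h s vb θ n (fun i => X i ω) ∂μ =
      (n : ℝ)⁻¹ * ∑ i : Fin n, ∫ ω, fitResid h s vb θ n i i (X i ω) ^ 2 ∂μ := by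
    intro n
    simp only [meanResid]
    rw [integral_const_mul, integral_finsetSum _ fun i _ => hI n i]
  refine ⟨fun n => (integrable_finsetSum _ fun i _ => hI n i).const_mul _,
    ⟨Cz * (1 + ∫ ω, X 0 ω ⬝ᵥ X 0 ω ∂μ), ?_⟩, ?_⟩
  · filter_upwards [hθ, eventually_gt_atTop 0] with n hn hn0
    have h0 : (0 : ℝ) < n := by exact_mod_cast hn0
    rw [hint]
    have h1 : ∀ i : Fin n, ∫ ω, fitResid h s vb θ n i i (X i ω) ^ 2 ∂μ ≤
        Cz * (1 + ∫ ω, X 0 ω ⬝ᵥ X 0 ω ∂μ) := by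
      intro i
      have h2 : Integrable (fun ω => X i ω ⬝ᵥ X i ω) μ := (hX.memLp_normSq i).integrable one_le_two
      refine (integral_mono (hI n i) (((integrable_const 1).add h2).const_mul Cz) fun ω =>
        hR.fitResid_sq_le hvb hCθ hn (hR.weight_self_pos n i).ne' _).trans (le_of_eq ?_)
      rw [integral_const_mul]
      congr 1
      rw [integral_add' (integrable_const 1) h2, hX.integral_normSq]
      simp
    calc _ ≤ (n : ℝ)⁻¹ * ∑ i : Fin n, Cz * (1 + ∫ ω, X 0 ω ⬝ᵥ X 0 ω ∂μ) :=
          mul_le_mul_of_nonneg_left (Finset.sum_le_sum fun i _ => h1 i) (by positivity)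
      _ = _ := by
          rw [Finset.sum_const, Finset.card_univ, Fintype.card_fin, nsmul_eq_mul]
          field_simp
  · set m4 := ∫ ω, (X 0 ω ⬝ᵥ X 0 ω) ^ 2 ∂μ with hm4
    have h1 := tendsto_whp_sum (μ := μ) (ι := fun n => Fin n)
      (η := fun n i ω => (n : ℝ)⁻¹ * (fitResid h s vb θ n i i (X i ω) ^ 2
        - ∫ ω, fitResid h s vb θ n i i (X i ω) ^ 2 ∂μ))
      (b := fun n => 2 * Cz ^ 2 * (1 + m4) * (n : ℝ)⁻¹)
      (fun n i => ((hL2 n i).sub (memLp_const _)).const_mul _)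
      (fun n i => by
        rw [integral_const_mul, integral_sub (hI n i) (integrable_const _)]; simp)
      (fun n i j hij => (hX.indep_X.indepFun fun h => hij (Fin.ext h)).comp
        ((((measurable_fitResid n i i).pow_const 2).sub_const _).const_mul _)
        ((((measurable_fitResid n j j).pow_const 2).sub_const _).const_mul _)) ?_
      (by
        have := (tendsto_inv_atTop_nhds_zero_nat (𝕜 := ℝ)).const_mul (2 * Cz ^ 2 * (1 + m4))
        rwa [mul_zero] at this)
    · refine h1.congr fun q => ?_
      rw [hint, meanResid, ← Finset.mul_sum, Finset.sum_sub_distrib, mul_sub]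
    · filter_upwards [hθ, eventually_gt_atTop 0] with n hn hn0
      have h0 : (0 : ℝ) < n := by exact_mod_cast hn0
      have h2 : ∀ i : Fin n, ∫ ω, ((n : ℝ)⁻¹ * (fitResid h s vb θ n i i (X i ω) ^ 2
          - ∫ ω, fitResid h s vb θ n i i (X i ω) ^ 2 ∂μ)) ^ 2 ∂μ ≤
          (n : ℝ)⁻¹ ^ 2 * (2 * Cz ^ 2 * (1 + m4)) := by
        intro i
        simp only [mul_pow]
        rw [integral_const_mul]
        refine mul_le_mul_of_nonneg_left ((integral_sub_mean_sq_le (hL2 n i)).trans ?_)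
          (by positivity)
        have h3 : Integrable (fun ω => (X i ω ⬝ᵥ X i ω) ^ 2) μ :=
          (hX.memLp_normSq i).integrable_sq
        refine (integral_mono (hL2 n i).integrable_sq
          (((integrable_const 1).add h3).const_mul (2 * Cz ^ 2)) fun ω => ?_).trans (le_of_eq ?_)
        · have h4 := hR.fitResid_sq_le hvb hCθ hn (hR.weight_self_pos n i).ne' (X i ω)
          refine (pow_le_pow_left₀ (sq_nonneg _) h4 2).trans ?_
          rw [mul_pow]
          simp only [Pi.add_apply]
          have : (1 + X i ω ⬝ᵥ X i ω) ^ 2 ≤ 2 * (1 + (X i ω ⬝ᵥ X i ω) ^ 2) := by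
            nlinarith [sq_nonneg (1 - X i ω ⬝ᵥ X i ω)]
          calc _ ≤ Cz ^ 2 * (2 * (1 + (X i ω ⬝ᵥ X i ω) ^ 2)) := by gcongr
            _ = _ := by ring
        · rw [integral_const_mul]
          congr 1
          rw [integral_add' (integrable_const 1) h3, hX.integral_normSq_sq]
          simp [hm4]
      refine (Finset.sum_le_sum fun i _ => h2 i).trans (le_of_eq ?_)
      rw [Finset.sum_const, Finset.card_univ, Fintype.card_fin, nsmul_eq_mul]
      field_simp

end SignalLimit

/-! ### From the expected to the actual smoothed signal -/

section SignalConclusion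

variable {Ω : Type*} [MeasurableSpace Ω] {μ : Measure Ω} [IsProbabilityMeasure μ]
  {p : ℕ} {X : ℕ → Ω → Fin p → ℝ} {ε : ℕ → Ω → ℝ} {σ : ℝ}
  {s : ℕ → Plane} {h : ℕ → ℝ} {K : ℝ → ℝ} {E : ℕ → Set (ℕ → Fin p → ℝ)} {c c' C L : ℝ}
  {ρ : ℕ → ℝ} {G : ∀ n : ℕ, Matrix (Fin n) (Fin n) ℝ} {CG : ℝ}
  {β : Plane → Fin p → ℝ} {B : ℝ}

/-- `(ρ / n) ‖(I - S) G m‖²` as a function of the covariates. -/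
def smoothedSignal (K : ℝ → ℝ) (h : ℕ → ℝ) (G : ∀ n : ℕ, Matrix (Fin n) (Fin n) ℝ) (ρ : ℕ → ℝ)
    (β : Plane → Fin p → ℝ) (s : ℕ → Plane) (n : ℕ) (x : ℕ → Fin p → ℝ) : ℝ :=
  ρ n / n * ((G n *ᵥ meanVec n β s x - smoother K (h n) n x s *ᵥ (G n *ᵥ meanVec n β s x)) ⬝ᵥ
    (G n *ᵥ meanVec n β s x - smoother K (h n) n x s *ᵥ (G n *ᵥ meanVec n β s x)))

lemma smoothedSignal_eq (hρ : ∀ n, 0 < ρ n) (n : ℕ) (x : ℕ → Fin p → ℝ) :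
    smoothedSignal K h G ρ β s n x = (n : ℝ)⁻¹ * ∑ i, (signal G ρ β s n x
      - smoother K (h n) n x s *ᵥ signal G ρ β s n x) i ^ 2 := by
  have h1 : signal G ρ β s n x - smoother K (h n) n x s *ᵥ signal G ρ β s n x =
      Real.sqrt (ρ n) • (G n *ᵥ meanVec n β s x
        - smoother K (h n) n x s *ᵥ (G n *ᵥ meanVec n β s x)) := by
    rw [signal, Matrix.mulVec_smul, smul_sub]
  rw [h1, smoothedSignal]
  simp only [Pi.smul_apply, smul_eq_mul, mul_pow, Real.sq_sqrt (hρ n).le]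
  rw [← Finset.mul_sum, dotProduct]
  simp only [← sq]
  ring

lemma integrable_add_and_le {f g : Ω → ℝ} {a b : ℝ} (hf : Integrable f μ ∧ ∫ ω, f ω ∂μ ≤ a)
    (hg : Integrable g μ ∧ ∫ ω, g ω ∂μ ≤ b) :
    Integrable (fun ω => f ω + g ω) μ ∧ ∫ ω, f ω + g ω ∂μ ≤ a + b := by
  refine ⟨hf.1.add hg.1, ?_⟩
  rw [integral_add hf.1 hg.1]
  exact add_le_add hf.2 hg.2

lemma integrable_const_mul_and_le {f : Ω → ℝ} {a k : ℝ} (hk : 0 ≤ k)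
    (hf : Integrable f μ ∧ ∫ ω, f ω ∂μ ≤ a) :
    Integrable (fun ω => k * f ω) μ ∧ ∫ ω, k * f ω ∂μ ≤ k * a := by
  refine ⟨hf.1.const_mul k, ?_⟩
  rw [integral_const_mul]
  exact mul_le_mul_of_nonneg_left hf.2 hk

/-- Deterministic leading part and remainder of the smoothed signal. -/
lemma LocalRegime.exists_signal_majorant (hR : LocalRegime μ X s h K E c c' C L)
    (hX : SampleCondition μ X ε σ) (hρ : ∀ n, 0 < ρ n) (hρt : Tendsto ρ atTop atTop)
    (hG : SmallRows G ρ CG) (hB : ∀ i, β (s i) ⬝ᵥ β (s i) ≤ B) :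
    ∃ (T D : ℕ → (ℕ → Fin p → ℝ) → ℝ) (t b : ℕ → ℝ) (A A' : ℝ),
      (∀ n x, 0 ≤ T n x) ∧ (∀ n x, 0 ≤ D n x) ∧ Tendsto b atTop (𝓝 0) ∧
      (∀ᶠ n in atTop, t n ≤ A) ∧
      (∀ n, Integrable (fun ω => T n fun i => X i ω) μ ∧ ∫ ω, T n (fun i => X i ω) ∂μ = t n) ∧
      (∀ᶠ n in atTop, Integrable (fun ω => D n fun i => X i ω) μ ∧
        ∫ ω, D n (fun i => X i ω) ∂μ ≤ b n) ∧
      Tendsto (fun q : ℕ × Ω => T q.1 (fun i => X i q.2) - t q.1) (whp μ) (𝓝 0) ∧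
      (∀ᶠ n in atTop, ∀ x ∈ E n, ∀ δ : ℝ, 0 < δ →
        |smoothedSignal K h G ρ β s n x - T n x| ≤ δ * T n x + (1 + δ⁻¹) * D n x) ∧
      (∀ᶠ n : ℕ in atTop, ∀ x, smoothedSignal K h G ρ β s n x ≤
        A' * (n * h n ^ 2) * ((n : ℝ)⁻¹ * ∑ j, signal G ρ β s n x j ^ 2)) := by
  -- The mean signal: `signal` is linear in the covariates, so replacing them by their mean gives
  -- its expectation.
  set vb : ∀ n : ℕ, Fin n → ℝ := fun n => signal G ρ β s n fun _ => firstMoment μ (X 0) with hvb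
  have hV := signal_const_sq_le hρ hG hB (firstMoment μ (X 0))
  obtain ⟨θ, Cθ, hCθ, hθ⟩ := hR.exists_population_fit hX.posDef (firstMoment μ (X 0))
    (vb := vb) hV
  have hθ1 : ∀ᶠ n : ℕ in atTop, ∀ i, θ n i ⬝ᵥ θ n i ≤ Cθ := hθ.mono fun n hn i => (hn i).1
  obtain ⟨AS, hAS, hsig⟩ := hX.integral_signal_sub_le hρ hG hB
  obtain ⟨A1, hA1⟩ := hR.integral_diagError_le hX hV hCθ hθ1
  obtain ⟨A2, hA2⟩ := hR.integral_scoreError_le hX hV hCθ hθ1 (hθ.mono fun n hn i => (hn i).2)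
  obtain ⟨hT1, ⟨A, hT2⟩, hT3⟩ := hR.tendsto_meanResid hX hV hCθ hθ1
  obtain ⟨A', hA', hres⟩ := hR.exists_resid_sq_le
  refine ⟨meanResid h s vb θ, fun n x => fitError c K h s vb θ n x (signal G ρ β s n x),
    fun n => ∫ ω, meanResid h s vb θ n (fun i => X i ω) ∂μ,
    fun n => 4 * (AS / Real.sqrt (ρ n) + C / c * (AS / Real.sqrt (ρ n))
      + A1 * ((n : ℝ) * h n ^ 2)⁻¹ + A2 * ((n : ℝ) * h n ^ 2)⁻¹), A, A',
    fun n x => mul_nonneg (by positivity) (Finset.sum_nonneg fun i _ => sq_nonneg _),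
    fun n x => ?_, ?_, hT2, fun n => ⟨hT1 n, rfl⟩, ?_, hT3, ?_, ?_⟩
  · refine mul_nonneg (by norm_num) (add_nonneg (add_nonneg (add_nonneg
      (mul_nonneg (by positivity) (Finset.sum_nonneg fun i _ => sq_nonneg _))
      (hR.smoothBound_nonneg _ _ _)) ?_) ?_)
    · have := hR.c_pos
      exact mul_nonneg (by positivity) (Finset.sum_nonneg fun i _ => mul_nonneg
        (div_nonneg (dot_self_nonneg _) (by positivity))
        (mul_nonneg (hR.weight_nonneg _ _ _) (sq_nonneg _)))
    · exact mul_nonneg (by positivity) (Finset.sum_nonneg fun i _ => mul_nonneg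
        (div_nonneg (dot_self_nonneg _) (by positivity))
        (Finset.sum_nonneg fun k _ => sq_nonneg _))
  · have h1 : Tendsto (fun n => AS / Real.sqrt (ρ n)) atTop (𝓝 0) := by
      have := (tendsto_inv_sqrt hρt).const_mul AS
      rwa [mul_zero] at this
    have h2 := tendsto_inv_atTop_zero.comp hR.bandwidth
    have h3 := (((h1.add (h1.const_mul (C / c))).add (h2.const_mul A1)).add
      (h2.const_mul A2)).const_mul 4
    simpa using h3
  · filter_upwards [hA1, hA2, hR.integral_smoothBound_le, eventually_gt_atTop 0]
      with n h1 h2 h3 hn0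
    have h0 : (0 : ℝ) < n := by exact_mod_cast hn0
    have h4 := h3 (fun ω _ j => signal G ρ β s n (fun k => X k ω) j - vb n j)
      (AS / Real.sqrt (ρ n)) (by positivity) (fun i j _ => (hsig n i j).2)
    have h5 : Integrable (fun ω => (n : ℝ)⁻¹ *
        ∑ i, (signal G ρ β s n (fun k => X k ω) i - vb n i) ^ 2) μ :=
      (integrable_finsetSum _ fun i _ => (hsig n i i).1.1).const_mul _
    have h6 : ∫ ω, (n : ℝ)⁻¹ * ∑ i, (signal G ρ β s n (fun k => X k ω) i - vb n i) ^ 2 ∂μ ≤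
        AS / Real.sqrt (ρ n) := by
      rw [integral_const_mul, integral_finsetSum _ fun i _ => (hsig n i i).1.1]
      calc _ ≤ (n : ℝ)⁻¹ * ∑ i : Fin n, AS / Real.sqrt (ρ n) :=
            mul_le_mul_of_nonneg_left (Finset.sum_le_sum fun i _ => (hsig n i i).1.2)
              (by positivity)
        _ = _ := by
            rw [Finset.sum_const, Finset.card_univ, Fintype.card_fin, nsmul_eq_mul]
            field_simp
    simp only [fitError]
    exact integrable_const_mul_and_le (by norm_num) (integrable_add_and_le (integrable_add_and_le
      (integrable_add_and_le ⟨h5, h6⟩ h4) h1) h2)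
  · filter_upwards [hR.exists_decomposition (vb := vb) (θ := θ)] with n hn x hx δ hδ
    obtain ⟨d, hd, hdle⟩ := hn x hx (signal G ρ β s n x)
    rw [smoothedSignal_eq hρ]
    set a : Fin n → ℝ := fun i => fitResid h s vb θ n i i (x i) with ha
    have e : (n : ℝ)⁻¹ * ∑ i, (signal G ρ β s n x
        - smoother K (h n) n x s *ᵥ signal G ρ β s n x) i ^ 2 - meanResid h s vb θ n x =
        (n : ℝ)⁻¹ * ∑ i, (2 * a i * d i + d i ^ 2) := by
      rw [meanResid, ← mul_sub, ← Finset.sum_sub_distrib]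
      congr 1
      refine Finset.sum_congr rfl fun i _ => ?_
      rw [hd i]; simp only [ha]; ring
    rw [e, abs_mul, abs_of_nonneg (by positivity : (0 : ℝ) ≤ (n : ℝ)⁻¹)]
    calc _ ≤ (n : ℝ)⁻¹ * ∑ i, (δ * a i ^ 2 + (1 + δ⁻¹) * d i ^ 2) := by
          refine mul_le_mul_of_nonneg_left ((Finset.abs_sum_le_sum_abs _ _).trans
            (Finset.sum_le_sum fun i _ => ?_)) (by positivity)
          -- Young's inequality with a free `δ`: the leading part is only bounded whereas the
          -- remainder tends to zero, so `δ` can later be fixed according to the required accuracy.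
          have h1 : |2 * a i * d i| ≤ δ * a i ^ 2 + δ⁻¹ * d i ^ 2 := by
            have h2 : δ * (a i + δ⁻¹ * d i) ^ 2 = δ * a i ^ 2 + δ⁻¹ * d i ^ 2 + 2 * a i * d i := by
              field_simp; ring
            have h3 : δ * (a i - δ⁻¹ * d i) ^ 2 = δ * a i ^ 2 + δ⁻¹ * d i ^ 2 - 2 * a i * d i := by
              field_simp; ring
            have h4 := mul_nonneg hδ.le (sq_nonneg (a i + δ⁻¹ * d i))
            have h5 := mul_nonneg hδ.le (sq_nonneg (a i - δ⁻¹ * d i))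
            rw [abs_le]
            constructor <;> linarith
          calc _ ≤ |2 * a i * d i| + |d i ^ 2| := abs_add_le _ _
            _ ≤ _ := by
                rw [abs_of_nonneg (sq_nonneg (d i))]
                linarith
      _ = δ * ((n : ℝ)⁻¹ * ∑ i, a i ^ 2) + (1 + δ⁻¹) * ((n : ℝ)⁻¹ * ∑ i, d i ^ 2) := by
          rw [Finset.sum_add_distrib, ← Finset.mul_sum, ← Finset.mul_sum]; ring
      _ ≤ _ := by
          have : 0 ≤ 1 + δ⁻¹ := by positivity
          exact add_le_add le_rfl (mul_le_mul_of_nonneg_left hdle this)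
  · filter_upwards [hres] with n hn x
    rw [smoothedSignal_eq hρ]
    calc _ ≤ (n : ℝ)⁻¹ * (A' * (n * h n ^ 2) * ∑ i, signal G ρ β s n x i ^ 2) :=
          mul_le_mul_of_nonneg_left (hn x _) (by positivity)
      _ = _ := by ring

lemma smoothedSignal_nonneg (hρ : ∀ n, 0 < ρ n) (n : ℕ) (x : ℕ → Fin p → ℝ) :
    0 ≤ smoothedSignal K h G ρ β s n x := by
  rw [smoothedSignal_eq hρ]
  exact mul_nonneg (by positivity) (Finset.sum_nonneg fun i _ => sq_nonneg _)

/-- The expectation is at most `2 t n + o(1)`, with the bad event contributing negligibly, so its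
limit `lam > 0` forces `t n` away from zero. As the smoothed signal is concentrated around `t n`,
the lower bound passes to probability; convergence of `t n` itself is not needed. -/
lemma LocalRegime.exists_signal_limit (hR : LocalRegime μ X s h K E c c' C L)
    (hX : SampleCondition μ X ε σ) (hρ : ∀ n, 0 < ρ n) (hρt : Tendsto ρ atTop atTop)
    (hG : SmallRows G ρ CG) (hB : ∀ i, β (s i) ⬝ᵥ β (s i) ≤ B) {lam : ℝ} (hlam : 0 < lam)
    (hlim : Tendsto (fun n => ∫ ω, smoothedSignal K h G ρ β s n (fun i => X i ω) ∂μ) atTop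
      (𝓝 lam)) (hρn : Tendsto (fun n : ℕ => ρ n / n) atTop (𝓝 0)) :
    ∃ (t : ℕ → ℝ) (A : ℝ), (∀ᶠ n in atTop, lam / 4 ≤ t n) ∧ (∀ᶠ n in atTop, t n ≤ A) ∧
      Tendsto (fun q : ℕ × Ω => smoothedSignal K h G ρ β s q.1 (fun i => X i q.2) - t q.1)
        (whp μ) (𝓝 0) ∧
      Tendsto (fun q : ℕ × Ω => ρ q.1 / q.1 * (noiseAt ε q ⬝ᵥ
        (G q.1 *ᵥ meanVec q.1 β s (fun i => X i q.2) - smootherAt K h s X q *ᵥ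
          (G q.1 *ᵥ meanVec q.1 β s (fun i => X i q.2))))) (whp μ) (𝓝 0) := by
  obtain ⟨T, D, t, b, A, A', hT0, hD0, hb, htA, hT, hD, hTt, hQT, hQ⟩ :=
    hR.exists_signal_majorant hX hρ hρt hG hB
  obtain ⟨AV, hV⟩ := hX.integral_signal_meanSq_le hρ hG hB
  have hQ2 : ∀ᶠ n in atTop, ∀ x ∈ E n,
      smoothedSignal K h G ρ β s n x ≤ 2 * T n x + 2 * D n x := by
    filter_upwards [hQT] with n hn x hx
    have := (abs_le.mp (hn x hx 1 one_pos)).2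
    norm_num at this
    linarith
  have hDt : Tendsto (fun q : ℕ × Ω => D q.1 fun i => X i q.2) (whp μ) (𝓝 0) :=
    tendsto_whp_of_integral (μ := μ) (f := fun n ω => D n fun i => X i ω)
      (G := fun n ω => D n fun i => X i ω) (b := b)
      (Eventually.of_forall fun q => (abs_of_nonneg (hD0 _ _)).le) (fun n ω => hD0 _ _) hD hb
  refine ⟨t, A, ?_, htA, ?_, ?_⟩
  -- The cube of `κ = n h²` comes from the crude bound `A' κ V` outside `E n`, where `V` is the mean
  -- square of the signal: splitting `κ V` against a bounded second moment of `V` costs `κ³` times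
  -- the probability.
  · set P : ℕ → ℝ := fun n => (n * h n ^ 2) ^ 3 * μ.real {ω | (fun i => X i ω) ∉ E n} with hP
    have hmeasE : ∀ n, MeasurableSet {ω | (fun i => X i ω) ∉ E n} := fun n =>
      hX.measurable_seq (hR.meas n).compl
    have hup : ∀ᶠ n : ℕ in atTop, ∫ ω, smoothedSignal K h G ρ β s n (fun i => X i ω) ∂μ ≤
        2 * t n + 2 * b n + |A'| / 2 * (P n + AV * (n * h n ^ 2)⁻¹) := by
      filter_upwards [hQ2, hQ, hD, hR.bandwidth.eventually_ge_atTop 1, eventually_gt_atTop 0]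
        with n h1 h2 h3 h4 hn0
      set κ : ℝ := n * h n ^ 2 with hκ
      have hκ0 : 0 < κ := by linarith
      set Vn : Ω → ℝ := fun ω => (n : ℝ)⁻¹ * ∑ j, signal G ρ β s n (fun k => X k ω) j ^ 2 with hVn
      set I : Ω → ℝ := {ω | (fun i => X i ω) ∉ E n}.indicator fun _ => (1 : ℝ) with hI
      have hI1 : Integrable I μ := (integrable_const _).indicator (hmeasE n)
      have hI2 : ∫ ω, I ω ∂μ = μ.real {ω | (fun i => X i ω) ∉ E n} := by
        rw [hI, integral_indicator_const _ (hmeasE n)]; simp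
      have hV2 := hV n hn0
      have hTn := hT n
      have hmaj := integrable_add_and_le (integrable_add_and_le
        (integrable_const_mul_and_le two_pos.le ⟨hTn.1, hTn.2.le⟩)
        (integrable_const_mul_and_le two_pos.le h3)) (integrable_const_mul_and_le
          (show 0 ≤ |A'| / 2 by positivity) (integrable_add_and_le
            (integrable_const_mul_and_le (pow_pos hκ0 3).le ⟨hI1, hI2.le⟩)
            (integrable_const_mul_and_le (inv_nonneg.mpr hκ0.le) hV2)))
      refine (integral_mono_of_nonneg (Eventually.of_forall fun ω =>
        smoothedSignal_nonneg hρ n _) hmaj.1 (Eventually.of_forall fun ω => ?_)).trans ?_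
      · have hT' := hT0 n fun i => X i ω
        have hD' := hD0 n fun i => X i ω
        by_cases hω : (fun i => X i ω) ∈ E n
        · have h5 := h1 _ hω
          have h6 : 0 ≤ |A'| / 2 * (κ ^ 3 * I ω + κ⁻¹ * Vn ω ^ 2) := by
            have : 0 ≤ I ω := Set.indicator_nonneg (fun _ _ => zero_le_one) _
            positivity
          simp only
          linarith
        · have h5 := h2 fun i => X i ω
          have h6 : I ω = 1 := Set.indicator_of_mem (show ω ∈ {ω | (fun i => X i ω) ∉ E n} from hω) _
          have hV0 : 0 ≤ Vn ω :=
            mul_nonneg (by positivity) (Finset.sum_nonneg fun i _ => sq_nonneg _)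
          -- Weights chosen so that both parts vanish in the mean: `κ³` times the probability tends
          -- to zero, and `κ⁻¹` times a bounded second moment does too.
          have h7 : κ * Vn ω ≤ (κ ^ 3 + κ⁻¹ * Vn ω ^ 2) / 2 := by
            have h8 : κ⁻¹ * (κ ^ 2 - Vn ω) ^ 2 = κ ^ 3 + κ⁻¹ * Vn ω ^ 2 - 2 * (κ * Vn ω) := by
              field_simp; ring
            have h9 := mul_nonneg (inv_nonneg.mpr hκ0.le) (sq_nonneg (κ ^ 2 - Vn ω))
            linarith
          have h8 : A' * κ * Vn ω ≤ |A'| * (κ * Vn ω) := by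
            rw [mul_assoc]
            exact mul_le_mul_of_nonneg_right (le_abs_self _) (by positivity)
          have h9 := mul_le_mul_of_nonneg_left h7 (abs_nonneg A')
          simp only [h6, mul_one]
          simp only [hVn] at h8 h9 ⊢
          linarith
      · refine hmaj.2.trans (le_of_eq ?_)
        simp only [hP]
        ring
    have hrest : Tendsto (fun n : ℕ => 2 * b n + |A'| / 2 * (P n + AV * (n * h n ^ 2)⁻¹)) atTop
        (𝓝 0) := by
      have h1 := (hb.const_mul 2).add ((hR.prob.add
        ((tendsto_inv_atTop_zero.comp hR.bandwidth).const_mul AV)).const_mul (|A'| / 2))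
      simpa using h1
    -- From `3 lam / 4 ≤ expectation ≤ 2 t n + lam / 4` follows `t n ≥ lam / 4`.
    filter_upwards [hup, hrest.eventually (ge_mem_nhds (show 0 < lam / 4 by positivity)),
      hlim.eventually (le_mem_nhds (show 3 * lam / 4 < lam by linarith))] with n h1 h2 h3
    linarith
  · rw [Metric.tendsto_nhds]
    intro e he
    set A0 := |A| + 1 with hA0
    have hA0p : 0 < A0 := by positivity
    set δ := e / (4 * A0) with hδ
    have hδp : 0 < δ := by positivity
    have h1 : ∀ᶠ q in whp μ, D q.1 (fun i => X i q.2) < e / (4 * (1 + δ⁻¹)) :=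
      hDt.eventually (gt_mem_nhds (by positivity))
    have h2 := (Metric.tendsto_nhds.mp hTt) (min 1 (e / 4)) (by positivity)
    filter_upwards [h1, h2, hR.whp_mem, tendsto_fst_whp.eventually hQT,
      tendsto_fst_whp.eventually htA] with q h1 h2 h3 h4 h5
    rw [Real.dist_eq, sub_zero] at h2 ⊢
    have h6 := h4 _ h3 δ hδp
    have h7 := (lt_min_iff.mp h2).1
    have h8 := (lt_min_iff.mp h2).2
    have h9 : T q.1 (fun i => X i q.2) ≤ A0 := by
      have := (abs_lt.mp h7).2
      have := le_abs_self A
      linarith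
    have h10 : δ * T q.1 (fun i => X i q.2) ≤ e / 4 := by
      calc _ ≤ δ * A0 := mul_le_mul_of_nonneg_left h9 hδp.le
        _ = _ := by rw [hδ]; field_simp
    have h11 : (1 + δ⁻¹) * D q.1 (fun i => X i q.2) ≤ e / 4 := by
      have h12 : 0 < 1 + δ⁻¹ := by positivity
      calc _ ≤ (1 + δ⁻¹) * (e / (4 * (1 + δ⁻¹))) := mul_le_mul_of_nonneg_left h1.le h12.le
        _ = _ := by field_simp
    have h13 := abs_sub_le (smoothedSignal K h G ρ β s q.1 fun i => X i q.2)
      (T q.1 fun i => X i q.2) (t q.1)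
    linarith
  -- Given the covariates, this cross term is centred with variance `σ² (ρ/n)` times the smoothed
  -- signal, which is bounded in the mean on `E n`, while `ρ/n → 0`.
  · refine tendsto_zero_of_sq ?_
    set r : ∀ n : ℕ, (ℕ → Fin p → ℝ) → Fin n → ℝ := fun n x =>
      G n *ᵥ meanVec n β s x - smoother K (h n) n x s *ᵥ (G n *ᵥ meanVec n β s x) with hr
    have hrm : ∀ n j, Measurable fun x => r n x j := by
      intro n j
      have hx : ∀ (k : ℕ) (a : Fin p), Measurable fun x : ℕ → Fin p → ℝ => x k a := fun k a =>
        (measurable_pi_apply a).comp (measurable_pi_apply (X := fun _ : ℕ => Fin p → ℝ) k)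
      have h1 : ∀ i, Measurable fun x : ℕ → Fin p → ℝ => (G n *ᵥ meanVec n β s x) i := fun i => by
        simp only [Matrix.mulVec, meanVec, dotProduct]
        refine Finset.measurable_fun_sum _ fun k _ => Measurable.const_mul ?_ _
        exact Finset.measurable_fun_sum _ fun a _ => (hx _ _).mul_const _
      simp only [hr, Pi.sub_apply]
      refine (h1 j).sub ?_
      rw [show (fun x : ℕ → Fin p → ℝ => (smoother K (h n) n x s *ᵥ (G n *ᵥ meanVec n β s x)) j) =
        fun x => ∑ i, smoother K (h n) n x s j i * (G n *ᵥ meanVec n β s x) i from rfl]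
      exact Finset.measurable_fun_sum _ fun i _ => (measurable_smoother K (h n) s j i).mul (h1 i)
    have h1 := hR.tendsto_noise hX (ι := fun _ => Unit)
      (A := fun n x _ j => ρ n / n * r n x j) (fun n _ j => (hrm n j).const_mul _)
      (g := fun n x => ρ n / n * (2 * T n x + 2 * D n x))
      (b := fun n => ρ n / n * (2 * A + 2 * b n))
      (fun n x => mul_nonneg (div_nonneg (hρ n).le (Nat.cast_nonneg _))
        (add_nonneg (mul_nonneg two_pos.le (hT0 _ _)) (mul_nonneg two_pos.le (hD0 _ _)))) ?_ ?_ ?_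
    · refine h1.congr fun q => ?_
      rw [Fintype.sum_unique]
      congr 1
      simp only [dotProduct, Finset.mul_sum]
      exact Finset.sum_congr rfl fun j _ => by simp only [noiseAt, smootherAt, hr]; ring
    · filter_upwards [hQ2] with n hn x hx
      rw [Fintype.sum_unique]
      have h2 : ∑ j, (ρ n / n * r n x j) ^ 2 = ρ n / n * smoothedSignal K h G ρ β s n x := by
        simp only [smoothedSignal, hr, mul_pow, dotProduct]
        rw [← Finset.mul_sum]
        simp only [sq]
        ring
      rw [h2]
      exact mul_le_mul_of_nonneg_left (hn x hx) (div_nonneg (hρ n).le (Nat.cast_nonneg _))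
    · filter_upwards [hD, htA] with n h2 h3
      have h4 := hT n
      exact integrable_const_mul_and_le (div_nonneg (hρ n).le (Nat.cast_nonneg _))
        (integrable_add_and_le (integrable_const_mul_and_le two_pos.le ⟨h4.1, h4.2.le.trans h3⟩)
          (integrable_const_mul_and_le two_pos.le h2))
    · have h2 := hρn.mul ((hb.const_mul 2).const_add (2 * A))
      rwa [zero_mul] at h2

end SignalConclusion

/-! ### The coefficients of the profile variance -/

section Coefficients

variable {Ω : Type*} [MeasurableSpace Ω] {μ : Measure Ω} [IsProbabilityMeasure μ]
  {p : ℕ} {X : ℕ → Ω → Fin p → ℝ} {ε : ℕ → Ω → ℝ} {σ : ℝ}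
  {s : ℕ → Plane} {h : ℕ → ℝ} {K : ℝ → ℝ} {E : ℕ → Set (ℕ → Fin p → ℝ)} {c c' C L : ℝ}
  {ρ : ℕ → ℝ} {G : ∀ n : ℕ, Matrix (Fin n) (Fin n) ℝ} {CG : ℝ}
  {β : Plane → Fin p → ℝ} {B : ℝ} {R : Set Plane}

/-- Cauchy–Schwarz: of the two factors only one has to be negligible, the other merely bounded with
high probability. -/
lemma tendsto_dot_of_bounded {l : Filter (ℕ × Ω)} {κ : ℕ × Ω → ℝ}
    {u v : ∀ q : ℕ × Ω, Fin q.1 → ℝ} (hu : Tendsto (fun q => κ q * (u q ⬝ᵥ u q)) l (𝓝 0))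
    {A : ℝ} (hv : ∀ᶠ q in l, |κ q * (v q ⬝ᵥ v q)| ≤ A) :
    Tendsto (fun q => κ q * (u q ⬝ᵥ v q)) l (𝓝 0) := by
  refine tendsto_zero_of_sq ?_
  have h1 := (hu.abs).mul_const A
  simp only [abs_zero, zero_mul] at h1
  refine squeeze_zero' (Eventually.of_forall fun q => sq_nonneg _) ?_ h1
  filter_upwards [hv] with q hq
  calc _ = κ q ^ 2 * (u q ⬝ᵥ v q) ^ 2 := mul_pow _ _ _
    _ ≤ κ q ^ 2 * ((u q ⬝ᵥ u q) * (v q ⬝ᵥ v q)) :=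
        mul_le_mul_of_nonneg_left (dotProduct_sq_le _ _) (sq_nonneg _)
    _ = (κ q * (u q ⬝ᵥ u q)) * (κ q * (v q ⬝ᵥ v q)) := by ring
    _ ≤ |κ q * (u q ⬝ᵥ u q)| * |κ q * (v q ⬝ᵥ v q)| := by
        rw [← abs_mul]; exact le_abs_self _
    _ ≤ _ := mul_le_mul_of_nonneg_left hq (abs_nonneg _)

lemma eventually_abs_le_of_tendsto {α : Type*} {l : Filter α} {f : α → ℝ} {a : ℝ}
    (hf : Tendsto f l (𝓝 a)) : ∀ᶠ q in l, |f q| ≤ |a| + 1 :=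
  hf.abs.eventually (ge_mem_nhds (lt_add_one _))

lemma tendsto_dot_sub {l : Filter (ℕ × Ω)} {κ : ℕ × Ω → ℝ}
    {u v : ∀ q : ℕ × Ω, Fin q.1 → ℝ} (hu : Tendsto (fun q => κ q * (u q ⬝ᵥ u q)) l (𝓝 0))
    (hv : Tendsto (fun q => κ q * (v q ⬝ᵥ v q)) l (𝓝 0)) :
    Tendsto (fun q => κ q * ((u q - v q) ⬝ᵥ (u q - v q))) l (𝓝 0) := by
  have h1 := tendsto_dot_of_bounded hu (eventually_abs_le_of_tendsto hv)
  have h2 := (hu.add hv).sub (h1.const_mul 2)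
  simp only [add_zero, mul_zero, sub_zero] at h2
  refine h2.congr fun q => ?_
  rw [sub_dotProduct, dotProduct_sub, dotProduct_sub, dotProduct_comm (v q) (u q)]
  ring

/-- The residuals `(I - S)(m + ε)`. -/
def residNull (β : Plane → Fin p → ℝ) (K : ℝ → ℝ) (h : ℕ → ℝ) (s : ℕ → Plane)
    (X : ℕ → Ω → Fin p → ℝ) (ε : ℕ → Ω → ℝ) (q : ℕ × Ω) : Fin q.1 → ℝ :=
  (meanVec q.1 β s (fun i => X i q.2) + noiseAt ε q)
    - smootherAt K h s X q *ᵥ (meanVec q.1 β s (fun i => X i q.2) + noiseAt ε q)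

/-- The residuals `(I - S) G (m + ε)`. -/
def residSlope (G : ∀ n : ℕ, Matrix (Fin n) (Fin n) ℝ) (β : Plane → Fin p → ℝ) (K : ℝ → ℝ)
    (h : ℕ → ℝ) (s : ℕ → Plane) (X : ℕ → Ω → Fin p → ℝ) (ε : ℕ → Ω → ℝ) (q : ℕ × Ω) :
    Fin q.1 → ℝ :=
  G q.1 *ᵥ (meanVec q.1 β s (fun i => X i q.2) + noiseAt ε q)
    - smootherAt K h s X q *ᵥ (G q.1 *ᵥ (meanVec q.1 β s (fun i => X i q.2) + noiseAt ε q))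

/-- Write `r₀ = ε + u`, with `u` consisting of bias and smoothed noise, and `r₁ = g + k`, with `g`
the smoothed signal and `k` the noise part. At the scale `n/ρ` both `u` and `k` are negligible. Only
`g · g` survives in the quadratic coefficient, and only the trace part of `ε · G ε` in the linear
one. -/
lemma LocalRegime.exists_coefficient_limits (hR : LocalRegime μ X s h K E c c' C L)
    (hX : SampleCondition μ X ε σ) (hRc : IsCompact R) (hβ : SmoothCoefficients R β)
    (hs : ∀ i, s i ∈ R) (hρ : ∀ n, 0 < ρ n) (hρt : Tendsto ρ atTop atTop)
    (hG : SmallRows G ρ CG) {lam : ℝ} (hlam : 0 < lam)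
    (hlim : Tendsto (fun n => ∫ ω, smoothedSignal K h G ρ β s n (fun i => X i ω) ∂μ) atTop
      (𝓝 lam))
    (hρh : Tendsto (fun n : ℕ => ρ n * h n ^ 4) atTop (𝓝 0))
    (hb : Tendsto (fun n : ℕ => (n : ℝ) * h n ^ 2 / ρ n) atTop atTop) :
    Tendsto (fun q : ℕ × Ω => (q.1 : ℝ)⁻¹ * (residNull β K h s X ε q ⬝ᵥ residNull β K h s X ε q))
      (whp μ) (𝓝 (σ ^ 2)) ∧
    Tendsto (fun q : ℕ × Ω => ρ q.1 / q.1 * (residNull β K h s X ε q ⬝ᵥ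
      residSlope G β K h s X ε q) - σ ^ 2 * (ρ q.1 / q.1 * (G q.1).trace)) (whp μ) (𝓝 0) ∧
    ∃ A : ℝ, ∀ᶠ q : ℕ × Ω in whp μ, lam / 8 ≤ ρ q.1 / q.1 * (residSlope G β K h s X ε q ⬝ᵥ
        residSlope G β K h s X ε q) ∧
      ρ q.1 / q.1 * (residSlope G β K h s X ε q ⬝ᵥ residSlope G β K h s X ε q) ≤ A := by
  obtain ⟨B, hB0, hB⟩ := hβ.exists_bound hRc
  have hρn : Tendsto (fun n : ℕ => ρ n / n) atTop (𝓝 0) := by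
    -- `ρ/n` is the product of `ρ/(n h²)` and `h²`, both of which tend to zero.
    have h1 := (tendsto_inv_of_ratio hb).mul (hR.h_tendsto.pow 2)
    simp only [zero_pow two_ne_zero, mul_zero] at h1
    refine h1.congr fun n => ?_
    have := (hR.h_pos n).ne'
    rcases eq_or_ne (n : ℝ) 0 with h0 | h0
    · simp [h0]
    · field_simp
  obtain ⟨t, A, ht1, ht2, hQ, hcross⟩ := hR.exists_signal_limit hX hρ hρt hG
    (fun i => hB _ (hs i)) hlam hlim hρn
  obtain ⟨hSe, hSte⟩ := hR.tendsto_smoother_noise hX hρ hb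
  have hGe := hR.tendsto_G_noise hX hρ hρt hG
  have hSGe := hR.tendsto_smoother_G_noise hX hρ hρt hG
  have hee := hX.tendsto_noise_sq
  have hquad := hX.tendsto_quadratic hρ hρt hG hρn
  have hbias := hR.tendsto_bias hX hRc hβ hs hρ hρh
  set κ : ℕ × Ω → ℝ := fun q => ρ q.1 / q.1 with hκ
  set e : ∀ q : ℕ × Ω, Fin q.1 → ℝ := noiseAt ε with he
  set S := smootherAt K h s X with hS
  set m : ∀ q : ℕ × Ω, Fin q.1 → ℝ := fun q => meanVec q.1 β s fun i => X i q.2 with hm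
  set u : ∀ q : ℕ × Ω, Fin q.1 → ℝ := fun q => (m q - S q *ᵥ m q) - S q *ᵥ e q with hu
  set g : ∀ q : ℕ × Ω, Fin q.1 → ℝ := fun q =>
    G q.1 *ᵥ m q - S q *ᵥ (G q.1 *ᵥ m q) with hg
  set k : ∀ q : ℕ × Ω, Fin q.1 → ℝ := fun q =>
    G q.1 *ᵥ e q - S q *ᵥ (G q.1 *ᵥ e q) with hk
  have hr0 : ∀ q, residNull β K h s X ε q = e q + u q := fun q => by
    simp only [residNull, hu, Matrix.mulVec_add]; abel
  have hr1 : ∀ q, residSlope G β K h s X ε q = g q + k q := fun q => by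
    simp only [residSlope, hg, hk, Matrix.mulVec_add]; abel
  have hut : Tendsto (fun q => κ q * (u q ⬝ᵥ u q)) (whp μ) (𝓝 0) := tendsto_dot_sub hbias hSe
  have hkt : Tendsto (fun q => κ q * (k q ⬝ᵥ k q)) (whp μ) (𝓝 0) := tendsto_dot_sub hGe hSGe
  have hQ' : Tendsto (fun q => κ q * (g q ⬝ᵥ g q) - t q.1) (whp μ) (𝓝 0) := hQ
  have hgb : ∀ᶠ q in whp μ, |κ q * (g q ⬝ᵥ g q)| ≤ A + 1 := by
    filter_upwards [eventually_abs_le_of_tendsto hQ', tendsto_fst_whp.eventually ht2]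
      with q h1 h2
    rw [abs_zero, zero_add] at h1
    rw [abs_of_nonneg (mul_nonneg (div_nonneg (hρ _).le (Nat.cast_nonneg _)) (dot_self_nonneg _))]
    have := (abs_le.mp h1).2
    linarith
  have hgk : Tendsto (fun q => κ q * (g q ⬝ᵥ k q)) (whp μ) (𝓝 0) :=
    (tendsto_dot_of_bounded hkt hgb).congr fun q => by rw [dotProduct_comm]
  have hslope : Tendsto (fun q => κ q * (residSlope G β K h s X ε q ⬝ᵥ
      residSlope G β K h s X ε q) - t q.1) (whp μ) (𝓝 0) := by
    have h1 := (hQ'.add hkt).add (hgk.const_mul 2)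
    simp only [add_zero, mul_zero] at h1
    refine h1.congr fun q => ?_
    rw [hr1, add_dotProduct, dotProduct_add, dotProduct_add, dotProduct_comm (k q) (g q)]
    ring
  have hslopeb : ∀ᶠ q in whp μ, lam / 8 ≤ κ q * (residSlope G β K h s X ε q ⬝ᵥ
        residSlope G β K h s X ε q) ∧
      κ q * (residSlope G β K h s X ε q ⬝ᵥ residSlope G β K h s X ε q) ≤ A + 1 := by
    filter_upwards [(Metric.tendsto_nhds.mp hslope) (min 1 (lam / 8)) (by positivity),
      tendsto_fst_whp.eventually ht1, tendsto_fst_whp.eventually ht2] with q h1 h2 h3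
    rw [Real.dist_eq, sub_zero] at h1
    have h4 := abs_lt.mp (h1.trans_le (min_le_left _ _))
    have h5 := abs_lt.mp (h1.trans_le (min_le_right _ _))
    constructor <;> linarith
  refine ⟨?_, ?_, A + 1, hslopeb⟩
  · have hu' : Tendsto (fun q : ℕ × Ω => (q.1 : ℝ)⁻¹ * (u q ⬝ᵥ u q)) (whp μ) (𝓝 0) := by
      -- As soon as `ρ ≥ 1`, the normalization `1/n` is weaker than `ρ/n`.
      refine squeeze_zero' (Eventually.of_forall fun q => mul_nonneg (by positivity)
        (dot_self_nonneg _)) ?_ hut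
      filter_upwards [tendsto_fst_whp.eventually (hρt.eventually_ge_atTop 1)] with q h1
      refine mul_le_mul_of_nonneg_right ?_ (dot_self_nonneg _)
      simp only [hκ]
      rw [div_eq_mul_inv]
      exact le_mul_of_one_le_left (by positivity) h1
    have h1 := tendsto_dot_of_bounded hu' (eventually_abs_le_of_tendsto hee)
    have h2 := (hee.add hu').add (h1.const_mul 2)
    simp only [add_zero, mul_zero] at h2
    refine h2.congr fun q => ?_
    rw [hr0, add_dotProduct, dotProduct_add, dotProduct_add, dotProduct_comm (e q) (u q)]
    ring
  · have h1 : Tendsto (fun q => κ q * (u q ⬝ᵥ residSlope G β K h s X ε q)) (whp μ) (𝓝 0) :=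
      tendsto_dot_of_bounded hut (A := A + 1) (hslopeb.mono fun q hq => by
        rw [abs_of_nonneg (mul_nonneg (div_nonneg (hρ _).le (Nat.cast_nonneg _))
          (dot_self_nonneg _))]
        exact hq.2)
    have h2 : Tendsto (fun q => κ q * (((S q)ᵀ *ᵥ e q) ⬝ᵥ (G q.1 *ᵥ e q))) (whp μ) (𝓝 0) :=
      tendsto_dot_of_bounded hSte (eventually_abs_le_of_tendsto hGe)
    have h3 := ((h1.add hcross).add hquad).sub h2
    simp only [add_zero, sub_zero] at h3
    refine h3.congr fun q => ?_
    -- Moving `S` to the left factor makes this term an inner product of two vectors already known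
    -- to be negligible.
    have h4 : ((S q)ᵀ *ᵥ e q) ⬝ᵥ (G q.1 *ᵥ e q) = e q ⬝ᵥ (S q *ᵥ (G q.1 *ᵥ e q)) := by
      rw [Matrix.mulVec_transpose, Matrix.dotProduct_mulVec (e q) (S q)]
    rw [hr0, add_dotProduct, h4]
    have h5 : e q ⬝ᵥ residSlope G β K h s X ε q = e q ⬝ᵥ g q + e q ⬝ᵥ (G q.1 *ᵥ e q)
        - e q ⬝ᵥ (S q *ᵥ (G q.1 *ᵥ e q)) := by
      rw [hr1, dotProduct_add, dotProduct_sub (e q) (G q.1 *ᵥ e q)]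
      ring
    rw [h5]
    simp only [hg, hκ]
    ring

end Coefficients

/-! ### The profile likelihood -/

section Likelihood

variable {n p : ℕ} {W : Matrix (Fin n) (Fin n) ℝ} {α₀ : ℝ}

lemma SatisfiesModel.sarMatrix_mulVec {β : Plane → Fin p → ℝ} {s : ℕ → Plane} {x : ℕ → Fin p → ℝ}
    {e : ℕ → ℝ} {y : Fin n → ℝ} (hY : SatisfiesModel W α₀ β s x e y) (hW : ∀ i, W i i = 0) :
    sarMatrix W α₀ *ᵥ y = meanVec n β s x + fun j : Fin n => e j := by
  ext i
  have h1 : (W *ᵥ y) i = ∑ j ∈ Finset.univ.erase i, W i j * y j := by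
    rw [Matrix.mulVec, dotProduct, ← Finset.add_sum_erase _ _ (Finset.mem_univ i), hW, zero_mul,
      zero_add]
  rw [sarMatrix, Matrix.sub_mulVec, Matrix.one_mulVec, Matrix.smul_mulVec, Pi.sub_apply,
    Pi.smul_apply, smul_eq_mul, h1, Pi.add_apply, meanVec, hY i]
  ring

/-- Since `W = G A(α₀)`, every `A(α)` is a perturbation of the identity by a multiple of `G`,
applied after `A(α₀)`; determinant and residuals thereby become explicit in `α₀ - α`. -/
lemma sarMatrix_eq_mul (hA : IsUnit (sarMatrix W α₀)) (α : ℝ) :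
    sarMatrix W α = (1 + (α₀ - α) • gMatrix W α₀) * sarMatrix W α₀ := by
  rw [add_mul, one_mul, Matrix.smul_mul, gMatrix, Matrix.mul_assoc,
    Matrix.nonsing_inv_mul _ ((Matrix.isUnit_iff_isUnit_det _).mp hA), mul_one, sarMatrix,
    sarMatrix, sub_smul]
  abel

lemma log_abs_det_sarMatrix_le (hA : IsUnit (sarMatrix W α₀)) {α : ℝ}
    (hα : IsUnit (sarMatrix W α)) :
    Real.log |(sarMatrix W α).det| - Real.log |(sarMatrix W α₀).det| ≤
      (α₀ - α) * (gMatrix W α₀).trace + (α₀ - α) ^ 2 / 2 * ∑ i, ∑ j, gMatrix W α₀ i j ^ 2 := by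
  have h0 : (sarMatrix W α₀).det ≠ 0 := ((Matrix.isUnit_iff_isUnit_det _).mp hA).ne_zero
  have h1 : (sarMatrix W α).det ≠ 0 := ((Matrix.isUnit_iff_isUnit_det _).mp hα).ne_zero
  rw [sarMatrix_eq_mul hA α, Matrix.det_mul] at h1 ⊢
  have h2 := left_ne_zero_of_mul h1
  rw [abs_mul, Real.log_mul (abs_ne_zero.mpr h2) (abs_ne_zero.mpr h0), add_sub_cancel_right]
  exact log_abs_det_one_add_smul_le _ _ h2

lemma sub_two_mul_sq_le_log {x : ℝ} (hx : |x| ≤ 1 / 2) : x - 2 * x ^ 2 ≤ Real.log (1 + x) := by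
  have h1 := (abs_le.mp hx).1
  have h2 : 0 < 1 + x := by linarith
  refine le_trans ?_ (Real.one_sub_inv_le_log_of_pos h2)
  have h3 : 1 - (1 + x)⁻¹ = x - x ^ 2 * (1 + x)⁻¹ := by field_simp; ring
  have h4 : (1 + x)⁻¹ ≤ 2 := by
    rw [inv_le_comm₀ h2 two_pos]; linarith
  have h5 := mul_le_mul_of_nonneg_left h4 (sq_nonneg x)
  linarith

/-- The gain in profile likelihood over the true parameter, in terms of the coefficients of the
quadratic polynomial `σ̃²`. -/
lemma profileLogLik_gain_le {K : ℝ → ℝ} {h : ℝ} {s : ℕ → Plane} {x : ℕ → Fin p → ℝ}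
    {y : Fin n → ℝ} (hn : 0 < n) (hA : IsUnit (sarMatrix W α₀)) {α : ℝ}
    (hα : IsUnit (sarMatrix W α)) {r : ℝ} (hr : 0 < r) {a b d : ℝ} (ha : 0 < a)
    (hvar : ∀ α, profileVariance K h W s x y α =
      a + (2 * (α₀ - α) * b + (α₀ - α) ^ 2 * d) / r)
    (hsmall : |(2 * (α₀ - α) * b + (α₀ - α) ^ 2 * d) / (r * a)| ≤ 1 / 2) :
    r / n * (profileLogLik K h W s x y α - profileLogLik K h W s x y α₀) ≤
      (α₀ - α) * (r / n * (gMatrix W α₀).trace - b / a) - (α₀ - α) ^ 2 * (d / (2 * a))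
      + (2 * (α₀ - α) * b + (α₀ - α) ^ 2 * d) ^ 2 / (r * a ^ 2)
      + (α₀ - α) ^ 2 / 2 * (r / n * ∑ i, ∑ j, gMatrix W α₀ i j ^ 2) := by
  have h0 : (0 : ℝ) < n := by exact_mod_cast hn
  have hdet := log_abs_det_sarMatrix_le hA hα
  set δ := α₀ - α with hδ
  set x' := (2 * δ * b + δ ^ 2 * d) / (r * a) with hx'
  have hv0 : profileVariance K h W s x y α₀ = a := by rw [hvar]; simp
  have hv : profileVariance K h W s x y α = a * (1 + x') := by
    rw [hvar, ← hδ, hx']; field_simp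
  have h1x : 0 < 1 + x' := by have := (abs_le.mp hsmall).1; linarith
  have hlog := sub_two_mul_sq_le_log hsmall
  have hL : profileLogLik K h W s x y α - profileLogLik K h W s x y α₀ =
      -(n / 2 * Real.log (1 + x'))
        + (Real.log |(sarMatrix W α).det| - Real.log |(sarMatrix W α₀).det|) := by
    rw [profileLogLik, profileLogLik, hv0, hv, Real.log_sqrt (by positivity),
      Real.log_sqrt ha.le, Real.log_mul ha.ne' h1x.ne']
    ring
  rw [hL]
  have h2 : -(n / 2 * Real.log (1 + x'))
        + (Real.log |(sarMatrix W α).det| - Real.log |(sarMatrix W α₀).det|) ≤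
      -(n / 2 * (x' - 2 * x' ^ 2)) + (δ * (gMatrix W α₀).trace
        + δ ^ 2 / 2 * ∑ i, ∑ j, gMatrix W α₀ i j ^ 2) := by
    have := mul_le_mul_of_nonneg_left hlog (show (0 : ℝ) ≤ n / 2 by positivity)
    linarith
  refine (mul_le_mul_of_nonneg_left h2 (div_nonneg hr.le h0.le)).trans (le_of_eq ?_)
  rw [hx']
  field_simp
  ring

end Likelihood

/-! ### Consistency of the profile estimate -/

section Consistency

variable {Ω : Type*} [MeasurableSpace Ω] {μ : Measure Ω} [IsProbabilityMeasure μ]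
  {p : ℕ} {X : ℕ → Ω → Fin p → ℝ} {ε : ℕ → Ω → ℝ} {σ : ℝ}
  {s : ℕ → Plane} {h : ℕ → ℝ} {K : ℝ → ℝ} {β : Plane → Fin p → ℝ} {R : Set Plane}
  {W : ∀ n : ℕ, Matrix (Fin n) (Fin n) ℝ} {ρ : ℕ → ℝ} {α₀ : ℝ}

/-- The smoother does not depend on `α` and `A(α) Y` is affine in `α`, so this is an exact identity.
Both coefficients are scaled by `ρ/n`, to be of order one. -/
lemma profileVariance_eq (hW : WeightCondition W α₀ ρ) {Y : ∀ n : ℕ, Ω → Fin n → ℝ}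
    (hY : ∀ n ω, SatisfiesModel (W n) α₀ β s (fun i => X i ω) (fun i => ε i ω) (Y n ω))
    (q : ℕ × Ω) (α : ℝ) :
    profileVariance K (h q.1) (W q.1) s (fun i => X i q.2) (Y q.1 q.2) α =
      (q.1 : ℝ)⁻¹ * (residNull β K h s X ε q ⬝ᵥ residNull β K h s X ε q) +
      (2 * (α₀ - α) * (ρ q.1 / q.1 * (residNull β K h s X ε q ⬝ᵥ
          residSlope (fun n => gMatrix (W n) α₀) β K h s X ε q))
        + (α₀ - α) ^ 2 * (ρ q.1 / q.1 * (residSlope (fun n => gMatrix (W n) α₀) β K h s X ε q ⬝ᵥ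
          residSlope (fun n => gMatrix (W n) α₀) β K h s X ε q))) / ρ q.1 := by
  obtain ⟨n, ω⟩ := q
  have hA := hW.invertible n
  have h1 : sarMatrix (W n) α₀ *ᵥ Y n ω = meanVec n β s (fun i => X i ω) + noiseAt ε (n, ω) :=
    (hY n ω).sarMatrix_mulVec (hW.diag_zero n)
  have h2 : sarMatrix (W n) α *ᵥ Y n ω = (meanVec n β s (fun i => X i ω) + noiseAt ε (n, ω))
      + (α₀ - α) • (gMatrix (W n) α₀ *ᵥ (meanVec n β s (fun i => X i ω) + noiseAt ε (n, ω))) := by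
    rw [sarMatrix_eq_mul hA α, ← Matrix.mulVec_mulVec, h1, Matrix.add_mulVec, Matrix.one_mulVec,
      Matrix.smul_mulVec]
  have h3 : sarMatrix (W n) α *ᵥ Y n ω - smoother K (h n) n (fun i => X i ω) s *ᵥ
      (sarMatrix (W n) α *ᵥ Y n ω) = residNull β K h s X ε (n, ω)
        + (α₀ - α) • residSlope (fun n => gMatrix (W n) α₀) β K h s X ε (n, ω) := by
    have h4 : ∀ (S : Matrix (Fin n) (Fin n) ℝ) (z v : Fin n → ℝ) (δ : ℝ),
        z + δ • v - S *ᵥ (z + δ • v) = (z - S *ᵥ z) + δ • (v - S *ᵥ v) := by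
      intro S z v δ
      rw [Matrix.mulVec_add, Matrix.mulVec_smul, smul_sub]
      abel
    rw [h2]
    exact h4 _ _ _ _
  have hρ := hW.rho_pos n
  simp only [profileVariance]
  rw [h3, add_dotProduct, dotProduct_add, dotProduct_add, smul_dotProduct, smul_dotProduct,
    dotProduct_smul, dotProduct_smul, dotProduct_comm (residSlope _ β K h s X ε (n, ω))
      (residNull β K h s X ε (n, ω))]
  simp only [smul_eq_mul]
  field_simp
  ring

set_option maxHeartbeats 1000000 in
-- All estimates depend on `α` only through `|α₀ - α| ≤ M'`, so they may be applied directly at the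
-- random maximizer; no uniform law over `Δ` is required.
theorem tendstoInMeasure_profileEstimate {E : ℕ → Set (ℕ → Fin p → ℝ)} {c c' C L : ℝ}
    (hR : LocalRegime μ X s h K E c c' C L) (hX : SampleCondition μ X ε σ) (hRc : IsCompact R)
    (hβ : SmoothCoefficients R β) (hs : ∀ i, s i ∈ R) (hW : WeightCondition W α₀ ρ)
    {Δ : Set ℝ} (hΔ : ParameterCondition W α₀ Δ)
    (hsing : SingularCondition μ K h W α₀ ρ β s X) {Y : ∀ n : ℕ, Ω → Fin n → ℝ}
    (hY : ∀ n ω, SatisfiesModel (W n) α₀ β s (fun i => X i ω) (fun i => ε i ω) (Y n ω))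
    (hρh : Tendsto (fun n : ℕ => ρ n * h n ^ 4) atTop (𝓝 0))
    (hb : Tendsto (fun n : ℕ => (n : ℝ) * h n ^ 2 / ρ n) atTop atTop) {αhat : ℕ → Ω → ℝ}
    (hα : Tendsto (fun n => μ {ω | ¬ IsProfileEstimate K (h n) (W n) s
          (fun i => X i ω) Δ (Y n ω) (αhat n ω)}) atTop (𝓝 0)) :
    TendstoInMeasure μ αhat atTop fun _ => α₀ := by
  have hρ := hW.rho_pos
  have hρt := hsing.rho_tendsto
  obtain ⟨CG, hCG, hG⟩ := exists_smallRows hW hsing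
  obtain ⟨lam, hlam, hlim⟩ := hsing.limit
  have hlim' : Tendsto (fun n => ∫ ω, smoothedSignal K h (fun n => gMatrix (W n) α₀) ρ β s n
      (fun i => X i ω) ∂μ) atTop (𝓝 lam) := by
    refine hlim.congr fun n => ?_
    rw [← integral_const_mul]
    rfl
  obtain ⟨ha, hB, C0, hC⟩ := hR.exists_coefficient_limits hX hRc hβ hs hρ hρt hG hlam hlim' hρh hb
  obtain ⟨M, hM⟩ := hΔ.isCompact.isBounded.exists_norm_le
  set a : ℕ × Ω → ℝ := fun q =>
    (q.1 : ℝ)⁻¹ * (residNull β K h s X ε q ⬝ᵥ residNull β K h s X ε q) with ha'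
  set b : ℕ × Ω → ℝ := fun q => ρ q.1 / q.1 * (residNull β K h s X ε q ⬝ᵥ
    residSlope (fun n => gMatrix (W n) α₀) β K h s X ε q) with hb'
  set d : ℕ × Ω → ℝ := fun q => ρ q.1 / q.1 *
    (residSlope (fun n => gMatrix (W n) α₀) β K h s X ε q ⬝ᵥ
      residSlope (fun n => gMatrix (W n) α₀) β K h s X ε q) with hd'
  set τ : ℕ → ℝ := fun n => ρ n / n * (gMatrix (W n) α₀).trace with hτ'
  set M' := 2 * |M| + 1 with hM'
  have hM'0 : 0 < M' := by positivity
  have hδM : ∀ α ∈ Δ, |α₀ - α| ≤ M' := by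
    intro α hα
    have h1 := hM α₀ (interior_subset hΔ.interior)
    have h2 := hM α hα
    rw [Real.norm_eq_abs] at h1 h2
    have := abs_sub α₀ α
    have := le_abs_self M
    linarith
  have hσ := hX.sigma_pos
  have hσ2 : 0 < σ ^ 2 := by positivity
  have hτb : ∀ᶠ n in atTop, |τ n| ≤ CG := by
    filter_upwards [eventually_gt_atTop 0] with n hn
    have h0 : (0 : ℝ) < n := by exact_mod_cast hn
    have h1 : |(gMatrix (W n) α₀).trace| ≤ n * (CG / ρ n) := by
      rw [Matrix.trace]
      refine (Finset.abs_sum_le_sum_abs _ _).trans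
        ((Finset.sum_le_sum fun i _ => hG.1 n i i).trans (le_of_eq ?_))
      rw [Finset.sum_const, Finset.card_univ, Fintype.card_fin, nsmul_eq_mul]
    have h2 := hρ n
    simp only [hτ']
    rw [abs_mul, abs_of_pos (div_pos h2 h0)]
    calc _ ≤ ρ n / n * (n * (CG / ρ n)) := mul_le_mul_of_nonneg_left h1 (div_pos h2 h0).le
      _ = _ := by field_simp
  rw [tendstoInMeasure_iff_dist]
  intro η hη
  suffices hmain : ∀ᶠ q in whp μ, ¬ η ≤ dist (αhat q.1 q.2) α₀ by
    rw [eventually_whp] at hmain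
    simpa only [not_not] using hmain
  -- Lower bound for `d/(2a)`, from `d ≥ lam/8` and `a < 2σ²`.
  set γ := lam / (32 * σ ^ 2) with hγ
  have hγ0 : 0 < γ := by positivity
  -- Bound for `|2 δ b + δ² d|`: here `|b| ≤ σ² CG + 1`, because `b` is within `1` of `σ² τ` and
  -- `|τ| ≤ CG`.
  set D := 2 * M' * (σ ^ 2 * CG + 1) + M' ^ 2 * |C0| with hD
  have hD0 : 0 ≤ D := by positivity
  have hρinv : Tendsto (fun n => (ρ n)⁻¹) atTop (𝓝 0) := tendsto_inv_atTop_zero.comp hρt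
  have ev1 : ∀ᶠ n in atTop, D * (2 / σ ^ 2) * (ρ n)⁻¹ ≤ 1 / 2 := by
    have := hρinv.const_mul (D * (2 / σ ^ 2))
    rw [mul_zero] at this
    exact this.eventually (ge_mem_nhds (by norm_num))
  have ev2 : ∀ᶠ n in atTop, D ^ 2 * (2 / σ ^ 2) ^ 2 * (ρ n)⁻¹ ≤ η ^ 2 * γ / 8 := by
    have := hρinv.const_mul (D ^ 2 * (2 / σ ^ 2) ^ 2)
    rw [mul_zero] at this
    exact this.eventually (ge_mem_nhds (by positivity))
  have ev3 : ∀ᶠ n in atTop, M' ^ 2 / 2 * (CG ^ 2 / Real.sqrt (ρ n)) ≤ η ^ 2 * γ / 8 := by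
    have := (tendsto_inv_sqrt hρt).const_mul (M' ^ 2 / 2 * CG ^ 2)
    rw [mul_zero] at this
    refine (this.eventually (ge_mem_nhds (show 0 < η ^ 2 * γ / 8 by positivity))).mono
      fun n hn => ?_
    rwa [div_eq_mul_inv (CG ^ 2), ← mul_assoc]
  -- The difference equals `(τ (a - σ²) - (b - σ² τ)) / a`; boundedness of `τ` suffices, as it need
  -- not converge.
  have hratio : Tendsto (fun q : ℕ × Ω => τ q.1 - b q / a q) (whp μ) (𝓝 0) := by
    have h1 : Tendsto (fun q : ℕ × Ω => a q - σ ^ 2) (whp μ) (𝓝 0) := by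
      have := ha.sub_const (σ ^ 2)
      rwa [sub_self] at this
    have h2 : Tendsto (fun q : ℕ × Ω => τ q.1 * (a q - σ ^ 2)) (whp μ) (𝓝 0) := by
      have h3 := h1.abs.const_mul CG
      rw [abs_zero, mul_zero] at h3
      refine squeeze_zero_norm' ?_ h3
      filter_upwards [tendsto_fst_whp.eventually hτb] with q hq
      rw [Real.norm_eq_abs, abs_mul]
      exact mul_le_mul_of_nonneg_right hq (abs_nonneg _)
    have h4 := (h2.sub hB).mul (ha.inv₀ hσ2.ne')
    simp only [sub_zero, zero_mul] at h4
    refine h4.congr' ?_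
    filter_upwards [ha.eventually (lt_mem_nhds hσ2)] with q hq
    simp only [hτ', hb'] at *
    field_simp
    ring
  have hest : ∀ᶠ q in whp μ, IsProfileEstimate K (h q.1) (W q.1) s (fun i => X i q.2) Δ
      (Y q.1 q.2) (αhat q.1 q.2) := eventually_whp.mpr hα
  filter_upwards [hest, ha.eventually (lt_mem_nhds (show σ ^ 2 / 2 < σ ^ 2 by linarith)),
    ha.eventually (gt_mem_nhds (show σ ^ 2 < 2 * σ ^ 2 by linarith)),
    hB.abs.eventually (gt_mem_nhds (show |(0 : ℝ)| < 1 by norm_num)), hC,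
    hratio.abs.eventually (gt_mem_nhds (show |(0 : ℝ)| < η ^ 2 * γ / (8 * M') by
      rw [abs_zero]; positivity)),
    tendsto_fst_whp.eventually hτb, tendsto_fst_whp.eventually ev1,
    tendsto_fst_whp.eventually ev2, tendsto_fst_whp.eventually ev3,
    tendsto_fst_whp.eventually (eventually_gt_atTop 0)]
    with q hest ha1 ha2 hb1 hd1 hrat hτ1 e1 e2 e3 hn hηq
  obtain ⟨n, ω⟩ := q
  simp only at hest hηq hτ1 e1 e2 e3 hn
  set α := αhat n ω with hαdef
  set δ := α₀ - α with hδ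
  have hδη : η ≤ |δ| := by rwa [hδ, abs_sub_comm, ← Real.dist_eq]
  have hδM' : |δ| ≤ M' := hδM α hest.1
  have h0 : (0 : ℝ) < n := by exact_mod_cast hn
  have hρn := hρ n
  have ha0 : 0 < a (n, ω) := by linarith
  have hd0 : 0 ≤ d (n, ω) := by linarith [hd1.1]
  have hdC : d (n, ω) ≤ |C0| := hd1.2.trans (le_abs_self _)
  have hbb : |b (n, ω)| ≤ σ ^ 2 * CG + 1 := by
    have h1 : |σ ^ 2 * τ n| ≤ σ ^ 2 * CG := by
      rw [abs_mul, abs_of_pos hσ2]; exact mul_le_mul_of_nonneg_left hτ1 hσ2.le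
    have h2 := abs_add_le (b (n, ω) - σ ^ 2 * τ n) (σ ^ 2 * τ n)
    rw [sub_add_cancel] at h2
    have h3 : |b (n, ω) - σ ^ 2 * τ n| < 1 := hb1
    linarith
  have hδ2 : δ ^ 2 ≤ M' ^ 2 := by
    rw [← sq_abs]; exact pow_le_pow_left₀ (abs_nonneg _) hδM' 2
  have hnum : |2 * δ * b (n, ω) + δ ^ 2 * d (n, ω)| ≤ D := by
    refine (abs_add_le _ _).trans ?_
    rw [abs_mul, abs_mul, abs_two, abs_of_nonneg (mul_nonneg (sq_nonneg δ) hd0), hD]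
    gcongr
  have hinva : (a (n, ω))⁻¹ ≤ 2 / σ ^ 2 := by
    rw [inv_le_comm₀ ha0 (by positivity), inv_div]; exact ha1.le
  have hsmall : |(2 * δ * b (n, ω) + δ ^ 2 * d (n, ω)) / (ρ n * a (n, ω))| ≤ 1 / 2 := by
    rw [abs_div, abs_of_pos (mul_pos hρn ha0)]
    refine le_trans ?_ e1
    calc _ = |2 * δ * b (n, ω) + δ ^ 2 * d (n, ω)| * (a (n, ω))⁻¹ * (ρ n)⁻¹ := by
          rw [div_eq_mul_inv, mul_inv]; ring
      _ ≤ _ := by gcongr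
  have hgain := profileLogLik_gain_le (K := K) (h := h n) (s := s) (x := fun i => X i ω)
    (y := Y n ω) hn (hW.invertible n) (hΔ.invertible n α hest.1) hρn ha0
    (fun α => profileVariance_eq (β := β) (ε := ε) (h := h) (K := K) hW hY (n, ω) α) hsmall
  have hmax : 0 ≤ ρ n / n * (profileLogLik K (h n) (W n) s (fun i => X i ω) (Y n ω) α
      - profileLogLik K (h n) (W n) s (fun i => X i ω) (Y n ω) α₀) := by
    refine mul_nonneg (div_pos hρn h0).le (sub_nonneg.mpr ?_)
    exact hest.2 (interior_subset hΔ.interior)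
  have t1 : δ * (τ n - b (n, ω) / a (n, ω)) ≤ η ^ 2 * γ / 8 := by
    calc _ ≤ |δ| * |τ n - b (n, ω) / a (n, ω)| := by rw [← abs_mul]; exact le_abs_self _
      _ ≤ M' * (η ^ 2 * γ / (8 * M')) := mul_le_mul hδM' hrat.le (abs_nonneg _) hM'0.le
      _ = _ := by field_simp
  have t2 : η ^ 2 * γ ≤ δ ^ 2 * (d (n, ω) / (2 * a (n, ω))) := by
    have h1 : γ ≤ d (n, ω) / (2 * a (n, ω)) := by
      rw [le_div_iff₀ (by positivity), hγ]
      calc _ ≤ lam / (32 * σ ^ 2) * (2 * (2 * σ ^ 2)) := by gcongr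
        _ = lam / 8 := by field_simp; norm_num
        _ ≤ _ := hd1.1
    have h2 : η ^ 2 ≤ δ ^ 2 := by
      rw [← sq_abs δ]; exact pow_le_pow_left₀ hη.le hδη 2
    exact mul_le_mul h2 h1 hγ0.le (sq_nonneg _)
  have t3 : (2 * δ * b (n, ω) + δ ^ 2 * d (n, ω)) ^ 2 / (ρ n * a (n, ω) ^ 2) ≤
      η ^ 2 * γ / 8 := by
    refine le_trans ?_ e2
    calc _ = |2 * δ * b (n, ω) + δ ^ 2 * d (n, ω)| ^ 2 * (a (n, ω))⁻¹ ^ 2 * (ρ n)⁻¹ := by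
          rw [sq_abs, div_eq_mul_inv, mul_inv, inv_pow]; ring
      _ ≤ _ := by gcongr
  have t4 : δ ^ 2 / 2 * (ρ n / n * ∑ i, ∑ j, gMatrix (W n) α₀ i j ^ 2) ≤ η ^ 2 * γ / 8 := by
    refine le_trans ?_ e3
    have h1 : ρ n / n * ∑ i, ∑ j, gMatrix (W n) α₀ i j ^ 2 ≤ CG ^ 2 / Real.sqrt (ρ n) := by
      calc _ = (n : ℝ)⁻¹ * ∑ i, ρ n * ∑ j, gMatrix (W n) α₀ i j ^ 2 := by
            rw [← Finset.mul_sum]; ring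
        _ ≤ (n : ℝ)⁻¹ * ∑ i : Fin n, CG ^ 2 / Real.sqrt (ρ n) :=
            mul_le_mul_of_nonneg_left (Finset.sum_le_sum fun i _ => hG.rho_sum_sq_le hρ n i)
              (by positivity)
        _ = _ := by
            rw [Finset.sum_const, Finset.card_univ, Fintype.card_fin, nsmul_eq_mul]
            field_simp
    have h2 : 0 ≤ ρ n / n * ∑ i, ∑ j, gMatrix (W n) α₀ i j ^ 2 :=
      mul_nonneg (div_pos hρn h0).le
        (Finset.sum_nonneg fun i _ => Finset.sum_nonneg fun j _ => sq_nonneg _)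
    exact mul_le_mul (by linarith) h1 h2 (by positivity)
  have hpos : 0 < η ^ 2 * γ := by positivity
  have hfin : (0 : ℝ) ≤ δ * (τ n - b (n, ω) / a (n, ω)) - δ ^ 2 * (d (n, ω) / (2 * a (n, ω)))
      + (2 * δ * b (n, ω) + δ ^ 2 * d (n, ω)) ^ 2 / (ρ n * a (n, ω) ^ 2)
      + δ ^ 2 / 2 * (ρ n / n * ∑ i, ∑ j, gMatrix (W n) α₀ i j ^ 2) := hmax.trans hgain
  -- The three error terms sum to at most `3 η² γ / 8`, less than the quadratic loss `η² γ`, whereas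
  -- the gain at a maximizer is nonnegative.
  linarith

end Consistency

/-! ### The limiting information matrix is singular -/

section Information

variable {Ω : Type*} [MeasurableSpace Ω] {μ : Measure Ω} [IsProbabilityMeasure μ]
  {p : ℕ} {X : ℕ → Ω → Fin p → ℝ} {ε : ℕ → Ω → ℝ} {σ : ℝ}
  {s : ℕ → Plane} {h : ℕ → ℝ} {K : ℝ → ℝ} {β : Plane → Fin p → ℝ} {R : Set Plane}
  {f : Plane → ℝ} {W : ∀ n : ℕ, Matrix (Fin n) (Fin n) ℝ} {ρ : ℕ → ℝ} {α₀ CG B : ℝ}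

/-- Kernel weights have bounded averages over the design points, so they average uniformly vanishing
sequences to zero. This alone gives `Z₁ = Z₂ = 0`. -/
lemma DesignCondition.tendsto_kernel_average (hs : DesignCondition R f s h) (hK : IsKernel K)
    (hpos : ∀ n, 0 < h n) (hh : Tendsto h atTop (𝓝 0)) {v : ∀ n : ℕ, Fin n → ℝ} {δ : ℕ → ℝ}
    (hδ : Tendsto δ atTop (𝓝 0)) (hv : ∀ n i, |v n i| ≤ δ n) {z : Plane} (hz : z ∈ R) :
    Tendsto (fun n : ℕ => (n : ℝ)⁻¹ * ∑ i : Fin n, v n i * scaledKernel K (h n) ‖s i - z‖) atTop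
      (𝓝 0) := by
  obtain ⟨C, hC, hsum⟩ := kernel_sum_le hs hK hpos hh
  have h1 := hδ.mul_const C
  rw [zero_mul] at h1
  refine squeeze_zero_norm' ?_ h1
  filter_upwards [hsum, eventually_gt_atTop 0] with n hn hn0
  have h0 : (0 : ℝ) < n := by exact_mod_cast hn0
  have hδ0 : 0 ≤ δ n := (abs_nonneg _).trans (hv n ⟨0, hn0⟩)
  rw [Real.norm_eq_abs, abs_mul, abs_of_pos (inv_pos.mpr h0)]
  calc (n : ℝ)⁻¹ * |∑ i : Fin n, v n i * scaledKernel K (h n) ‖s i - z‖|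
      ≤ (n : ℝ)⁻¹ * ∑ i : Fin n, δ n * scaledKernel K (h n) ‖s i - z‖ := by
        refine mul_le_mul_of_nonneg_left ((Finset.abs_sum_le_sum_abs _ _).trans
          (Finset.sum_le_sum fun i _ => ?_)) (inv_pos.mpr h0).le
        have hk : 0 ≤ scaledKernel K (h n) ‖s i - z‖ := div_nonneg (hK.nonneg _) (sq_nonneg _)
        rw [abs_mul, abs_of_nonneg hk]
        exact mul_le_mul_of_nonneg_right (hv n i) hk
    _ ≤ (n : ℝ)⁻¹ * (δ n * (C * n)) := by
        rw [← Finset.mul_sum]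
        exact mul_le_mul_of_nonneg_left (mul_le_mul_of_nonneg_left (hn z hz) hδ0)
          (inv_pos.mpr h0).le
    _ = δ n * C := by field_simp

lemma abs_le_sqrt_dotProduct (v : Fin p → ℝ) (a : Fin p) : |v a| ≤ Real.sqrt (v ⬝ᵥ v) := by
  rw [← Real.sqrt_sq_eq_abs]
  refine Real.sqrt_le_sqrt ?_
  rw [dotProduct, sq]
  exact Finset.single_le_sum (f := fun i => v i * v i) (fun i _ => mul_self_nonneg _)
    (Finset.mem_univ a)

lemma isZOne_zero (hs : DesignCondition R f s h) (hK : IsKernel K) (hpos : ∀ n, 0 < h n)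
    (hh : Tendsto h atTop (𝓝 0)) (hρt : Tendsto ρ atTop atTop)
    (hG : SmallRows (fun n => gMatrix (W n) α₀) ρ CG) (hB : ∀ i, β (s i) ⬝ᵥ β (s i) ≤ B) :
    IsZOne K h W α₀ β s R 0 := by
  intro z hz
  rw [tendsto_pi_nhds]
  intro a
  have hδ : Tendsto (fun n => CG / ρ n * Real.sqrt B) atTop (𝓝 0) := by
    simpa using (hρt.const_div_atTop CG).mul_const (Real.sqrt B)
  refine (hs.tendsto_kernel_average hK hpos hh
    (v := fun n i => gMatrix (W n) α₀ i i * β (s i) a) hδ (fun n i => ?_) hz).congr fun n => ?_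
  · rw [abs_mul]
    exact mul_le_mul (hG.1 n i i) ((abs_le_sqrt_dotProduct _ a).trans (Real.sqrt_le_sqrt (hB i)))
      (abs_nonneg _) ((abs_nonneg _).trans (hG.1 n i i))
  · simp only [Pi.smul_apply, Finset.sum_apply, smul_eq_mul]
    congr 1
    exact Finset.sum_congr rfl fun i _ => by ring

lemma isZTwo_zero (hs : DesignCondition R f s h) (hK : IsKernel K) (hpos : ∀ n, 0 < h n)
    (hh : Tendsto h atTop (𝓝 0)) (hρt : Tendsto ρ atTop atTop)
    (hG : SmallRows (fun n => gMatrix (W n) α₀) ρ CG) (hB : ∀ i, β (s i) ⬝ᵥ β (s i) ≤ B) :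
    IsZTwo K h W α₀ β s R 0 := by
  intro z hz
  rw [tendsto_pi_nhds]
  intro a
  have hδ : Tendsto (fun n => CG / Real.sqrt (ρ n) * Real.sqrt B) atTop (𝓝 0) := by
    simpa using ((Real.tendsto_sqrt_atTop.comp hρt).const_div_atTop CG).mul_const (Real.sqrt B)
  refine (hs.tendsto_kernel_average hK hpos hh
    (v := fun n i => ∑ j ∈ Finset.univ.erase i, gMatrix (W n) α₀ i j * β (s j) a) hδ
    (fun n i => ?_) hz).congr fun n => ?_
  · calc |∑ j ∈ Finset.univ.erase i, gMatrix (W n) α₀ i j * β (s j) a|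
        ≤ ∑ j ∈ Finset.univ.erase i, |gMatrix (W n) α₀ i j| * Real.sqrt B := by
          refine (Finset.abs_sum_le_sum_abs _ _).trans (Finset.sum_le_sum fun j _ => ?_)
          rw [abs_mul]
          exact mul_le_mul_of_nonneg_left
            ((abs_le_sqrt_dotProduct _ a).trans (Real.sqrt_le_sqrt (hB j))) (abs_nonneg _)
      _ ≤ ∑ j, |gMatrix (W n) α₀ i j| * Real.sqrt B :=
          Finset.sum_le_sum_of_subset_of_nonneg (Finset.erase_subset _ _)
            fun j _ _ => by positivity
      _ ≤ CG / Real.sqrt (ρ n) * Real.sqrt B := by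
          rw [← Finset.sum_mul]
          exact mul_le_mul_of_nonneg_right (hG.2 n i) (Real.sqrt_nonneg _)
  · simp only [Pi.smul_apply, Finset.sum_apply, smul_eq_mul]
    congr 1
    refine Finset.sum_congr rfl fun i _ => ?_
    rw [Finset.sum_mul]
    exact Finset.sum_congr rfl fun j _ => by ring

lemma zVec_eq_zero {Z₁ Z₂ : Plane → Fin p → ℝ} (h1 : ∀ i, Z₁ (s i) = 0) (h2 : ∀ i, Z₂ (s i) = 0)
    (n : ℕ) (Ψ : Matrix (Fin p) (Fin p) ℝ) (Γ : Fin p → ℝ) (x : ℕ → Fin p → ℝ) :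
    zVec n K f Ψ Γ Z₁ Z₂ s x = 0 := by
  ext i
  simp [zVec, h1, h2]

/-- The mean square of `G m` is `1/ρ` times that of the scaled signal, whose second moment, hence by
`V ≤ (1 + V²)/2` whose mean, is bounded. -/
lemma SampleCondition.tendsto_integral_gMatrix_meanVec (hX : SampleCondition μ X ε σ)
    (hρ : ∀ n, 0 < ρ n) (hρt : Tendsto ρ atTop atTop)
    (hG : SmallRows (fun n => gMatrix (W n) α₀) ρ CG) (hB : ∀ i, β (s i) ⬝ᵥ β (s i) ≤ B) :
    Tendsto (fun n : ℕ => (n : ℝ)⁻¹ * ∫ ω,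
      ((gMatrix (W n) α₀ *ᵥ meanVec n β s fun i => X i ω) ⬝ᵥ
        (gMatrix (W n) α₀ *ᵥ meanVec n β s fun i => X i ω)) ∂μ) atTop (𝓝 0) := by
  obtain ⟨A, hA⟩ := hX.integral_signal_meanSq_le hρ hG hB
  have h1 : Tendsto (fun n => (1 + A) / 2 / ρ n) atTop (𝓝 0) := hρt.const_div_atTop _
  refine squeeze_zero_norm' ?_ h1
  filter_upwards [eventually_gt_atTop 0] with n hn
  obtain ⟨hi, hle⟩ := hA n hn
  set V : Ω → ℝ := fun ω => (n : ℝ)⁻¹ *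
    ∑ j, signal (fun n => gMatrix (W n) α₀) ρ β s n (fun k => X k ω) j ^ 2 with hV
  have hV0 : ∀ ω, 0 ≤ V ω := fun ω =>
    mul_nonneg (by positivity) (Finset.sum_nonneg fun j _ => sq_nonneg _)
  have hρn := hρ n
  have h0 : (0 : ℝ) < n := by exact_mod_cast hn
  have h2 : ∀ ω, (n : ℝ)⁻¹ * ((gMatrix (W n) α₀ *ᵥ meanVec n β s fun i => X i ω) ⬝ᵥ
        (gMatrix (W n) α₀ *ᵥ meanVec n β s fun i => X i ω)) = (ρ n)⁻¹ * V ω := by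
    intro ω
    have h3 : ∑ j, signal (fun n => gMatrix (W n) α₀) ρ β s n (fun k => X k ω) j ^ 2 =
        ρ n * ((gMatrix (W n) α₀ *ᵥ meanVec n β s fun i => X i ω) ⬝ᵥ
          (gMatrix (W n) α₀ *ᵥ meanVec n β s fun i => X i ω)) := by
      rw [dotProduct, Finset.mul_sum]
      refine Finset.sum_congr rfl fun j _ => ?_
      rw [signal, Pi.smul_apply, smul_eq_mul, mul_pow, Real.sq_sqrt hρn.le, sq]
    simp only [hV]
    rw [h3]
    field_simp
  rw [← integral_const_mul]
  simp only [h2]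
  rw [integral_const_mul, Real.norm_eq_abs,
    abs_of_nonneg (mul_nonneg (inv_pos.mpr hρn).le (integral_nonneg hV0)), div_eq_inv_mul _ (ρ n)]
  refine mul_le_mul_of_nonneg_left ?_ (inv_pos.mpr hρn).le
  calc ∫ ω, V ω ∂μ ≤ ∫ ω, (1 + V ω ^ 2) / 2 ∂μ := by
        refine integral_mono_of_nonneg (Eventually.of_forall hV0)
          (((integrable_const 1).add hi).div_const 2) (Eventually.of_forall fun ω => ?_)
        have := sq_nonneg (V ω - 1)
        simp only
        nlinarith
    _ = (1 + ∫ ω, V ω ^ 2 ∂μ) / 2 := by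
        have hi' : Integrable (fun ω => V ω ^ 2) μ := hi
        rw [integral_div, integral_add (integrable_const 1) hi', integral_const, probReal_univ,
          one_smul]
    _ ≤ (1 + A) / 2 := by linarith

lemma tendsto_trace_gMatrix (hρt : Tendsto ρ atTop atTop)
    (hG : SmallRows (fun n => gMatrix (W n) α₀) ρ CG) :
    Tendsto (fun n : ℕ => (n : ℝ)⁻¹ * (gMatrix (W n) α₀).trace) atTop (𝓝 0) := by
  refine squeeze_zero_norm' ?_ (hρt.const_div_atTop CG)
  filter_upwards [eventually_gt_atTop 0] with n hn
  have h0 : (0 : ℝ) < n := by exact_mod_cast hn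
  rw [Real.norm_eq_abs, abs_mul, abs_of_pos (inv_pos.mpr h0), inv_mul_le_iff₀ h0, Matrix.trace]
  refine (Finset.abs_sum_le_sum_abs _ _).trans
    ((Finset.sum_le_sum fun i _ => hG.1 n i i).trans (le_of_eq ?_))
  rw [Finset.sum_const, Finset.card_univ, Fintype.card_fin, nsmul_eq_mul]

lemma tendsto_trace_symm_gMatrix (hρt : Tendsto ρ atTop atTop) (hCG : 0 ≤ CG)
    (hρ : ∀ n, 0 < ρ n) (hG : SmallRows (fun n => gMatrix (W n) α₀) ρ CG) :
    Tendsto (fun n : ℕ => (n : ℝ)⁻¹ *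
      ((gMatrix (W n) α₀ + (gMatrix (W n) α₀)ᵀ) * gMatrix (W n) α₀).trace) atTop (𝓝 0) := by
  have h1 : Tendsto (fun n => 2 * (CG / ρ n * (CG / Real.sqrt (ρ n)))) atTop (𝓝 0) := by
    simpa using ((hρt.const_div_atTop CG).mul
      ((Real.tendsto_sqrt_atTop.comp hρt).const_div_atTop CG)).const_mul 2
  refine squeeze_zero_norm' ?_ h1
  filter_upwards [eventually_gt_atTop 0] with n hn
  have h0 : (0 : ℝ) < n := by exact_mod_cast hn
  have hρn := hρ n
  have h2 : ((gMatrix (W n) α₀ + (gMatrix (W n) α₀)ᵀ) * gMatrix (W n) α₀).trace =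
      ∑ i, ∑ j, (gMatrix (W n) α₀ j i + gMatrix (W n) α₀ i j) * gMatrix (W n) α₀ i j := by
    rw [Matrix.trace_mul_comm]
    simp only [Matrix.trace, Matrix.diag_apply, Matrix.mul_apply, Matrix.add_apply,
      Matrix.transpose_apply]
    exact Finset.sum_congr rfl fun i _ => Finset.sum_congr rfl fun j _ => by ring
  rw [Real.norm_eq_abs, abs_mul, abs_of_pos (inv_pos.mpr h0), inv_mul_le_iff₀ h0, h2]
  calc |∑ i, ∑ j, (gMatrix (W n) α₀ j i + gMatrix (W n) α₀ i j) * gMatrix (W n) α₀ i j|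
      ≤ ∑ i, ∑ j, 2 * (CG / ρ n) * |gMatrix (W n) α₀ i j| := by
        refine (Finset.abs_sum_le_sum_abs _ _).trans (Finset.sum_le_sum fun i _ =>
          (Finset.abs_sum_le_sum_abs _ _).trans (Finset.sum_le_sum fun j _ => ?_))
        rw [abs_mul]
        refine mul_le_mul_of_nonneg_right ((abs_add_le _ _).trans ?_) (abs_nonneg _)
        have h3 := hG.1 n i j
        have h4 := hG.1 n j i
        linarith
    _ ≤ ∑ i : Fin n, 2 * (CG / ρ n) * (CG / Real.sqrt (ρ n)) := by
        refine Finset.sum_le_sum fun i _ => ?_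
        rw [← Finset.mul_sum]
        exact mul_le_mul_of_nonneg_left (hG.2 n i) (by positivity)
    _ = n * (2 * (CG / ρ n * (CG / Real.sqrt (ρ n)))) := by
        rw [Finset.sum_const, Finset.card_univ, Fintype.card_fin, nsmul_eq_mul]
        ring

/-- The `α`-row of the matrix vanishes because its three limits are zero. Limits being unique, every
matrix satisfying the definition is this one. -/
lemma informationLimit_singular (hK : IsKernel K) (hpos : ∀ n, 0 < h n)
    (hh : Tendsto h atTop (𝓝 0)) (hβ : SmoothCoefficients R β) (hX : SampleCondition μ X ε σ)
    (hs : DesignCondition R f s h) (hW : WeightCondition W α₀ ρ)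
    (hsing : SingularCondition μ K h W α₀ ρ β s X) :
    (∃ Om, IsInformationLimit μ K h W α₀ σ β R f s X Om) ∧
      ∀ Om, IsInformationLimit μ K h W α₀ σ β R f s X Om → Om.det = 0 := by
  obtain ⟨CG, hCG, hG⟩ := exists_smallRows hW hsing
  obtain ⟨B, -, hB⟩ := hβ.exists_bound hs.isCompact
  have hρt := hsing.rho_tendsto
  have hBs : ∀ i, β (s i) ⬝ᵥ β (s i) ≤ B := fun i => hB _ (hs.mem i)
  have hZ1 := isZOne_zero hs hK hpos hh hρt hG hBs
  have hZ2 := isZTwo_zero hs hK hpos hh hρt hG hBs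
  have hlam := hX.tendsto_integral_gMatrix_meanVec hW.rho_pos hρt hG hBs
  have hpi1 := tendsto_trace_symm_gMatrix hρt hCG.le hW.rho_pos hG
  have hpi2 := tendsto_trace_gMatrix hρt hG
  refine ⟨⟨_, 0, 0, 0, 0, 0, hZ1, hZ2, ?_, hpi1, hpi2, rfl⟩, ?_⟩
  · simpa only [zVec_eq_zero (Z₁ := 0) (Z₂ := 0) (fun _ => rfl) (fun _ => rfl), sub_zero]
      using hlam
  · rintro Om ⟨Z₁, Z₂, lam₁, pi₁, pi₂, h1, h2, h3, h4, h5, rfl⟩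
    -- Another choice of `Z₁` and `Z₂` is determined on `R` only; this suffices, as `zVec` evaluates
    -- them only at design points.
    have e1 : ∀ i, Z₁ (s i) = 0 := fun i =>
      tendsto_nhds_unique (h1 _ (hs.mem i)) (hZ1 _ (hs.mem i))
    have e2 : ∀ i, Z₂ (s i) = 0 := fun i =>
      tendsto_nhds_unique (h2 _ (hs.mem i)) (hZ2 _ (hs.mem i))
    simp only [zVec_eq_zero e1 e2, sub_zero] at h3
    rw [tendsto_nhds_unique h3 hlam, tendsto_nhds_unique h4 hpi1, tendsto_nhds_unique h5 hpi2,
      Matrix.det_fin_two]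
    simp

end Information

end SpatialVC

end

/-! ### The theorem -/

theorem theorem4 {Ω : Type*} [MeasurableSpace Ω] (μ : Measure Ω) [IsProbabilityMeasure μ]
    (p : ℕ) (X : ℕ → Ω → Fin p → ℝ) (ε : ℕ → Ω → ℝ) (σ : ℝ)
    (R : Set SpatialVC.Plane) (f : SpatialVC.Plane → ℝ) (s : ℕ → SpatialVC.Plane)
    (β : SpatialVC.Plane → Fin p → ℝ)
    (K : ℝ → ℝ) (h : ℕ → ℝ) (W : ∀ n : ℕ, Matrix (Fin n) (Fin n) ℝ) (ρ : ℕ → ℝ)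
    (α₀ : ℝ) (Δ : Set ℝ) (Y : ∀ n : ℕ, Ω → Fin n → ℝ)
    (hY : ∀ n ω, SpatialVC.SatisfiesModel (W n) α₀ β s (fun i => X i ω) (fun i => ε i ω) (Y n ω))
    (hK : SpatialVC.IsKernel K) (hpos : ∀ n, 0 < h n) (hh : Tendsto h atTop (𝓝 0))
    (hβ : SpatialVC.SmoothCoefficients R β)
    (hX : SpatialVC.SampleCondition μ X ε σ)
    (hs : SpatialVC.DesignCondition R f s h)
    (hW : SpatialVC.WeightCondition W α₀ ρ)
    (hΔ : SpatialVC.ParameterCondition W α₀ Δ)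
    (hsing : SpatialVC.SingularCondition μ K h W α₀ ρ β s X) :
    ((∃ Om, SpatialVC.IsInformationLimit μ K h W α₀ σ β R f s X Om) ∧
      ∀ Om, SpatialVC.IsInformationLimit μ K h W α₀ σ β R f s X Om → Om.det = 0) ∧
    (Tendsto (fun n : ℕ => (n : ℝ) * h n ^ 8) atTop (𝓝 0) →
      Tendsto (fun n : ℕ => Real.sqrt n * h n ^ 2 / Real.log n ^ 2) atTop atTop →
      Tendsto ρ atTop atTop →
      Tendsto (fun n : ℕ => ρ n * h n ^ 4) atTop (𝓝 0) →
      Tendsto (fun n : ℕ => (n : ℝ) * h n ^ 2 / ρ n) atTop atTop →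
      ∀ αhat : ℕ → Ω → ℝ,
        Tendsto (fun n => μ {ω | ¬ SpatialVC.IsProfileEstimate K (h n) (W n) s
          (fun i => X i ω) Δ (Y n ω) (αhat n ω)}) atTop (𝓝 0) →
        TendstoInMeasure μ αhat atTop (fun _ => α₀)) := by
  refine ⟨SpatialVC.informationLimit_singular hK hpos hh hβ hX hs hW hsing, ?_⟩
  intro _ hlog _ hρh hb αhat hα
  obtain ⟨E, c, c', C, L, hR⟩ :=
    SpatialVC.exists_localRegime hX hs hK hpos hh (SpatialVC.eventually_sqrt_le hlog)
  exact SpatialVC.tendstoInMeasure_profileEstimate hR hX hs.isCompact hβ hs.mem hW hΔ hsing hY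
    hρh hb hα
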